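/- Let $m>0$, $\lambda_{nc}>0$. On $\mathbb{R}^4$ use the Minkowski product $x\cdot y=x_0y_0-x_1y_1-x_2y_2-x_3y_3$, $x^2=x\cdot x$, and write $\omega_{\mathbf l}=\sqrt{|\mathbf l|^2+m^2}$. Let $$\hat\Delta_+(l)=\tfrac1{2\pi}\theta(l_0)\,\delta(l^2-m^2),\qquad \hat\Delta_R(p)=\lim_{\epsilon\to0^+}\frac{1}{(2\pi)^2}\,\frac{-1}{p^2-m^2+i\epsilon p_0},$$ so that $\hat\Delta_+$ is the measure $(2\pi)^{-1}\,d^3\mathbf l/(2\omega_{\mathbf l})$ on the positive mass shell. Put $\Omega=\{k\in\mathbb{R}^4: k^2>0,\ k^2\neq 4m^2\}$. 1. The expression $$F(y,k)=\int d^4l\ \hat\Delta_+(l)\,e^{iy\cdot l}\left(\hat\Delta_R(k-l)+\hat\Delta_R(k+l)\right),$$ in which the bracket is first integrated in $k$ with the test function and the result is then integrated against $\hat\Delta_+(l)$, is a well-defined tempered distribution $F\in\mathcal S'(\mathbb{R}^8)$. 2. For $k\in\Omega$ the expression also defines a tempered distribution $F(\cdot,k)\in\mathcal S'(\mathbb{R}^4)$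 (as the limit $\epsilon\to0^+$ of the regularized expressions). The map $k\mapsto F(\cdot,k)$ is smooth on $\Omega$ (tested against each Schwartz function), and $F(f\otimes g)=\int dk\,F(\cdot,k)(f)\,g(k)$ for $f\in\mathcal S(\mathbb R^4)$ and every smooth $g$ with compact support in $\Omega$. 3. On the open set $\{(y,k): y^2<0,\ k\in\Omega\}$ the distribution $F$ is given by a $C^\infty$ function, again written $F(y,k)$. For each fixed $k\in\Omega$ the distribution $F(\cdot,k)$ restricted to spacelike $y$ is the smooth function $y\mapsto F(y,k)$. 4. Let $\sigma=(\sigma^{\mu\nu})$ be a real antisymmetric $4\times4$ matrix whose electric part $\mathbf e=(\sigma^{01},\sigma^{02},\sigma^{03})$ and magnetic part $\mathbf b=(\sigma^{23},\sigma^{31},\sigma^{12})$ satisfy $|\mathbf e|^2=|\mathbf b|^2$ and $\mathbf e\cdot\mathbf b=\pm\lambda_{nc}^4$, and let $(k\sigma)^\nu=k_\mu\sigma^{\mu\nu}$. If $k^2>0$, then $(k\sigma)^2\le-\lambda_{nc}^4k^2$, so $k\sigma$ is spacelike. Hence $\Sigma_{np}(k)=F(k\sigma,k)$ is well defined for $k\in\Omega$,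 and it is smooth on $\Omega$. 5. For $k\in\Omega$, with $a=\sqrt{-(k\sigma)^2}$ and $\omega_l=\sqrt{l^2+m^2}$, $$\Sigma_{np}(k)=\operatorname{sgn}(k_0)\,\frac{i}{2\pi}\,\theta(k^2-4m^2)\,\frac{\sqrt{k^2-4m^2}}{8\sqrt{k^2}}\;\frac{\sin\left(\frac12a\sqrt{k^2-4m^2}\right)}{\frac12a\sqrt{k^2-4m^2}}+\frac1{(2\pi)^2}\ \mathrm{p.v.}\!\!\int_0^\infty dl\ \frac{l^2}{2\omega_l}\,\frac1{l^2-\frac{k^2}4+m^2}\,\frac{\sin(al)}{al}.$$ For $k^2<4m^2$ the first term is absent and the integral converges absolutely. For $k^2>4m^2$ the integral is the principal value at $l=\sqrt{k^2/4-m^2}$: the limit as $\delta\to0^+$ of the absolutely convergent integrals over $\{l\ge0:|l-\sqrt{k^2/4-m^2}|\ge\delta\}$. 6. $\Sigma_{np}(k)=\Sigma_{np}(-k)$ for all $k$ with $0<k^2<4m^2$, in particular in a neighbourhood of the mass shell $k^2=m^2$. -/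

import Mathlib

open MeasureTheory Filter Topology Set
open scoped SchwartzMap ContDiff

/-- Four-vectors, given by their contravariant components `x 0, x 1, x 2, x 3`. -/
abbrev R4 : Type := EuclideanSpace ℝ (Fin 4)

/-- Spatial vectors. -/
abbrev R3 : Type := EuclideanSpace ℝ (Fin 3)

namespace NCPhi3

noncomputable section

/-- The Minkowski product `x · y`, for the metric `diag (+,-,-,-)`; `x² = mdot x x`. -/
def mdot (x y : R4) : ℝ := x 0 * y 0 - x 1 * y 1 - x 2 * y 2 - x 3 * y 3

/-- The one-particle energy `ω_v = √(|v|² + m²)`. -/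
def omega (m : ℝ) (v : R3) : ℝ := Real.sqrt (‖v‖ ^ 2 + m ^ 2)

/-- The point `(ω_v, v)` of the positive mass shell. -/
def onShell (m : ℝ) (v : R3) : R4 := !₂[omega m v, v 0, v 1, v 2]

/-- The free two-point function in momentum space,
`Δ̂₊(l) = (2π)⁻¹ θ(l₀) δ(l² - m²)`, i.e. the measure `(2π)⁻¹ d³v / (2 ω_v)` on the positive
mass shell. -/
def deltaPlus (m : ℝ) : Measure R4 :=
  ENNReal.ofReal (1 / (2 * Real.pi)) •
    Measure.map (onShell m)
      ((volume : Measure R3).withDensity fun v => ENNReal.ofReal (1 / (2 * omega m v)))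

/-- The retarded propagator in momentum space before the limit `ε → 0+`:
`(2π)⁻² · (-1) / (p² - m² + i ε p₀)`. -/
def deltaRet (m ε : ℝ) (p : R4) : ℂ :=
  (1 / (2 * Real.pi) ^ 2 : ℂ) *
    (-1 / (((mdot p p - m ^ 2 : ℝ) : ℂ) + Complex.I * ((ε * p 0 : ℝ) : ℂ)))

/-- The phase `e^{i y l}`. -/
def phase (y l : R4) : ℂ := Complex.exp (Complex.I * ((mdot y l : ℝ) : ℂ))

/-- The expression `Δ̂_R(k - l) + Δ̂_R(k + l)`, with `ε > 0`, integrated in `k` (and the phase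
`e^{i y l}` in `y`) with a test function `h (y, k)`. -/
def loopPairing (m ε : ℝ) (h : 𝓢(R4 × R4, ℂ)) (l : R4) : ℂ :=
  ∫ k : R4, (deltaRet m ε (k - l) + deltaRet m ε (k + l)) * ∫ y : R4, phase y l * h (y, k)

/-- `F` is the tempered distribution on `ℝ⁸` given by
`F(y,k) = ∫ d⁴l Δ̂₊(l) e^{i y l} (Δ̂_R(k - l) + Δ̂_R(k + l))`: the expression in parentheses, a
distribution in `k`, is integrated with the test function first (giving the function `J` of `l`),
and the result is integrated against the measure `Δ̂₊`. The existence of the limit and the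
integrability are part of the assertion; `F` is determined by it. -/
def IsLoopDistribution (m : ℝ) (F : 𝓢'(R4 × R4, ℂ)) : Prop :=
  ∀ h : 𝓢(R4 × R4, ℂ), ∃ J : R4 → ℂ,
    (∀ l, Tendsto (fun ε => loopPairing m ε h l) (𝓝[>] 0) (𝓝 (J l))) ∧
    Integrable J (deltaPlus m) ∧
    F h = ∫ l, J l ∂(deltaPlus m)

/-- `T` is the tempered distribution `y ↦ F(y, k)` at the fixed momentum `k`: the product of
`Δ̂₊(·)` with `Δ̂_R(k - ·) + Δ̂_R(k + ·)`, integrated with `∫ d⁴y e^{i y l} f(y)`. -/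
def IsLoopSlice (m : ℝ) (k : R4) (T : 𝓢'(R4, ℂ)) : Prop :=
  ∀ f : 𝓢(R4, ℂ),
    Tendsto
      (fun ε : ℝ => ∫ l : R4, (deltaRet m ε (k - l) + deltaRet m ε (k + l)) *
        (∫ y : R4, phase y l * f y) ∂(deltaPlus m))
      (𝓝[>] 0) (𝓝 (T f))

/-- The timelike momenta with `k² ≠ 4m²`. -/
def regularTimelike (m : ℝ) : Set R4 := {k | 0 < mdot k k ∧ mdot k k ≠ 4 * m ^ 2}

/-- The spacelike vectors. -/
def spacelike : Set R4 := {y | mdot y y < 0}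

/-- The vector `kσ`, with components `(kσ)^ν = k_μ σ^{μν}`. -/
def kSigma (σ : Matrix (Fin 4) (Fin 4) ℝ) (k : R4) : R4 :=
  WithLp.toLp 2 fun ν => k 0 * σ 0 ν - k 1 * σ 1 ν - k 2 * σ 2 ν - k 3 * σ 3 ν

/-- The joint spectrum of the commutators of the coordinates at the length scale `lam`: the real
antisymmetric matrices `σ^{μν}` whose electric part `e = (σ⁰¹, σ⁰², σ⁰³)` and magnetic part
`b = (σ²³, σ³¹, σ¹²)` satisfy `|e|² - |b|² = 0` and `e · b = ± lam⁴`. -/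
def commutatorSpectrum (lam : ℝ) : Set (Matrix (Fin 4) (Fin 4) ℝ) :=
  {σ | σ.transpose = -σ ∧
    (σ 0 1 ^ 2 + σ 0 2 ^ 2 + σ 0 3 ^ 2) - (σ 2 3 ^ 2 + σ 3 1 ^ 2 + σ 1 2 ^ 2) = 0 ∧
    (σ 0 1 * σ 2 3 + σ 0 2 * σ 3 1 + σ 0 3 * σ 1 2 = lam ^ 4 ∨
      σ 0 1 * σ 2 3 + σ 0 2 * σ 3 1 + σ 0 3 * σ 1 2 = -lam ^ 4)}

/-- The integrand `l² / (2 ω_l) · 1 / (l² - K/4 + m²) · sin (a l) / (a l)`, where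
`ω_l = √(l² + m²)`. -/
def npIntegrand (m K a l : ℝ) : ℝ :=
  l ^ 2 / (2 * Real.sqrt (l ^ 2 + m ^ 2)) * (1 / (l ^ 2 - K / 4 + m ^ 2)) *
    (Real.sin (a * l) / (a * l))

/-- The half line `l ≥ 0` without the `δ`-neighbourhood of the point `c`. -/
def cutHalfLine (c δ : ℝ) : Set ℝ := {l | 0 ≤ l ∧ δ ≤ |l - c|}

/-- `P` is the (principal value) integral of `npIntegrand m K a` over `(0, ∞)`: an absolutely
convergent integral if `K < 4m²`, where the denominator has no zero, and the principal value at the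
zero `l = √(K/4 - m²)` of the denominator if `K > 4m²`. -/
def IsNpIntegral (m K a P : ℝ) : Prop :=
  (K < 4 * m ^ 2 →
    IntegrableOn (npIntegrand m K a) (Ioi 0) ∧ P = ∫ l in Ioi 0, npIntegrand m K a l) ∧
  (4 * m ^ 2 < K →
    (∀ δ > 0, IntegrableOn (npIntegrand m K a) (cutHalfLine (Real.sqrt (K / 4 - m ^ 2)) δ)) ∧
    Tendsto (fun δ => ∫ l in cutHalfLine (Real.sqrt (K / 4 - m ^ 2)) δ, npIntegrand m K a l)
      (𝓝[>] 0) (𝓝 P))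

/-- The threshold term
`(2π)⁻¹ θ(K - 4m²) √(K - 4m²) / (8 √K) · sin (a √(K - 4m²) / 2) / (a √(K - 4m²) / 2)`. -/
def npThreshold (m K a : ℝ) : ℝ :=
  if 4 * m ^ 2 < K then
    1 / (2 * Real.pi) * (Real.sqrt (K - 4 * m ^ 2) / (8 * Real.sqrt K)) *
      (Real.sin (1 / 2 * a * Real.sqrt (K - 4 * m ^ 2)) /
        (1 / 2 * a * Real.sqrt (K - 4 * m ^ 2)))
  else 0

end

end NCPhi3

/-! On the mass shell `l² = m²`, so the denominators `(k ∓ l)² - m²` reduce to `k² ∓ 2 k·l`. For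
forward timelike `k` the second is positive. The first vanishes on a sphere of momenta if `k² > 4m²`
and nowhere if `k² < 4m²`; at `k² = 4m²` the sphere shrinks to a point, which is why this value is
excluded. A backward `k` is treated as the forward vector `-k` with the opposite sign of `iε`.

The distribution `F`. The regularized propagator is the Fourier transform in time of a damped
oscillation whose frequency is bounded below. Letting `1 - ∂²/∂k₀²` act on the test function
produces a factor `1 + t²`, and dividing by it leaves a kernel that is bounded uniformly in `ε`
(`integral_deltaRet_partialFourier`). The partial Fourier transform of the test function decays
rapidly in `k` and in `l`, so dominated convergence gives the limit, its integrability and the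
seminorm bound.

The slices. Near the sphere of zeros the coordinates are a direction `n` of the rest frame and `x =
k² - 2 k·l`. There the integrand is a smooth function over `x ± iεs` with `s > 0`, and the
Sokhotski–Plemelj formula holds with bounds uniform in `ε` (`norm_integral_near_pole_le`,
`tendsto_integral_near_pole`). The limit is a divided difference plus a delta term. It is smooth in
`k`, and it does not depend on the positive function `s` (`exists_hasLimit_above`). Fubini at `ε >
0`, followed by the limit on both sides, shows that `F` is the integral of its slices
(`loop_eq_integral_slice`).

Spacelike `y`. As `s` is immaterial, the regularization `iε(k₀ - l₀)` may be replaced by one that is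
invariant under the rotations fixing `k`. The two propagators then combine, in the limit, to a
single fraction with denominator `r² + m² - k²/4 ∓ iε` (`tendsto_symmetric`). The angular integral
of the phase is `e^{iτω} sin(Yr)/(Yr)` up to a constant, where `τ` and `Y` are the time and the
distance of `y` in the rest frame; spacelike means `|τ| < Y`. In the rapidity `w`, with `r = m sinh
w` and `ω = m cosh w`, the integrand is meromorphic, and the phase is bounded on the strip `0 ≤ Im w
≤ π/2` because `|τ| < Y`. Shifting the contour to `Im w = π/2` leaves one residue and an
exponentially damped integral (`integral_bottom_eq`). Their limits are explicit and smooth in all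
variables, and they give the representing function `loopFunction`.

The diagonal. Antisymmetry of `σ` makes `kσ` orthogonal to `k`, so `τ = 0`. Moreover `-(kσ)² = q·k`,
where `q` is the energy-momentum tensor of the field `σ` applied to `k`. The identity `q² = λ⁸ k²`
and the reversed Cauchy–Schwarz inequality give the lower bound (`mdot_kSigma_le`). At `τ = 0` the
limit of the radial integral is evaluated a second time, without rotating the contour: directly
below the threshold, and by Sokhotski–Plemelj above it, where the delta term becomes the threshold
term (`exists_isNpIntegral`). The sign of `k₀` enters only through the side from which the pole is
approached, so below the threshold it is invisible. -/

namespace NCPhi3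

open scoped FourierTransform

/-! ### Smooth dependence of integrals on parameters -/

/-- Differentiation under the integral sign, to all orders: `k ↦ ∫ w(x) g(k, x) dμ(x)` is smooth if
`g` is smooth and its derivatives are dominated. -/
theorem contDiffOn_integral_of_dominated {E E' : Type*} [NormedAddCommGroup E] [NormedSpace ℝ E]
    [NormedAddCommGroup E'] [NormedSpace ℝ E'] [MeasurableSpace E'] [BorelSpace E']
    [SecondCountableTopology E'] {U : Set E} {V : Set E'} (hU : IsOpen U) (hV : IsOpen V)
    {g : E × E' → ℂ} (hg : ContDiffOn ℝ ∞ g (U ×ˢ V)) {μ : Measure E'} (hμ : ∀ᵐ x ∂μ, x ∈ V)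
    {w : E' → ℂ} (hw : AEStronglyMeasurable w μ)
    (hb : ∀ n : ℕ, ∀ k₀ ∈ U, ∃ N ∈ 𝓝 k₀, ∃ B : E' → ℝ, Integrable B μ ∧
      ∀ᵐ x ∂μ, ∀ k ∈ N, ‖w x‖ * ‖iteratedFDeriv ℝ n g (k, x)‖ ≤ B x) :
    ContDiffOn ℝ ∞ (fun k => ∫ x, w x * g (k, x) ∂μ) U := by
  have hUV : IsOpen (U ×ˢ V) := hU.prod hV
  have hres : μ.restrict V = μ := Measure.restrict_eq_self_of_ae_mem hμ
  -- The candidate for the n-th derivative in `k`: the total derivative of `g` with all arguments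
  -- restricted to the first factor. The inclusion has norm at most one, so bounds on total
  -- derivatives are enough.
  set p : (n : ℕ) → E → E' → E [×n]→L[ℝ] ℂ := fun n k x =>
    (iteratedFDeriv ℝ n g (k, x)).compContinuousLinearMap fun _ => ContinuousLinearMap.inl ℝ E E'
    with hp
  have hgat : ∀ k ∈ U, ∀ x ∈ V, ContDiffAt ℝ ∞ g (k, x) := fun k hk x hx =>
    hg.contDiffAt (hUV.mem_nhds ⟨hk, hx⟩)
  have hcont : ∀ n, ContinuousOn (fun z => iteratedFDeriv ℝ n g z) (U ×ˢ V) := by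
    intro n
    refine ((hg.continuousOn_iteratedFDerivWithin (m := n) (mod_cast le_top)
      hUV.uniqueDiffOn)).congr ?_
    intro z hz
    exact (iteratedFDerivWithin_of_isOpen n hUV hz).symm
  have hpnorm : ∀ n k x, ‖p n k x‖ ≤ ‖iteratedFDeriv ℝ n g (k, x)‖ := by
    intro n k x
    refine (ContinuousMultilinearMap.norm_compContinuousLinearMap_le _ _).trans ?_
    refine mul_le_of_le_one_right (norm_nonneg _) ?_
    refine Finset.prod_le_one (fun _ _ => norm_nonneg _) fun _ _ => ?_
    exact ContinuousLinearMap.norm_inl_le_one ℝ E E'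
  have hpmeas : ∀ n, ∀ k ∈ U, AEStronglyMeasurable (p n k) μ := by
    intro n k hk
    rw [← hres]
    refine ContinuousOn.aestronglyMeasurable ?_ hV.measurableSet
    have h1 : ContinuousOn (fun x => iteratedFDeriv ℝ n g (k, x)) V :=
      (hcont n).comp (by fun_prop) fun x hx => ⟨hk, hx⟩
    exact (ContinuousMultilinearMap.compContinuousLinearMapL
      (fun _ : Fin n => ContinuousLinearMap.inl ℝ E E')).continuous.comp_continuousOn h1
  have hpderiv : ∀ n, ∀ k ∈ U, ∀ x ∈ V,
      HasFDerivAt (fun k => p n k x) (p (n + 1) k x).curryLeft k := by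
    intro n k hk x hx
    have h1 : DifferentiableAt ℝ (iteratedFDeriv ℝ n g) (k, x) :=
      ((hgat k hk x hx).differentiableAt_iteratedFDeriv (mod_cast ENat.natCast_lt_top n))
    have h2 := h1.hasFDerivAt.comp k ((hasFDerivAt_id (𝕜 := ℝ) k).prodMk (hasFDerivAt_const x k))
    have h3 := (ContinuousMultilinearMap.compContinuousLinearMapL
      (F := ℂ) (fun _ : Fin n => ContinuousLinearMap.inl ℝ E E')).hasFDerivAt.comp k h2
    refine h3.congr_fderiv ?_
    ext v m
    simp only [hp, ContinuousLinearMap.comp_apply, ContinuousLinearMap.prod_apply,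
      ContinuousMultilinearMap.compContinuousLinearMapL_apply,
      ContinuousMultilinearMap.compContinuousLinearMap_apply,
      ContinuousMultilinearMap.curryLeft_apply, iteratedFDeriv_succ_apply_left]
    rfl
  have hpint : ∀ n, ∀ k ∈ U, Integrable (fun x => w x • p n k x) μ := by
    intro n k hk
    obtain ⟨N, hN, B, hB, hle⟩ := hb n k hk
    refine hB.mono' (hw.smul (hpmeas n k hk)) ?_
    filter_upwards [hle] with x hx
    rw [norm_smul]
    exact (mul_le_mul_of_nonneg_left (hpnorm n k x) (norm_nonneg _)).trans
      (hx k (mem_of_mem_nhds hN))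
  have hder : ∀ n, ∀ k ∈ U, HasFDerivAt (fun k => ∫ x, w x • p n k x ∂μ)
      (∫ x, w x • p (n + 1) k x ∂μ).curryLeft k := by
    intro n k hk
    obtain ⟨N, hN, B, hB, hle⟩ := hb (n + 1) k hk
    have key := hasFDerivAt_integral_of_dominated_of_fderiv_le (𝕜 := ℝ) (μ := μ)
      (F := fun k x => w x • p n k x) (F' := fun k x => w x • (p (n + 1) k x).curryLeft)
      (bound := B) (x₀ := k) (s := N ∩ U) (inter_mem hN (hU.mem_nhds hk))
      (by filter_upwards [hU.mem_nhds hk] with k' hk' using (hpint n k' hk').1)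
      (hpint n k hk)
      (by
        refine hw.smul ?_
        exact (continuousMultilinearCurryLeftEquiv ℝ (fun _ : Fin (n + 1) => E) ℂ).continuous
          |>.comp_aestronglyMeasurable (hpmeas (n + 1) k hk))
      (by
        filter_upwards [hle] with x hx k' hk'
        rw [norm_smul]
        refine le_trans ?_ (hx k' hk'.1)
        gcongr
        refine le_trans (le_of_eq ?_) (hpnorm (n + 1) k' x)
        exact ContinuousMultilinearMap.curryLeft_norm _)
      hB
      (by
        filter_upwards [hμ] with x hx k' hk'
        exact (hpderiv n k' hk'.2 x hx).const_smul (w x))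
    refine key.congr_fderiv ?_
    let Λ : (E [×(n + 1)]→L[ℝ] ℂ) →L[ℝ] (E →L[ℝ] E [×n]→L[ℝ] ℂ) :=
      (continuousMultilinearCurryLeftEquiv ℝ (fun _ : Fin (n + 1) => E) ℂ
        ).toContinuousLinearEquiv.toContinuousLinearMap
    have h4 := ContinuousLinearMap.integral_comp_comm (𝕜 := ℝ) (E := E [×(n + 1)]→L[ℝ] ℂ)
      (Fₗ := E →L[ℝ] E [×n]→L[ℝ] ℂ) Λ (hpint (n + 1) k hk)
    exact h4
  have hT : HasFTaylorSeriesUpToOn ∞ (fun k => ∫ x, w x * g (k, x) ∂μ)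
      (fun k n => ∫ x, w x • p n k x ∂μ) U := by
    refine ⟨fun k hk => ?_, fun n _ k hk => (hder n k hk).hasFDerivWithinAt, fun n _ k hk =>
      (hder n k hk).continuousAt.continuousWithinAt⟩
    let Λ : (E [×0]→L[ℝ] ℂ) →L[ℝ] ℂ :=
      (continuousMultilinearCurryFin0 ℝ E ℂ).toContinuousLinearEquiv.toContinuousLinearMap
    have h5 := Λ.integral_comp_comm (hpint 0 k hk)
    refine h5.symm.trans ?_
    rfl
  exact hT.contDiffOn

/-- An integral over a compact set of a smooth function depends smoothly on parameters. -/
theorem contDiffOn_integral_of_isCompact {E E' : Type*} [NormedAddCommGroup E] [NormedSpace ℝ E]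
    [FiniteDimensional ℝ E]
    [NormedAddCommGroup E'] [NormedSpace ℝ E'] [MeasurableSpace E'] [BorelSpace E']
    [SecondCountableTopology E'] {U : Set E} {V Z : Set E'} (hU : IsOpen U) (hV : IsOpen V)
    (hZ : IsCompact Z) (hZV : Z ⊆ V) {g : E × E' → ℂ} (hg : ContDiffOn ℝ ∞ g (U ×ˢ V))
    {μ : Measure E'} [IsFiniteMeasure μ] (hμ : ∀ᵐ x ∂μ, x ∈ Z) :
    ContDiffOn ℝ ∞ (fun k => ∫ x, g (k, x) ∂μ) U := by
  have h := contDiffOn_integral_of_dominated hU hV hg (hμ.mono fun x hx => hZV hx)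
    (w := fun _ => 1) aestronglyMeasurable_const ?_
  · simpa using h
  intro n k₀ hk₀
  -- In finite dimension `k₀` has a compact neighbourhood inside `U`. On its product with `Z` each
  -- derivative is bounded by a constant, which is integrable for a finite measure.
  obtain ⟨N, hN, hNU, hNc⟩ := local_compact_nhds (hU.mem_nhds hk₀)
  have hUV : IsOpen (U ×ˢ V) := hU.prod hV
  have hcont : ContinuousOn (fun z => iteratedFDeriv ℝ n g z) (N ×ˢ Z) := by
    refine (((hg.continuousOn_iteratedFDerivWithin (m := n) (mod_cast le_top)
      hUV.uniqueDiffOn)).congr ?_).mono (prod_mono hNU hZV)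
    intro z hz
    exact (iteratedFDerivWithin_of_isOpen n hUV hz).symm
  obtain ⟨C, hC⟩ := (hNc.prod hZ).exists_bound_of_continuousOn hcont
  refine ⟨N, hN, fun _ => C, integrable_const _, ?_⟩
  filter_upwards [hμ] with x hx k hk
  simpa using hC (k, x) ⟨hk, hx⟩


/-! ### The Sokhotski–Plemelj formula with a variable regularization -/

section Pole

open Complex

lemma abs_le_norm_ofReal_add_I_mul (x b : ℝ) : |x| ≤ ‖(x : ℂ) + I * (b : ℂ)‖ := by
  simpa using Complex.abs_re_le_norm ((x : ℂ) + I * (b : ℂ))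

lemma abs_le_norm_ofReal_add_I_mul' (x b : ℝ) : |b| ≤ ‖(x : ℂ) + I * (b : ℂ)‖ := by
  simpa using Complex.abs_im_le_norm ((x : ℂ) + I * (b : ℂ))

lemma ofReal_add_I_mul_ne_zero {x b : ℝ} (h : x ≠ 0 ∨ b ≠ 0) : (x : ℂ) + I * (b : ℂ) ≠ 0 := by
  intro h0
  have h1 := congrArg Complex.re h0
  have h2 := congrArg Complex.im h0
  simp at h1 h2
  tauto

/-- An antiderivative is `½ log(x² + b²) - i arctan(x/b)`, built from real functions without branch
cuts. The logarithm is even and cancels over the symmetric interval. -/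
lemma integral_inv_ofReal_add_I_mul (δ : ℝ) {b : ℝ} (hb : b ≠ 0) :
    ∫ x in (-δ)..δ, ((x : ℂ) + I * (b : ℂ))⁻¹ = -2 * I * (Real.arctan (δ / b) : ℂ) := by
  have hne : ∀ x : ℝ, (x : ℂ) + I * (b : ℂ) ≠ 0 := fun x => ofReal_add_I_mul_ne_zero (Or.inr hb)
  have hd : ∀ x ∈ uIcc (-δ) δ, HasDerivAt
      (fun x : ℝ => ((1 / 2 * Real.log (x ^ 2 + b ^ 2) : ℝ) : ℂ) - I * (Real.arctan (x / b) : ℂ))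
      (((x : ℂ) + I * (b : ℂ))⁻¹) x := by
    intro x _
    have hp : x ^ 2 + b ^ 2 ≠ 0 := by positivity
    have h1 : HasDerivAt (fun x : ℝ => 1 / 2 * Real.log (x ^ 2 + b ^ 2))
        (1 / 2 * (2 * x / (x ^ 2 + b ^ 2))) x := by
      have := (((hasDerivAt_id x).pow 2).add_const (b ^ 2)).log hp
      refine (this.const_mul (1 / 2 : ℝ)).congr_deriv ?_
      simp
    have h2 : HasDerivAt (fun x : ℝ => Real.arctan (x / b))
        (1 / (1 + (x / b) ^ 2) * (1 / b)) x := ((hasDerivAt_id x).div_const b).arctan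
    refine (h1.ofReal_comp.sub (h2.ofReal_comp.const_mul I)).congr_deriv ?_
    refine eq_inv_of_mul_eq_one_left ?_
    have hp' : (x : ℂ) ^ 2 + (b : ℂ) ^ 2 ≠ 0 := by exact_mod_cast hp
    have hb' : (b : ℂ) ≠ 0 := by exact_mod_cast hb
    have e1 : 1 / (1 + (x / b) ^ 2) * (1 / b) = b / (x ^ 2 + b ^ 2) := by
      have : b ^ 2 + x ^ 2 ≠ 0 := by positivity
      have : 1 + (x / b) ^ 2 ≠ 0 := by positivity
      field_simp
      ring
    rw [e1]
    push_cast
    field_simp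
    ring_nf
    rw [I_sq]
    ring
  rw [intervalIntegral.integral_eq_sub_of_hasDerivAt hd]
  · rw [neg_div, Real.arctan_neg]
    push_cast
    ring_nf
  · refine ContinuousOn.intervalIntegrable ?_
    exact (ContinuousOn.inv₀ (by fun_prop) fun x _ => hne x)

variable {δ A L s₀ : ℝ} {ψ : ℝ → ℂ} {s : ℝ → ℝ}

/-- The difference has numerator of size `|ε| |s₂ - s₁|`. One factor of the denominator is at least
`|x|`, which absorbs the Lipschitz bound, and the other is at least `|ε| s₂`. Hence the estimate is
uniform in `ε` and `x`. -/
lemma norm_inv_sub_inv_le {s₁ s₂ s₀ L ε x : ℝ} (hL0 : 0 ≤ L) (hs₀ : 0 < s₀) (h₂ : s₀ ≤ s₂) (h₁ : s₀ ≤ s₁)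
    (hε : ε ≠ 0) (hL : |s₁ - s₂| ≤ L * |x|) :
    ‖((x : ℂ) + I * ((ε * s₁ : ℝ) : ℂ))⁻¹ - ((x : ℂ) + I * ((ε * s₂ : ℝ) : ℂ))⁻¹‖ ≤ L / s₀ := by
  have n1 : (x : ℂ) + I * ((ε * s₁ : ℝ) : ℂ) ≠ 0 :=
    ofReal_add_I_mul_ne_zero (Or.inr (mul_ne_zero hε (by linarith)))
  have n2 : (x : ℂ) + I * ((ε * s₂ : ℝ) : ℂ) ≠ 0 :=
    ofReal_add_I_mul_ne_zero (Or.inr (mul_ne_zero hε (by linarith)))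
  rw [inv_sub_inv n1 n2, norm_div, norm_mul]
  have e : (x : ℂ) + I * ((ε * s₂ : ℝ) : ℂ) - ((x : ℂ) + I * ((ε * s₁ : ℝ) : ℂ)) =
      I * ((ε * (s₂ - s₁) : ℝ) : ℂ) := by push_cast; ring
  rw [e, norm_mul, norm_I, one_mul, norm_real, Real.norm_eq_abs, abs_mul]
  have b1 := abs_le_norm_ofReal_add_I_mul x (ε * s₁)
  have b2 := abs_le_norm_ofReal_add_I_mul' x (ε * s₂)
  rw [abs_mul, abs_of_pos (show 0 < s₂ by linarith)] at b2
  have hε' : 0 < |ε| := abs_pos.2 hε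
  have p1 := norm_pos_iff.2 n1
  have p2 := norm_pos_iff.2 n2
  rw [div_le_div_iff₀ (mul_pos p1 p2) hs₀]
  rw [abs_sub_comm] at hL
  have hLx : 0 ≤ L * |x| := (abs_nonneg _).trans hL
  have hs₂ : 0 < s₂ := by linarith
  calc |ε| * |s₂ - s₁| * s₀ ≤ |ε| * (L * |x|) * s₂ := by gcongr
    _ = L * (|x| * (|ε| * s₂)) := by ring
    _ ≤ L * (‖(x : ℂ) + I * ((ε * s₁ : ℝ) : ℂ)‖ * ‖(x : ℂ) + I * ((ε * s₂ : ℝ) : ℂ)‖) := by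
      gcongr

/-- The simple pole in the regularization `x + iεs(x)`, split into convergent parts. -/
lemma integral_near_pole_eq (hδ : 0 < δ) (hψ : ContinuousOn ψ (Icc (-δ) δ))
    (hs : ContinuousOn s (Icc (-δ) δ)) (hs₀ : 0 < s₀) (hss : ∀ x ∈ Icc (-δ) δ, s₀ ≤ s x)
    {ε : ℝ} (hε : ε ≠ 0) :
    ∫ x in (-δ)..δ, ψ x / ((x : ℂ) + I * ((ε * s x : ℝ) : ℂ)) =
      (∫ x in (-δ)..δ, (ψ x - ψ 0) / ((x : ℂ) + I * ((ε * s x : ℝ) : ℂ))) +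
      ψ 0 * (∫ x in (-δ)..δ, (((x : ℂ) + I * ((ε * s x : ℝ) : ℂ))⁻¹ -
        ((x : ℂ) + I * ((ε * s 0 : ℝ) : ℂ))⁻¹)) +
      ψ 0 * (-2 * I * (Real.arctan (δ / (ε * s 0)) : ℂ)) := by
  have h0 : (0 : ℝ) ∈ Icc (-δ) δ := ⟨by linarith, hδ.le⟩
  have hu : uIcc (-δ) δ = Icc (-δ) δ := uIcc_of_le (by linarith)
  have hne : ∀ x ∈ Icc (-δ) δ, (x : ℂ) + I * ((ε * s x : ℝ) : ℂ) ≠ 0 := fun x hx =>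
    ofReal_add_I_mul_ne_zero (Or.inr (mul_ne_zero hε (by linarith [hss x hx])))
  have hb : ε * s 0 ≠ 0 := mul_ne_zero hε (by linarith [hss 0 h0])
  have hne0 : ∀ x : ℝ, (x : ℂ) + I * ((ε * s 0 : ℝ) : ℂ) ≠ 0 := fun x =>
    ofReal_add_I_mul_ne_zero (Or.inr hb)
  have hc : ContinuousOn (fun x : ℝ => ((x : ℂ) + I * ((ε * s x : ℝ) : ℂ))⁻¹) (Icc (-δ) δ) := by
    refine ContinuousOn.inv₀ ?_ hne
    have : ContinuousOn (fun x => ((ε * s x : ℝ) : ℂ)) (Icc (-δ) δ) :=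
      continuous_ofReal.comp_continuousOn (continuousOn_const.mul hs)
    fun_prop
  have hc0 : ContinuousOn (fun x : ℝ => ((x : ℂ) + I * ((ε * s 0 : ℝ) : ℂ))⁻¹) (Icc (-δ) δ) :=
    ContinuousOn.inv₀ (by fun_prop) fun x _ => hne0 x
  rw [← integral_inv_ofReal_add_I_mul δ hb, ← intervalIntegral.integral_const_mul,
    ← intervalIntegral.integral_const_mul, ← intervalIntegral.integral_add,
    ← intervalIntegral.integral_add]
  · refine intervalIntegral.integral_congr fun x _ => ?_
    simp only [div_eq_mul_inv]
    ring
  all_goals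
    refine ContinuousOn.intervalIntegrable ?_
    rw [hu]
  · simp only [div_eq_mul_inv]
    exact ((hψ.sub continuousOn_const).mul hc).add (continuousOn_const.mul (hc.sub hc0))
  · exact continuousOn_const.mul hc0
  · simp only [div_eq_mul_inv]
    exact (hψ.sub continuousOn_const).mul hc
  · exact continuousOn_const.mul (hc.sub hc0)

lemma norm_sub_div_le {ψ₀ ψ₁ : ℂ} {A b x : ℝ} (hA : 0 ≤ A) (h : ‖ψ₁ - ψ₀‖ ≤ A * |x|) :
    ‖(ψ₁ - ψ₀) / ((x : ℂ) + I * (b : ℂ))‖ ≤ A := by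
  rw [norm_div]
  refine div_le_of_le_mul₀ (norm_nonneg _) hA (h.trans ?_)
  gcongr
  exact abs_le_norm_ofReal_add_I_mul x b

/-- The three parts of the splitting are bounded separately. The bound is independent of `ε`, which
allows dominated convergence over directions, and linear in `A`, which yields continuity in the test
function. -/
lemma norm_integral_near_pole_le (hδ : 0 < δ) (hψ : ContinuousOn ψ (Icc (-δ) δ))
    (hs : ContinuousOn s (Icc (-δ) δ)) (hs₀ : 0 < s₀) (hss : ∀ x ∈ Icc (-δ) δ, s₀ ≤ s x)
    (hA : 0 ≤ A) (hL : 0 ≤ L)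
    (hψ0 : ‖ψ 0‖ ≤ A) (hψA : ∀ x ∈ Icc (-δ) δ, ‖ψ x - ψ 0‖ ≤ A * |x|)
    (hsL : ∀ x ∈ Icc (-δ) δ, |s x - s 0| ≤ L * |x|) {ε : ℝ} (hε : ε ≠ 0) :
    ‖∫ x in (-δ)..δ, ψ x / ((x : ℂ) + I * ((ε * s x : ℝ) : ℂ))‖ ≤
      A * (2 * δ + L / s₀ * (2 * δ) + Real.pi) := by
  have h0 : (0 : ℝ) ∈ Icc (-δ) δ := ⟨by linarith, hδ.le⟩
  have habs : |δ - -δ| = 2 * δ := by rw [abs_of_pos (by linarith)]; ring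
  have hsub : ∀ x ∈ uIoc (-δ) δ, x ∈ Icc (-δ) δ := fun x hx => by
    rw [uIoc_of_le (by linarith)] at hx
    exact ⟨hx.1.le, hx.2⟩
  rw [integral_near_pole_eq hδ hψ hs hs₀ hss hε]
  have b1 : ‖∫ x in (-δ)..δ, (ψ x - ψ 0) / ((x : ℂ) + I * ((ε * s x : ℝ) : ℂ))‖ ≤ A * (2 * δ) := by
    rw [← habs]
    exact intervalIntegral.norm_integral_le_of_norm_le_const fun x hx =>
      norm_sub_div_le hA (hψA x (hsub x hx))
  have b2 : ‖∫ x in (-δ)..δ, (((x : ℂ) + I * ((ε * s x : ℝ) : ℂ))⁻¹ -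
        ((x : ℂ) + I * ((ε * s 0 : ℝ) : ℂ))⁻¹)‖ ≤ L / s₀ * (2 * δ) := by
    rw [← habs]
    exact intervalIntegral.norm_integral_le_of_norm_le_const fun x hx =>
      norm_inv_sub_inv_le hL hs₀ (hss 0 h0) (hss x (hsub x hx)) hε (hsL x (hsub x hx))
  have b3 : ‖-2 * I * (Real.arctan (δ / (ε * s 0)) : ℂ)‖ ≤ Real.pi := by
    have : |Real.arctan (δ / (ε * s 0))| ≤ Real.pi / 2 :=
      abs_le.2 ⟨(Real.neg_pi_div_two_lt_arctan _).le, (Real.arctan_lt_pi_div_two _).le⟩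
    simp only [norm_mul, norm_neg, norm_I, Complex.norm_two, norm_real, Real.norm_eq_abs]
    linarith
  have hLs : 0 ≤ L / s₀ * (2 * δ) := by positivity
  calc _ ≤ A * (2 * δ) + A * (L / s₀ * (2 * δ)) + A * Real.pi := by
        refine norm_add₃_le.trans ?_
        rw [norm_mul, norm_mul]
        gcongr
    _ = _ := by ring

/-- The first part converges by dominated convergence to the divided difference, which is the
principal value over a symmetric interval. In the second part `s x` is replaced by `s 0`; its
integrand is bounded and tends to zero off `x = 0`. The arctangent in the third part tends to
`±π/2`. So `s` has no influence on the limit. -/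
lemma tendsto_integral_near_pole (hδ : 0 < δ) (hψ : ContinuousOn ψ (Icc (-δ) δ))
    (hs : ContinuousOn s (Icc (-δ) δ)) (hs₀ : 0 < s₀) (hss : ∀ x ∈ Icc (-δ) δ, s₀ ≤ s x)
    (hA : 0 ≤ A) (hL : 0 ≤ L) (hψA : ∀ x ∈ Icc (-δ) δ, ‖ψ x - ψ 0‖ ≤ A * |x|)
    (hsL : ∀ x ∈ Icc (-δ) δ, |s x - s 0| ≤ L * |x|) {η : ℝ} (hη : η = 1 ∨ η = -1) :
    Tendsto (fun ε : ℝ => ∫ x in (-δ)..δ, ψ x / ((x : ℂ) + I * ((η * ε * s x : ℝ) : ℂ)))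
      (𝓝[>] 0) (𝓝 ((∫ x in (-δ)..δ, (ψ x - ψ 0) / (x : ℂ)) - I * (η * Real.pi : ℝ) * ψ 0)) := by
  have h0 : (0 : ℝ) ∈ Icc (-δ) δ := ⟨by linarith, hδ.le⟩
  have hu : uIcc (-δ) δ = Icc (-δ) δ := uIcc_of_le (by linarith)
  have hη0 : η ≠ 0 := by rcases hη with rfl | rfl <;> norm_num
  have hsub : ∀ x ∈ uIoc (-δ) δ, x ∈ Icc (-δ) δ := fun x hx => by
    rw [uIoc_of_le (by linarith)] at hx
    exact ⟨hx.1.le, hx.2⟩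
  have hx0 : ∀ᵐ x : ℝ, x ≠ 0 := by simp [ae_iff, measure_singleton]
  have hpos : ∀ᶠ ε : ℝ in 𝓝[>] 0, 0 < ε := eventually_mem_nhdsWithin
  have hlim : ∀ x : ℝ, x ≠ 0 → ∀ b : ℝ, Tendsto
      (fun ε : ℝ => ((x : ℂ) + I * ((η * ε * b : ℝ) : ℂ))⁻¹) (𝓝[>] 0) (𝓝 ((x : ℂ)⁻¹)) := by
    intro x hx b
    refine tendsto_nhdsWithin_of_tendsto_nhds ?_
    have : ContinuousAt (fun ε : ℝ => ((x : ℂ) + I * ((η * ε * b : ℝ) : ℂ))⁻¹) 0 :=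
      ContinuousAt.inv₀ (by fun_prop) (ofReal_add_I_mul_ne_zero (Or.inl hx))
    simpa [ContinuousAt] using this
  have hmeas1 : ∀ ε : ℝ, 0 < ε → ∀ x ∈ Icc (-δ) δ,
      (x : ℂ) + I * ((η * ε * s x : ℝ) : ℂ) ≠ 0 := fun ε hε x hx =>
    ofReal_add_I_mul_ne_zero (Or.inr (mul_ne_zero (mul_ne_zero hη0 hε.ne') (by
      linarith [hss x hx])))
  have hc : ∀ ε : ℝ, 0 < ε →
      ContinuousOn (fun x : ℝ => ((x : ℂ) + I * ((η * ε * s x : ℝ) : ℂ))⁻¹) (Icc (-δ) δ) := by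
    intro ε hε
    refine ContinuousOn.inv₀ ?_ (hmeas1 ε hε)
    have : ContinuousOn (fun x => ((η * ε * s x : ℝ) : ℂ)) (Icc (-δ) δ) :=
      continuous_ofReal.comp_continuousOn (continuousOn_const.mul hs)
    fun_prop
  have hIoc : uIoc (-δ) δ ⊆ Icc (-δ) δ := hsub
  have t1 : Tendsto (fun ε : ℝ => ∫ x in (-δ)..δ,
      (ψ x - ψ 0) / ((x : ℂ) + I * ((η * ε * s x : ℝ) : ℂ))) (𝓝[>] 0)
      (𝓝 (∫ x in (-δ)..δ, (ψ x - ψ 0) / (x : ℂ))) := by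
    refine intervalIntegral.tendsto_integral_filter_of_dominated_convergence (fun _ => A) ?_ ?_
      intervalIntegrable_const ?_
    · filter_upwards [hpos] with ε hε
      refine (ContinuousOn.aestronglyMeasurable ?_ measurableSet_Icc).mono_measure
        (Measure.restrict_mono hIoc le_rfl)
      simp only [div_eq_mul_inv]
      exact (hψ.sub continuousOn_const).mul (hc ε hε)
    · filter_upwards with ε
      exact Eventually.of_forall fun x hx => norm_sub_div_le hA (hψA x (hsub x hx))
    · filter_upwards [hx0] with x hx _
      simp only [div_eq_mul_inv]
      exact (hlim x hx (s x)).const_mul _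
  have t2 : Tendsto (fun ε : ℝ => ∫ x in (-δ)..δ, (((x : ℂ) + I * ((η * ε * s x : ℝ) : ℂ))⁻¹ -
        ((x : ℂ) + I * ((η * ε * s 0 : ℝ) : ℂ))⁻¹)) (𝓝[>] 0) (𝓝 (∫ _ in (-δ)..δ, (0 : ℂ))) := by
    refine intervalIntegral.tendsto_integral_filter_of_dominated_convergence (fun _ => L / s₀) ?_ ?_
      intervalIntegrable_const ?_
    · filter_upwards [hpos] with ε hε
      refine (ContinuousOn.aestronglyMeasurable ?_ measurableSet_Icc).mono_measure
        (Measure.restrict_mono hIoc le_rfl)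
      refine (hc ε hε).sub (ContinuousOn.inv₀ (by fun_prop) fun x _ => ?_)
      exact ofReal_add_I_mul_ne_zero (Or.inr (mul_ne_zero (mul_ne_zero hη0 hε.ne') (by
        linarith [hss 0 h0])))
    · filter_upwards [hpos] with ε hε
      exact Eventually.of_forall fun x hx => norm_inv_sub_inv_le hL hs₀ (hss 0 h0)
        (hss x (hsub x hx)) (mul_ne_zero hη0 hε.ne') (hsL x (hsub x hx))
    · filter_upwards [hx0] with x hx _
      simpa using (hlim x hx (s x)).sub (hlim x hx (s 0))
  have t3 : Tendsto (fun ε : ℝ => (Real.arctan (δ / (η * ε * s 0)) : ℂ)) (𝓝[>] 0)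
      (𝓝 ((η * (Real.pi / 2) : ℝ) : ℂ)) := by
    refine (continuous_ofReal.tendsto _).comp ?_
    have hs0 : 0 < s 0 := by linarith [hss 0 h0]
    have e : ∀ ε : ℝ, Real.arctan (δ / (η * ε * s 0)) = η * Real.arctan (δ / s 0 * ε⁻¹) := by
      intro ε
      have e1 : δ / (η * ε * s 0) = η * (δ / s 0 * ε⁻¹) := by
        rcases hη with rfl | rfl <;> simp only [div_eq_mul_inv, mul_inv] <;> norm_num <;> ring
      rw [e1]
      rcases hη with rfl | rfl <;> simp
    simp only [e]
    refine Tendsto.const_mul _ ((Real.tendsto_arctan_atTop.mono_right nhdsWithin_le_nhds).comp ?_)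
    exact tendsto_inv_nhdsGT_zero.const_mul_atTop (by positivity)
  have tt := (t1.add (t2.const_mul (ψ 0))).add ((t3.const_mul (-2 * I)).const_mul (ψ 0))
  have e : ∀ᶠ ε : ℝ in 𝓝[>] 0, _ = ∫ x in (-δ)..δ, ψ x / ((x : ℂ) + I * ((η * ε * s x : ℝ) : ℂ)) :=
    hpos.mono fun ε hε => (integral_near_pole_eq hδ hψ hs hs₀ hss (mul_ne_zero hη0 hε.ne')).symm
  refine (tt.congr' e).trans (le_of_eq (congrArg 𝓝 ?_))
  simp only [intervalIntegral.integral_zero]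
  push_cast
  ring

end Pole


/-! ### The residue theorem for a rectangle -/

section Residue

open Complex

/-- The integral along the boundary of the rectangle `[-R, R] × [0, T]`. -/
noncomputable def rectIntegral (R T : ℝ) (f : ℂ → ℂ) : ℂ :=
  (∫ x : ℝ in (-R)..R, f (x + ((0 : ℝ) : ℂ) * I)) - (∫ x : ℝ in (-R)..R, f (x + (T : ℂ) * I)) +
    I * (∫ y : ℝ in (0 : ℝ)..T, f ((R : ℂ) + y * I)) -
    I * (∫ y : ℝ in (0 : ℝ)..T, f (((-R : ℝ) : ℂ) + y * I))

variable {R T : ℝ} {w₀ : ℂ}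

lemma rectIntegral_eq_zero (hR : 0 < R) (hT : 0 < T) {f : ℂ → ℂ}
    (hf : DifferentiableOn ℂ f (Icc (-R) R ×ℂ Icc 0 T)) : rectIntegral R T f = 0 := by
  have h := integral_boundary_rect_eq_zero_of_differentiableOn f
    (((-R : ℝ) : ℂ) + ((0 : ℝ) : ℂ) * I) ((R : ℂ) + (T : ℂ) * I) (by
      simpa [uIcc_of_le (show -R ≤ R by linarith), uIcc_of_le hT.le] using hf)
  simpa [rectIntegral] using h

lemma log_sub_log_neg {w : ℂ} (hw : 0 < w.im) : log w - log (-w) = Real.pi * I := by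
  rw [Complex.log, Complex.log, norm_neg, arg_neg_eq_arg_sub_pi_of_im_pos hw]
  push_cast
  ring

/-- The principal logarithm of `w - w₀` is an antiderivative on the lower, upper and right sides.
The left side crosses the branch cut, so there the logarithm of `-(w - w₀)` is used. At each of the
two left corners the logarithms differ by `πi`. -/
lemma rectIntegral_inv_sub (h₁ : -R < w₀.re) (h₂ : w₀.re < R) (h₃ : 0 < w₀.im) (h₄ : w₀.im < T) :
    rectIntegral R T (fun w => (w - w₀)⁻¹) = 2 * Real.pi * I := by
  have hor : ∀ t : ℝ, t ≠ w₀.im →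
      ∫ x : ℝ in (-R)..R, ((x : ℂ) + (t : ℂ) * I - w₀)⁻¹ =
        log ((R : ℂ) + t * I - w₀) - log (((-R : ℝ) : ℂ) + t * I - w₀) := by
    intro t ht
    have him : ∀ x : ℝ, ((x : ℂ) + (t : ℂ) * I - w₀).im ≠ 0 := fun x => by
      simpa [sub_eq_zero] using ht
    rw [intervalIntegral.integral_eq_sub_of_hasDerivAt
      (f := fun x : ℝ => log ((x : ℂ) + t * I - w₀))]
    · intro x _
      have h := (((hasDerivAt_id x).ofReal_comp.add_const ((t : ℂ) * I)).sub_const w₀).clog_real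
        (mem_slitPlane_iff.2 (Or.inr (him x)))
      simpa using h
    · refine Continuous.intervalIntegrable ?_ _ _
      exact Continuous.inv₀ (by fun_prop) fun x h => him x (by rw [h]; rfl)
  have ver1 : I * ∫ y : ℝ in (0 : ℝ)..T, ((R : ℂ) + (y : ℂ) * I - w₀)⁻¹ =
      log ((R : ℂ) + T * I - w₀) - log ((R : ℂ) + ((0 : ℝ) : ℂ) * I - w₀) := by
    have hre : ∀ y : ℝ, 0 < ((R : ℂ) + (y : ℂ) * I - w₀).re := fun y => by simpa using h₂
    rw [← intervalIntegral.integral_const_mul, intervalIntegral.integral_eq_sub_of_hasDerivAt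
      (f := fun y : ℝ => log ((R : ℂ) + y * I - w₀))]
    · intro y _
      have h := ((((hasDerivAt_id y).ofReal_comp.mul_const I).const_add (R : ℂ)).sub_const
        w₀).clog_real (mem_slitPlane_iff.2 (Or.inl (hre y)))
      simpa [div_eq_mul_inv] using h
    · refine Continuous.intervalIntegrable ?_ _ _
      exact continuous_const.mul (Continuous.inv₀ (by fun_prop) fun y h =>
        (hre y).ne' (by rw [h]; rfl))
  have ver2 : I * ∫ y : ℝ in (0 : ℝ)..T, (((-R : ℝ) : ℂ) + (y : ℂ) * I - w₀)⁻¹ =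
      log (-(((-R : ℝ) : ℂ) + T * I - w₀)) - log (-(((-R : ℝ) : ℂ) + ((0 : ℝ) : ℂ) * I - w₀)) := by
    have hre : ∀ y : ℝ, 0 < (-(((-R : ℝ) : ℂ) + (y : ℂ) * I - w₀)).re := fun y => by
      simp; linarith
    rw [← intervalIntegral.integral_const_mul, intervalIntegral.integral_eq_sub_of_hasDerivAt
      (f := fun y : ℝ => log (-(((-R : ℝ) : ℂ) + y * I - w₀)))]
    · intro y _
      have h := ((((hasDerivAt_id y).ofReal_comp.mul_const I).const_add ((-R : ℝ) : ℂ)).sub_const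
        w₀).neg.clog_real (mem_slitPlane_iff.2 (Or.inl (hre y)))
      refine h.congr_deriv ?_
      simp only [Pi.neg_apply, id, neg_div_neg_eq]
      simp [div_eq_mul_inv]
    · refine Continuous.intervalIntegrable ?_ _ _
      exact continuous_const.mul (Continuous.inv₀ (by fun_prop) fun y h =>
        (hre y).ne' (by rw [h]; simp))
  rw [rectIntegral, hor 0 h₃.ne, hor T h₄.ne', ver1, ver2]
  have e1 := log_sub_log_neg (w := ((-R : ℝ) : ℂ) + T * I - w₀) (by simpa using h₄)
  have e2 := log_sub_log_neg (w := -(((-R : ℝ) : ℂ) + ((0 : ℝ) : ℂ) * I - w₀)) (by simpa using h₃)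
  rw [neg_neg] at e2
  linear_combination e1 + e2

/-- The residue theorem for a simple pole inside a rectangle. -/
lemma rectIntegral_div_sub (h₁ : -R < w₀.re) (h₂ : w₀.re < R) (h₃ : 0 < w₀.im) (h₄ : w₀.im < T)
    {S : Set ℂ} (hS : IsOpen S) (hRS : Icc (-R) R ×ℂ Icc 0 T ⊆ S) {M : ℂ → ℂ}
    (hM : DifferentiableOn ℂ M S) :
    rectIntegral R T (fun w => M w / (w - w₀)) = 2 * Real.pi * I * M w₀ := by
  have hR : 0 < R := by linarith
  have hT : 0 < T := by linarith
  have hw₀ : w₀ ∈ S := hRS ⟨⟨h₁.le, h₂.le⟩, ⟨h₃.le, h₄.le⟩⟩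
  -- By removability of the singularity the difference quotient is holomorphic at `w₀` as well. Its
  -- contour integral vanishes, and only `M w₀ / (w - w₀)` contributes.
  have hd : DifferentiableOn ℂ (dslope M w₀) S := (differentiableOn_dslope (hS.mem_nhds hw₀)).2 hM
  have h0 := rectIntegral_eq_zero hR hT (hd.mono hRS)
  have hi := rectIntegral_inv_sub h₁ h₂ h₃ h₄
  have key : ∀ w ≠ w₀, M w / (w - w₀) = dslope M w₀ w + M w₀ * (w - w₀)⁻¹ := by
    intro w hw
    have : w - w₀ ≠ 0 := sub_ne_zero.2 hw
    rw [dslope_of_ne _ hw, slope_def_field]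
    field_simp
    ring
  have path : ∀ (a b : ℝ) (γ : ℝ → ℂ), Continuous γ →
      (∀ x ∈ uIcc a b, γ x ∈ Icc (-R) R ×ℂ Icc 0 T) → (∀ x ∈ uIcc a b, γ x ≠ w₀) →
      ∫ x in a..b, M (γ x) / (γ x - w₀) =
        (∫ x in a..b, dslope M w₀ (γ x)) + M w₀ * ∫ x in a..b, (γ x - w₀)⁻¹ := by
    intro a b γ hγ hin hne
    rw [← intervalIntegral.integral_const_mul, ← intervalIntegral.integral_add]
    · exact intervalIntegral.integral_congr fun x hx => key _ (hne x hx)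
    · refine ContinuousOn.intervalIntegrable ?_
      exact hd.continuousOn.comp hγ.continuousOn fun x hx => hRS (hin x hx)
    · refine ContinuousOn.intervalIntegrable ?_
      exact continuousOn_const.mul (ContinuousOn.inv₀ (by fun_prop) fun x hx =>
        sub_ne_zero.2 (hne x hx))
  have hu1 : uIcc (-R) R = Icc (-R) R := uIcc_of_le (by linarith)
  have hu2 : uIcc 0 T = Icc 0 T := uIcc_of_le hT.le
  have p1 := path (-R) R (fun x => (x : ℂ) + ((0 : ℝ) : ℂ) * I) (by fun_prop)
    (by rw [hu1]; intro x hx; simpa [mem_reProdIm, hT.le] using hx)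
    (fun x _ h => by have := congrArg Complex.im h; simp at this; linarith)
  have p2 := path (-R) R (fun x => (x : ℂ) + (T : ℂ) * I) (by fun_prop)
    (by rw [hu1]; intro x hx; simpa [mem_reProdIm, hT.le] using hx)
    (fun x _ h => by have := congrArg Complex.im h; simp at this; linarith)
  have p3 := path 0 T (fun y => (R : ℂ) + (y : ℂ) * I) (by fun_prop)
    (by rw [hu2]; intro x hx; simpa [mem_reProdIm, hR.le] using hx)
    (fun x _ h => by have := congrArg Complex.re h; simp at this; linarith)
  have p4 := path 0 T (fun y => ((-R : ℝ) : ℂ) + (y : ℂ) * I) (by fun_prop)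
    (by rw [hu2]; intro x hx; simpa [mem_reProdIm, hR.le] using hx)
    (fun x _ h => by have := congrArg Complex.re h; simp at this; linarith)
  simp only [rectIntegral] at h0 hi ⊢
  rw [p1, p2, p3, p4]
  linear_combination h0 + M w₀ * hi

/-- The residue theorem for a quotient of entire functions with a simple pole in a rectangle. -/
lemma rectIntegral_div (h₁ : -R < w₀.re) (h₂ : w₀.re < R) (h₃ : 0 < w₀.im) (h₄ : w₀.im < T)
    {N D : ℂ → ℂ} (hN : Differentiable ℂ N) (hD : Differentiable ℂ D)
    (hD0 : ∀ w ∈ Icc (-R) R ×ℂ Icc 0 T, D w = 0 → w = w₀) (hDw : D w₀ = 0) {d : ℂ}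
    (hd : HasDerivAt D d w₀) (hd0 : d ≠ 0) :
    rectIntegral R T (fun w => N w / D w) = 2 * Real.pi * I * (N w₀ / d) := by
  have hds : Differentiable ℂ (dslope D w₀) := by
    rw [← differentiableOn_univ] at hD ⊢
    exact (differentiableOn_dslope univ_mem).2 hD
  -- On this open set `N / D` equals a holomorphic function over `w - w₀`: the difference quotient
  -- of `D` is moved into the numerator. It contains the closed rectangle because the zero of `D` is
  -- simple and is the only one there.
  set S : Set ℂ := {w | dslope D w₀ w ≠ 0}
  have hS : IsOpen S := isOpen_ne_fun hds.continuous continuous_const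
  have hdd : dslope D w₀ w₀ = d := by rw [dslope_same, hd.deriv]
  have hRS : Icc (-R) R ×ℂ Icc 0 T ⊆ S := by
    intro w hw
    rcases eq_or_ne w w₀ with rfl | hne
    · exact fun h => hd0 (hdd ▸ h)
    · simp only [S, mem_ofPred_eq, dslope_of_ne _ hne, slope_def_field, hDw, sub_zero]
      exact div_ne_zero (fun h => hne (hD0 w hw h)) (sub_ne_zero.2 hne)
  have h := rectIntegral_div_sub h₁ h₂ h₃ h₄ hS hRS (M := fun w => N w / dslope D w₀ w)
    (hN.differentiableOn.div hds.differentiableOn fun w hw => hw)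
  simp only [hdd] at h
  rw [← h]
  congr 1
  ext w
  rcases eq_or_ne w w₀ with rfl | hne
  · simp [hDw]
  · rw [dslope_of_ne _ hne, slope_def_field, hDw, sub_zero, div_div, div_mul_cancel₀]
    exact sub_ne_zero.2 hne

end Residue


/-! ### Rapidity coordinates for the radial integral -/

section Wick

open Complex

/-- Both factors of `(r - z)(r + z)` stay at distance at least `Im z` from zero and grow like `|r|`,
hence each is bounded below by a multiple of `1 + |r|`. -/
lemma exists_le_norm_sq_sub_sq {z : ℂ} (hz : 0 < z.im) :
    ∃ c > 0, ∀ r : ℝ, c * (1 + r ^ 2) ≤ ‖(r : ℂ) ^ 2 - z ^ 2‖ := by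
  have h1 : ∀ w : ℂ, |w.im| = z.im → ‖w‖ = ‖z‖ → ∀ r : ℝ,
      1 + |r| ≤ ((1 + ‖z‖) / z.im + 1) * ‖(r : ℂ) - w‖ := by
    intro w hw hwz r
    have a1 : z.im ≤ ‖(r : ℂ) - w‖ := by
      rw [← hw, ← abs_neg]
      simpa using abs_im_le_norm ((r : ℂ) - w)
    have a2 : |r| ≤ ‖z‖ + ‖(r : ℂ) - w‖ := by
      have := norm_add_le w ((r : ℂ) - w)
      rw [add_sub_cancel, norm_real, Real.norm_eq_abs, hwz] at this
      exact this
    have a3 : 1 + ‖z‖ ≤ (1 + ‖z‖) / z.im * ‖(r : ℂ) - w‖ := by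
      rw [div_mul_eq_mul_div, le_div_iff₀ hz]
      gcongr
    linarith
  set C := (1 + ‖z‖) / z.im + 1
  have hC : 0 < C := by positivity
  refine ⟨(C ^ 2)⁻¹, by positivity, fun r => ?_⟩
  have b1 := h1 z (abs_of_pos hz) rfl r
  have b2 := h1 (-z) (by simpa using abs_of_pos hz) (norm_neg z) r
  rw [sub_neg_eq_add] at b2
  rw [inv_mul_le_iff₀ (by positivity), sq_sub_sq, norm_mul]
  calc 1 + r ^ 2 ≤ (1 + |r|) * (1 + |r|) := by nlinarith [abs_nonneg r, sq_abs r]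
    _ ≤ (C * ‖(r : ℂ) - z‖) * (C * ‖(r : ℂ) + z‖) := by gcongr
    _ = _ := by ring

lemma sq_sub_sq_ne_zero_of_im_pos {z : ℂ} (hz : 0 < z.im) (r : ℝ) : (r : ℂ) ^ 2 - z ^ 2 ≠ 0 := by
  obtain ⟨c, hc, h⟩ := exists_le_norm_sq_sub_sq hz
  exact norm_pos_iff.1 (lt_of_lt_of_le (by positivity) (h r))

/-- A bounded continuous function divided by `r² - z²` is integrable. -/
lemma integrable_div_sq_sub_sq {z : ℂ} (hz : 0 < z.im) {f : ℝ → ℂ} (hf : Continuous f) {C : ℝ}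
    (hC : ∀ r, ‖f r‖ ≤ C) : Integrable fun r : ℝ => f r / ((r : ℂ) ^ 2 - z ^ 2) := by
  obtain ⟨c, hc, h⟩ := exists_le_norm_sq_sub_sq hz
  refine (integrable_inv_one_add_sq.const_mul (C / c)).mono' ?_ ?_
  · refine Continuous.aestronglyMeasurable (hf.div (by fun_prop) fun r => ?_)
    exact sq_sub_sq_ne_zero_of_im_pos hz r
  · refine Eventually.of_forall fun r => ?_
    have hC0 : 0 ≤ C := (norm_nonneg _).trans (hC 0)
    rw [norm_div, ← div_eq_mul_inv, div_div]
    exact div_le_div₀ hC0 (hC r) (by positivity) (h r)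

/-- The substitution `r = m sinh x` turns the square root `√(r² + m²)` into the entire function `m
cosh x`, so that contours can be moved without branch cuts. -/
lemma integral_comp_mul_sinh {m : ℝ} (hm : 0 < m) (F : ℝ → ℂ) :
    ∫ x : ℝ, (m * Real.cosh x) • F (m * Real.sinh x) = ∫ r, F r := by
  have h := integral_image_eq_integral_abs_deriv_smul (s := univ) MeasurableSet.univ
    (f := fun x => m * Real.sinh x) (f' := fun x => m * Real.cosh x)
    (fun x _ => ((Real.hasDerivAt_sinh x).const_mul m).hasDerivWithinAt)
    (fun x _ y _ hxy => Real.sinh_injective (mul_left_cancel₀ hm.ne' hxy)) F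
  have himg : (fun x => m * Real.sinh x) '' univ = univ := by
    rw [image_univ, range_eq_univ]
    intro y
    obtain ⟨x, hx⟩ := Real.sinh_surjective (y / m)
    exact ⟨x, by simp only [hx]; field_simp⟩
  rw [himg] at h
  simp only [Measure.restrict_univ] at h
  rw [h]
  refine integral_congr_ae (Eventually.of_forall fun x => ?_)
  simp only [abs_of_pos (mul_pos hm (Real.cosh_pos x))]

lemma integrable_comp_mul_sinh {m : ℝ} (hm : 0 < m) {F : ℝ → ℂ} (hF : Integrable F) :
    Integrable fun x : ℝ => (m * Real.cosh x) • F (m * Real.sinh x) := by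
  have h := (integrableOn_image_iff_integrableOn_abs_deriv_smul (s := univ) MeasurableSet.univ
    (f := fun x => m * Real.sinh x) (f' := fun x => m * Real.cosh x)
    (fun x _ => ((Real.hasDerivAt_sinh x).const_mul m).hasDerivWithinAt)
    (fun x _ y _ hxy => Real.sinh_injective (mul_left_cancel₀ hm.ne' hxy)) F).1 hF.integrableOn
  rw [integrableOn_univ] at h
  refine h.congr (Eventually.of_forall fun x => ?_)
  simp only [abs_of_pos (mul_pos hm (Real.cosh_pos x))]

lemma integral_eq_integral_Ioi_add_neg {F : ℝ → ℂ} (hF : Integrable F) :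
    ∫ r, F r = ∫ r in Ioi (0 : ℝ), (F r + F (-r)) := by
  rw [integral_add hF.integrableOn (by
    have := hF.comp_neg
    exact this.integrableOn), integral_comp_neg_Ioi, neg_zero,
    ← intervalIntegral.integral_Iic_add_Ioi hF.integrableOn hF.integrableOn (b := 0), add_comm]

lemma cosh_add_mul_I (x y : ℝ) : Complex.cosh (x + y * I) =
    (Real.cosh x * Real.cos y : ℝ) + (Real.sinh x * Real.sin y : ℝ) * I := by
  rw [Complex.cosh_add, Complex.cosh_mul_I, Complex.sinh_mul_I]
  push_cast
  ring

lemma sinh_add_mul_I (x y : ℝ) : Complex.sinh (x + y * I) =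
    (Real.sinh x * Real.cos y : ℝ) + (Real.cosh x * Real.sin y : ℝ) * I := by
  rw [Complex.sinh_add, Complex.cosh_mul_I, Complex.sinh_mul_I]
  push_cast
  ring

lemma norm_sinh_sq (x y : ℝ) :
    ‖Complex.sinh (x + y * I)‖ ^ 2 = Real.sinh x ^ 2 + Real.sin y ^ 2 := by
  rw [sinh_add_mul_I, Complex.sq_norm, Complex.normSq_add_mul_I]
  nlinarith [Real.cosh_sq x, Real.sin_sq_add_cos_sq y]

variable {m Y τ : ℝ} {z Ω : ℂ}

/-- The phase `e^{i(τω + Yr)}` in the rapidity parametrization `r = m sinh w`, `ω = m cosh w`. -/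
noncomputable def rapidityPhase (m τ Y : ℝ) (w : ℂ) : ℂ :=
  Complex.exp (I * m * (τ * Complex.cosh w + Y * Complex.sinh w))

/-- The real part of the exponent is `-m (τ sinh x + Y cosh x) sin y`. It is nonpositive on the
strip because `|τ| < Y` and `|sinh x| ≤ cosh x`. This is where spacelike separation is needed. -/
lemma norm_rapidityPhase_le (hm : 0 < m) (hτ : |τ| < Y) (x : ℝ) {y : ℝ} (hy : y ∈ Icc 0 (Real.pi / 2)) :
    ‖rapidityPhase m τ Y (x + y * I)‖ ≤ 1 := by
  rw [rapidityPhase, Complex.norm_exp, Real.exp_le_one_iff, cosh_add_mul_I, sinh_add_mul_I]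
  have hs : 0 ≤ Real.sin y := Real.sin_nonneg_of_nonneg_of_le_pi hy.1 (by linarith [hy.2, Real.pi_pos])
  have h1 : |Real.sinh x| ≤ Real.cosh x := by
    rw [← Real.cosh_abs, Real.abs_sinh]
    exact (Real.sinh_lt_cosh _).le
  have h2 : 0 ≤ τ * Real.sinh x + Y * Real.cosh x := by
    have h3 : |τ * Real.sinh x| ≤ Y * Real.cosh x := by
      rw [abs_mul]
      exact mul_le_mul hτ.le h1 (abs_nonneg _) ((abs_nonneg _).trans hτ.le)
    linarith [neg_abs_le (τ * Real.sinh x)]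
  have h4 : 0 ≤ m * ((τ * Real.sinh x + Y * Real.cosh x) * Real.sin y) := by positivity
  simp [-ofReal_sin, -ofReal_cos, -ofReal_sinh, -ofReal_cosh, -ofReal_mul]
  nlinarith

/-- The rapidity is `log((z + Ω)/m)`; from `(Ω - z)(Ω + z) = m²` the inverse exponential is `(Ω -
z)/m`. The signs of `Im z` and `Re Ω` are those of the sine and cosine of its imaginary part, which
therefore lies in the first quadrant. -/
lemma exists_rapidity (hm : 0 < m) (hz : 0 < z.im) (hΩ : 0 < Ω.re) (h : Ω ^ 2 = z ^ 2 + m ^ 2) :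
    ∃ w₀ : ℂ, m * Complex.sinh w₀ = z ∧ m * Complex.cosh w₀ = Ω ∧ 0 < w₀.im ∧
      w₀.im < Real.pi / 2 := by
  have hm' : (m : ℂ) ≠ 0 := by exact_mod_cast hm.ne'
  have hne : z + Ω ≠ 0 := by
    intro h0
    have h1 : (Ω - z) * (z + Ω) = m ^ 2 := by linear_combination h
    rw [h0, mul_zero] at h1
    exact pow_ne_zero 2 hm' h1.symm
  set w₀ := log ((z + Ω) / m)
  have e1 : Complex.exp w₀ = (z + Ω) / m := Complex.exp_log (div_ne_zero hne hm')
  have e2 : Complex.exp (-w₀) = (Ω - z) / m := by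
    rw [Complex.exp_neg, e1, inv_eq_iff_eq_inv, inv_div, div_eq_div_iff hm']
    · linear_combination h
    · intro h0
      have h1 : (Ω - z) * (z + Ω) = m ^ 2 := by linear_combination h
      rw [h0, zero_mul] at h1
      exact pow_ne_zero 2 hm' h1.symm
  have hs : m * Complex.sinh w₀ = z := by
    rw [Complex.sinh, e1, e2]
    field_simp
    ring
  have hc : m * Complex.cosh w₀ = Ω := by
    rw [Complex.cosh, e1, e2]
    field_simp
    ring
  refine ⟨w₀, hs, hc, ?_⟩
  have hw : w₀ = (w₀.re : ℂ) + (w₀.im : ℂ) * I := (re_add_im w₀).symm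
  have him : 0 < Real.sin w₀.im := by
    rw [← hs, hw, sinh_add_mul_I] at hz
    simp [-ofReal_sin, -ofReal_cos, -ofReal_sinh, -ofReal_cosh, -ofReal_mul] at hz
    have := Real.cosh_pos w₀.re
    by_contra hn
    push Not at hn
    nlinarith [mul_pos hm this]
  have hre : 0 < Real.cos w₀.im := by
    rw [← hc, hw, cosh_add_mul_I] at hΩ
    simp [-ofReal_sin, -ofReal_cos, -ofReal_sinh, -ofReal_cosh, -ofReal_mul] at hΩ
    have := Real.cosh_pos w₀.re
    by_contra hn
    push Not at hn
    nlinarith [mul_pos hm this]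
  have a1 : w₀.im ≤ Real.pi := Complex.log_im_le_pi _
  have a2 : -Real.pi < w₀.im := Complex.neg_pi_lt_log_im _
  have p1 : 0 < w₀.im := by
    by_contra hn
    push Not at hn
    linarith [Real.sin_nonpos_of_nonpos_of_neg_pi_le hn a2.le]
  refine ⟨p1, ?_⟩
  by_contra hn
  push Not at hn
  linarith [Real.cos_nonpos_of_pi_div_two_le_of_le hn (by linarith)]

/-- On the closed strip `sinh w` has nonnegative imaginary part and `cosh w` nonnegative real part.
This rules out the wrong signs of `m sinh w = ±z` and `m cosh w = ±Ω`. Sinh and cosh together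
determine the exponential, which is injective on the strip. -/
lemma rapidity_unique {w₀ w : ℂ} (hm : 0 < m) (hz : 0 < z.im) (hΩ : 0 < Ω.re)
    (h₁ : m * Complex.sinh w₀ = z) (h₂ : m * Complex.cosh w₀ = Ω) (h₃ : 0 < w₀.im)
    (h₄ : w₀.im < Real.pi / 2) (hw : w.im ∈ Icc 0 (Real.pi / 2))
    (h : (m * Complex.sinh w) ^ 2 - z ^ 2 = 0) : w = w₀ := by
  have hww : w = (w.re : ℂ) + (w.im : ℂ) * I := (re_add_im w).symm
  have hsin : 0 ≤ Real.sin w.im :=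
    Real.sin_nonneg_of_nonneg_of_le_pi hw.1 (by linarith [hw.2, Real.pi_pos])
  have hcos : 0 ≤ Real.cos w.im :=
    Real.cos_nonneg_of_neg_pi_div_two_le_of_le (by linarith [hw.1, Real.pi_pos]) hw.2
  have him : 0 ≤ (m * Complex.sinh w).im := by
    rw [hww, sinh_add_mul_I]
    have := Real.cosh_pos w.re
    simp [-ofReal_sin, -ofReal_cos, -ofReal_sinh, -ofReal_cosh, -ofReal_mul]
    positivity
  have hre : 0 ≤ (m * Complex.cosh w).re := by
    rw [hww, cosh_add_mul_I]
    have := Real.cosh_pos w.re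
    simp [-ofReal_sin, -ofReal_cos, -ofReal_sinh, -ofReal_cosh, -ofReal_mul]
    positivity
  have hs : m * Complex.sinh w = z := by
    rcases sq_eq_sq_iff_eq_or_eq_neg.1 (sub_eq_zero.1 h) with h | h
    · exact h
    · rw [h] at him
      simp at him
      linarith
  have hc : m * Complex.cosh w = Ω := by
    have : (m * Complex.cosh w) ^ 2 = Ω ^ 2 := by
      rw [← h₂, mul_pow, mul_pow, Complex.cosh_sq, Complex.cosh_sq]
      linear_combination (m * Complex.sinh w + z) * hs - (m * Complex.sinh w₀ + z) * h₁
    rcases sq_eq_sq_iff_eq_or_eq_neg.1 this with h | h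
    · exact h
    · rw [h] at hre
      simp at hre
      linarith
  have hm' : (m : ℂ) ≠ 0 := by exact_mod_cast hm.ne'
  have he : Complex.exp w = Complex.exp w₀ := by
    rw [← Complex.cosh_add_sinh, ← Complex.cosh_add_sinh]
    refine mul_left_cancel₀ hm' ?_
    linear_combination hc + hs - h₁ - h₂
  have := Real.pi_pos
  exact Complex.exp_inj_of_neg_pi_lt_of_le_pi (by linarith [hw.1]) (by linarith [hw.2])
    (by linarith) (by linarith) he

end Wick


/-! ### Contour rotation to imaginary momenta -/

section Wick

open Complex

variable {m Y τ : ℝ} {z Ω : ℂ}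

/-- The energy `√(r² + m²)`. -/
noncomputable def energy (m r : ℝ) : ℝ := Real.sqrt (r ^ 2 + m ^ 2)

lemma energy_pos (hm : 0 < m) (r : ℝ) : 0 < energy m r := Real.sqrt_pos.2 (by positivity)

lemma energy_sq (m r : ℝ) : energy m r ^ 2 = r ^ 2 + m ^ 2 := Real.sq_sqrt (by positivity)

lemma abs_le_energy (m r : ℝ) : |r| ≤ energy m r := Real.abs_le_sqrt (by nlinarith [sq_nonneg m])

@[fun_prop]
lemma continuous_energy (m : ℝ) : Continuous (energy m) := by
  unfold energy
  fun_prop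

lemma energy_neg (m r : ℝ) : energy m (-r) = energy m r := by simp [energy]

lemma energy_mul_sinh (hm : 0 < m) (x : ℝ) : energy m (m * Real.sinh x) = m * Real.cosh x := by
  rw [energy, ← Real.sqrt_sq (mul_pos hm (Real.cosh_pos x)).le, mul_pow, mul_pow, Real.cosh_sq]
  ring_nf

lemma integrable_bottom (hm : 0 < m) (hz : 0 < z.im) : Integrable fun r : ℝ =>
    (r / energy m r : ℝ) * Complex.exp (I * ((τ * energy m r + Y * r : ℝ) : ℂ)) /
      ((r : ℂ) ^ 2 - z ^ 2) := by
  refine integrable_div_sq_sub_sq hz (C := 1) ?_ fun r => ?_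
  · have : Continuous fun r => r / energy m r :=
      continuous_id.div (continuous_energy m) fun r => (energy_pos hm r).ne'
    fun_prop
  · rw [norm_mul, mul_comm I, Complex.norm_exp_ofReal_mul_I, mul_one, norm_real, Real.norm_eq_abs,
      abs_div, abs_of_pos (energy_pos hm r)]
    exact div_le_one_of_le₀ (abs_le_energy m r) (energy_pos hm r).le

lemma abs_mul_le_mul_energy (hτ : |τ| < Y) (m t : ℝ) : |τ * t| ≤ Y * energy m t := by
  rw [abs_mul]
  exact mul_le_mul hτ.le (abs_le_energy m t) (abs_nonneg _) ((abs_nonneg _).trans hτ.le)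

lemma integrable_top (hτ : |τ| < Y) (hΩ : 0 < Ω.re) : Integrable fun t : ℝ =>
    (Real.exp (-(τ * t + Y * energy m t)) : ℂ) / ((t : ℂ) ^ 2 - (I * Ω) ^ 2) := by
  refine integrable_div_sq_sub_sq (by simpa using hΩ) (C := 1) ?_ fun t => ?_
  · have : Continuous fun t => Real.exp (-(τ * t + Y * energy m t)) := by fun_prop
    fun_prop
  · rw [norm_real, Real.norm_eq_abs, Real.abs_exp, Real.exp_le_one_iff]
    linarith [neg_abs_le (τ * t), abs_mul_le_mul_energy hτ m t]

/-- The integrand of the loop integral in the rapidity parametrization. -/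
noncomputable def rapidityIntegrand (m τ Y : ℝ) (z w : ℂ) : ℂ :=
  m * Complex.sinh w * rapidityPhase m τ Y w / ((m * Complex.sinh w) ^ 2 - z ^ 2)

lemma rapidityIntegrand_bottom (hm : 0 < m) (x : ℝ) : rapidityIntegrand m τ Y z (x + ((0 : ℝ) : ℂ) * I) =
    (m * Real.cosh x) • (((m * Real.sinh x) / energy m (m * Real.sinh x) : ℝ) * Complex.exp
      (I * ((τ * energy m (m * Real.sinh x) + Y * (m * Real.sinh x) : ℝ) : ℂ)) /
      (((m * Real.sinh x : ℝ) : ℂ) ^ 2 - z ^ 2)) := by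
  have h1 : Complex.sinh (x + ((0 : ℝ) : ℂ) * I) = Real.sinh x := by simp
  have h2 : Complex.cosh (x + ((0 : ℝ) : ℂ) * I) = Real.cosh x := by simp
  rw [rapidityIntegrand, rapidityPhase, h1, h2, energy_mul_sinh hm, real_smul]
  have h4 : I * m * (τ * (Real.cosh x : ℂ) + Y * (Real.sinh x : ℂ)) =
      I * ((τ * (m * Real.cosh x) + Y * (m * Real.sinh x) : ℝ) : ℂ) := by push_cast; ring
  have h5 : ((m * Real.cosh x : ℝ) : ℂ) * ((m * Real.sinh x / (m * Real.cosh x) : ℝ) : ℂ) =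
      m * (Real.sinh x : ℂ) := by
    have h6 : (Real.cosh x : ℂ) ≠ 0 := by exact_mod_cast (Real.cosh_pos x).ne'
    have h7 : (m : ℂ) ≠ 0 := by exact_mod_cast hm.ne'
    rw [ofReal_div, ofReal_mul, ofReal_mul]
    field_simp
  rw [h4, ← mul_div_assoc, ← mul_assoc ((m * Real.cosh x : ℝ) : ℂ), h5, ofReal_mul m (Real.sinh x)]

/-- On `Im w = π/2` the functions sinh and cosh are exchanged up to a factor `i`. The oscillating
phase becomes a real exponential, and the denominator becomes `-(t² + Ω²)` with `t = m sinh x`. -/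
lemma rapidityIntegrand_top (hm : 0 < m) (h : Ω ^ 2 = z ^ 2 + m ^ 2) (x : ℝ) :
    rapidityIntegrand m τ Y z (x + ((Real.pi / 2 : ℝ) : ℂ) * I) =
    -I * ((m * Real.cosh x) • ((Real.exp (-(τ * (m * Real.sinh x) +
      Y * energy m (m * Real.sinh x))) : ℂ) /
      (((m * Real.sinh x : ℝ) : ℂ) ^ 2 - (I * Ω) ^ 2))) := by
  have h1 : Complex.sinh (x + ((Real.pi / 2 : ℝ) : ℂ) * I) = I * Real.cosh x := by
    rw [sinh_add_mul_I]; simp [mul_comm]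
  have h2 : Complex.cosh (x + ((Real.pi / 2 : ℝ) : ℂ) * I) = I * Real.sinh x := by
    rw [cosh_add_mul_I]; simp [mul_comm]
  rw [rapidityIntegrand, rapidityPhase, h1, h2, energy_mul_sinh hm, real_smul]
  have h4 : I * m * (τ * (I * (Real.sinh x : ℂ)) + Y * (I * (Real.cosh x : ℂ))) =
      ((-(τ * (m * Real.sinh x) + Y * (m * Real.cosh x)) : ℝ) : ℂ) := by
    push_cast
    linear_combination (m * (τ * Complex.sinh x + Y * Complex.cosh x) : ℂ) * I_sq
  have h5 : (m * (I * (Real.cosh x : ℂ))) ^ 2 - z ^ 2 =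
      -(((m * Real.sinh x : ℝ) : ℂ) ^ 2 - (I * Ω) ^ 2) := by
    have : (Real.cosh x : ℂ) ^ 2 = (Real.sinh x : ℂ) ^ 2 + 1 := by exact_mod_cast Real.cosh_sq x
    rw [ofReal_mul]
    linear_combination (m ^ 2 * (Real.cosh x : ℂ) ^ 2 - Ω ^ 2) * I_sq - m ^ 2 * this + h
  rw [h4, h5, ofReal_exp, div_neg, ofReal_mul m (Real.cosh x)]
  ring

/-- The phase is bounded by one, the remaining numerator is of order `|sinh w|` and the denominator
of order `|sinh w|²`, while `|sinh w| ≥ sinh R` on both sides. The integrand is thus `O(1 / sinh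
R)`. -/
lemma tendsto_side (hm : 0 < m) (hτ : |τ| < Y) {σ : ℝ} (hσ : σ = 1 ∨ σ = -1) :
    Tendsto (fun R : ℝ => ∫ y : ℝ in (0 : ℝ)..(Real.pi / 2),
      rapidityIntegrand m τ Y z (((σ * R : ℝ) : ℂ) + y * I)) atTop (𝓝 0) := by
  have hsinh : Tendsto (fun R : ℝ => m * Real.sinh R) atTop atTop :=
    (Real.sinhOrderIso.tendsto_atTop).const_mul_atTop hm
  have hlim : Tendsto (fun R : ℝ => 2 * (m * Real.sinh R)⁻¹ * |Real.pi / 2 - 0|) atTop (𝓝 0) := by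
    have := (tendsto_inv_atTop_zero.comp hsinh).const_mul 2 |>.mul_const |Real.pi / 2 - 0|
    simpa using this
  refine squeeze_zero_norm' ?_ hlim
  filter_upwards [hsinh.eventually_ge_atTop (2 * ‖z‖), hsinh.eventually_gt_atTop 0] with R hR hR0
  refine intervalIntegral.norm_integral_le_of_norm_le_const fun y hy => ?_
  rw [uIoc_of_le (by positivity)] at hy
  have hE := norm_rapidityPhase_le hm hτ (σ * R) ⟨hy.1.le, hy.2⟩
  rw [rapidityIntegrand]
  set w : ℂ := ((σ * R : ℝ) : ℂ) + y * I
  have hn : Real.sinh R ≤ ‖Complex.sinh w‖ := by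
    have h1 := norm_sinh_sq (σ * R) y
    have h2 : Real.sinh (σ * R) ^ 2 = Real.sinh R ^ 2 := by
      rcases hσ with rfl | rfl <;> simp
    refine le_of_sq_le_sq ?_ (norm_nonneg _)
    rw [h1, h2]
    nlinarith [sq_nonneg (Real.sin y)]
  have hms : m * Real.sinh R ≤ ‖m * Complex.sinh w‖ := by
    rw [norm_mul, norm_real, Real.norm_of_nonneg hm.le]
    gcongr
  set a := ‖m * Complex.sinh w‖ with ha
  have ha0 : 0 < a := hR0.trans_le hms
  have hden : a ^ 2 / 2 ≤ ‖(m * Complex.sinh w) ^ 2 - z ^ 2‖ := by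
    have h1 := norm_sub_norm_le ((m * Complex.sinh w) ^ 2) (z ^ 2)
    rw [norm_pow, norm_pow, ← ha] at h1
    nlinarith [norm_nonneg z]
  rw [norm_div, norm_mul, ← ha, div_le_iff₀ (lt_of_lt_of_le (by positivity) hden)]
  calc a * ‖rapidityPhase m τ Y w‖ ≤ a * 1 := by gcongr
    _ = 2 * a⁻¹ * (a ^ 2 / 2) := by field_simp
    _ ≤ 2 * (m * Real.sinh R)⁻¹ * ‖(m * Complex.sinh w) ^ 2 - z ^ 2‖ := by gcongr

/-- Rotation of the contour of the loop integral to imaginary momenta. -/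
theorem integral_bottom_eq (hm : 0 < m) (hτ : |τ| < Y) (hz : 0 < z.im) (hΩ : 0 < Ω.re)
    (h : Ω ^ 2 = z ^ 2 + m ^ 2) :
    ∫ r : ℝ, (r / energy m r : ℝ) * Complex.exp (I * ((τ * energy m r + Y * r : ℝ) : ℂ)) /
      ((r : ℂ) ^ 2 - z ^ 2) =
    Real.pi * I / Ω * Complex.exp (I * (τ * Ω + Y * z)) -
      I * ∫ t : ℝ, (Real.exp (-(τ * t + Y * energy m t)) : ℂ) / ((t : ℂ) ^ 2 - (I * Ω) ^ 2) := by
  obtain ⟨w₀, hs, hch, hw1, hw2⟩ := exists_rapidity hm hz hΩ h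
  have hm' : (m : ℂ) ≠ 0 := by exact_mod_cast hm.ne'
  have hΩ0 : Ω ≠ 0 := fun h0 => by simp [h0] at hΩ
  have hz0 : z ≠ 0 := fun h0 => by simp [h0] at hz
  set N : ℂ → ℂ := fun w => m * Complex.sinh w * rapidityPhase m τ Y w with hN
  set D : ℂ → ℂ := fun w => (m * Complex.sinh w) ^ 2 - z ^ 2 with hD
  have hNd : Differentiable ℂ N := by
    simp only [hN]
    unfold rapidityPhase
    fun_prop
  have hDd : Differentiable ℂ D := by
    simp only [hD]
    fun_prop
  have hDder : HasDerivAt D (2 * z * Ω) w₀ := by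
    have := (((Complex.hasDerivAt_sinh w₀).const_mul (m : ℂ)).pow 2).sub_const (z ^ 2)
    refine this.congr_deriv ?_
    rw [← hs, ← hch]
    ring
  -- Once `R` exceeds the real part of the rapidity, the rectangle contains the only pole of the
  -- strip.
  have hrect : ∀ᶠ R : ℝ in atTop, rectIntegral R (Real.pi / 2) (rapidityIntegrand m τ Y z) =
      2 * Real.pi * I * (N w₀ / (2 * z * Ω)) := by
    filter_upwards [eventually_gt_atTop |w₀.re|] with R hR
    have hb := abs_lt.1 hR
    refine rectIntegral_div hb.1 hb.2 hw1 hw2 hNd hDd (fun w hw hw0 => ?_) ?_ hDder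
      (mul_ne_zero (mul_ne_zero two_ne_zero hz0) hΩ0)
    · exact rapidity_unique hm hz hΩ hs hch hw1 hw2 hw.2 hw0
    · simp [hD, hs]
  have i1 := integrable_comp_mul_sinh hm (integrable_bottom (τ := τ) (Y := Y) hm hz)
  have i2 := integrable_comp_mul_sinh hm (integrable_top (m := m) hτ hΩ)
  have l1 := intervalIntegral_tendsto_integral i1 tendsto_neg_atTop_atBot tendsto_id
  have l2 := (intervalIntegral_tendsto_integral i2 tendsto_neg_atTop_atBot tendsto_id).const_mul (-I)
  have l3 := (tendsto_side (z := z) hm hτ (Or.inl rfl)).const_mul I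
  have l4 := (tendsto_side (z := z) hm hτ (Or.inr rfl)).const_mul I
  have ll := ((l1.sub l2).add l3).sub l4
  rw [integral_comp_mul_sinh hm (fun r : ℝ => (r / energy m r : ℝ) *
    Complex.exp (I * ((τ * energy m r + Y * r : ℝ) : ℂ)) / ((r : ℂ) ^ 2 - z ^ 2)),
    integral_comp_mul_sinh hm (fun t : ℝ => (Real.exp (-(τ * t + Y * energy m t)) : ℂ) /
      ((t : ℂ) ^ 2 - (I * Ω) ^ 2))] at ll
  have hc := (tendsto_const_nhds (x := 2 * Real.pi * I * (N w₀ / (2 * z * Ω)))).congr'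
    (hrect.mono fun R h => h.symm)
  simp only [rectIntegral, rapidityIntegrand_bottom hm, rapidityIntegrand_top hm h,
    intervalIntegral.integral_const_mul] at hc
  simp only [one_mul, neg_one_mul, id] at ll
  have hu := tendsto_nhds_unique ll hc
  have hE : N w₀ / (2 * z * Ω) = Complex.exp (I * (τ * Ω + Y * z)) / (2 * Ω) := by
    have : I * m * (τ * Complex.cosh w₀ + Y * Complex.sinh w₀) = I * (τ * Ω + Y * z) := by
      rw [← hs, ← hch]; ring
    simp only [hN, rapidityPhase, this, hs]
    field_simp
  rw [hE, mul_zero, add_zero, sub_zero] at hu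
  rw [sub_eq_iff_eq_add.1 hu]
  field_simp
  ring

end Wick


/-! ### Boundary values of the radial integral -/

section Wick

open Complex

variable {m Y τ : ℝ} {z Ω : ℂ}

/-- The radial integrand of the loop integral in the rest frame. -/
noncomputable def radialIntegrand (m τ Y : ℝ) (r : ℝ) : ℂ :=
  (r / (2 * energy m r) * Real.sin (Y * r) : ℝ) * Complex.exp (I * ((τ * energy m r : ℝ) : ℂ))

/-- The integral over imaginary momenta. -/
noncomputable def euclideanIntegral (m τ Y : ℝ) (κ : ℂ) : ℂ :=
  ∫ t in Ioi (0 : ℝ), ((Real.cosh (τ * t) * Real.exp (-(Y * energy m t)) : ℝ) : ℂ) /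
    ((t : ℂ) ^ 2 + κ)

@[fun_prop]
lemma continuous_radialIntegrand (hm : 0 < m) (τ Y : ℝ) : Continuous (radialIntegrand m τ Y) := by
  unfold radialIntegrand
  have : Continuous fun r => r / (2 * energy m r) :=
    continuous_id.div (by fun_prop) fun r => by have := energy_pos hm r; positivity
  fun_prop

lemma norm_radialIntegrand_le (hm : 0 < m) (τ Y r : ℝ) : ‖radialIntegrand m τ Y r‖ ≤ 1 := by
  have := energy_pos hm r
  rw [radialIntegrand, norm_mul, mul_comm I, Complex.norm_exp_ofReal_mul_I, mul_one, norm_real,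
    Real.norm_eq_abs, abs_mul, abs_div, abs_of_pos (show 0 < 2 * energy m r by positivity)]
  have h1 : |r| / (2 * energy m r) ≤ 1 :=
    div_le_one_of_le₀ (by linarith [abs_le_energy m r]) (by positivity)
  exact mul_le_one₀ h1 (abs_nonneg _) (Real.abs_sin_le_one _)

lemma integrable_radial (hm : 0 < m) (hz : 0 < z.im) :
    Integrable fun r : ℝ => radialIntegrand m τ Y r / ((r : ℂ) ^ 2 - z ^ 2) :=
  integrable_div_sq_sub_sq hz (continuous_radialIntegrand hm τ Y) (norm_radialIntegrand_le hm τ Y)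

lemma norm_sq_add_ge {κ : ℂ} (t : ℝ) : t ^ 2 + κ.re ≤ ‖(t : ℂ) ^ 2 + κ‖ := by
  refine le_trans (le_of_eq ?_) (re_le_norm _)
  rw [add_re, ← ofReal_pow, ofReal_re]

lemma cosh_mul_exp_le (hτ : |τ| < Y) (m t : ℝ) :
    Real.cosh (τ * t) * Real.exp (-(Y * energy m t)) ≤ 1 := by
  have h := abs_mul_le_mul_energy hτ m t
  have h1 : Real.cosh (τ * t) ≤ Real.exp |τ * t| := by
    rw [Real.cosh_eq]
    linarith [Real.exp_le_exp.2 (le_abs_self (τ * t)), Real.exp_le_exp.2 (neg_le_abs (τ * t))]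
  calc _ ≤ Real.exp |τ * t| * Real.exp (-(Y * energy m t)) := by gcongr
    _ ≤ 1 := by rw [← Real.exp_add, Real.exp_le_one_iff]; linarith

lemma integrable_sq_add_inv {a : ℝ} (ha : 0 < a) : Integrable fun t : ℝ => (t ^ 2 + a)⁻¹ := by
  have h := (integrable_inv_one_add_sq.comp_mul_left' (R := (Real.sqrt a)⁻¹) (by positivity)).const_mul a⁻¹
  refine h.congr (Eventually.of_forall fun t => ?_)
  simp only
  rw [mul_pow, inv_pow, Real.sq_sqrt ha.le]
  field_simp
  ring

lemma aestronglyMeasurable_euclidean {κ : ℂ} (hκ : 0 < κ.re) : Continuous fun t : ℝ =>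
    ((Real.cosh (τ * t) * Real.exp (-(Y * energy m t)) : ℝ) : ℂ) / ((t : ℂ) ^ 2 + κ) := by
  have : Continuous fun t => Real.cosh (τ * t) * Real.exp (-(Y * energy m t)) := by
    have := Real.continuous_cosh
    fun_prop
  refine Continuous.div (by fun_prop) (by fun_prop) fun t => ?_
  exact norm_pos_iff.1 (lt_of_lt_of_le (by positivity) (norm_sq_add_ge t))

lemma norm_euclidean_le (hτ : |τ| < Y) {κ : ℂ} {a : ℝ} (ha : 0 < a) (hκ : a ≤ κ.re) (t : ℝ) :
    ‖((Real.cosh (τ * t) * Real.exp (-(Y * energy m t)) : ℝ) : ℂ) / ((t : ℂ) ^ 2 + κ)‖ ≤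
      (t ^ 2 + a)⁻¹ := by
  rw [norm_div, norm_real, Real.norm_of_nonneg (by positivity), ← one_div]
  have h := norm_sq_add_ge (κ := κ) t
  exact div_le_div₀ zero_le_one (cosh_mul_exp_le hτ m t) (by positivity) (by linarith)

lemma norm_euclideanIntegral_le (hτ : |τ| < Y) {κ : ℂ} {a : ℝ} (ha : 0 < a) (hκ : a ≤ κ.re) :
    ‖euclideanIntegral m τ Y κ‖ ≤ ∫ t in Ioi (0 : ℝ), (t ^ 2 + a)⁻¹ :=
  norm_integral_le_of_norm_le (integrable_sq_add_inv ha).integrableOn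
    (Eventually.of_forall fun t => norm_euclidean_le hτ ha hκ t)

lemma tendsto_euclideanIntegral (hτ : |τ| < Y) {ι : Type*} {l : Filter ι} [l.IsCountablyGenerated]
    {κ : ι → ℂ} {a : ℝ} (ha : 0 < a) (hκ : ∀ᶠ i in l, a ≤ (κ i).re) {κ₀ : ℂ}
    (h : Tendsto κ l (𝓝 κ₀)) (h₀ : a ≤ κ₀.re) :
    Tendsto (fun i => euclideanIntegral m τ Y (κ i)) l (𝓝 (euclideanIntegral m τ Y κ₀)) := by
  refine tendsto_integral_filter_of_dominated_convergence (fun t => (t ^ 2 + a)⁻¹) ?_ ?_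
    (integrable_sq_add_inv ha).integrableOn ?_
  · filter_upwards [hκ] with i hi
    exact (aestronglyMeasurable_euclidean (ha.trans_le hi)).aestronglyMeasurable
  · filter_upwards [hκ] with i hi
    exact Eventually.of_forall fun t => norm_euclidean_le hτ ha hi t
  · refine Eventually.of_forall fun t => Tendsto.div tendsto_const_nhds (h.const_add _) ?_
    exact norm_pos_iff.1 (lt_of_lt_of_le (by nlinarith [sq_nonneg t]) (norm_sq_add_ge t))

/-- The radial loop integral as a residue and an integral over imaginary momenta. -/
theorem integral_radial_eq (hm : 0 < m) (hτ : |τ| < Y) (hz : 0 < z.im) (hΩ : 0 < Ω.re)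
    (h : Ω ^ 2 = z ^ 2 + m ^ 2) :
    ∫ r in Ioi (0 : ℝ), radialIntegrand m τ Y r / ((r : ℂ) ^ 2 - z ^ 2) =
      Real.pi / (4 * Ω) * Complex.exp (I * (τ * Ω + Y * z)) -
        1 / 2 * euclideanIntegral m τ Y (Ω ^ 2) := by
  have h0 := integral_bottom_eq hm hτ hz hΩ h
  rw [integral_eq_integral_Ioi_add_neg (integrable_bottom hm hz),
    integral_eq_integral_Ioi_add_neg (integrable_top hτ hΩ)] at h0
  -- Adding the values at `r` and `-r`: the odd factor `r/ω` leaves `2i sin(Yr)` of the exponential,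
  -- and the `2ω` in the radial integrand supplies another factor 2.
  have e1 : ∀ r : ℝ, (r / energy m r : ℝ) * Complex.exp (I * ((τ * energy m r + Y * r : ℝ) : ℂ)) /
      ((r : ℂ) ^ 2 - z ^ 2) + ((-r) / energy m (-r) : ℝ) *
      Complex.exp (I * ((τ * energy m (-r) + Y * (-r) : ℝ) : ℂ)) / (((-r : ℝ) : ℂ) ^ 2 - z ^ 2) =
      4 * I * (radialIntegrand m τ Y r / ((r : ℂ) ^ 2 - z ^ 2)) := by
    intro r
    have hs : (Real.sin (Y * r) : ℂ) = (Complex.exp (-((Y * r : ℝ) : ℂ) * I) -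
      Complex.exp (((Y * r : ℝ) : ℂ) * I)) * I / 2 := by rw [ofReal_sin, Complex.sin]
    have hE : (energy m r : ℂ) ≠ 0 := by exact_mod_cast (energy_pos hm r).ne'
    have p1 : Complex.exp (I * ((τ * energy m r + Y * r : ℝ) : ℂ)) =
        Complex.exp (I * ((τ * energy m r : ℝ) : ℂ)) * Complex.exp (((Y * r : ℝ) : ℂ) * I) := by
      rw [← Complex.exp_add]; congr 1; push_cast; ring
    have p2 : Complex.exp (I * ((τ * energy m r + Y * (-r) : ℝ) : ℂ)) =
        Complex.exp (I * ((τ * energy m r : ℝ) : ℂ)) * Complex.exp (-((Y * r : ℝ) : ℂ) * I) := by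
      rw [← Complex.exp_add]; congr 1; push_cast; ring
    rw [energy_neg, radialIntegrand, ofReal_mul, hs, p1, p2, ofReal_neg, neg_sq]
    push_cast
    field_simp
    rw [I_sq]
    ring
  -- Along imaginary momenta the energy is even in `t`, so the sum of the two exponentials is a
  -- hyperbolic cosine.
  have e2 : ∀ t : ℝ, (Real.exp (-(τ * t + Y * energy m t)) : ℂ) / ((t : ℂ) ^ 2 - (I * Ω) ^ 2) +
      (Real.exp (-(τ * (-t) + Y * energy m (-t))) : ℂ) / (((-t : ℝ) : ℂ) ^ 2 - (I * Ω) ^ 2) =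
      2 * (((Real.cosh (τ * t) * Real.exp (-(Y * energy m t)) : ℝ) : ℂ) / ((t : ℂ) ^ 2 + Ω ^ 2)) := by
    intro t
    have hd : (t : ℂ) ^ 2 - (I * Ω) ^ 2 = (t : ℂ) ^ 2 + Ω ^ 2 := by rw [mul_pow, I_sq]; ring
    have p1 : Real.exp (-(τ * t + Y * energy m t)) =
        Real.exp (-(τ * t)) * Real.exp (-(Y * energy m t)) := by rw [← Real.exp_add]; ring_nf
    have p2 : Real.exp (-(τ * (-t) + Y * energy m t)) =
        Real.exp (τ * t) * Real.exp (-(Y * energy m t)) := by rw [← Real.exp_add]; ring_nf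
    rw [energy_neg, p1, p2, Real.cosh_eq, ofReal_neg, neg_sq, hd]
    push_cast
    ring
  simp only [e1, e2, integral_const_mul] at h0
  rw [euclideanIntegral]
  have hΩ0 : Ω ≠ 0 := fun h0 => by simp [h0] at hΩ
  have h1 := congrArg (fun w => w / (4 * I)) h0
  simp only [mul_div_cancel_left₀ _ (mul_ne_zero (by norm_num : (4 : ℂ) ≠ 0) I_ne_zero)] at h1
  rw [h1]
  field_simp
  ring

/-- The residue contains the phase at the rapidity of the pole, a point of the strip on which the
phase is bounded by one. -/
lemma norm_residue_le (hm : 0 < m) (hτ : |τ| < Y) (hz : 0 < z.im) (hΩ : 0 < Ω.re)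
    (h : Ω ^ 2 = z ^ 2 + m ^ 2) : ‖Complex.exp (I * (τ * Ω + Y * z))‖ ≤ 1 := by
  obtain ⟨w₀, hs, hc, hw1, hw2⟩ := exists_rapidity hm hz hΩ h
  have := norm_rapidityPhase_le hm hτ w₀.re ⟨hw1.le, hw2.le⟩
  rw [re_add_im, rapidityPhase] at this
  convert! this using 3
  rw [← hs, ← hc]
  ring

/-- The principal square root. -/
noncomputable def csqrt (w : ℂ) : ℂ := Complex.exp (Complex.log w / 2)

lemma csqrt_sq {w : ℂ} (hw : w ≠ 0) : csqrt w ^ 2 = w := by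
  rw [csqrt, ← Complex.exp_nat_mul]
  convert! Complex.exp_log hw using 2
  push_cast
  ring

lemma csqrt_re_pos {w : ℂ} (hw : w ∈ slitPlane) : 0 < (csqrt w).re := by
  rw [csqrt, Complex.exp_re]
  have him : (Complex.log w / 2).im = w.arg / 2 := by
    rw [show Complex.log w / 2 = ((1 / 2 : ℝ) : ℂ) * Complex.log w by push_cast; ring,
      Complex.im_ofReal_mul, Complex.log_im]
    ring
  rw [him]
  have h1 : w.arg < Real.pi := lt_of_le_of_ne (arg_le_pi w) (slitPlane_arg_ne_pi hw)
  have h2 := neg_pi_lt_arg w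
  exact mul_pos (Real.exp_pos _) (Real.cos_pos_of_mem_Ioo ⟨by linarith, by linarith⟩)

lemma continuousAt_csqrt {w : ℂ} (hw : w ∈ slitPlane) : ContinuousAt csqrt w :=
  Complex.continuous_exp.continuousAt.comp ((continuousAt_clog hw).div_const 2)

lemma csqrt_ofReal {x : ℝ} (hx : 0 < x) : csqrt x = Real.sqrt x := by
  have h : (x : ℂ) ∈ slitPlane := by simpa using hx
  have h1 : csqrt x ^ 2 = (Real.sqrt x : ℂ) ^ 2 := by
    rw [csqrt_sq (by exact_mod_cast hx.ne'), ← ofReal_pow, Real.sq_sqrt hx.le]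
  rcases sq_eq_sq_iff_eq_or_eq_neg.1 h1 with h2 | h2
  · exact h2
  · have := csqrt_re_pos h
    rw [h2] at this
    simp at this
    linarith [Real.sqrt_nonneg x]

/-- The limit of the pole position `z`, `z² = K/4 - m² + i0η`, `Im z ≥ 0`. -/
noncomputable def polePosition (m η K : ℝ) : ℂ :=
  if 4 * m ^ 2 < K then (η * Real.sqrt (K / 4 - m ^ 2) : ℝ) else I * Real.sqrt (m ^ 2 - K / 4)

/-- The boundary value of the radial loop integral. -/
noncomputable def radialLimit (m η K τ Y : ℝ) : ℂ :=
  Real.pi / (2 * Real.sqrt K) * Complex.exp (I * (τ * (Real.sqrt K / 2) + Y * polePosition m η K)) -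
    1 / 2 * euclideanIntegral m τ Y (K / 4 : ℝ)

/-- The branches are fixed by `Im z > 0` and `Re Ω > 0`. Above the threshold the principal root of
`z²` has imaginary part of sign `η`, so it is multiplied by `η`. Below it, `z` is `i` times the
principal root of `-z²`. In both cases the argument of the root stays off the cut as `ε → 0`, since
`K ≠ 4m²`. -/
lemma exists_pole_approx {η K : ℝ} (hη : η = 1 ∨ η = -1) (hK : 0 < K) (hKm : K ≠ 4 * m ^ 2) :
    ∃ z Ω : ℝ → ℂ, (∀ ε > 0, 0 < (z ε).im ∧ 0 < (Ω ε).re ∧ (Ω ε) ^ 2 = z ε ^ 2 + m ^ 2 ∧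
      z ε ^ 2 = ((K / 4 - m ^ 2 : ℝ) : ℂ) + I * ((η * ε : ℝ) : ℂ)) ∧
      Tendsto z (𝓝[>] 0) (𝓝 (polePosition m η K)) ∧
      Tendsto Ω (𝓝[>] 0) (𝓝 (Real.sqrt K / 2 : ℝ)) := by
  have hη0 : η ≠ 0 := by rcases hη with rfl | rfl <;> norm_num
  set w : ℝ → ℂ := fun ε => ((K / 4 - m ^ 2 : ℝ) : ℂ) + I * ((η * ε : ℝ) : ℂ) with hw
  set Ω : ℝ → ℂ := fun ε => csqrt (((K / 4 : ℝ) : ℂ) + I * ((η * ε : ℝ) : ℂ)) with hΩ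
  have hslit : ∀ ε : ℝ, ((K / 4 : ℝ) : ℂ) + I * ((η * ε : ℝ) : ℂ) ∈ slitPlane := fun ε =>
    mem_slitPlane_iff.2 (Or.inl (by simp; linarith))
  have hΩ2 : ∀ ε, Ω ε ^ 2 = ((K / 4 : ℝ) : ℂ) + I * ((η * ε : ℝ) : ℂ) := fun ε =>
    csqrt_sq (slitPlane_ne_zero (hslit ε))
  have hΩlim : Tendsto Ω (𝓝[>] 0) (𝓝 (Real.sqrt K / 2 : ℝ)) := by
    refine tendsto_nhdsWithin_of_tendsto_nhds ?_
    have h1 : ContinuousAt Ω 0 := ContinuousAt.comp (g := csqrt) (continuousAt_csqrt (hslit 0)) (by fun_prop)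
    have h2 : Ω 0 = (Real.sqrt K / 2 : ℝ) := by
      simp only [hΩ, mul_zero, ofReal_zero, add_zero]
      rw [csqrt_ofReal (by linarith), Real.sqrt_div hK.le, show (4 : ℝ) = 2 ^ 2 by norm_num,
        Real.sqrt_sq (by norm_num)]
    rw [← h2]
    exact h1
  have hrest : ∀ ε z, z ^ 2 = w ε → Ω ε ^ 2 = z ^ 2 + m ^ 2 := fun ε z hz => by
    rw [hz, hΩ2, hw]; push_cast; ring
  by_cases hc : 4 * m ^ 2 < K
  · have hs : ∀ ε, w ε ∈ slitPlane := fun ε => mem_slitPlane_iff.2 (Or.inl (by simp [hw]; simp [← ofReal_pow]; linarith))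
    have hz2 : ∀ ε, (η * csqrt (w ε)) ^ 2 = w ε := fun ε => by
      rw [mul_pow, csqrt_sq (slitPlane_ne_zero (hs ε))]
      rcases hη with rfl | rfl <;> simp
    refine ⟨fun ε => η * csqrt (w ε), Ω, fun ε hε => ⟨?_, csqrt_re_pos (hslit ε),
      hrest ε _ (hz2 ε), hz2 ε⟩, ?_, hΩlim⟩
    · have h1 := csqrt_re_pos (hs ε)
      have h2 : (csqrt (w ε) ^ 2).im = η * ε := by
        rw [csqrt_sq (slitPlane_ne_zero (hs ε))]; simp [hw]; simp [← ofReal_pow]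
      rw [sq, mul_im] at h2
      rw [im_ofReal_mul]
      have h3 : (η * (csqrt (w ε)).im) * (2 * (csqrt (w ε)).re) = ε := by
        have : η * η = 1 := by rcases hη with rfl | rfl <;> norm_num
        linear_combination η * h2 + ε * this
      by_contra hn
      push Not at hn
      nlinarith
    · refine tendsto_nhdsWithin_of_tendsto_nhds ?_
      have h1 : ContinuousAt (fun ε => (η : ℂ) * csqrt (w ε)) 0 :=
        continuousAt_const.mul (ContinuousAt.comp (g := csqrt) (continuousAt_csqrt (hs 0)) (by fun_prop))
      have h2 : (η : ℂ) * csqrt (w 0) = polePosition m η K := by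
        rw [polePosition, if_pos hc]
        simp only [hw, mul_zero, ofReal_zero, add_zero]
        rw [csqrt_ofReal (by linarith), ofReal_mul]
      rw [← h2]
      exact h1
  · have hc' : K < 4 * m ^ 2 := lt_of_le_of_ne (not_lt.1 hc) hKm
    have hs : ∀ ε, -w ε ∈ slitPlane := fun ε => mem_slitPlane_iff.2 (Or.inl (by simp [hw]; simp [← ofReal_pow]; linarith))
    have hz2 : ∀ ε, (I * csqrt (-w ε)) ^ 2 = w ε := fun ε => by
      rw [mul_pow, csqrt_sq (slitPlane_ne_zero (hs ε)), I_sq]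
      ring
    refine ⟨fun ε => I * csqrt (-w ε), Ω, fun ε hε => ⟨?_, csqrt_re_pos (hslit ε),
      hrest ε _ (hz2 ε), hz2 ε⟩, ?_, hΩlim⟩
    · simpa using csqrt_re_pos (hs ε)
    · refine tendsto_nhdsWithin_of_tendsto_nhds ?_
      have h1 : ContinuousAt (fun ε => I * csqrt (-w ε)) 0 :=
        continuousAt_const.mul (ContinuousAt.comp (g := csqrt) (continuousAt_csqrt (hs 0)) (by fun_prop))
      have h2 : I * csqrt (-w 0) = polePosition m η K := by
        rw [polePosition, if_neg hc]
        simp only [hw, mul_zero, ofReal_zero, add_zero]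
        rw [← ofReal_neg, csqrt_ofReal (by linarith), neg_sub]
      rw [← h2]
      exact h1

/-- The regularized radial integral converges to its boundary value, boundedly in `τ` and `Y`. -/
theorem exists_radial_limit {η K : ℝ} (hm : 0 < m) (hη : η = 1 ∨ η = -1) (hK : 0 < K)
    (hKm : K ≠ 4 * m ^ 2) : ∃ C : ℝ, ∀ τ Y : ℝ, |τ| < Y →
      (∀ ε > 0, Integrable (fun r : ℝ => radialIntegrand m τ Y r /
        (((r ^ 2 + m ^ 2 - K / 4 : ℝ) : ℂ) - I * ((η * ε : ℝ) : ℂ)))) ∧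
      (∀ ε > 0, ‖∫ r in Ioi (0 : ℝ), radialIntegrand m τ Y r /
        (((r ^ 2 + m ^ 2 - K / 4 : ℝ) : ℂ) - I * ((η * ε : ℝ) : ℂ))‖ ≤ C) ∧
      Tendsto (fun ε : ℝ => ∫ r in Ioi (0 : ℝ), radialIntegrand m τ Y r /
        (((r ^ 2 + m ^ 2 - K / 4 : ℝ) : ℂ) - I * ((η * ε : ℝ) : ℂ))) (𝓝[>] 0)
        (𝓝 (radialLimit m η K τ Y)) := by
  obtain ⟨z, Ω, hzΩ, hz, hΩ⟩ := exists_pole_approx (m := m) hη hK hKm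
  -- `Re Ω² = K/4` for every `ε`. Hence `|Ω| ≥ √K/2`, which bounds the prefactor `π/(4Ω)` of the
  -- residue, and `t² + K/4` bounds the denominator of the Euclidean integral from below.
  refine ⟨Real.pi / (2 * Real.sqrt K) + 1 / 2 * ∫ t in Ioi (0 : ℝ), (t ^ 2 + K / 4)⁻¹,
    fun τ Y hτ => ?_⟩
  have hΩ2 : ∀ ε > 0, Ω ε ^ 2 = ((K / 4 : ℝ) : ℂ) + I * ((η * ε : ℝ) : ℂ) := fun ε hε => by
    rw [(hzΩ ε hε).2.2.1, (hzΩ ε hε).2.2.2]; push_cast; ring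
  have hre : ∀ ε > 0, (Ω ε ^ 2).re = K / 4 := fun ε hε => by
    rw [hΩ2 ε hε]; simp
  have hden : ∀ ε > 0, ∀ r : ℝ, (((r ^ 2 + m ^ 2 - K / 4 : ℝ) : ℂ) - I * ((η * ε : ℝ) : ℂ)) =
      (r : ℂ) ^ 2 - z ε ^ 2 := fun ε hε r => by
    rw [(hzΩ ε hε).2.2.2]; push_cast; ring
  have heq : ∀ ε > 0, ∫ r in Ioi (0 : ℝ), radialIntegrand m τ Y r /
      (((r ^ 2 + m ^ 2 - K / 4 : ℝ) : ℂ) - I * ((η * ε : ℝ) : ℂ)) =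
      Real.pi / (4 * Ω ε) * Complex.exp (I * (τ * Ω ε + Y * z ε)) -
        1 / 2 * euclideanIntegral m τ Y (Ω ε ^ 2) := fun ε hε => by
    simp only [hden ε hε]
    exact integral_radial_eq hm hτ (hzΩ ε hε).1 (hzΩ ε hε).2.1 (hzΩ ε hε).2.2.1
  refine ⟨fun ε hε => ?_, fun ε hε => ?_, ?_⟩
  · simp only [hden ε hε]
    exact integrable_radial hm (hzΩ ε hε).1
  · rw [heq ε hε]
    refine (norm_sub_le _ _).trans (add_le_add ?_ ?_)
    · rw [norm_mul]
      have h1 := norm_residue_le hm hτ (hzΩ ε hε).1 (hzΩ ε hε).2.1 (hzΩ ε hε).2.2.1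
      have h2 : Real.sqrt K / 2 ≤ ‖Ω ε‖ := by
        refine le_of_sq_le_sq ?_ (norm_nonneg _)
        rw [div_pow, Real.sq_sqrt hK.le, ← norm_pow]
        refine le_trans (le_of_eq ?_) (re_le_norm _)
        rw [hre ε hε]; norm_num
      have hsK := Real.sqrt_pos.2 hK
      calc _ ≤ ‖(Real.pi : ℂ) / (4 * Ω ε)‖ * 1 := by gcongr
        _ = Real.pi / (4 * ‖Ω ε‖) := by
          rw [mul_one, norm_div, norm_real, norm_mul, Real.norm_of_nonneg Real.pi_pos.le]; simp
        _ ≤ _ := by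
          refine div_le_div_of_nonneg_left Real.pi_pos.le (by positivity) (by linarith)
    · rw [norm_mul, norm_div, norm_one, Complex.norm_two]
      gcongr
      exact norm_euclideanIntegral_le hτ (by positivity) (hre ε hε).ge
  · have hsK : (Real.sqrt K / 2 : ℝ) ≠ 0 := by have := Real.sqrt_pos.2 hK; positivity
    have hsq : Tendsto (fun ε => Ω ε ^ 2) (𝓝[>] 0) (𝓝 ((K / 4 : ℝ) : ℂ)) := by
      have := hΩ.pow 2
      rwa [← ofReal_pow, div_pow, Real.sq_sqrt hK.le, show (2 : ℝ) ^ 2 = 4 by norm_num] at this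
    have t1 : Tendsto (fun ε => Real.pi / (4 * Ω ε) * Complex.exp (I * (τ * Ω ε + Y * z ε)) -
        1 / 2 * euclideanIntegral m τ Y (Ω ε ^ 2)) (𝓝[>] 0) (𝓝
        (Real.pi / (4 * (Real.sqrt K / 2 : ℝ)) * Complex.exp (I * (τ * (Real.sqrt K / 2 : ℝ) +
          Y * polePosition m η K)) - 1 / 2 * euclideanIntegral m τ Y (K / 4 : ℝ))) := by
      refine Tendsto.sub (Tendsto.mul (tendsto_const_nhds.div (hΩ.const_mul 4) ?_) ?_)
        (Tendsto.const_mul _ ?_)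
      · exact mul_ne_zero (by norm_num : (4 : ℂ) ≠ 0) (by exact_mod_cast hsK)
      · exact (Complex.continuous_exp.tendsto _).comp
          (((hΩ.const_mul _).add (hz.const_mul _)).const_mul _)
      · refine tendsto_euclideanIntegral hτ (a := K / 4) (by positivity) ?_ hsq (by simp)
        filter_upwards [self_mem_nhdsWithin] with ε hε
        exact (hre ε hε).ge
    have e0 : radialLimit m η K τ Y = Real.pi / (4 * (Real.sqrt K / 2 : ℝ)) *
        Complex.exp (I * (τ * (Real.sqrt K / 2 : ℝ) + Y * polePosition m η K)) -
        1 / 2 * euclideanIntegral m τ Y (K / 4 : ℝ) := by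
      rw [radialLimit]
      congr 2
      · push_cast; ring
      · push_cast; rfl
    rw [e0]
    refine t1.congr' ?_
    filter_upwards [self_mem_nhdsWithin] with ε hε
    exact (heq ε hε).symm

end Wick


/-! ### Minkowski geometry and the mass shell -/

section Kinematics

open Complex

lemma norm_sq_R3 (v : R3) : ‖v‖ ^ 2 = v 0 ^ 2 + v 1 ^ 2 + v 2 ^ 2 := by
  simp [EuclideanSpace.norm_sq_eq, Fin.sum_univ_three]

lemma norm_sq_R4 (v : R4) : ‖v‖ ^ 2 = v 0 ^ 2 + v 1 ^ 2 + v 2 ^ 2 + v 3 ^ 2 := by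
  simp [EuclideanSpace.norm_sq_eq, Fin.sum_univ_four]

lemma mdot_comm (x y : R4) : mdot x y = mdot y x := by simp only [mdot]; ring

lemma mdot_add_left (x y z : R4) : mdot (x + y) z = mdot x z + mdot y z := by
  simp only [mdot, PiLp.add_apply]; ring

lemma mdot_add_right (x y z : R4) : mdot x (y + z) = mdot x y + mdot x z := by
  simp only [mdot, PiLp.add_apply]; ring

lemma mdot_sub_left (x y z : R4) : mdot (x - y) z = mdot x z - mdot y z := by
  simp only [mdot, PiLp.sub_apply]; ring

lemma mdot_sub_right (x y z : R4) : mdot x (y - z) = mdot x y - mdot x z := by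
  simp only [mdot, PiLp.sub_apply]; ring

lemma mdot_smul_left (a : ℝ) (x y : R4) : mdot (a • x) y = a * mdot x y := by
  simp only [mdot, PiLp.smul_apply, smul_eq_mul]; ring

lemma mdot_smul_right (a : ℝ) (x y : R4) : mdot x (a • y) = a * mdot x y := by
  simp only [mdot, PiLp.smul_apply, smul_eq_mul]; ring

lemma mdot_neg_neg (x : R4) : mdot (-x) (-x) = mdot x x := by
  simp only [mdot, PiLp.neg_apply]; ring

/-- The reflection of the spatial coordinates. -/
noncomputable def parity : R4 ≃ₗ[ℝ] R4 where
  toFun x := !₂[x 0, -x 1, -x 2, -x 3]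
  invFun x := !₂[x 0, -x 1, -x 2, -x 3]
  map_add' x y := by ext i; fin_cases i <;> simp <;> ring
  map_smul' a x := by ext i; fin_cases i <;> simp
  left_inv x := by ext i; fin_cases i <;> simp
  right_inv x := by ext i; fin_cases i <;> simp

/-- This makes the Minkowski product a Euclidean inner product with a reflected argument, so that
smoothness and the Fourier transform carry over from the Euclidean setting. -/
lemma inner_parity (x y : R4) : inner ℝ x (parity y) = mdot x y := by
  simp [PiLp.inner_apply, Fin.sum_univ_four, parity, mdot]
  ring

lemma mdot_eq_inner (x y : R4) : mdot x y = inner ℝ x (parity y) := (inner_parity x y).symm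

/-- The parity transformation as a continuous linear equivalence. -/
noncomputable def parityL : R4 ≃L[ℝ] R4 := parity.toContinuousLinearEquiv

lemma parityL_apply (x : R4) : parityL x = parity x := rfl

@[fun_prop]
lemma contDiff_mdot {E : Type*} [NormedAddCommGroup E] [NormedSpace ℝ E] {n : ℕ∞ω} {f g : E → R4}
    (hf : ContDiff ℝ n f) (hg : ContDiff ℝ n g) : ContDiff ℝ n fun x => mdot (f x) (g x) := by
  simp only [mdot_eq_inner, ← parityL_apply]
  exact hf.inner ℝ (parityL.contDiff.comp hg)

@[fun_prop]
lemma continuous_mdot {E : Type*} [TopologicalSpace E] {f g : E → R4}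
    (hf : Continuous f) (hg : Continuous g) : Continuous fun x => mdot (f x) (g x) := by
  simp only [mdot_eq_inner, ← parityL_apply]
  exact hf.inner (parityL.continuous.comp hg)

/-- The Fourier transform with the Minkowski product, `f ↦ (l ↦ ∫ e^{i y l} f(y) dy)`. -/
noncomputable def testFourier : 𝓢(R4, ℂ) →L[ℂ] 𝓢(R4, ℂ) :=
  -- Evaluating the Fourier transform with kernel `e^{-2πi⟨y,ξ⟩}` at `ξ = -(2π)⁻¹` times the
  -- reflected `l` gives the kernel `e^{i y·l}`.
  (SchwartzMap.compCLMOfContinuousLinearEquiv ℂ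
    (parityL.trans (ContinuousLinearEquiv.smulLeft (Units.mk0 (-(2 * Real.pi)⁻¹)
      (by simp) : ℝˣ)))).comp (FourierTransform.fourierCLM ℂ 𝓢(R4, ℂ))

lemma testFourier_apply (f : 𝓢(R4, ℂ)) (l : R4) :
    testFourier f l = ∫ y, phase y l * f y := by
  have hpi := Real.pi_pos
  simp only [testFourier, ContinuousLinearMap.comp_apply,
    SchwartzMap.compCLMOfContinuousLinearEquiv_apply, Function.comp_apply]
  rw [show (FourierTransform.fourierCLM ℂ 𝓢(R4, ℂ)) f = 𝓕 f from rfl, SchwartzMap.fourier_coe,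
    Real.fourier_eq']
  refine integral_congr_ae (Eventually.of_forall fun y => ?_)
  simp only [smul_eq_mul, phase]
  congr 2
  have : -2 * Real.pi * inner ℝ y ((parityL.trans (ContinuousLinearEquiv.smulLeft
      (Units.mk0 (-(2 * Real.pi)⁻¹) (by simp) : ℝˣ))) l) = mdot y l := by
    rw [ContinuousLinearEquiv.trans_apply, parityL_apply, ContinuousLinearEquiv.smulLeft_apply_apply,
      Units.smul_def, Units.val_mk0, inner_smul_right, ← mdot_eq_inner]
    field_simp
  rw [this, mul_comm]

lemma omega_pos {m : ℝ} (hm : 0 < m) (v : R3) : 0 < omega m v := Real.sqrt_pos.2 (by positivity)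

lemma omega_sq (m : ℝ) (v : R3) : omega m v ^ 2 = ‖v‖ ^ 2 + m ^ 2 := Real.sq_sqrt (by positivity)

lemma le_omega (m : ℝ) (v : R3) : m ≤ omega m v :=
  Real.le_sqrt_of_sq_le (by nlinarith [sq_nonneg ‖v‖])

@[simp] lemma onShell_zero (m : ℝ) (v : R3) : onShell m v 0 = omega m v := rfl
@[simp] lemma onShell_one (m : ℝ) (v : R3) : onShell m v 1 = v 0 := rfl
@[simp] lemma onShell_two (m : ℝ) (v : R3) : onShell m v 2 = v 1 := rfl
@[simp] lemma onShell_three (m : ℝ) (v : R3) : onShell m v 3 = v 2 := rfl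

lemma mdot_onShell_self (m : ℝ) (v : R3) : mdot (onShell m v) (onShell m v) = m ^ 2 := by
  have h := omega_sq m v
  rw [norm_sq_R3] at h
  simp only [mdot, onShell_zero, onShell_one, onShell_two, onShell_three]
  linarith

@[fun_prop]
lemma continuous_omega (m : ℝ) : Continuous (omega m) := by
  unfold omega
  fun_prop

@[fun_prop]
lemma continuous_onShell (m : ℝ) : Continuous (onShell m) := by
  unfold onShell
  refine (PiLp.continuous_toLp 2 _).comp (continuous_pi fun i => ?_)
  fin_cases i <;> simp <;> fun_prop

/-- The spatial part of a four-vector. -/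
noncomputable def spatial (x : R4) : R3 := !₂[x 1, x 2, x 3]

@[fun_prop]
lemma continuous_spatial : Continuous spatial := by
  unfold spatial
  refine (PiLp.continuous_toLp 2 _).comp (continuous_pi fun i => ?_)
  fin_cases i <;> simp <;> fun_prop

@[simp] lemma spatial_onShell (m : ℝ) (v : R3) : spatial (onShell m v) = v := by
  ext i; fin_cases i <;> simp [spatial]

lemma onShell_spatial {m : ℝ} {x : R4} (h : mdot x x = m ^ 2) (h0 : 0 < x 0) :
    onShell m (spatial x) = x := by
  have : omega m (spatial x) = x 0 := by
    rw [omega, norm_sq_R3, Real.sqrt_eq_iff_eq_sq (by positivity) h0.le]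
    simp only [mdot, spatial] at h ⊢
    simp
    linarith
  ext i; fin_cases i
  · simpa using this
  all_goals simp [spatial]

lemma measurableEmbedding_onShell (m : ℝ) : MeasurableEmbedding (onShell m) :=
  (continuous_onShell m).measurableEmbedding fun v w h => by
    rw [← spatial_onShell m v, h, spatial_onShell]

lemma norm_le_norm_onShell (m : ℝ) (v : R3) : ‖v‖ ≤ ‖onShell m v‖ := by
  refine le_of_sq_le_sq ?_ (norm_nonneg _)
  rw [norm_sq_R3, norm_sq_R4]
  simp
  positivity

lemma measurable_shellDensity (m : ℝ) :
    Measurable fun v : R3 => ENNReal.ofReal (1 / (2 * omega m v)) := by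
  have := continuous_omega m
  fun_prop

lemma integral_deltaPlus {m : ℝ} (hm : 0 < m) (Φ : R4 → ℂ) :
    ∫ l, Φ l ∂(deltaPlus m) =
      (1 / (2 * Real.pi) : ℝ) * ∫ v : R3, ((1 / (2 * omega m v) : ℝ) : ℂ) * Φ (onShell m v) := by
  have hpi := Real.pi_pos
  rw [deltaPlus, integral_smul_measure, (measurableEmbedding_onShell m).integral_map,
    integral_withDensity_eq_integral_toReal_smul (measurable_shellDensity m)
      (Eventually.of_forall fun v => ENNReal.ofReal_lt_top), ENNReal.toReal_ofReal (by positivity)]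
  rw [real_smul]
  congr 1
  refine integral_congr_ae (Eventually.of_forall fun v => ?_)
  have := omega_pos hm v
  simp only
  rw [ENNReal.toReal_ofReal (by positivity), real_smul]

lemma integrable_deltaPlus_iff {m : ℝ} (hm : 0 < m) {Φ : R4 → ℂ} :
    Integrable Φ (deltaPlus m) ↔
      Integrable fun v : R3 => ((1 / (2 * omega m v) : ℝ) : ℂ) * Φ (onShell m v) := by
  have hpi := Real.pi_pos
  rw [deltaPlus, integrable_smul_measure (by simp; positivity) ENNReal.ofReal_ne_top,
    (measurableEmbedding_onShell m).integrable_map_iff,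
    integrable_withDensity_iff_integrable_smul' (measurable_shellDensity m)
      (Eventually.of_forall fun v => ENNReal.ofReal_lt_top)]
  refine integrable_congr (Eventually.of_forall fun v => ?_)
  have := omega_pos hm v
  simp only [Function.comp_apply]
  rw [ENNReal.toReal_ofReal (by positivity), real_smul]

lemma ae_deltaPlus {m : ℝ} {p : R4 → Prop} (h : ∀ v, p (onShell m v)) :
    ∀ᵐ l ∂(deltaPlus m), p l := by
  refine Measure.ae_smul_measure ?_ _
  rw [(measurableEmbedding_onShell m).ae_map_iff]
  exact Eventually.of_forall h

/-- The shell is three-dimensional, so the power 4 is integrable even if the density `1/(2ω)` is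
only bounded by `1/(2m)`. All integrability over `l` is reduced to this weight. -/
lemma integrable_rpow_deltaPlus {m : ℝ} (hm : 0 < m) :
    Integrable (fun x : R4 => (1 + ‖x‖) ^ (-(4 : ℝ))) (deltaPlus m) := by
  have h3 : Integrable (fun v : R3 => (1 + ‖v‖) ^ (-(4 : ℝ))) :=
    integrable_one_add_norm (by simp; norm_num)
  have hc : Integrable (fun x : R4 => (((1 + ‖x‖) ^ (-(4 : ℝ)) : ℝ) : ℂ)) (deltaPlus m) := by
    rw [integrable_deltaPlus_iff hm]
    refine (h3.const_mul (1 / (2 * m))).mono' ?_ (Eventually.of_forall fun v => ?_)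
    · refine Continuous.aestronglyMeasurable ?_
      have h1 : Continuous fun v => 1 / (2 * omega m v) := by
        refine continuous_const.div (by fun_prop) fun v => ?_
        have := omega_pos hm v
        positivity
      have h2 : Continuous fun v : R3 => (1 + ‖onShell m v‖) ^ (-(4 : ℝ)) :=
        Continuous.rpow_const (by fun_prop) fun v => Or.inl (by positivity)
      fun_prop
    · have := omega_pos hm v
      rw [norm_mul, norm_real, norm_real, Real.norm_of_nonneg (by positivity),
        Real.norm_of_nonneg (by positivity)]
      refine mul_le_mul ?_ ?_ (by positivity) (by positivity)
      · gcongr; exact le_omega m v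
      · exact Real.rpow_le_rpow_of_nonpos (by positivity) (by gcongr; exact norm_le_norm_onShell m v)
          (by norm_num)
  refine hc.norm.congr (Eventually.of_forall fun x => ?_)
  simp only [norm_real]
  exact Real.norm_of_nonneg (by positivity)

lemma hasTemperateGrowth_deltaPlus {m : ℝ} (hm : 0 < m) : (deltaPlus m).HasTemperateGrowth :=
  ⟨4, by simpa using integrable_rpow_deltaPlus hm⟩

end Kinematics


/-! ### Boosts to the rest frame -/

section Boost

/-- The time direction. -/
noncomputable def timeAxis : R4 := EuclideanSpace.single 0 1

@[simp] lemma timeAxis_zero : timeAxis 0 = 1 := by simp [timeAxis]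
@[simp] lemma timeAxis_one : timeAxis 1 = 0 := by simp [timeAxis]
@[simp] lemma timeAxis_two : timeAxis 2 = 0 := by simp [timeAxis]
@[simp] lemma timeAxis_three : timeAxis 3 = 0 := by simp [timeAxis]

@[simp] lemma mdot_timeAxis (x : R4) : mdot x timeAxis = x 0 := by simp [mdot]

/-- The Lorentz transformation that exchanges the unit vector `u` with the time direction:
the half turn in the plane of these two vectors around their sum. -/
noncomputable def boost (u x : R4) : R4 :=
  (mdot x (u + timeAxis) / (1 + u 0)) • (u + timeAxis) - x

variable {u : R4} (hu : mdot u u = 1) (hu0 : 0 < u 0)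
include hu hu0

/-- With `w = u + e₀` one has `w² = 2(1 + u₀)`, so the map is `x ↦ 2 (x·w)/w² w - x`, the negative
of a reflection. -/
lemma mdot_boost_boost (x y : R4) : mdot (boost u x) (boost u y) = mdot x y := by
  have h0 : 1 + u 0 ≠ 0 := by positivity
  have hw : mdot (u + timeAxis) (u + timeAxis) = 2 * (1 + u 0) := by
    rw [mdot_add_left, mdot_add_right, hu, mdot_comm timeAxis, mdot_add_left]
    simp; ring
  simp only [boost, mdot_sub_left, mdot_sub_right, mdot_smul_left, mdot_smul_right, hw]
  rw [mdot_comm (u + timeAxis) y]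
  field_simp
  ring

lemma boost_boost (x : R4) : boost u (boost u x) = x := by
  have h0 : 1 + u 0 ≠ 0 := by positivity
  have hw : mdot (u + timeAxis) (u + timeAxis) = 2 * (1 + u 0) := by
    rw [mdot_add_left, mdot_add_right, hu, mdot_comm timeAxis, mdot_add_left]
    simp; ring
  have h1 : mdot (boost u x) (u + timeAxis) = mdot x (u + timeAxis) := by
    rw [boost, mdot_sub_left, mdot_smul_left, hw]
    field_simp
    ring
  rw [boost, h1, boost]
  simp

lemma boost_self : boost u u = timeAxis := by
  have h0 : 1 + u 0 ≠ 0 := by positivity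
  have : mdot u (u + timeAxis) = 1 + u 0 := by simp [mdot_add_right, hu]
  rw [boost, this, div_self h0]
  simp

lemma boost_zero (x : R4) : boost u x 0 = mdot x u := by
  rw [← mdot_timeAxis, ← boost_self hu hu0, mdot_boost_boost hu hu0]

lemma mdot_boost_left (x y : R4) : mdot (boost u x) y = mdot x (boost u y) := by
  rw [← boost_boost hu hu0 y, mdot_boost_boost hu hu0, boost_boost hu hu0]

lemma mdot_boost (x : R4) : mdot (boost u x) u = x 0 := by
  rw [mdot_boost_left hu hu0, boost_self hu hu0, mdot_timeAxis]

end Boost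

/-! ### The forward light cone -/

section Cone

/-- Cauchy–Schwarz for the spatial parts, each of which is shorter than the corresponding time
component. -/
lemma mdot_pos {x y : R4} (hx : 0 < mdot x x) (hx0 : 0 < x 0) (hy : 0 < mdot y y) (hy0 : 0 < y 0) :
    0 < mdot x y := by
  simp only [mdot] at *
  have h : (x 1 * y 1 + x 2 * y 2 + x 3 * y 3) ^ 2 < (x 0 * y 0) ^ 2 := by
    have h1 : (x 1 * y 1 + x 2 * y 2 + x 3 * y 3) ^ 2 ≤
        (x 1 ^ 2 + x 2 ^ 2 + x 3 ^ 2) * (y 1 ^ 2 + y 2 ^ 2 + y 3 ^ 2) := by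
      nlinarith [sq_nonneg (x 1 * y 2 - x 2 * y 1), sq_nonneg (x 1 * y 3 - x 3 * y 1),
        sq_nonneg (x 2 * y 3 - x 3 * y 2)]
    have h2 : (x 1 ^ 2 + x 2 ^ 2 + x 3 ^ 2) * (y 1 ^ 2 + y 2 ^ 2 + y 3 ^ 2) < x 0 ^ 2 * y 0 ^ 2 := by
      refine mul_lt_mul'' (by linarith) (by linarith) (by positivity) (by positivity)
    nlinarith
  have := abs_lt_of_sq_lt_sq' h (by positivity)
  linarith [this.2]

lemma mdot_onShell_pos {m : ℝ} (hm : 0 < m) {x : R4} (hx : 0 < mdot x x) (hx0 : 0 < x 0) (v : R3) :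
    0 < mdot x (onShell m v) :=
  mdot_pos hx hx0 (by rw [mdot_onShell_self]; positivity) (by simpa using omega_pos hm v)

end Cone

/-! ### Lorentz invariance of the measure on the mass shell -/

section Invariance

variable {m : ℝ} (hm : 0 < m) {u : R4} (hu : mdot u u = 1) (hu0 : 0 < u 0)

/-- The action of `boost u` on the mass shell, in terms of spatial momenta. -/
noncomputable def shellBoost (m : ℝ) (u : R4) (v : R3) : R3 := spatial (boost u (onShell m v))

include hm hu hu0

lemma onShell_shellBoost (v : R3) : onShell m (shellBoost m u v) = boost u (onShell m v) := by
  refine onShell_spatial ?_ ?_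
  · rw [mdot_boost_boost hu hu0, mdot_onShell_self]
  · rw [boost_zero hu hu0, mdot_comm]
    exact mdot_onShell_pos hm (by rw [hu]; norm_num) hu0 v

lemma shellBoost_shellBoost (v : R3) : shellBoost m u (shellBoost m u v) = v := by
  rw [shellBoost, onShell_shellBoost hm hu hu0, boost_boost hu hu0, spatial_onShell]

lemma omega_shellBoost (v : R3) : omega m (shellBoost m u v) = mdot u (onShell m v) := by
  rw [← onShell_zero, onShell_shellBoost hm hu hu0, boost_zero hu hu0, mdot_comm]

omit hm hu hu0 in
lemma inner_R3 (v w : R3) : inner ℝ v w = v 0 * w 0 + v 1 * w 1 + v 2 * w 2 := by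
  simp [PiLp.inner_apply, Fin.sum_univ_three]; ring

omit hm hu in
lemma shellBoost_eq (v : R3) : shellBoost m u v =
    (omega m v - inner ℝ v (spatial u) / (1 + u 0)) • spatial u - v := by
  have h0 : 1 + u 0 ≠ 0 := by positivity
  have : mdot (onShell m v) (u + timeAxis) / (1 + u 0) =
      omega m v - inner ℝ v (spatial u) / (1 + u 0) := by
    rw [inner_R3]
    field_simp
    simp [mdot, spatial]
    ring
  rw [shellBoost, boost, this]
  ext i
  fin_cases i <;> simp [spatial]

omit hu hu0 in
lemma hasFDerivAt_omega (v : R3) :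
    HasFDerivAt (omega m) ((omega m v)⁻¹ • innerSL ℝ v) v := by
  have h1 : HasFDerivAt (fun v : R3 => ‖v‖ ^ 2 + m ^ 2) (2 • innerSL ℝ v) v :=
    (hasStrictFDerivAt_norm_sq v).hasFDerivAt.add_const _
  have h2 := h1.sqrt (by positivity)
  refine h2.congr_fderiv ?_
  have h3 := (omega_pos hm v).ne'
  rw [← omega]
  ext w
  simp
  field_simp

/-- The derivative of `shellBoost`. -/
noncomputable def shellBoostDeriv (m : ℝ) (u : R4) (v : R3) : R3 →L[ℝ] R3 :=
  ((omega m v)⁻¹ • innerSL ℝ v - (1 + u 0)⁻¹ • innerSL ℝ (spatial u)).smulRight (spatial u) -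
    ContinuousLinearMap.id ℝ R3

omit hu in
lemma hasFDerivAt_shellBoost (v : R3) :
    HasFDerivAt (shellBoost m u) (shellBoostDeriv m u v) v := by
  have h1 : HasFDerivAt (fun v : R3 => inner ℝ v (spatial u) / (1 + u 0))
      ((1 + u 0)⁻¹ • innerSL ℝ (spatial u)) v := by
    have := ((innerSL ℝ (spatial u)).hasFDerivAt (x := v)).const_mul (1 + u 0)⁻¹
    refine this.congr_of_eventuallyEq (Eventually.of_forall fun w => ?_)
    simp [real_inner_comm, div_eq_inv_mul]
  have h2 := (((hasFDerivAt_omega hm v).sub h1).smul_const (spatial u)).sub (hasFDerivAt_id v)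
  exact h2.congr_of_eventuallyEq (Eventually.of_forall fun w => shellBoost_eq hu0 w)

/-- The derivative is minus a transvection, so its determinant up to sign is one plus a single value
of a linear form. By `u² = 1` this is `(u·l)/ω`, and `u·l` is the energy of the boosted momentum. -/
lemma abs_det_shellBoostDeriv (v : R3) :
    |(shellBoostDeriv m u v).det| = omega m (shellBoost m u v) / omega m v := by
  have h0 : 1 + u 0 ≠ 0 := by positivity
  have h1 := omega_pos hm v
  set f : Module.Dual ℝ R3 :=
    ((omega m v)⁻¹ • innerSL ℝ v - (1 + u 0)⁻¹ • innerSL ℝ (spatial u) : R3 →L[ℝ] ℝ).toLinearMap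
    with hf
  have h2 : (shellBoostDeriv m u v : R3 →ₗ[ℝ] R3) =
      (-1 : ℝ) • LinearMap.transvection f (-spatial u) := by
    ext w
    simp [shellBoostDeriv, LinearMap.transvection, hf]
    ring
  rw [ContinuousLinearMap.det, h2, LinearMap.det_smul, LinearMap.transvection.det,
    omega_shellBoost hm hu hu0]
  have h3 : 1 + f (-spatial u) = mdot u (onShell m v) / omega m v := by
    have h4 : inner ℝ (spatial u) (spatial u) = u 0 ^ 2 - 1 := by
      rw [inner_R3]
      simp only [mdot] at hu
      simp [spatial]
      linarith
    have h5 : mdot u (onShell m v) = u 0 * omega m v - inner ℝ v (spatial u) := by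
      rw [inner_R3]
      simp [mdot, spatial]
      ring
    rw [h5]
    simp only [hf, map_neg, ContinuousLinearMap.coe_coe, sub_apply,
      smul_apply, innerSL_apply_apply, h4, smul_eq_mul]
    field_simp
    ring
  have h6 := mdot_onShell_pos hm (by rw [hu]; norm_num) hu0 v
  rw [h3, abs_mul, abs_of_pos (div_pos h6 h1)]
  simp

/-- The Lorentz invariance of the measure on the mass shell. -/
lemma map_shellBoost :
    Measure.map (shellBoost m u)
      ((volume : Measure R3).withDensity fun v => ENNReal.ofReal (1 / (2 * omega m v))) =
    (volume : Measure R3).withDensity fun v => ENNReal.ofReal (1 / (2 * omega m v)) := by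
  have hinv := shellBoost_shellBoost hm hu hu0
  have hinj : Function.Injective (shellBoost m u) := (show Function.Involutive _ from hinv).injective
  have hsurj : Function.Surjective (shellBoost m u) :=
    (show Function.Involutive _ from hinv).surjective
  have hcont : Continuous (shellBoost m u) :=
    continuous_iff_continuousAt.2 fun v => (hasFDerivAt_shellBoost hm hu0 v).continuousAt
  refine Measure.ext fun A hA => ?_
  have hA' := hcont.measurable hA
  rw [Measure.map_apply hcont.measurable hA, withDensity_apply _ hA', withDensity_apply _ hA]
  -- The Jacobian, the ratio of new to old energy, cancels against the density `1/(2ω)` at the image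
  -- point.
  have := lintegral_image_eq_lintegral_abs_det_fderiv_mul (volume : Measure R3) hA'
    (fun v _ => (hasFDerivAt_shellBoost hm hu0 v).hasFDerivWithinAt) hinj.injOn
    fun v => ENNReal.ofReal (1 / (2 * omega m v))
  rw [image_preimage_eq _ hsurj] at this
  rw [this]
  refine setLIntegral_congr_fun hA' fun v _ => ?_
  have h1 := omega_pos hm v
  have h2 := omega_pos hm (shellBoost m u v)
  rw [abs_det_shellBoostDeriv hm hu hu0, ← ENNReal.ofReal_mul (by positivity)]
  congr 1
  field_simp

lemma map_boost_deltaPlus : Measure.map (boost u) (deltaPlus m) = deltaPlus m := by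
  have hb : Continuous (boost u) := by unfold boost; fun_prop
  have hcont : Continuous (shellBoost m u) :=
    continuous_iff_continuousAt.2 fun v => (hasFDerivAt_shellBoost hm hu0 v).continuousAt
  have h : boost u ∘ onShell m = onShell m ∘ shellBoost m u :=
    funext fun v => (onShell_shellBoost hm hu hu0 v).symm
  rw [deltaPlus, Measure.map_smul, Measure.map_map hb.measurable (continuous_onShell m).measurable,
    h, ← Measure.map_map (continuous_onShell m).measurable hcont.measurable,
    map_shellBoost hm hu hu0]

lemma measurePreserving_boost : MeasurePreserving (boost u) (deltaPlus m) (deltaPlus m) :=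
  ⟨(show Continuous (boost u) by unfold boost; fun_prop).measurable, map_boost_deltaPlus hm hu hu0⟩

omit hm in
lemma measurableEmbedding_boost : MeasurableEmbedding (boost u) :=
  (show Continuous (boost u) by unfold boost; fun_prop).measurableEmbedding
    (show Function.Involutive (boost u) from boost_boost hu hu0).injective

end Invariance


/-! ### Polar coordinates in momentum space -/

section Polar

/-- The unit sphere of spatial directions. -/
abbrev S2 : Type := Metric.sphere (0 : R3) 1

/-- The surface measure on the unit sphere. -/
noncomputable abbrev sphereMeasure : Measure S2 := (volume : Measure R3).toSphere

/-- The measure `r² dr` on the positive half line. -/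
noncomputable def radialMeasure : Measure ℝ :=
  (volume.restrict (Ioi 0)).withDensity fun r => ENNReal.ofReal (r ^ 2)

lemma map_volumeIoiPow :
    Measure.map Subtype.val (Measure.volumeIoiPow 2) = radialMeasure := by
  refine Measure.ext fun A hA => ?_
  have hA' : MeasurableSet ((Subtype.val : Ioi (0 : ℝ) → ℝ) ⁻¹' A) := measurable_subtype_coe hA
  rw [Measure.map_apply measurable_subtype_coe hA, Measure.volumeIoiPow, withDensity_apply _ hA',
    setLIntegral_subtype measurableSet_Ioi _ fun a : ℝ => ENNReal.ofReal (a ^ 2), radialMeasure,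
    withDensity_apply _ hA, Measure.restrict_restrict hA, Subtype.image_preimage_coe, inter_comm]

instance : SFinite radialMeasure := by unfold radialMeasure; infer_instance

lemma integral_radialMeasure (f : ℝ → ℂ) :
    ∫ r, f r ∂radialMeasure = ∫ r in Ioi 0, ((r ^ 2 : ℝ) : ℂ) * f r := by
  rw [radialMeasure, integral_withDensity_eq_integral_toReal_smul (by fun_prop)
    (Eventually.of_forall fun r => ENNReal.ofReal_lt_top)]
  refine integral_congr_ae (Eventually.of_forall fun r => ?_)
  simp only
  rw [ENNReal.toReal_ofReal (by positivity), Complex.real_smul]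

/-- Polar coordinates. -/
lemma polar_coordinates (g : R3 → ℂ) :
    (∫ v, g v = ∫ p, g (p.2 • (p.1 : R3)) ∂(sphereMeasure.prod radialMeasure)) ∧
      (Integrable g ↔ Integrable (fun p : S2 × ℝ => g (p.2 • (p.1 : R3)))
        (sphereMeasure.prod radialMeasure)) := by
  have hd : Module.finrank ℝ R3 - 1 = 2 := by simp
  have hmp := (volume : Measure R3).measurePreserving_homeomorphUnitSphereProd
  rw [hd] at hmp
  have he := (homeomorphUnitSphereProd R3).measurableEmbedding
  have h2 : MeasurePreserving (Prod.map id Subtype.val : S2 × Ioi (0 : ℝ) → S2 × ℝ)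
      (sphereMeasure.prod (Measure.volumeIoiPow 2)) (sphereMeasure.prod radialMeasure) :=
    (MeasurePreserving.id _).prod ⟨measurable_subtype_coe, map_volumeIoiPow⟩
  have he2 : MeasurableEmbedding (Prod.map id Subtype.val : S2 × Ioi (0 : ℝ) → S2 × ℝ) :=
    MeasurableEmbedding.id.prodMap (MeasurableEmbedding.subtype_coe measurableSet_Ioi)
  have h3 := h2.comp hmp
  have he3 := he2.comp he
  have hg : ((fun p : S2 × ℝ => g (p.2 • (p.1 : R3))) ∘
      ((Prod.map id Subtype.val : S2 × Ioi (0 : ℝ) → S2 × ℝ) ∘ homeomorphUnitSphereProd R3)) =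
      g ∘ Subtype.val := by
    funext x
    simp only [Function.comp_apply, Prod.map_fst, Prod.map_snd, id]
    have hx : ‖(x : R3)‖ ≠ 0 := norm_ne_zero_iff.2 x.2
    simp [smul_smul, hx]
  constructor
  · rw [← h3.integral_comp he3]
    change _ = ∫ x, ((fun p : S2 × ℝ => g (p.2 • (p.1 : R3))) ∘
      ((Prod.map id Subtype.val : S2 × Ioi (0 : ℝ) → S2 × ℝ) ∘ homeomorphUnitSphereProd R3)) x ∂_
    rw [hg, Function.comp_def, integral_subtype_comap (measurableSet_singleton _).compl,
      restrict_compl_singleton]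
  · rw [← h3.integrable_comp_emb he3, hg, ← integrableOn_iff_comap_subtypeVal
      (measurableSet_singleton _).compl, IntegrableOn, restrict_compl_singleton]

end Polar

/-! ### The spherical average of a plane wave -/

section Moments

lemma integral_comp_isometry (A : R3 ≃ₗᵢ[ℝ] R3) {f : R3 → ℂ} : ∫ v, f (A v) = ∫ v, f v :=
  A.measurePreserving.integral_comp A.toHomeomorph.measurableEmbedding _

lemma gaussian_moment_line (j : ℕ) :
    ∫ x : ℝ, x ^ (2 * j) * Real.exp (-x ^ 2) = Real.Gamma (j + 1 / 2) := by
  have h := integral_rpow_mul_exp_neg_rpow (p := 2) (q := 2 * j) (by norm_num)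
    (by linarith [j.cast_nonneg (α := ℝ)])
  have h1 := integral_comp_abs (f := fun x : ℝ => x ^ (2 * j) * Real.exp (-x ^ 2))
  simp only [sq_abs, pow_mul] at h1
  simp only [pow_mul, h1]
  have h2 : ∫ x in Ioi (0 : ℝ), (x ^ 2) ^ j * Real.exp (-x ^ 2) =
      ∫ x in Ioi (0 : ℝ), x ^ (2 * (j : ℝ)) * Real.exp (-x ^ (2 : ℝ)) := by
    refine setIntegral_congr_fun measurableSet_Ioi fun x hx => ?_
    rw [← pow_mul, ← Real.rpow_natCast x (2 * j), Real.rpow_two]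
    push_cast
    rfl
  rw [h2, h, show (j : ℝ) + 1 / 2 = (2 * j + 1) / 2 by ring]
  ring

lemma gaussian_moment_half (p : ℕ) :
    ∫ x in Ioi (0 : ℝ), x ^ 2 * (x ^ p * Real.exp (-x ^ 2)) =
      1 / 2 * Real.Gamma ((p + 3) / 2) := by
  have h := integral_rpow_mul_exp_neg_rpow (p := 2) (q := p + 2) (by norm_num)
    (by linarith [p.cast_nonneg (α := ℝ)])
  rw [show ((p : ℝ) + 3) / 2 = (p + 2 + 1) / 2 by ring, ← h]
  refine setIntegral_congr_fun measurableSet_Ioi fun x hx => ?_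
  rw [show (p + 2 : ℝ) = ((p + 2 : ℕ) : ℝ) by push_cast; ring, Real.rpow_natCast,
    Real.rpow_two]
  ring

lemma gaussian_moment_space (j : ℕ) :
    ∫ v : R3, (((v 0) ^ (2 * j) * Real.exp (-‖v‖ ^ 2) : ℝ) : ℂ) =
      (Real.Gamma (j + 1 / 2) * Real.pi : ℝ) := by
  have h := (EuclideanSpace.volume_preserving_symm_measurableEquiv_toLp (Fin 3)).symm.integral_comp'
    (g := fun v : R3 => ((v 0) ^ (2 * j) * Real.exp (-‖v‖ ^ 2) : ℝ))
  have h2 := integral_fintype_prod_volume_eq_prod (ι := Fin 3) (𝕜 := ℝ) (E := fun _ => ℝ)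
    ![fun x => x ^ (2 * j) * Real.exp (-x ^ 2), fun x => Real.exp (-x ^ 2),
      fun x => Real.exp (-x ^ 2)]
  have h3 : ∫ x : ℝ, Real.exp (-x ^ 2) = Real.sqrt Real.pi := by
    simpa using integral_gaussian 1
  simp only [Fin.prod_univ_three] at h2
  simp only [Matrix.cons_val_zero, Matrix.cons_val_one, Matrix.cons_val_two, Matrix.tail_cons,
    Matrix.head_cons, h3, gaussian_moment_line] at h2
  rw [mul_assoc, Real.mul_self_sqrt Real.pi_pos.le] at h2
  rw [integral_complex_ofReal, ← h2]
  congr 1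
  refine h.symm.trans ?_
  refine integral_congr_ae (Eventually.of_forall fun v => ?_)
  beta_reduce
  rw [norm_sq_R3, mul_assoc, mul_assoc, ← Real.exp_add, ← Real.exp_add]
  simp only [MeasurableEquiv.symm_symm, MeasurableEquiv.coe_toLp]
  ring_nf

lemma inner_smul_sphere (n : S2) (w : R3) (r : ℝ) (p : ℕ) :
    ((inner ℝ (r • (n : R3)) w ^ p * Real.exp (-‖r • (n : R3)‖ ^ 2) : ℝ) : ℂ) =
      ((inner ℝ (n : R3) w ^ p : ℝ) : ℂ) * ((r ^ p * Real.exp (-r ^ 2) : ℝ) : ℂ) := by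
  have hn : ‖(n : R3)‖ = 1 := by simp
  rw [norm_smul, hn, inner_smul_left]
  simp only [mul_one, Real.norm_eq_abs, sq_abs, mul_pow]
  push_cast
  simp
  ring

/-- In polar coordinates a Gaussian moment factors into a moment of the sphere and a nonzero value
of the Gamma function. Computing the left side in another way thus determines the moments of the
sphere. -/
lemma integral_gaussian_moment (w : R3) (p : ℕ) :
    ∫ v : R3, ((inner ℝ v w ^ p * Real.exp (-‖v‖ ^ 2) : ℝ) : ℂ) =
      (∫ n : S2, ((inner ℝ (n : R3) w ^ p : ℝ) : ℂ) ∂sphereMeasure) *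
        (1 / 2 * Real.Gamma ((p + 3) / 2) : ℝ) := by
  rw [(polar_coordinates _).1]
  simp only [inner_smul_sphere]
  rw [integral_prod_mul (fun n : S2 => ((inner ℝ (n : R3) w ^ p : ℝ) : ℂ))
    (fun r : ℝ => ((r ^ p * Real.exp (-r ^ 2) : ℝ) : ℂ)), integral_radialMeasure,
    ← gaussian_moment_half, ← integral_complex_ofReal]
  simp only [Complex.ofReal_mul]

lemma sphere_moment_odd (w : R3) (j : ℕ) :
    ∫ n : S2, ((inner ℝ (n : R3) w ^ (2 * j + 1) : ℝ) : ℂ) ∂sphereMeasure = 0 := by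
  have h := integral_gaussian_moment w (2 * j + 1)
  have h0 : ∫ v : R3, ((inner ℝ v w ^ (2 * j + 1) * Real.exp (-‖v‖ ^ 2) : ℝ) : ℂ) = 0 := by
    have h1 := integral_neg_eq_self
      (fun v : R3 => ((inner ℝ v w ^ (2 * j + 1) * Real.exp (-‖v‖ ^ 2) : ℝ) : ℂ)) volume
    simp only [inner_neg_left, norm_neg, (odd_two_mul_add_one j).neg_pow, neg_mul,
      Complex.ofReal_neg, integral_neg] at h1
    exact self_eq_neg.1 h1.symm
  rw [h0] at h
  refine (mul_eq_zero.1 h.symm).resolve_right ?_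
  have : 0 < Real.Gamma ((((2 * j + 1 : ℕ) : ℝ) + 3) / 2) := Real.Gamma_pos_of_pos (by positivity)
  exact_mod_cast (by positivity : (1 / 2 * Real.Gamma ((((2 * j + 1 : ℕ) : ℝ) + 3) / 2)) ≠ 0)

/-- A reflection carries `w` to a multiple of the first basis vector, and the Gaussian moment
reduces to one dimension. The quotient of `Γ(j + 1/2)` and `Γ(j + 3/2) = (j + 1/2) Γ(j + 1/2)`
leaves `4π/(2j + 1)`. -/
lemma sphere_moment_even (w : R3) (j : ℕ) :
    ∫ n : S2, ((inner ℝ (n : R3) w ^ (2 * j) : ℝ) : ℂ) ∂sphereMeasure =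
      (4 * Real.pi * ‖w‖ ^ (2 * j) / (2 * j + 1) : ℝ) := by
  have h := integral_gaussian_moment w (2 * j)
  set e : R3 := ‖w‖ • EuclideanSpace.single 0 1 with he
  have hnorm : ‖w‖ = ‖e‖ := by simp [he, norm_smul]
  set A := Submodule.reflection (ℝ ∙ (w - e))ᗮ with hA
  have hAw : A w = e := Submodule.reflection_sub hnorm
  have h1 : ∫ v : R3, ((inner ℝ v w ^ (2 * j) * Real.exp (-‖v‖ ^ 2) : ℝ) : ℂ) =
      ((‖w‖ ^ (2 * j) : ℝ) : ℂ) * (Real.Gamma (j + 1 / 2) * Real.pi : ℝ) := by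
    rw [← gaussian_moment_space, ← integral_const_mul, ← integral_comp_isometry A
      (f := fun v => ((‖w‖ ^ (2 * j) : ℝ) : ℂ) *
        (((v 0) ^ (2 * j) * Real.exp (-‖v‖ ^ 2) : ℝ) : ℂ))]
    refine integral_congr_ae (Eventually.of_forall fun v => ?_)
    beta_reduce
    have h2 : inner ℝ v w = ‖w‖ * (A v) 0 := by
      rw [← A.inner_map_map, hAw, he, inner_smul_right]
      simp [EuclideanSpace.inner_single_right]
    rw [h2, A.norm_map]
    push_cast
    ring
  rw [h1] at h
  have hG : 0 < Real.Gamma ((j : ℝ) + 1 / 2) := Real.Gamma_pos_of_pos (by positivity)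
  have h3 : Real.Gamma ((((2 * j : ℕ) : ℝ) + 3) / 2) = (j + 1 / 2) * Real.Gamma (j + 1 / 2) := by
    rw [← Real.Gamma_add_one (by positivity)]
    congr 1
    push_cast
    ring
  rw [h3] at h
  have h4 : ((1 / 2 * ((j + 1 / 2) * Real.Gamma (j + 1 / 2)) : ℝ) : ℂ) ≠ 0 := by
    exact_mod_cast (by positivity : (1 / 2 * ((j + 1 / 2) * Real.Gamma (j + 1 / 2)) : ℝ) ≠ 0)
  refine mul_right_cancel₀ h4 (h.symm.trans ?_)
  have h5 : (2 * (j : ℂ) + 1) ≠ 0 := by exact_mod_cast (Nat.succ_ne_zero (2 * j))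
  push_cast
  field_simp
  ring

lemma continuous_inner_sphere (w : R3) : Continuous fun n : S2 => inner ℝ (n : R3) w := by
  fun_prop

/-- The average of a plane wave over the sphere. -/
lemma sphere_integral_exp (w : R3) (hw : w ≠ 0) :
    ∫ n : S2, Complex.exp (Complex.I * ((inner ℝ (n : R3) w : ℝ) : ℂ)) ∂sphereMeasure =
      (4 * Real.pi * (Real.sin ‖w‖ / ‖w‖) : ℝ) := by
  have hw' : ‖w‖ ≠ 0 := norm_ne_zero_iff.2 hw
  -- The exponential series is integrated term by term over the sphere. The odd terms vanish, and
  -- the factor `1/(2j + 1)` of the even ones turns the cosine series into that of `sin ‖w‖ / ‖w‖`.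
  have hsum : HasSum (fun p : ℕ => ∫ n : S2, (Complex.I * ((inner ℝ (n : R3) w : ℝ) : ℂ)) ^ p /
      (p.factorial : ℂ) ∂sphereMeasure)
      (∫ n : S2, Complex.exp (Complex.I * ((inner ℝ (n : R3) w : ℝ) : ℂ)) ∂sphereMeasure) := by
    refine hasSum_integral_of_dominated_convergence
      (fun p _ => ‖w‖ ^ p / (p.factorial : ℝ)) (fun p => ?_) (fun p => ?_) ?_ ?_ ?_
    · refine Continuous.aestronglyMeasurable ?_
      have := continuous_inner_sphere w
      fun_prop
    · refine Eventually.of_forall fun n => ?_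
      rw [norm_div, norm_pow, norm_mul, Complex.norm_I, one_mul, Complex.norm_real,
        Complex.norm_natCast]
      gcongr
      have := norm_inner_le_norm (𝕜 := ℝ) (n : R3) w
      simpa using this
    · exact Eventually.of_forall fun n => Real.summable_pow_div_factorial _
    · exact integrable_const _
    · refine Eventually.of_forall fun n => ?_
      rw [Complex.exp_eq_exp_ℂ]
      exact NormedSpace.expSeries_div_hasSum_exp _
  have hval : ∀ p : ℕ, ∫ n : S2, (Complex.I * ((inner ℝ (n : R3) w : ℝ) : ℂ)) ^ p /
      (p.factorial : ℂ) ∂sphereMeasure = Complex.I ^ p / (p.factorial : ℂ) *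
        ∫ n : S2, ((inner ℝ (n : R3) w ^ p : ℝ) : ℂ) ∂sphereMeasure := fun p => by
    rw [← integral_const_mul]
    refine integral_congr_ae (Eventually.of_forall fun n => ?_)
    beta_reduce
    rw [mul_pow]
    push_cast
    ring
  simp only [hval] at hsum
  have hodd : HasSum (fun j : ℕ => Complex.I ^ (2 * j + 1) / ((2 * j + 1).factorial : ℂ) *
      ∫ n : S2, ((inner ℝ (n : R3) w ^ (2 * j + 1) : ℝ) : ℂ) ∂sphereMeasure) 0 := by
    simp only [sphere_moment_odd, mul_zero]
    exact hasSum_zero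
  have heven : HasSum (fun j : ℕ => Complex.I ^ (2 * j) / ((2 * j).factorial : ℂ) *
      ∫ n : S2, ((inner ℝ (n : R3) w ^ (2 * j) : ℝ) : ℂ) ∂sphereMeasure)
      ((4 * Real.pi * (Real.sin ‖w‖ / ‖w‖) : ℝ) : ℂ) := by
    have h1 := ((Complex.hasSum_ofReal.2 (Real.hasSum_sin ‖w‖)).mul_left
      ((4 * Real.pi / ‖w‖ : ℝ) : ℂ))
    have h2 : (fun j : ℕ => Complex.I ^ (2 * j) / ((2 * j).factorial : ℂ) *
        ∫ n : S2, ((inner ℝ (n : R3) w ^ (2 * j) : ℝ) : ℂ) ∂sphereMeasure) =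
        fun j : ℕ => ((4 * Real.pi / ‖w‖ : ℝ) : ℂ) *
          (((-1) ^ j * ‖w‖ ^ (2 * j + 1) / ((2 * j + 1).factorial : ℝ) : ℝ) : ℂ) := by
      funext j
      rw [sphere_moment_even, pow_mul, Complex.I_sq, Nat.factorial_succ]
      have : ((2 * j).factorial : ℂ) ≠ 0 := by exact_mod_cast (Nat.factorial_pos _).ne'
      have h2 : (2 * (j : ℂ) + 1) ≠ 0 := by exact_mod_cast (Nat.succ_ne_zero (2 * j))
      have h3 : (‖w‖ : ℂ) ≠ 0 := by exact_mod_cast hw'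
      push_cast
      field_simp
      ring
    rw [h2, show (4 * Real.pi * (Real.sin ‖w‖ / ‖w‖) : ℝ) =
      4 * Real.pi / ‖w‖ * Real.sin ‖w‖ by ring, Complex.ofReal_mul]
    exact h1
  have := (HasSum.even_add_odd (f := fun p : ℕ => Complex.I ^ p / (p.factorial : ℂ) *
    ∫ n : S2, ((inner ℝ (n : R3) w ^ p : ℝ) : ℂ) ∂sphereMeasure) heven hodd).unique hsum
  rw [← this, add_zero]

end Moments


/-! ### Seminorms of test functions -/

section SchwartzNorm

variable {E : Type*} [NormedAddCommGroup E] [NormedSpace ℝ E]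

/-- The maximum of the Schwartz seminorms of order at most `N`. -/
noncomputable def schwartzNorm (N : ℕ) : Seminorm ℂ 𝓢(E, ℂ) :=
  (Finset.Iic (N, N)).sup (schwartzSeminormFamily ℂ E ℂ)

lemma weight_le_schwartzNorm {i j N : ℕ} (hi : i ≤ N) (hj : j ≤ N) (f : 𝓢(E, ℂ)) (x : E) :
    (1 + ‖x‖) ^ i * ‖iteratedFDeriv ℝ j f x‖ ≤ 2 ^ N * schwartzNorm N f :=
  SchwartzMap.one_add_le_sup_seminorm_apply (𝕜 := ℂ) (m := (N, N)) hi hj f x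

lemma norm_le_schwartzNorm {i N : ℕ} (hi : i ≤ N) (f : 𝓢(E, ℂ)) (x : E) :
    (1 + ‖x‖) ^ i * ‖f x‖ ≤ 2 ^ N * schwartzNorm N f := by
  simpa using weight_le_schwartzNorm hi (Nat.zero_le N) f x

lemma schwartzNorm_le {N : ℕ} {f : 𝓢(E, ℂ)} {C : ℝ} (hC : 0 ≤ C)
    (h : ∀ i ≤ N, ∀ j ≤ N, ∀ x, ‖x‖ ^ i * ‖iteratedFDeriv ℝ j f x‖ ≤ C) :
    schwartzNorm N f ≤ C := by
  refine Seminorm.finset_sup_apply_le hC fun i hi => ?_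
  have := Finset.mem_Iic.1 hi
  exact SchwartzMap.seminorm_le_bound ℂ _ _ f hC fun x => h _ this.1 _ this.2 x

lemma finset_sup_le_schwartzNorm (s : Finset (ℕ × ℕ)) :
    ∃ N, s.sup (schwartzSeminormFamily ℂ E ℂ) ≤ schwartzNorm N := by
  refine ⟨max (s.sup Prod.fst) (s.sup Prod.snd), Finset.sup_mono fun i hi => ?_⟩
  rw [Finset.mem_Iic]
  exact ⟨(Finset.le_sup (f := Prod.fst) hi).trans (le_max_left _ _),
    (Finset.le_sup (f := Prod.snd) hi).trans (le_max_right _ _)⟩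

lemma exists_schwartzNorm_comp_le {E' : Type*} [NormedAddCommGroup E'] [NormedSpace ℝ E']
    (A : 𝓢(E, ℂ) →L[ℂ] 𝓢(E', ℂ)) (N : ℕ) :
    ∃ (N' : ℕ) (C : ℝ), 0 ≤ C ∧ ∀ f, schwartzNorm N (A f) ≤ C * schwartzNorm N' f := by
  have hc : Continuous ((schwartzNorm N : Seminorm ℂ 𝓢(E', ℂ)).comp (A : 𝓢(E, ℂ) →ₗ[ℂ] 𝓢(E', ℂ))) := by
    refine Continuous.comp (g := schwartzNorm N) ?_ A.continuous
    have := (schwartz_withSeminorms ℂ E' ℂ).continuous_seminorm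
    exact Seminorm.continuous_finsetSup fun i _ => this i
  obtain ⟨s, C, -, h⟩ := Seminorm.bound_of_continuous (schwartz_withSeminorms ℂ E ℂ) _ hc
  obtain ⟨N', hN'⟩ := finset_sup_le_schwartzNorm (E := E) s
  refine ⟨N', C, C.2, fun f => (h f).trans ?_⟩
  exact mul_le_mul_of_nonneg_left (hN' f) C.2

/-- A linear functional with a seminorm bound, as a continuous linear map. -/
lemma exists_schwartz_functional (A : 𝓢(E, ℂ) → ℂ) (hadd : ∀ f g, A (f + g) = A f + A g)
    (hsmul : ∀ (a : ℂ) f, A (a • f) = a * A f)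
    (hb : ∃ (N : ℕ) (C : ℝ), ∀ f, ‖A f‖ ≤ C * schwartzNorm N f) :
    ∃ T : 𝓢(E, ℂ) →L[ℂ] ℂ, ∀ f, T f = A f := by
  obtain ⟨N, C, h⟩ := hb
  refine ⟨SchwartzMap.mkCLMtoNormedSpace (𝕜 := ℂ) (σ := RingHom.id ℂ) A hadd hsmul
    ⟨Finset.Iic (N, N), |C|, abs_nonneg _, fun f => (h f).trans ?_⟩, fun f => rfl⟩
  exact mul_le_mul_of_nonneg_right (le_abs_self C) (apply_nonneg _ _)

end SchwartzNorm

/-! ### Restriction and partial Fourier transform of test functions -/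

section Slice

lemma hasTemperateGrowth_slice (k : R4) :
    Function.HasTemperateGrowth fun y : R4 => (y, k) := by
  have h := (ContinuousLinearMap.inl ℝ R4 R4).hasTemperateGrowth.add
    (Function.HasTemperateGrowth.const ((0, k) : R4 × R4))
  convert h using 1
  funext y
  simp

/-- The restriction of a test function to a fixed value of the second variable. -/
noncomputable def slice (k : R4) : 𝓢(R4 × R4, ℂ) →L[ℂ] 𝓢(R4, ℂ) :=
  SchwartzMap.compCLM ℂ (hasTemperateGrowth_slice k) ⟨1, 1, fun y => by
    have : ‖y‖ ≤ ‖(y, k)‖ := le_max_left _ _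
    simp only [pow_one, one_mul]
    linarith⟩

@[simp] lemma slice_apply (k : R4) (h : 𝓢(R4 × R4, ℂ)) (y : R4) : slice k h y = h (y, k) := rfl

lemma norm_iteratedFDeriv_slice_le (k : R4) (h : 𝓢(R4 × R4, ℂ)) (j : ℕ) (y : R4) :
    ‖iteratedFDeriv ℝ j (slice k h) y‖ ≤ ‖iteratedFDeriv ℝ j h (y, k)‖ := by
  have e : (slice k h : R4 → ℂ) =
      (fun z => h (z + (0, k))) ∘ (ContinuousLinearMap.inl ℝ R4 R4) := by
    funext y; simp
  rw [e, ContinuousLinearMap.iteratedFDeriv_comp_right (ContinuousLinearMap.inl ℝ R4 R4)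
    (f := fun z => h (z + (0, k))) (n := ∞) ((h.smooth ⊤).comp (contDiff_id.add contDiff_const)) y
    (by exact_mod_cast le_top), iteratedFDeriv_comp_add_right]
  refine (ContinuousMultilinearMap.norm_compContinuousLinearMap_le _ _).trans ?_
  have h1 : ‖ContinuousLinearMap.inl ℝ R4 R4‖ ≤ 1 := ContinuousLinearMap.norm_inl_le_one ℝ R4 R4
  simp only [ContinuousLinearMap.inl_apply, Prod.mk_add_mk, add_zero, zero_add, Finset.prod_const,
    Finset.card_univ, Fintype.card_fin]
  exact mul_le_of_le_one_right (norm_nonneg _) (pow_le_one₀ (norm_nonneg _) h1)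

/-- The norm of `(y, k)` dominates those of `y` and `k`. Decay of order `M` in `k` therefore costs
`M` further orders of the seminorm. -/
lemma schwartzNorm_slice_le (N M : ℕ) (k : R4) (h : 𝓢(R4 × R4, ℂ)) :
    (1 + ‖k‖) ^ M * schwartzNorm N (slice k h) ≤ 2 ^ (N + M) * schwartzNorm (N + M) h := by
  have hk : 0 < (1 + ‖k‖) ^ M := by positivity
  rw [← le_div_iff₀' hk]
  have h0 : 0 ≤ schwartzNorm (N + M) h := apply_nonneg _ _
  refine schwartzNorm_le (by positivity) fun i hi j hj y => ?_
  rw [le_div_iff₀' hk]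
  have hy : ‖y‖ ≤ 1 + ‖(y, k)‖ := by
    have : ‖y‖ ≤ ‖(y, k)‖ := le_max_left _ _
    linarith
  have hk' : 1 + ‖k‖ ≤ 1 + ‖(y, k)‖ := by
    have : ‖k‖ ≤ ‖(y, k)‖ := le_max_right _ _
    linarith
  calc (1 + ‖k‖) ^ M * (‖y‖ ^ i * ‖iteratedFDeriv ℝ j (slice k h) y‖)
      ≤ (1 + ‖(y, k)‖) ^ M * ((1 + ‖(y, k)‖) ^ i * ‖iteratedFDeriv ℝ j h (y, k)‖) := by
        gcongr
        exact norm_iteratedFDeriv_slice_le k h j y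
    _ = (1 + ‖(y, k)‖) ^ (i + M) * ‖iteratedFDeriv ℝ j h (y, k)‖ := by ring
    _ ≤ _ := weight_le_schwartzNorm (by omega) (by omega) h (y, k)

/-- The Fourier transform in the first variable. -/
noncomputable def partialFourier (h : 𝓢(R4 × R4, ℂ)) (k l : R4) : ℂ := testFourier (slice k h) l

lemma partialFourier_eq (h : 𝓢(R4 × R4, ℂ)) (k l : R4) :
    partialFourier h k l = ∫ y, phase y l * h (y, k) := testFourier_apply _ _

lemma norm_phase (y l : R4) : ‖phase y l‖ = 1 := by
  rw [phase, mul_comm, Complex.norm_exp_ofReal_mul_I]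

@[fun_prop]
lemma continuous_phase : Continuous fun p : R4 × R4 => phase p.1 p.2 := by
  unfold phase
  fun_prop

/-- Decay in `k` comes from the slices, decay in `l` from the continuity of the Fourier transform on
Schwartz space. Both are controlled by one seminorm of `h`. -/
lemma exists_partialFourier_le (M : ℕ) : ∃ (N : ℕ) (C : ℝ), 0 ≤ C ∧ ∀ h k l,
    (1 + ‖k‖) ^ M * (1 + ‖l‖) ^ M * ‖partialFourier h k l‖ ≤ C * schwartzNorm N h := by
  obtain ⟨N, C, hC, h1⟩ := exists_schwartzNorm_comp_le testFourier M
  refine ⟨N + M, 2 ^ M * (C * 2 ^ (N + M)), by positivity, fun h k l => ?_⟩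
  have h2 := norm_le_schwartzNorm le_rfl (testFourier (slice k h)) l (i := M)
  calc (1 + ‖k‖) ^ M * (1 + ‖l‖) ^ M * ‖partialFourier h k l‖
      = (1 + ‖k‖) ^ M * ((1 + ‖l‖) ^ M * ‖testFourier (slice k h) l‖) := by
        rw [partialFourier]; ring
    _ ≤ (1 + ‖k‖) ^ M * (2 ^ M * (C * schwartzNorm N (slice k h))) := by
        refine mul_le_mul_of_nonneg_left (h2.trans ?_) (by positivity)
        exact mul_le_mul_of_nonneg_left (h1 _) (by positivity)
    _ = 2 ^ M * (C * ((1 + ‖k‖) ^ M * schwartzNorm N (slice k h))) := by ring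
    _ ≤ 2 ^ M * (C * (2 ^ (N + M) * schwartzNorm (N + M) h)) := by
        exact mul_le_mul_of_nonneg_left
          (mul_le_mul_of_nonneg_left (schwartzNorm_slice_le N M k h) hC) (by positivity)
    _ = _ := by ring

lemma continuous_partialFourier (h : 𝓢(R4 × R4, ℂ)) :
    Continuous fun p : R4 × R4 => partialFourier h p.1 p.2 := by
  simp only [partialFourier_eq]
  have hint : Integrable fun y : R4 => 2 ^ 5 * schwartzNorm 5 h * (1 + ‖y‖) ^ (-(5 : ℝ)) :=
    (integrable_one_add_norm (by simp; norm_num)).const_mul _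
  refine continuous_of_dominated (bound := fun y : R4 =>
    2 ^ 5 * schwartzNorm 5 h * (1 + ‖y‖) ^ (-(5 : ℝ))) (fun p => ?_) (fun p => ?_) hint ?_
  · refine Continuous.aestronglyMeasurable ?_
    have h1 : Continuous fun y : R4 => phase y p.2 :=
      continuous_phase.comp (continuous_id.prodMk continuous_const)
    exact h1.mul (h.continuous.comp (by fun_prop))
  · refine Eventually.of_forall fun y => ?_
    rw [norm_mul, norm_phase, one_mul, Real.rpow_neg (by positivity), ← div_eq_mul_inv,
      le_div_iff₀' (by positivity)]
    have h1 := norm_le_schwartzNorm le_rfl h (y, p.1) (i := 5)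
    refine le_trans ?_ h1
    have : ‖y‖ ≤ ‖(y, p.1)‖ := le_max_left _ _
    have h5 : (1 + ‖y‖) ^ (5 : ℝ) = (1 + ‖y‖) ^ 5 := by exact_mod_cast Real.rpow_natCast _ 5
    rw [h5]
    gcongr
  · refine Eventually.of_forall fun y => ?_
    have h1 : Continuous fun p : R4 × R4 => phase y p.2 :=
      continuous_phase.comp (continuous_const.prodMk continuous_snd)
    exact h1.mul (h.continuous.comp (by fun_prop))

attribute [irreducible] partialFourier

@[fun_prop]
lemma continuous_partialFourier_comp {X : Type*} [TopologicalSpace X] {f g : X → R4}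
    (h : 𝓢(R4 × R4, ℂ)) (hf : Continuous f) (hg : Continuous g) :
    Continuous fun x => partialFourier h (f x) (g x) :=
  (continuous_partialFourier h).comp (hf.prodMk hg)

lemma integrable_partialFourier (h : 𝓢(R4 × R4, ℂ)) (l : R4) :
    Integrable fun k => partialFourier h k l := by
  obtain ⟨N, C, hC, h1⟩ := exists_partialFourier_le 5
  have hint : Integrable fun y : R4 => C * schwartzNorm N h * (1 + ‖y‖) ^ (-(5 : ℝ)) :=
    (integrable_one_add_norm (by simp; norm_num)).const_mul _
  refine hint.mono' ?_ (Eventually.of_forall fun k => ?_)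
  · exact Continuous.aestronglyMeasurable (by fun_prop)
  · rw [Real.rpow_neg (by positivity), ← div_eq_mul_inv, le_div_iff₀' (by positivity)]
    have h5 : (1 + ‖k‖) ^ (5 : ℝ) = (1 + ‖k‖) ^ 5 := by exact_mod_cast Real.rpow_natCast _ 5
    rw [h5]
    refine le_trans ?_ (h1 h k l)
    have : 1 ≤ (1 + ‖l‖) ^ 5 := one_le_pow₀ (by linarith [norm_nonneg l])
    calc (1 + ‖k‖) ^ 5 * ‖partialFourier h k l‖ = (1 + ‖k‖) ^ 5 * 1 * ‖partialFourier h k l‖ := by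
          ring
      _ ≤ _ := by gcongr

/-- The exponent 5 suffices to integrate over four-dimensional `k`. The exponent 4 that is kept in
`l` is integrable over the three-dimensional shell. -/
lemma exists_integral_partialFourier_le : ∃ (N : ℕ) (C : ℝ), 0 ≤ C ∧
    ∀ (h : 𝓢(R4 × R4, ℂ)) (l : R4), (∫ k, ‖partialFourier h k l‖) ≤ C * schwartzNorm N h * (1 + ‖l‖) ^ (-(4 : ℝ)) := by
  obtain ⟨N, C, hC, h1⟩ := exists_partialFourier_le 5
  have hint : Integrable fun y : R4 => (1 + ‖y‖) ^ (-(5 : ℝ)) :=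
    integrable_one_add_norm (by simp; norm_num)
  refine ⟨N, C * ∫ y : R4, (1 + ‖y‖) ^ (-(5 : ℝ)),
    mul_nonneg hC (integral_nonneg fun y => by positivity), fun h l => ?_⟩
  have h2 : ∫ k, ‖partialFourier h k l‖ ≤
      ∫ k : R4, C * schwartzNorm N h * (1 + ‖l‖) ^ (-(4 : ℝ)) * (1 + ‖k‖) ^ (-(5 : ℝ)) := by
    refine integral_mono (integrable_partialFourier h l).norm (hint.const_mul _) fun k => ?_
    rw [Real.rpow_neg (by positivity), Real.rpow_neg (by positivity), ← div_eq_mul_inv,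
      ← div_eq_mul_inv, div_div, le_div_iff₀' (by positivity)]
    refine le_trans ?_ (h1 h k l)
    have h5 : (1 + ‖k‖) ^ (5 : ℝ) = (1 + ‖k‖) ^ 5 := by exact_mod_cast Real.rpow_natCast _ 5
    have h4 : (1 + ‖l‖) ^ (4 : ℝ) = (1 + ‖l‖) ^ 4 := by exact_mod_cast Real.rpow_natCast _ 4
    rw [h5, h4, mul_comm ((1 + ‖l‖) ^ 4)]
    gcongr
    · linarith [norm_nonneg l]
    · norm_num
  rw [integral_const_mul] at h2
  linarith

end Slice


/-! ### The retarded propagator as a damped oscillation in time -/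

section RetardedKernel

open Complex

/-- The frequency `√(|p|² + m² - ε²/4)` of the damped oscillation with damping `ε/2`. -/
noncomputable def dampedFreq (m ε : ℝ) (p : R4) : ℝ :=
  Real.sqrt (p 0 ^ 2 - mdot p p + m ^ 2 - ε ^ 2 / 4)

/-- The damped oscillation whose Fourier transform in time is `deltaRet`. -/
noncomputable def dampedOsc (m ε : ℝ) (p : R4) (t : ℝ) : ℝ :=
  Real.exp (-(ε / 2 * t)) * (Real.sin (dampedFreq m ε p * t) / dampedFreq m ε p)

/-- The Fourier transform in time of the damped oscillation, regularized by the factor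
`1 / (1 + t²)`. -/
noncomputable def smoothedKernel (m ε : ℝ) (p : R4) : ℂ :=
  ∫ t in Ioi (0 : ℝ), exp (I * ((t * p 0 : ℝ) : ℂ)) * ((dampedOsc m ε p t / (1 + t ^ 2) : ℝ) : ℂ)

variable {m : ℝ} (hm : 0 < m)

lemma spatial_sq_nonneg (p : R4) : 0 ≤ p 0 ^ 2 - mdot p p := by
  have : p 0 ^ 2 - mdot p p = p 1 ^ 2 + p 2 ^ 2 + p 3 ^ 2 := by simp only [mdot]; ring
  rw [this]; positivity

include hm

/-- For `ε ≤ m` at least `3m²/4` remains under the root. The lower bound keeps the amplitude bounded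
uniformly in `ε` and in the momentum. -/
lemma half_le_dampedFreq {ε : ℝ} (h0 : 0 ≤ ε) (h1 : ε ≤ m) (p : R4) : m / 2 ≤ dampedFreq m ε p :=
  Real.le_sqrt_of_sq_le (by nlinarith [spatial_sq_nonneg p])

lemma dampedFreq_sq {ε : ℝ} (h0 : 0 ≤ ε) (h1 : ε ≤ m) (p : R4) :
    dampedFreq m ε p ^ 2 = p 0 ^ 2 - mdot p p + m ^ 2 - ε ^ 2 / 4 :=
  Real.sq_sqrt (by nlinarith [spatial_sq_nonneg p])

lemma abs_dampedOsc_le {ε t : ℝ} (h0 : 0 ≤ ε) (h1 : ε ≤ m) (p : R4) :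
    |dampedOsc m ε p t| ≤ Real.exp (-(ε / 2 * t)) * (2 / m) := by
  have h := half_le_dampedFreq hm h0 h1 p
  have hw : 0 < dampedFreq m ε p := by linarith
  rw [dampedOsc, abs_mul, abs_of_pos (Real.exp_pos _), abs_div, abs_of_pos hw]
  refine mul_le_mul_of_nonneg_left ?_ (Real.exp_pos _).le
  calc |Real.sin (dampedFreq m ε p * t)| / dampedFreq m ε p ≤ 1 / (m / 2) := by
        gcongr; exact Real.abs_sin_le_one _
    _ = 2 / m := by field_simp

lemma abs_dampedOsc_le' {ε t : ℝ} (h0 : 0 ≤ ε) (h1 : ε ≤ m) (ht : 0 ≤ t) (p : R4) :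
    |dampedOsc m ε p t| ≤ 2 / m := by
  refine (abs_dampedOsc_le hm h0 h1 p).trans ?_
  refine mul_le_of_le_one_left (by positivity) (Real.exp_le_one_iff.2 ?_)
  have : 0 ≤ ε / 2 * t := by positivity
  linarith

/-- The retarded propagator as the Fourier transform in time of a damped oscillation. -/
lemma deltaRet_eq_integral {ε : ℝ} (h0 : 0 < ε) (h1 : ε ≤ m) (p : R4) :
    deltaRet m ε p = (1 / (2 * Real.pi) ^ 2 : ℂ) *
      ∫ t in Ioi (0 : ℝ), exp (I * ((t * p 0 : ℝ) : ℂ)) * ((dampedOsc m ε p t : ℝ) : ℂ) := by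
  set w := dampedFreq m ε p with hw
  have hw0 : 0 < w := by linarith [half_le_dampedFreq hm h0.le h1 p]
  have hwC : (w : ℂ) ≠ 0 := by exact_mod_cast hw0.ne'
  have hw2 := dampedFreq_sq hm h0.le h1 p
  -- The exponents of the two exponentials in the damped sine. Their product is `-((p₀ + iε/2)² -
  -- w²) = -(p² - m² + iεp₀)`, because the frequency was lowered by `ε²/4`, and their difference is
  -- `2iw`.
  set a₁ : ℂ := -(ε / 2 : ℝ) + I * ((p 0 + w : ℝ) : ℂ) with ha₁
  set a₂ : ℂ := -(ε / 2 : ℝ) + I * ((p 0 - w : ℝ) : ℂ) with ha₂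
  have hr₁ : a₁.re < 0 := by simp [ha₁]; exact h0
  have hr₂ : a₂.re < 0 := by simp [ha₂]; exact h0
  have hn₁ : a₁ ≠ 0 := fun h => by simp [h] at hr₁
  have hn₂ : a₂ ≠ 0 := fun h => by simp [h] at hr₂
  have hfun : ∀ t : ℝ, exp (I * ((t * p 0 : ℝ) : ℂ)) * ((dampedOsc m ε p t : ℝ) : ℂ) =
      1 / (2 * I * w) * (exp (a₁ * t) - exp (a₂ * t)) := fun t => by
    rw [dampedOsc, ← hw]
    push_cast
    rw [Complex.sin]
    have e1 : exp (a₁ * t) = exp (I * (t * p 0)) * exp (-(ε / 2 * t)) * exp (w * t * I) := by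
      rw [← Complex.exp_add, ← Complex.exp_add, ha₁]; congr 1; push_cast; ring
    have e2 : exp (a₂ * t) = exp (I * (t * p 0)) * exp (-(ε / 2 * t)) * exp (-(w * t) * I) := by
      rw [← Complex.exp_add, ← Complex.exp_add, ha₂]; congr 1; push_cast; ring
    rw [e1, e2]
    field_simp
    rw [I_sq]
    ring
  simp only [hfun]
  rw [integral_const_mul, integral_sub (integrableOn_exp_mul_complex_Ioi hr₁ 0)
    (integrableOn_exp_mul_complex_Ioi hr₂ 0), integral_exp_mul_complex_Ioi hr₁,
    integral_exp_mul_complex_Ioi hr₂, deltaRet]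
  congr 1
  have hprod : a₁ * a₂ = -(((mdot p p - m ^ 2 : ℝ) : ℂ) + I * ((ε * p 0 : ℝ) : ℂ)) := by
    have : ((mdot p p - m ^ 2 : ℝ) : ℂ) = ((p 0 ^ 2 - ε ^ 2 / 4 - w ^ 2 : ℝ) : ℂ) := by
      congr 1; linarith
    rw [this, ha₁, ha₂]
    push_cast
    ring_nf
    rw [I_sq]
    ring
  have hdiff : a₁ - a₂ = 2 * I * w := by rw [ha₁, ha₂]; push_cast; ring
  have hden : ((mdot p p - m ^ 2 : ℝ) : ℂ) + I * ((ε * p 0 : ℝ) : ℂ) = -(a₁ * a₂) := by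
    rw [hprod, neg_neg]
  rw [hden, ← hdiff]
  have : a₁ - a₂ ≠ 0 := by rw [hdiff]; simp [hwC]
  simp only [ofReal_zero, mul_zero, Complex.exp_zero]
  field_simp
  ring

lemma continuous_dampedOsc {ε : ℝ} (h0 : 0 ≤ ε) (h1 : ε ≤ m) :
    Continuous fun x : R4 × ℝ => dampedOsc m ε x.1 x.2 := by
  have hw : ∀ p, dampedFreq m ε p ≠ 0 := fun p => by
    have := half_le_dampedFreq hm h0 h1 p
    linarith
  have hc : Continuous (dampedFreq m ε) := by unfold dampedFreq; fun_prop
  unfold dampedOsc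
  refine Continuous.mul (by fun_prop) (Continuous.div (by fun_prop) (by fun_prop) fun x => hw _)

omit hm in
lemma integrable_inv_one_add_sq_Ioi : IntegrableOn (fun t : ℝ => (1 + t ^ 2)⁻¹) (Ioi 0) :=
  integrable_inv_one_add_sq.integrableOn

lemma norm_smoothed_integrand_le {ε t : ℝ} (h0 : 0 ≤ ε) (h1 : ε ≤ m) (ht : 0 ≤ t) (p q : R4) :
    ‖exp (I * ((t * q 0 : ℝ) : ℂ)) * ((dampedOsc m ε p t / (1 + t ^ 2) : ℝ) : ℂ)‖ ≤
      2 / m * (1 + t ^ 2)⁻¹ := by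
  rw [norm_mul, mul_comm I, norm_exp_ofReal_mul_I, one_mul, norm_real, Real.norm_eq_abs, abs_div,
    abs_of_pos (by positivity : 0 < 1 + t ^ 2), div_eq_mul_inv]
  gcongr
  exact abs_dampedOsc_le' hm h0 h1 ht p

/-- The factor `1/(1 + t²)` replaces the damping as the source of convergence, so the bound survives
the limit `ε → 0`. -/
lemma norm_smoothedKernel_le {ε : ℝ} (h0 : 0 ≤ ε) (h1 : ε ≤ m) (p : R4) :
    ‖smoothedKernel m ε p‖ ≤ 2 / m * ∫ t in Ioi (0 : ℝ), (1 + t ^ 2)⁻¹ := by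
  rw [← integral_const_mul]
  refine norm_integral_le_of_norm_le (integrable_inv_one_add_sq_Ioi.const_mul _) ?_
  filter_upwards [ae_restrict_mem measurableSet_Ioi] with t ht
  exact norm_smoothed_integrand_le hm h0 h1 (le_of_lt ht) p p

lemma continuous_smoothedKernel {ε : ℝ} (h0 : 0 ≤ ε) (h1 : ε ≤ m) :
    Continuous (smoothedKernel m ε) := by
  have hc := continuous_dampedOsc hm h0 h1
  refine continuous_of_dominated (bound := fun t => 2 / m * (1 + t ^ 2)⁻¹) (fun p => ?_)
    (fun p => ?_) (integrable_inv_one_add_sq_Ioi.const_mul _) ?_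
  · refine Continuous.aestronglyMeasurable ?_
    have h2 : Continuous fun t : ℝ => dampedOsc m ε p t :=
      hc.comp (continuous_const.prodMk continuous_id)
    have h3 : Continuous fun t : ℝ => dampedOsc m ε p t / (1 + t ^ 2) :=
      h2.div (by fun_prop) fun t => by positivity
    fun_prop
  · filter_upwards [ae_restrict_mem measurableSet_Ioi] with t ht
    exact norm_smoothed_integrand_le hm h0 h1 (le_of_lt ht) p p
  · refine Eventually.of_forall fun t => ?_
    have h2 : Continuous fun p : R4 => dampedOsc m ε p t :=
      hc.comp (continuous_id.prodMk continuous_const)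
    have h3 : Continuous fun p : R4 => dampedOsc m ε p t / (1 + t ^ 2) := h2.div_const _
    fun_prop

lemma tendsto_smoothedKernel (p : R4) :
    Tendsto (fun ε => smoothedKernel m ε p) (𝓝[>] 0) (𝓝 (smoothedKernel m 0 p)) := by
  have hev : ∀ᶠ ε : ℝ in 𝓝[>] 0, 0 < ε ∧ ε ≤ m := by
    filter_upwards [self_mem_nhdsWithin, mem_nhdsWithin_of_mem_nhds (Iic_mem_nhds hm)] with ε h h'
    exact ⟨h, h'⟩
  refine tendsto_integral_filter_of_dominated_convergence (fun t => 2 / m * (1 + t ^ 2)⁻¹) ?_ ?_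
    (integrable_inv_one_add_sq_Ioi.const_mul _) ?_
  · filter_upwards [hev] with ε hε
    refine Continuous.aestronglyMeasurable ?_
    have h2 : Continuous fun t : ℝ => dampedOsc m ε p t :=
      (continuous_dampedOsc hm hε.1.le hε.2).comp (continuous_const.prodMk continuous_id)
    have h3 : Continuous fun t : ℝ => dampedOsc m ε p t / (1 + t ^ 2) :=
      h2.div (by fun_prop) fun t => by positivity
    fun_prop
  · filter_upwards [hev] with ε hε
    filter_upwards [ae_restrict_mem measurableSet_Ioi] with t ht
    exact norm_smoothed_integrand_le hm hε.1.le hε.2 (le_of_lt ht) p p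
  · refine Eventually.of_forall fun t => ?_
    have hw : Tendsto (fun ε => dampedFreq m ε p) (𝓝[>] 0) (𝓝 (dampedFreq m 0 p)) := by
      have : Continuous fun ε => dampedFreq m ε p := by unfold dampedFreq; fun_prop
      exact (this.tendsto 0).mono_left nhdsWithin_le_nhds
    have hw0 : dampedFreq m 0 p ≠ 0 := by
      have := half_le_dampedFreq hm le_rfl hm.le p
      linarith
    have h1 : Tendsto (fun ε : ℝ => Real.exp (-(ε / 2 * t))) (𝓝[>] 0)
        (𝓝 (Real.exp (-(0 / 2 * t)))) :=
      ((by fun_prop : Continuous fun ε : ℝ => Real.exp (-(ε / 2 * t))).tendsto 0).mono_left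
        nhdsWithin_le_nhds
    have h2 : Tendsto (fun ε => dampedOsc m ε p t) (𝓝[>] 0) (𝓝 (dampedOsc m 0 p t)) :=
      h1.mul (((Real.continuous_sin.tendsto _).comp (hw.mul_const t)).div hw hw0)
    exact ((continuous_ofReal.tendsto _).comp (h2.div_const _)).const_mul _

end RetardedKernel

/-! ### Integration by parts in the energy variable -/

section TimeDerivative

open Complex LineDeriv

instance : (volume : Measure (R4 × R4)).IsAddHaarMeasure := by
  rw [Measure.volume_eq_prod]; infer_instance

/-- The direction of `k 0` in `(y, k)`-space. -/
noncomputable def energyAxis : R4 × R4 := (0, timeAxis)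

/-- The operator `1 - ∂²/∂k₀²`. -/
noncomputable def oneSubDeriv : 𝓢(R4 × R4, ℂ) →L[ℂ] 𝓢(R4 × R4, ℂ) :=
  ContinuousLinearMap.id ℂ _ -
    (lineDerivOpCLM ℂ 𝓢(R4 × R4, ℂ) energyAxis).comp (lineDerivOpCLM ℂ 𝓢(R4 × R4, ℂ) energyAxis)

lemma oneSubDeriv_apply (h : 𝓢(R4 × R4, ℂ)) (z : R4 × R4) :
    oneSubDeriv h z = h z - (∂_{energyAxis} (∂_{energyAxis} h) : 𝓢(R4 × R4, ℂ)) z := rfl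

/-- Integration by parts against a bounded eigenfunction `A` of `∂/∂k₀` with eigenvalue `c`.
Boundedness of `A` against a Schwartz function provides the integrability. -/
lemma integral_lineDeriv_eq {A : R4 × R4 → ℂ} {B : ℝ} {c : ℂ} (hA : Continuous A)
    (hB : ∀ z, ‖A z‖ ≤ B) (hd : ∀ z, HasLineDerivAt ℝ A (c * A z) z energyAxis)
    (h : 𝓢(R4 × R4, ℂ)) :
    ∫ z, A z * (∂_{energyAxis} h : 𝓢(R4 × R4, ℂ)) z = -c * ∫ z, A z * h z := by
  have hint : ∀ g : 𝓢(R4 × R4, ℂ), Integrable fun z => A z * g z := fun g =>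
    (g.integrable (μ := volume)).bdd_mul hA.aestronglyMeasurable (Eventually.of_forall hB)
  have := integral_bilinear_hasLineDerivAt_right_eq_neg_left_of_integrable (μ := volume)
    (f := A) (f' := fun z => c * A z) (g := h) (g' := (∂_{energyAxis} h : 𝓢(R4 × R4, ℂ)))
    (v := energyAxis) (B := ContinuousLinearMap.mul ℝ ℂ) ?_ ?_ ?_ (fun z _ => hd z)
    (fun z _ => ?_)
  · simp only [ContinuousLinearMap.mul_apply'] at this
    rw [this, neg_mul, ← integral_const_mul]
    simp only [mul_assoc]
  · simp only [ContinuousLinearMap.mul_apply', mul_assoc]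
    exact (hint h).const_mul c
  · exact hint _
  · exact hint _
  · rw [SchwartzMap.lineDerivOp_apply]
    exact (h.differentiableAt.lineDifferentiableAt).hasLineDerivAt

lemma integral_oneSubDeriv {A : R4 × R4 → ℂ} {B : ℝ} {c : ℂ} (hA : Continuous A)
    (hB : ∀ z, ‖A z‖ ≤ B) (hd : ∀ z, HasLineDerivAt ℝ A (c * A z) z energyAxis)
    (h : 𝓢(R4 × R4, ℂ)) :
    ∫ z, A z * oneSubDeriv h z = (1 - c ^ 2) * ∫ z, A z * h z := by
  have hint : ∀ g : 𝓢(R4 × R4, ℂ), Integrable fun z => A z * g z := fun g =>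
    (g.integrable (μ := volume)).bdd_mul hA.aestronglyMeasurable (Eventually.of_forall hB)
  simp only [oneSubDeriv_apply, mul_sub]
  rw [integral_sub (hint _) (hint _), integral_lineDeriv_eq hA hB hd,
    integral_lineDeriv_eq hA hB hd]
  ring

end TimeDerivative


/-! ### The loop integral as a tempered distribution in both variables -/

section LoopDistribution

open Complex

variable {m : ℝ} (hm : 0 < m)
include hm

omit hm in
-- The frequency depends only on the spatial momentum; hence the whole dependence of the wave on
-- `k₀` sits in `e^{itk₀}`.
lemma dampedOsc_add_timeAxis (ε t s : ℝ) (p : R4) :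
    dampedOsc m ε (p + s • timeAxis) t = dampedOsc m ε p t := by
  have : dampedFreq m ε (p + s • timeAxis) = dampedFreq m ε p := by
    simp only [dampedFreq, mdot, PiLp.add_apply, PiLp.smul_apply, smul_eq_mul, timeAxis_zero,
      timeAxis_one, timeAxis_two, timeAxis_three]
    congr 1
    ring
  rw [dampedOsc, this, dampedOsc]

/-- The wave times the phase is an eigenfunction of `∂/∂k₀` with eigenvalue `it`, so `1 - ∂²/∂k₀²`
contributes `1 - (it)² = 1 + t²`. -/
lemma integral_wave_partialFourier {ε t : ℝ} (h0 : 0 ≤ ε) (h1 : ε ≤ m) (ht : 0 ≤ t)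
    (h : 𝓢(R4 × R4, ℂ)) (l' l : R4) :
    ∫ k, exp (I * ((t * (k - l') 0 : ℝ) : ℂ)) * ((dampedOsc m ε (k - l') t : ℝ) : ℂ) *
        partialFourier (oneSubDeriv h) k l =
      (1 + t ^ 2) * ∫ k, exp (I * ((t * (k - l') 0 : ℝ) : ℂ)) *
        ((dampedOsc m ε (k - l') t : ℝ) : ℂ) * partialFourier h k l := by
  set A : R4 × R4 → ℂ := fun z => exp (I * ((t * (z.2 - l') 0 : ℝ) : ℂ)) *
    ((dampedOsc m ε (z.2 - l') t : ℝ) : ℂ) * phase z.1 l with hA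
  have hAc : Continuous A := by
    have h2 : Continuous fun z : R4 × R4 => dampedOsc m ε (z.2 - l') t :=
      (continuous_dampedOsc hm h0 h1).comp (Continuous.prodMk (by fun_prop) continuous_const)
    have h3 : Continuous fun z : R4 × R4 => phase z.1 l :=
      continuous_phase.comp (continuous_fst.prodMk continuous_const)
    rw [hA]
    fun_prop
  have hB : ∀ z, ‖A z‖ ≤ 2 / m := fun z => by
    rw [hA, norm_mul, norm_mul, norm_phase, mul_comm I, norm_exp_ofReal_mul_I, norm_real, one_mul,
      mul_one, Real.norm_eq_abs]
    exact abs_dampedOsc_le' hm h0 h1 ht _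
  have hd : ∀ z, HasLineDerivAt ℝ A (I * t * A z) z energyAxis := fun z => by
    have e : (fun s : ℝ => A (z + s • energyAxis)) = fun s : ℝ => exp (I * t * s) * A z := by
      funext s
      have e1 : (z + s • energyAxis).2 - l' = (z.2 - l') + s • timeAxis := by
        simp [energyAxis]; abel
      have e2 : (z + s • energyAxis).1 = z.1 := by simp [energyAxis]
      simp only [hA, e1, e2, dampedOsc_add_timeAxis]
      rw [← mul_assoc, ← mul_assoc, ← Complex.exp_add]
      congr 4
      simp
      ring
    rw [HasLineDerivAt, e]
    have h2 : HasDerivAt (fun s : ℝ => I * t * (s : ℂ)) (I * t) 0 := by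
      simpa using (ofRealCLM.hasDerivAt (x := 0)).const_mul (I * (t : ℂ))
    simpa using (h2.cexp).mul_const (A z)
  have hfub : ∀ g : 𝓢(R4 × R4, ℂ), ∫ z, A z * g z =
      ∫ k, exp (I * ((t * (k - l') 0 : ℝ) : ℂ)) * ((dampedOsc m ε (k - l') t : ℝ) : ℂ) *
        partialFourier g k l := fun g => by
    have hint : Integrable (fun z => A z * g z) (volume.prod volume) :=
      (g.integrable (μ := volume)).bdd_mul hAc.aestronglyMeasurable (Eventually.of_forall hB)
    rw [Measure.volume_eq_prod, integral_prod_symm _ hint]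
    refine integral_congr_ae (Eventually.of_forall fun k => ?_)
    simp only [hA, partialFourier_eq]
    rw [← integral_const_mul]
    simp only [mul_assoc]
  rw [← hfub, ← hfub, integral_oneSubDeriv hAc hB hd, mul_pow, I_sq]
  ring

/-- For `ε > 0` the damping makes the double integral over `k` and `t` absolutely convergent. The
order is exchanged, the factor `1 + t²` is traded at each `t`, and the order is exchanged back. The
right side makes sense at `ε = 0` too. -/
lemma integral_deltaRet_partialFourier {ε : ℝ} (h0 : 0 < ε) (h1 : ε ≤ m)
    (h : 𝓢(R4 × R4, ℂ)) (l' l : R4) :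
    ∫ k, deltaRet m ε (k - l') * partialFourier h k l =
      (1 / (2 * Real.pi) ^ 2 : ℂ) *
        ∫ k, smoothedKernel m ε (k - l') * partialFourier (oneSubDeriv h) k l := by
  have hcd : Continuous fun x : R4 × ℝ => dampedOsc m ε (x.1 - l') x.2 :=
    (continuous_dampedOsc hm h0.le h1).comp (g := fun x : R4 × ℝ => dampedOsc m ε x.1 x.2)
      (f := fun x : R4 × ℝ => (x.1 - l', x.2)) (by fun_prop)
  have hi1 : Integrable (fun x : R4 × ℝ => exp (I * ((x.2 * (x.1 - l') 0 : ℝ) : ℂ)) *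
      ((dampedOsc m ε (x.1 - l') x.2 : ℝ) : ℂ) * partialFourier h x.1 l)
      (volume.prod (volume.restrict (Ioi 0))) := by
    have he : IntegrableOn (fun t : ℝ => Real.exp (-(ε / 2) * t) * (2 / m)) (Ioi 0) :=
      (integrableOn_exp_mul_Ioi (by linarith) 0).mul_const _
    refine ((integrable_partialFourier h l).norm.mul_prod he).mono' ?_
      (Eventually.of_forall fun x => ?_)
    · exact Continuous.aestronglyMeasurable (by fun_prop)
    · rw [norm_mul, norm_mul, mul_comm I, norm_exp_ofReal_mul_I, one_mul, norm_real, mul_comm,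
        Real.norm_eq_abs, neg_mul]
      exact mul_le_mul_of_nonneg_left (abs_dampedOsc_le hm h0.le h1 _) (norm_nonneg _)
  have hi2 : Integrable (fun x : R4 × ℝ => exp (I * ((x.2 * (x.1 - l') 0 : ℝ) : ℂ)) *
      ((dampedOsc m ε (x.1 - l') x.2 / (1 + x.2 ^ 2) : ℝ) : ℂ) *
      partialFourier (oneSubDeriv h) x.1 l) (volume.prod (volume.restrict (Ioi 0))) := by
    have he : IntegrableOn (fun t : ℝ => 2 / m * (1 + t ^ 2)⁻¹) (Ioi 0) :=
      integrable_inv_one_add_sq_Ioi.const_mul _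
    refine ((integrable_partialFourier (oneSubDeriv h) l).norm.mul_prod he).mono' ?_ ?_
    · have h3 : Continuous fun x : R4 × ℝ => dampedOsc m ε (x.1 - l') x.2 / (1 + x.2 ^ 2) :=
        hcd.div (by fun_prop) fun x => by positivity
      exact Continuous.aestronglyMeasurable (by fun_prop)
    · have h4 : ∀ᵐ x : R4 × ℝ ∂(volume.prod (volume.restrict (Ioi 0))), x.2 ∈ Ioi (0 : ℝ) :=
        Measure.quasiMeasurePreserving_snd.ae (ae_restrict_mem measurableSet_Ioi)
      filter_upwards [h4] with x hx
      rw [norm_mul, mul_comm]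
      exact mul_le_mul_of_nonneg_left
        (norm_smoothed_integrand_le hm h0.le h1 (le_of_lt hx) _ _) (norm_nonneg _)
  calc ∫ k, deltaRet m ε (k - l') * partialFourier h k l
      = (1 / (2 * Real.pi) ^ 2 : ℂ) * ∫ k, ∫ t in Ioi (0 : ℝ),
          exp (I * ((t * (k - l') 0 : ℝ) : ℂ)) * ((dampedOsc m ε (k - l') t : ℝ) : ℂ) *
            partialFourier h k l := by
        rw [← integral_const_mul]
        refine integral_congr_ae (Eventually.of_forall fun k => ?_)
        beta_reduce
        rw [deltaRet_eq_integral hm h0 h1, integral_mul_const, mul_assoc]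
    _ = (1 / (2 * Real.pi) ^ 2 : ℂ) * ∫ t in Ioi (0 : ℝ), ∫ k,
          exp (I * ((t * (k - l') 0 : ℝ) : ℂ)) * ((dampedOsc m ε (k - l') t : ℝ) : ℂ) *
            partialFourier h k l := by
        rw [integral_integral_swap hi1]
    _ = (1 / (2 * Real.pi) ^ 2 : ℂ) * ∫ t in Ioi (0 : ℝ), ∫ k,
          exp (I * ((t * (k - l') 0 : ℝ) : ℂ)) *
            ((dampedOsc m ε (k - l') t / (1 + t ^ 2) : ℝ) : ℂ) *
            partialFourier (oneSubDeriv h) k l := by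
        congr 1
        refine setIntegral_congr_fun measurableSet_Ioi fun t ht => ?_
        have h2 := integral_wave_partialFourier hm h0.le h1 (le_of_lt ht) h l' l
        have h3 : (1 + (t : ℂ) ^ 2) ≠ 0 := by exact_mod_cast (by positivity : (1 + t ^ 2) ≠ 0)
        beta_reduce
        rw [← mul_right_inj' h3, ← h2, ← integral_const_mul]
        refine integral_congr_ae (Eventually.of_forall fun k => ?_)
        beta_reduce
        push_cast
        field_simp
    _ = _ := by
        rw [← integral_integral_swap hi2]
        congr 1
        refine integral_congr_ae (Eventually.of_forall fun k => ?_)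
        beta_reduce
        rw [smoothedKernel, integral_mul_const]

/-- The pairing of the two propagators with a test function, in terms of bounded kernels. -/
noncomputable def loopKernelPairing (m ε : ℝ) (h : 𝓢(R4 × R4, ℂ)) (l : R4) : ℂ :=
  (1 / (2 * Real.pi) ^ 2 : ℂ) * ∫ k, (smoothedKernel m ε (k - l) + smoothedKernel m ε (k + l)) *
    partialFourier (oneSubDeriv h) k l

lemma integrable_smoothedKernel_mul {ε : ℝ} (h0 : 0 ≤ ε) (h1 : ε ≤ m) (h : 𝓢(R4 × R4, ℂ))
    (l' l : R4) : Integrable fun k => smoothedKernel m ε (k - l') * partialFourier h k l :=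
  (integrable_partialFourier h l).bdd_mul (c := 2 / m * ∫ t in Ioi (0 : ℝ), (1 + t ^ 2)⁻¹)
    ((continuous_smoothedKernel hm h0 h1).comp (by fun_prop)).aestronglyMeasurable
    (Eventually.of_forall fun k => norm_smoothedKernel_le hm h0 h1 _)

omit hm in
lemma add_eq_sub_neg' (k l : R4) : k + l = k - (-l) := by abel

omit hm in
-- If `|p₀| ≥ m/2` the imaginary part is large enough. Otherwise `p² ≤ m²/4`, and the real part is.
-- The bound degenerates as `ε → 0` and serves only for integrability at fixed `ε`.
lemma norm_deltaRet_le (hm : 0 < m) {ε : ℝ} (h0 : 0 < ε) (h1 : ε ≤ m) (p : R4) :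
    ‖deltaRet m ε p‖ ≤ (1 / (2 * Real.pi) ^ 2) * (2 / (ε * m)) := by
  have hpi := Real.pi_pos
  have hlow : ε * m / 2 ≤ ‖((mdot p p - m ^ 2 : ℝ) : ℂ) + I * ((ε * p 0 : ℝ) : ℂ)‖ := by
    rcases le_total (m / 2) |p 0| with h | h
    · refine le_trans ?_ (abs_im_le_norm _)
      simp only [add_im, ofReal_im, mul_im, I_re, I_im, ofReal_re, zero_mul, one_mul, zero_add]
      rw [abs_mul, abs_of_pos h0]
      nlinarith
    · refine le_trans ?_ (abs_re_le_norm _)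
      simp only [add_re, ofReal_re, mul_re, I_re, I_im, ofReal_im, zero_mul, one_mul, sub_zero,
        add_zero]
      have h2 := spatial_sq_nonneg p
      have h3 : p 0 ^ 2 ≤ (m / 2) ^ 2 := by
        rw [← sq_abs]; gcongr
      rw [abs_sub_comm]
      refine le_trans ?_ (le_abs_self _)
      nlinarith
  have hpos : 0 < ε * m / 2 := by positivity
  have e : ‖(1 / (2 * Real.pi) ^ 2 : ℂ)‖ = 1 / (2 * Real.pi) ^ 2 := by
    rw [show (1 / (2 * Real.pi) ^ 2 : ℂ) = ((1 / (2 * Real.pi) ^ 2 : ℝ) : ℂ) by push_cast; rfl,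
      norm_real, Real.norm_of_nonneg (by positivity)]
  rw [deltaRet, norm_mul, e, norm_div, norm_neg, norm_one]
  refine mul_le_mul_of_nonneg_left ?_ (by positivity)
  calc 1 / ‖((mdot p p - m ^ 2 : ℝ) : ℂ) + I * ((ε * p 0 : ℝ) : ℂ)‖ ≤ 1 / (ε * m / 2) := by gcongr
    _ = 2 / (ε * m) := by field_simp

lemma continuous_deltaRet {ε : ℝ} (h0 : 0 < ε) : Continuous (deltaRet m ε) := by
  unfold deltaRet
  refine continuous_const.mul (Continuous.div continuous_const (by fun_prop) fun p hp => ?_)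
  have hre := congrArg re hp
  have him := congrArg im hp
  simp only [add_re, ofReal_re, mul_re, I_re, I_im, ofReal_im, zero_mul, sub_zero,
    add_zero, zero_re, mul_zero] at hre
  simp only [add_im, ofReal_im, mul_im, I_re, I_im, ofReal_re, zero_mul, one_mul, zero_add,
    zero_im] at him
  rcases mul_eq_zero.1 him with h | h
  · linarith
  · have := spatial_sq_nonneg p
    rw [h] at this
    nlinarith

lemma loopPairing_eq {ε : ℝ} (h0 : 0 < ε) (h1 : ε ≤ m) (h : 𝓢(R4 × R4, ℂ)) (l : R4) :
    loopPairing m ε h l = loopKernelPairing m ε h l := by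
  have hi : ∀ l' : R4, Integrable fun k => deltaRet m ε (k - l') * partialFourier h k l :=
    fun l' => (integrable_partialFourier h l).bdd_mul
      ((continuous_deltaRet hm h0).comp (by fun_prop)).aestronglyMeasurable
      (Eventually.of_forall fun k => norm_deltaRet_le hm h0 h1 _)
  have hk := integrable_smoothedKernel_mul hm h0.le h1 (oneSubDeriv h)
  rw [loopPairing, loopKernelPairing]
  simp only [← partialFourier_eq, add_mul, add_eq_sub_neg']
  rw [integral_add (hi _) (hi _), integral_add (hk _ _) (hk _ _), mul_add,
    integral_deltaRet_partialFourier hm h0 h1, integral_deltaRet_partialFourier hm h0 h1]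

lemma tendsto_loopPairing (h : 𝓢(R4 × R4, ℂ)) (l : R4) :
    Tendsto (fun ε => loopPairing m ε h l) (𝓝[>] 0) (𝓝 (loopKernelPairing m 0 h l)) := by
  have hev : ∀ᶠ ε : ℝ in 𝓝[>] 0, 0 < ε ∧ ε ≤ m := by
    filter_upwards [self_mem_nhdsWithin, mem_nhdsWithin_of_mem_nhds (Iic_mem_nhds hm)] with ε h h'
    exact ⟨h, h'⟩
  refine Tendsto.congr' (f₁ := fun ε => loopKernelPairing m ε h l) ?_ ?_
  · filter_upwards [hev] with ε hε
    exact (loopPairing_eq hm hε.1 hε.2 h l).symm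
  refine Tendsto.const_mul _ ?_
  set C := 2 / m * ∫ t in Ioi (0 : ℝ), (1 + t ^ 2)⁻¹ with hC
  refine tendsto_integral_filter_of_dominated_convergence
    (fun k => (C + C) * ‖partialFourier (oneSubDeriv h) k l‖) ?_ ?_
    ((integrable_partialFourier _ l).norm.const_mul _) ?_
  · filter_upwards [hev] with ε hε
    have hc := continuous_smoothedKernel hm hε.1.le hε.2
    have hp : Continuous fun k => partialFourier (oneSubDeriv h) k l := by
      fun_prop
    have h1 : Continuous fun k => smoothedKernel m ε (k - l) :=
      hc.comp (f := fun k => k - l) (by fun_prop)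
    have h2 : Continuous fun k => smoothedKernel m ε (k + l) :=
      hc.comp (f := fun k => k + l) (by fun_prop)
    exact ((h1.add h2).mul hp).aestronglyMeasurable
  · filter_upwards [hev] with ε hε
    refine Eventually.of_forall fun k => ?_
    rw [norm_mul]
    gcongr
    exact (norm_add_le _ _).trans (add_le_add (norm_smoothedKernel_le hm hε.1.le hε.2 _)
      (norm_smoothedKernel_le hm hε.1.le hε.2 _))
  · exact Eventually.of_forall fun k =>
      ((tendsto_smoothedKernel hm _).add (tendsto_smoothedKernel hm _)).mul_const _

/-- One bound for all `ε` in `[0, m]`, integrable over the shell. It gives integrability of the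
limit, temperedness of `F`, and dominated convergence in `l`. -/
lemma exists_loopKernelPairing_le : ∃ (N : ℕ) (C : ℝ), ∀ ε, 0 ≤ ε → ε ≤ m →
    ∀ (h : 𝓢(R4 × R4, ℂ)) (l : R4),
    ‖loopKernelPairing m ε h l‖ ≤ C * schwartzNorm N h * (1 + ‖l‖) ^ (-(4 : ℝ)) := by
  obtain ⟨N, C, hC, h1⟩ := exists_integral_partialFourier_le
  obtain ⟨N', C', hC', h2⟩ := exists_schwartzNorm_comp_le oneSubDeriv N
  set c := 2 / m * ∫ t in Ioi (0 : ℝ), (1 + t ^ 2)⁻¹ with hc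
  have hc0 : 0 ≤ c := mul_nonneg (by positivity) (integral_nonneg fun t => by positivity)
  refine ⟨N', ‖(1 / (2 * Real.pi) ^ 2 : ℂ)‖ * ((c + c) * (C * C')), fun ε h0 h1' h l => ?_⟩
  rw [loopKernelPairing, norm_mul, mul_assoc, mul_assoc]
  refine mul_le_mul_of_nonneg_left ?_ (norm_nonneg _)
  have h3 : ‖∫ k, (smoothedKernel m ε (k - l) + smoothedKernel m ε (k + l)) *
      partialFourier (oneSubDeriv h) k l‖ ≤
      ∫ k, (c + c) * ‖partialFourier (oneSubDeriv h) k l‖ := by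
    refine norm_integral_le_of_norm_le ((integrable_partialFourier _ l).norm.const_mul _)
      (Eventually.of_forall fun k => ?_)
    rw [norm_mul]
    gcongr
    exact (norm_add_le _ _).trans (add_le_add (norm_smoothedKernel_le hm h0 h1' _)
      (norm_smoothedKernel_le hm h0 h1' _))
  rw [integral_const_mul] at h3
  refine h3.trans ?_
  rw [mul_assoc]
  refine mul_le_mul_of_nonneg_left ((h1 _ _).trans ?_) (by positivity)
  calc C * schwartzNorm N (oneSubDeriv h) * (1 + ‖l‖) ^ (-(4 : ℝ))
      ≤ C * (C' * schwartzNorm N' h) * (1 + ‖l‖) ^ (-(4 : ℝ)) := by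
        gcongr; exact h2 h
    _ = _ := by ring

lemma aestronglyMeasurable_loopKernelPairing {ε : ℝ} (h0 : 0 ≤ ε) (h1 : ε ≤ m) (h : 𝓢(R4 × R4, ℂ)) :
    AEStronglyMeasurable (loopKernelPairing m ε h) (deltaPlus m) := by
  have hc := continuous_smoothedKernel hm h0 h1
  refine AEStronglyMeasurable.const_mul ?_ _
  have h2 : StronglyMeasurable fun p : R4 × R4 =>
      (smoothedKernel m ε (p.2 - p.1) + smoothedKernel m ε (p.2 + p.1)) *
        partialFourier (oneSubDeriv h) p.2 p.1 := by
    have : Continuous fun p : R4 × R4 => partialFourier (oneSubDeriv h) p.2 p.1 := by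
      fun_prop
    have h1 : Continuous fun p : R4 × R4 => smoothedKernel m ε (p.2 - p.1) :=
      hc.comp (f := fun p : R4 × R4 => p.2 - p.1) (by fun_prop)
    have h2 : Continuous fun p : R4 × R4 => smoothedKernel m ε (p.2 + p.1) :=
      hc.comp (f := fun p : R4 × R4 => p.2 + p.1) (by fun_prop)
    exact ((h1.add h2).mul this).stronglyMeasurable
  exact h2.integral_prod_right.aestronglyMeasurable

lemma integrable_loopKernelPairing {ε : ℝ} (h0 : 0 ≤ ε) (h1 : ε ≤ m) (h : 𝓢(R4 × R4, ℂ)) :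
    Integrable (loopKernelPairing m ε h) (deltaPlus m) := by
  obtain ⟨N, C, hb⟩ := exists_loopKernelPairing_le hm
  exact ((integrable_rpow_deltaPlus hm).const_mul _).mono'
    (aestronglyMeasurable_loopKernelPairing hm h0 h1 h) (Eventually.of_forall (hb ε h0 h1 h))

/-- The two-variable distribution. -/
lemma exists_isLoopDistribution : ∃ F : 𝓢'(R4 × R4, ℂ), IsLoopDistribution m F ∧
    ∀ h, F h = ∫ l, loopKernelPairing m 0 h l ∂(deltaPlus m) := by
  have hm0 : (0 : ℝ) ≤ m := hm.le
  have hpf_add : ∀ (f g : 𝓢(R4 × R4, ℂ)) k l, partialFourier (f + g) k l =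
      partialFourier f k l + partialFourier g k l := fun f g k l => by
    simp [partialFourier, map_add]
  have hpf_smul : ∀ (a : ℂ) (f : 𝓢(R4 × R4, ℂ)) k l, partialFourier (a • f) k l =
      a * partialFourier f k l := fun a f k l => by
    simp [partialFourier, map_smul]
  have hint : ∀ (h : 𝓢(R4 × R4, ℂ)) l, Integrable fun k =>
      (smoothedKernel m 0 (k - l) + smoothedKernel m 0 (k + l)) *
        partialFourier (oneSubDeriv h) k l := fun h l => by
    simp only [add_mul, add_eq_sub_neg']
    exact (integrable_smoothedKernel_mul hm le_rfl hm0 _ _ _).add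
      (integrable_smoothedKernel_mul hm le_rfl hm0 _ _ _)
  set L : 𝓢(R4 × R4, ℂ) → ℂ := fun h => ∫ l, loopKernelPairing m 0 h l ∂(deltaPlus m) with hL
  have hadd : ∀ f g, L (f + g) = L f + L g := fun f g => by
    simp only [hL]
    rw [← integral_add (integrable_loopKernelPairing hm le_rfl hm0 f)
      (integrable_loopKernelPairing hm le_rfl hm0 g)]
    refine integral_congr_ae (Eventually.of_forall fun l => ?_)
    simp only [loopKernelPairing, map_add, hpf_add, mul_add ((smoothedKernel m 0 _) + _)]
    rw [integral_add (hint f l) (hint g l), mul_add]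
  have hsmul : ∀ (a : ℂ) f, L (a • f) = a * L f := fun a f => by
    simp only [hL]
    rw [← integral_const_mul]
    refine integral_congr_ae (Eventually.of_forall fun l => ?_)
    simp only [loopKernelPairing, map_smul, hpf_smul]
    rw [mul_left_comm, ← integral_const_mul a]
    congr 1
    refine integral_congr_ae (Eventually.of_forall fun k => ?_)
    ring
  have hbound : ∃ (N : ℕ) (C : ℝ), ∀ f, ‖L f‖ ≤ C * schwartzNorm N f := by
    obtain ⟨N, C, hb⟩ := exists_loopKernelPairing_le hm
    refine ⟨N, C * ∫ l, (1 + ‖l‖) ^ (-(4 : ℝ)) ∂(deltaPlus m), fun h => ?_⟩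
    refine (norm_integral_le_of_norm_le ((integrable_rpow_deltaPlus hm).const_mul _)
      (Eventually.of_forall (hb 0 le_rfl hm0 h))).trans (le_of_eq ?_)
    rw [integral_const_mul]
    ring
  obtain ⟨T, hT⟩ := exists_schwartz_functional L hadd hsmul hbound
  exact ⟨ContinuousLinearMap.toPointwiseConvergenceCLM _ _ _ _ T, fun h =>
    ⟨loopKernelPairing m 0 h, tendsto_loopPairing hm h,
      integrable_loopKernelPairing hm le_rfl hm0 h, hT h⟩, hT⟩

end LoopDistribution


/-! ### Rest-frame polar coordinates on the mass shell -/

section ShellPolar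

variable {m : ℝ} (hm : 0 < m)

lemma omega_smul_sphere (r : ℝ) (n : S2) : omega m (r • (n : R3)) = energy m r := by
  have hn : ‖(n : R3)‖ = 1 := by simp
  rw [omega, norm_smul, hn, mul_one, Real.norm_eq_abs, sq_abs, energy]

variable {u : R4} (hu : mdot u u = 1) (hu0 : 0 < u 0)
include hm hu hu0

lemma shell_polar_aux {Φ : R4 → ℂ} (hΦ : Integrable Φ (deltaPlus m)) :
    Integrable (fun p : S2 × ℝ => ((1 / (2 * energy m p.2) : ℝ) : ℂ) *
      Φ (boost u (onShell m (p.2 • (p.1 : R3))))) (sphereMeasure.prod radialMeasure) ∧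
    ∫ l, Φ l ∂(deltaPlus m) = (1 / (2 * Real.pi) : ℝ) *
      ∫ p : S2 × ℝ, ((1 / (2 * energy m p.2) : ℝ) : ℂ) *
        Φ (boost u (onShell m (p.2 • (p.1 : R3)))) ∂(sphereMeasure.prod radialMeasure) := by
  have hmp := measurePreserving_boost hm hu hu0
  have hme := measurableEmbedding_boost hu hu0
  have h1 : Integrable (fun l => Φ (boost u l)) (deltaPlus m) :=
    (hmp.integrable_comp_emb hme).2 hΦ
  rw [integrable_deltaPlus_iff hm, (polar_coordinates _).2] at h1
  simp only [omega_smul_sphere] at h1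
  refine ⟨h1, ?_⟩
  rw [← hmp.integral_comp hme, integral_deltaPlus hm, (polar_coordinates _).1]
  simp only [omega_smul_sphere]

lemma shell_polar {Φ : R4 → ℂ} (hΦ : Integrable Φ (deltaPlus m)) :
    Integrable (fun n : S2 => ∫ r in Ioi (0 : ℝ), ((r ^ 2 / (2 * energy m r) : ℝ) : ℂ) *
      Φ (boost u (onShell m (r • (n : R3))))) sphereMeasure ∧
    ∫ l, Φ l ∂(deltaPlus m) = (1 / (2 * Real.pi) : ℝ) *
      ∫ n : S2, (∫ r in Ioi (0 : ℝ), ((r ^ 2 / (2 * energy m r) : ℝ) : ℂ) *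
        Φ (boost u (onShell m (r • (n : R3))))) ∂sphereMeasure := by
  obtain ⟨h1, h2⟩ := shell_polar_aux hm hu hu0 hΦ
  have h3 := h1.integral_prod_left
  simp only [integral_radialMeasure] at h3
  have e : ∀ (n : S2) (r : ℝ), ((r ^ 2 : ℝ) : ℂ) * (((1 / (2 * energy m r) : ℝ) : ℂ) *
      Φ (boost u (onShell m (r • (n : R3))))) = ((r ^ 2 / (2 * energy m r) : ℝ) : ℂ) *
      Φ (boost u (onShell m (r • (n : R3)))) := fun n r => by
    push_cast; ring
  simp only [e] at h3
  refine ⟨h3, ?_⟩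
  rw [h2, integral_prod _ h1]
  simp only [integral_radialMeasure, e]

/-- The order with the directions innermost suits integrands whose denominator depends on the radius
alone. -/
lemma shell_polar_symm {Φ : R4 → ℂ} (hΦ : Integrable Φ (deltaPlus m)) :
    ∫ l, Φ l ∂(deltaPlus m) = (1 / (2 * Real.pi) : ℝ) *
      ∫ r in Ioi (0 : ℝ), ((r ^ 2 / (2 * energy m r) : ℝ) : ℂ) *
        ∫ n : S2, Φ (boost u (onShell m (r • (n : R3)))) ∂sphereMeasure := by
  obtain ⟨h1, h2⟩ := shell_polar_aux hm hu hu0 hΦ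
  rw [h2, integral_prod_symm _ h1, integral_radialMeasure]
  congr 1
  refine integral_congr_ae (Eventually.of_forall fun r => ?_)
  dsimp only
  rw [integral_const_mul, ← mul_assoc]
  congr 1
  push_cast
  ring

end ShellPolar

/-! ### Coordinates adapted to the zero of the denominator -/

section NearPoint

/-- The four-velocity of a timelike momentum. -/
noncomputable def velocity (k : R4) : R4 := (Real.sqrt (mdot k k))⁻¹ • k

/-- The radius `r` at which `k² - 2 k · l = x` for `l = (√(r² + m²), r n)` in the rest frame. -/
noncomputable def nearRadius (m : ℝ) (k : R4) (x : ℝ) : ℝ :=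
  Real.sqrt ((mdot k k - x) ^ 2 / (4 * mdot k k) - m ^ 2)

/-- The point of the mass shell in the direction `n` of the rest frame of `k`
with `k² - 2 k · l = x`. -/
noncomputable def nearPoint (m : ℝ) (k : R4) (n : R3) (x : ℝ) : R4 :=
  boost (velocity k) (onShell m (nearRadius m k x • n))

/-- The momenta `k` and numbers `x` for which there is a sphere of such points. -/
def nearDomain (m : ℝ) : Set (R4 × ℝ) :=
  {p | 0 < mdot p.1 p.1 ∧ 0 < p.1 0 ∧ p.2 < mdot p.1 p.1 ∧
    4 * m ^ 2 * mdot p.1 p.1 < (mdot p.1 p.1 - p.2) ^ 2}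

lemma mdot_velocity {k : R4} (hk : 0 < mdot k k) : mdot (velocity k) (velocity k) = 1 := by
  have h := Real.sq_sqrt hk.le
  have h0 := Real.sqrt_pos.2 hk
  rw [velocity, mdot_smul_left, mdot_smul_right]
  field_simp
  linarith

lemma velocity_zero_pos {k : R4} (hk : 0 < mdot k k) (hk0 : 0 < k 0) : 0 < velocity k 0 := by
  have h0 := Real.sqrt_pos.2 hk
  simp only [velocity, PiLp.smul_apply, smul_eq_mul]
  positivity

lemma mdot_boost_velocity {k : R4} (hk : 0 < mdot k k) (hk0 : 0 < k 0) (l : R4) :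
    mdot k (boost (velocity k) l) = Real.sqrt (mdot k k) * l 0 := by
  have h0 := Real.sqrt_pos.2 hk
  have h := mdot_boost (mdot_velocity hk) (velocity_zero_pos hk hk0) l
  rw [velocity, mdot_smul_right, ← velocity, mdot_comm] at h
  rw [← h, mdot_comm k]
  field_simp

lemma isOpen_nearDomain (m : ℝ) : IsOpen (nearDomain m) := by
  have h1 : Continuous fun p : R4 × ℝ => mdot p.1 p.1 := by fun_prop
  have h2 : Continuous fun p : R4 × ℝ => p.1 0 := by fun_prop
  exact (isOpen_lt continuous_const h1).inter ((isOpen_lt continuous_const h2).inter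
    ((isOpen_lt continuous_snd h1).inter
      (isOpen_lt (continuous_const.mul h1) ((h1.sub continuous_snd).pow 2))))

lemma nearRadius_arg_pos {m : ℝ} {k : R4} {x : ℝ} (h : (k, x) ∈ nearDomain m) :
    0 < (mdot k k - x) ^ 2 / (4 * mdot k k) - m ^ 2 := by
  obtain ⟨h1, -, -, h4⟩ := h
  simp only at h1 h4
  rw [sub_pos, lt_div_iff₀ (by positivity)]
  linarith

lemma nearRadius_pos {m : ℝ} {k : R4} {x : ℝ} (h : (k, x) ∈ nearDomain m) :
    0 < nearRadius m k x := Real.sqrt_pos.2 (nearRadius_arg_pos h)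

lemma energy_nearRadius {m : ℝ} {k : R4} {x : ℝ} (h : (k, x) ∈ nearDomain m) :
    energy m (nearRadius m k x) = (mdot k k - x) / (2 * Real.sqrt (mdot k k)) := by
  obtain ⟨h1, -, h3, -⟩ := id h
  simp only at h1 h3
  have hs := Real.sq_sqrt h1.le
  rw [energy, nearRadius, Real.sq_sqrt (nearRadius_arg_pos h).le, sub_add_cancel,
    Real.sqrt_eq_iff_eq_sq (by positivity) (div_nonneg (by linarith) (by positivity)), div_pow,
    mul_pow, hs]
  norm_num

lemma mdot_nearPoint {m : ℝ} {k : R4} {x : ℝ} (h : (k, x) ∈ nearDomain m) (n : S2) :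
    mdot k (nearPoint m k n x) = (mdot k k - x) / 2 := by
  have h1 := h.1
  have h0 := Real.sqrt_pos.2 h1
  simp only at h1 h0
  rw [nearPoint, mdot_boost_velocity h1 h.2.1, onShell_zero, omega_smul_sphere, energy_nearRadius h]
  field_simp

@[fun_prop]
lemma contDiff_omega {m : ℝ} (hm : 0 < m) : ContDiff ℝ ∞ (omega m) := by
  unfold omega
  exact ContDiff.sqrt ((contDiff_norm_sq ℝ).add contDiff_const) fun v => by positivity

lemma contDiff_onShell {m : ℝ} (hm : 0 < m) : ContDiff ℝ ∞ (onShell m) := by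
  rw [contDiff_euclidean]
  have h := contDiff_omega hm
  intro i
  fin_cases i
  · exact h
  all_goals simp; fun_prop

lemma contDiffOn_velocity : ContDiffOn ℝ ∞ velocity {k | 0 < mdot k k} := by
  unfold velocity
  refine ContDiffOn.smul (ContDiffOn.inv (ContDiffOn.sqrt ?_ fun k hk => ne_of_gt hk)
    fun k hk => (Real.sqrt_pos.2 hk).ne') contDiffOn_id
  exact (contDiff_mdot contDiff_id contDiff_id).contDiffOn

lemma contDiffOn_nearRadius (m : ℝ) :
    ContDiffOn ℝ ∞ (fun p : R4 × ℝ => nearRadius m p.1 p.2) (nearDomain m) := by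
  unfold nearRadius
  have h1 : ContDiff ℝ ∞ fun p : R4 × ℝ => mdot p.1 p.1 := contDiff_mdot contDiff_fst contDiff_fst
  refine ContDiffOn.sqrt (ContDiffOn.sub (ContDiffOn.div ?_ ?_ fun p hp => ?_) contDiffOn_const)
    fun p hp => (nearRadius_arg_pos hp).ne'
  · exact ((h1.sub contDiff_snd).pow 2).contDiffOn
  · exact (contDiff_const.mul h1).contDiffOn
  · have := hp.1
    positivity

lemma contDiffOn_nearPoint {m : ℝ} (hm : 0 < m) :
    ContDiffOn ℝ ∞ (fun p : R4 × (R3 × ℝ) => nearPoint m p.1 p.2.1 p.2.2)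
      {p | (p.1, p.2.2) ∈ nearDomain m} := by
  have hv : ContDiffOn ℝ ∞ (fun p : R4 × (R3 × ℝ) => velocity p.1)
      {p | (p.1, p.2.2) ∈ nearDomain m} :=
    contDiffOn_velocity.comp contDiffOn_fst fun p hp => hp.1
  have hr : ContDiffOn ℝ ∞ (fun p : R4 × (R3 × ℝ) => nearRadius m p.1 p.2.2)
      {p | (p.1, p.2.2) ∈ nearDomain m} :=
    (contDiffOn_nearRadius m).comp (t := nearDomain m)
      (f := fun p : R4 × (R3 × ℝ) => (p.1, p.2.2))
      (contDiff_fst.prodMk (contDiff_snd.comp contDiff_snd)).contDiffOn fun p hp => hp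
  have hs : ContDiffOn ℝ ∞ (fun p : R4 × (R3 × ℝ) => onShell m (nearRadius m p.1 p.2.2 • p.2.1))
      {p | (p.1, p.2.2) ∈ nearDomain m} :=
    (contDiff_onShell hm).comp_contDiffOn
      (hr.smul (contDiff_fst.comp contDiff_snd).contDiffOn)
  unfold nearPoint boost
  have hw := hv.add (contDiffOn_const (c := timeAxis))
  have hmd : ContDiff ℝ ∞ fun q : R4 × R4 => mdot q.1 q.2 := contDiff_mdot contDiff_fst contDiff_snd
  have h1 := hmd.comp_contDiffOn (hs.prodMk hw)
  have h0 : ContDiffOn ℝ ∞ (fun p : R4 × (R3 × ℝ) => 1 + velocity p.1 0)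
      {p | (p.1, p.2.2) ∈ nearDomain m} :=
    contDiffOn_const.add ((contDiffOn_euclidean.1 hv) 0)
  refine ((h1.div h0 fun p hp => ?_).smul hw).sub hs
  have := velocity_zero_pos hp.1 hp.2.1
  positivity

/-- A condition on `δ` under which the points `l` of the mass shell with `|k² - 2 k · l| < δ`
are parametrized by `nearPoint`. -/
lemma mem_nearDomain {m δ : ℝ} (hm : 0 < m) {k : R4} (hk : 0 < mdot k k) (hk0 : 0 < k 0)
    (hδ : δ ≤ mdot k k - 2 * m * Real.sqrt (mdot k k)) {x : ℝ} (hx : x < δ) :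
    (k, x) ∈ nearDomain m := by
  have h0 := Real.sqrt_pos.2 hk
  have hs := Real.sq_sqrt hk.le
  have h1 : 2 * m * Real.sqrt (mdot k k) < mdot k k - x := by linarith
  refine ⟨hk, hk0, ?_, ?_⟩
  · simp only
    have : 0 < 2 * m * Real.sqrt (mdot k k) := by positivity
    linarith
  · simp only
    calc 4 * m ^ 2 * mdot k k = (2 * m * Real.sqrt (mdot k k)) ^ 2 := by rw [mul_pow, hs]; ring
      _ < _ := by gcongr

lemma hasDerivAt_nearRadius {m : ℝ} {k : R4} {x : ℝ} (h : (k, x) ∈ nearDomain m) :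
    HasDerivAt (nearRadius m k)
      (-((mdot k k - x) / (4 * mdot k k)) / nearRadius m k x) x := by
  have h1 : HasDerivAt (fun x => (mdot k k - x) ^ 2 / (4 * mdot k k) - m ^ 2)
      (2 * (mdot k k - x) * (-1) / (4 * mdot k k)) x := by
    have := (((hasDerivAt_id x).const_sub (mdot k k)).pow 2).div_const (4 * mdot k k)
    simpa using this.sub_const (m ^ 2)
  have h2 := h1.sqrt (nearRadius_arg_pos h).ne'
  refine h2.congr_deriv ?_
  have h3 := nearRadius_pos h
  have h4 : 0 < mdot k k := h.1
  rw [← nearRadius]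
  field_simp

/-- In the rest frame `x = M² - 2Mω` with `M = √k²`. From `dx = -2M (r/ω) dr` the measure `r²/(2ω)
dr` becomes `r/(4M) dx`. The condition on `δ` keeps `r` positive, so that the substitution is a
smooth bijection. -/
lemma near_integral {m δ : ℝ} (hm : 0 < m) {k : R4} (hk : 0 < mdot k k) (hk0 : 0 < k 0)
    (hδ0 : 0 < δ) (hδ : δ ≤ mdot k k - 2 * m * Real.sqrt (mdot k k)) {Φ : R4 → ℂ}
    (hΦ : Integrable Φ (deltaPlus m)) :
    Integrable (fun n : S2 => ∫ x in (-δ)..δ,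
      ((nearRadius m k x / (4 * Real.sqrt (mdot k k)) : ℝ) : ℂ) * Φ (nearPoint m k n x))
      sphereMeasure ∧
    ∫ l in {l | |mdot k k - 2 * mdot k l| < δ}, Φ l ∂(deltaPlus m) = (1 / (2 * Real.pi) : ℝ) *
      ∫ n : S2, (∫ x in (-δ)..δ,
        ((nearRadius m k x / (4 * Real.sqrt (mdot k k)) : ℝ) : ℂ) * Φ (nearPoint m k n x))
        ∂sphereMeasure := by
  set A : Set R4 := {l | |mdot k k - 2 * mdot k l| < δ} with hA
  have hMpos := Real.sqrt_pos.2 hk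
  have hMsq := Real.sq_sqrt hk.le
  have hAm : MeasurableSet A := (isOpen_lt (by fun_prop) continuous_const).measurableSet
  have hdom : ∀ x ∈ Ioo (-δ) δ, (k, x) ∈ nearDomain m := fun x hx =>
    mem_nearDomain hm hk hk0 hδ hx.2
  obtain ⟨h1, h2⟩ := shell_polar hm (mdot_velocity hk) (velocity_zero_pos hk hk0)
    (hΦ.indicator hAm)
  have himage : nearRadius m k '' Ioo (-δ) δ =
      {r | 0 < r ∧ |mdot k k - 2 * (Real.sqrt (mdot k k) * energy m r)| < δ} := by
    ext r
    constructor
    · rintro ⟨x, hx, rfl⟩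
      refine ⟨nearRadius_pos (hdom x hx), ?_⟩
      rw [energy_nearRadius (hdom x hx)]
      have : mdot k k - 2 * (Real.sqrt (mdot k k) * ((mdot k k - x) / (2 * Real.sqrt (mdot k k)))) =
          x := by field_simp; ring
      rw [this, abs_lt]
      exact hx
    · rintro ⟨hr, hx⟩
      refine ⟨mdot k k - 2 * (Real.sqrt (mdot k k) * energy m r), abs_lt.1 hx, ?_⟩
      rw [nearRadius, Real.sqrt_eq_iff_eq_sq _ hr.le]
      · have := energy_sq m r
        have e : (mdot k k - (mdot k k - 2 * (Real.sqrt (mdot k k) * energy m r))) ^ 2 =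
            4 * mdot k k * energy m r ^ 2 := by
          rw [sub_sub_cancel, mul_pow, mul_pow, hMsq]; ring
        rw [e, mul_div_cancel_left₀ _ (by positivity), this]
        ring
      · exact (nearRadius_arg_pos (hdom _ (abs_lt.1 hx))).le
  have hSm : MeasurableSet (nearRadius m k '' Ioo (-δ) δ) := by
    rw [himage]
    have hc := continuous_energy m
    have hc' : Continuous fun r => |mdot k k - 2 * (Real.sqrt (mdot k k) * energy m r)| := by
      fun_prop
    exact ((isOpen_lt continuous_const continuous_id).inter
      (isOpen_lt hc' continuous_const)).measurableSet
  have hinj : InjOn (nearRadius m k) (Ioo (-δ) δ) := fun x hx y hy hxy => by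
    have e1 := energy_nearRadius (hdom x hx)
    rw [hxy, energy_nearRadius (hdom y hy)] at e1
    field_simp at e1
    linarith
  have hinner : ∀ n : S2, ∫ r in Ioi (0 : ℝ), ((r ^ 2 / (2 * energy m r) : ℝ) : ℂ) *
      A.indicator Φ (boost (velocity k) (onShell m (r • (n : R3)))) =
      ∫ x in (-δ)..δ, ((nearRadius m k x / (4 * Real.sqrt (mdot k k)) : ℝ) : ℂ) *
        Φ (nearPoint m k n x) := fun n => by
    have e : ∀ r ∈ Ioi (0 : ℝ), ((r ^ 2 / (2 * energy m r) : ℝ) : ℂ) *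
        A.indicator Φ (boost (velocity k) (onShell m (r • (n : R3)))) =
        (nearRadius m k '' Ioo (-δ) δ).indicator (fun r => ((r ^ 2 / (2 * energy m r) : ℝ) : ℂ) *
          Φ (boost (velocity k) (onShell m (r • (n : R3))))) r := fun r hr => by
      by_cases hmem : r ∈ nearRadius m k '' Ioo (-δ) δ
      · rw [indicator_of_mem hmem, indicator_of_mem]
        rw [himage] at hmem
        simpa only [hA, mem_ofPred_eq, mdot_boost_velocity hk hk0, onShell_zero, omega_smul_sphere]
          using hmem.2
      · rw [indicator_of_notMem hmem, indicator_of_notMem, mul_zero]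
        rw [himage] at hmem
        intro hc
        simp only [hA, mem_ofPred_eq, mdot_boost_velocity hk hk0, onShell_zero,
          omega_smul_sphere] at hc
        exact hmem ⟨hr, hc⟩
    rw [setIntegral_congr_fun measurableSet_Ioi e, setIntegral_indicator hSm,
      inter_eq_self_of_subset_right (by rw [himage]; exact fun r hr => hr.1),
      integral_image_eq_integral_abs_deriv_smul measurableSet_Ioo
        (fun x hx => (hasDerivAt_nearRadius (hdom x hx)).hasDerivWithinAt) hinj,
      intervalIntegral.integral_of_le (by linarith), integral_Ioc_eq_integral_Ioo]
    refine setIntegral_congr_fun measurableSet_Ioo fun x hx => ?_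
    have hr := nearRadius_pos (hdom x hx)
    have hxK : 0 < mdot k k - x := sub_pos.2 (hdom x hx).2.2.1
    beta_reduce
    rw [Complex.real_smul, ← mul_assoc, ← Complex.ofReal_mul, ← nearPoint,
      energy_nearRadius (hdom x hx)]
    congr 2
    rw [neg_div, abs_neg, abs_of_pos (by positivity)]
    field_simp
    rw [hMsq]
  simp only [hinner] at h1 h2
  rw [integral_indicator hAm] at h2
  exact ⟨h1, h2⟩

end NearPoint


/-! ### Smooth dependence away from the zero of the denominator -/

section FarFunction

/-- The function is `x/(x² + ρ(x))` with a bump `ρ` at the origin. Its derivatives are bounded on a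
compact interval by continuity, and outside it they are those of `1/x`. Temperate growth then passes
to compositions with polynomials. -/
lemma exists_farFunction {δ : ℝ} (hδ : 0 < δ) : ∃ η : ℝ → ℝ, Function.HasTemperateGrowth η ∧
    (∃ B, ∀ x, |η x| ≤ B) ∧ ∀ x, δ ≤ |x| → η x = x⁻¹ := by
  set ρ : ContDiffBump (0 : ℝ) := ⟨δ / 2, δ, by positivity, by linarith⟩ with hρ
  have hpos : ∀ x : ℝ, 0 < x ^ 2 + ρ x := fun x => by
    have h0 := ρ.nonneg (x := x)
    rcases le_or_gt |x| (δ / 2) with h | h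
    · have : ρ x = 1 := ρ.one_of_mem_closedBall (by simpa using h)
      rw [this]; positivity
    · have : x ≠ 0 := fun hx => by rw [hx, abs_zero] at h; linarith
      positivity
  have hfar : ∀ x : ℝ, δ ≤ |x| → x / (x ^ 2 + ρ x) = x⁻¹ := fun x hx => by
    have h1 : ρ x = 0 := ρ.zero_of_le_dist (by simpa using hx)
    have h2 : x ≠ 0 := fun h => by rw [h, abs_zero] at hx; linarith
    rw [h1, add_zero]
    field_simp
  have hsm : ContDiff ℝ ∞ fun x : ℝ => x / (x ^ 2 + ρ x) :=
    contDiff_id.div ((contDiff_id.pow 2).add ρ.contDiff) fun x => (hpos x).ne'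
  have hbd : ∀ n : ℕ, ∃ C, ∀ x, ‖iteratedFDeriv ℝ n (fun x : ℝ => x / (x ^ 2 + ρ x)) x‖ ≤ C := by
    intro n
    have hc : Continuous fun x => iteratedFDeriv ℝ n (fun x : ℝ => x / (x ^ 2 + ρ x)) x :=
      hsm.continuous_iteratedFDeriv (mod_cast le_top)
    obtain ⟨C, hC⟩ := (isCompact_Icc (a := -(2 * δ)) (b := 2 * δ)).exists_bound_of_continuousOn
      hc.continuousOn
    refine ⟨max C (n.factorial * δ⁻¹ ^ (n + 1)), fun x => ?_⟩
    rcases le_or_gt |x| (2 * δ) with h | h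
    · exact (hC x (abs_le.1 h)).trans (le_max_left _ _)
    · refine le_trans ?_ (le_max_right _ _)
      have hx : δ < |x| := by linarith
      have hev : (fun x : ℝ => x / (x ^ 2 + ρ x)) =ᶠ[𝓝 x] fun x => x⁻¹ := by
        filter_upwards [(isOpen_lt continuous_const continuous_abs).mem_nhds hx] with y hy
        exact hfar y (le_of_lt hy)
      rw [norm_iteratedFDeriv_eq_norm_iteratedDeriv, hev.iteratedDeriv_eq, iteratedDeriv_eq_iterate,
        iter_deriv_inv, norm_mul, norm_mul, norm_pow, norm_neg, norm_one, one_pow, one_mul,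
        Real.norm_natCast, Real.norm_eq_abs, abs_zpow,
        show (-1 - n : ℤ) = -((n + 1 : ℕ) : ℤ) by push_cast; ring, zpow_neg, zpow_natCast, inv_pow]
      gcongr
  refine ⟨_, ⟨hsm, fun n => ?_⟩, ?_, hfar⟩
  · obtain ⟨C, hC⟩ := hbd n
    exact ⟨0, C, fun x => by simpa using hC x⟩
  · obtain ⟨C, hC⟩ := hbd 0
    exact ⟨C, fun x => by
      have := hC x
      rwa [norm_iteratedFDeriv_zero, Real.norm_eq_abs] at this⟩

variable {m : ℝ} (hm : 0 < m)
include hm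

lemma integrable_schwartz_deltaPlus (φ : 𝓢(R4, ℂ)) : Integrable φ (deltaPlus m) :=
  haveI := hasTemperateGrowth_deltaPlus hm
  φ.integrable

/-- The composed function has temperate growth jointly in `k` and `l`. For `k` near a given point
its derivatives grow at most like a power of `1 + ‖l‖`; the Schwartz function absorbs this and
leaves four powers for integrability. -/
lemma contDiff_far {η : ℝ → ℝ} (hη : Function.HasTemperateGrowth η) (c : ℝ) (φ : 𝓢(R4, ℂ)) :
    ContDiff ℝ ∞ fun k => ∫ l, φ l * ((η (mdot k k + c * mdot k l) : ℝ) : ℂ) ∂(deltaPlus m) := by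
  have hg : Function.HasTemperateGrowth fun p : R4 × R4 =>
      ((η (mdot p.1 p.1 + c * mdot p.1 p.2) : ℝ) : ℂ) := by
    have h1 : ∀ i, Function.HasTemperateGrowth fun p : R4 × R4 => p.1 i := fun i =>
      ((EuclideanSpace.proj i : R4 →L[ℝ] ℝ).comp (ContinuousLinearMap.fst ℝ R4 R4)).hasTemperateGrowth
    have h2 : ∀ i, Function.HasTemperateGrowth fun p : R4 × R4 => p.2 i := fun i =>
      ((EuclideanSpace.proj i : R4 →L[ℝ] ℝ).comp (ContinuousLinearMap.snd ℝ R4 R4)).hasTemperateGrowth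
    have h3 : Function.HasTemperateGrowth fun p : R4 × R4 => mdot p.1 p.1 := by
      unfold mdot; fun_prop
    have h4 : Function.HasTemperateGrowth fun p : R4 × R4 => mdot p.1 p.2 := by
      unfold mdot; fun_prop
    have h5 : Function.HasTemperateGrowth fun p : R4 × R4 => mdot p.1 p.1 + c * mdot p.1 p.2 :=
      h3.add ((Function.HasTemperateGrowth.const c).mul h4)
    exact (Function.Complex.hasTemperateGrowth_ofReal.comp hη).comp h5
  rw [← contDiffOn_univ]
  refine contDiffOn_integral_of_dominated isOpen_univ isOpen_univ (g := fun p : R4 × R4 =>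
    ((η (mdot p.1 p.1 + c * mdot p.1 p.2) : ℝ) : ℂ)) (hg.1.contDiffOn) (by simp)
    φ.continuous.aestronglyMeasurable fun n k₀ _ => ?_
  obtain ⟨p, C, hC⟩ := hg.2 n
  refine ⟨Metric.ball k₀ 1, Metric.ball_mem_nhds _ one_pos, fun l =>
    (C * (1 + (‖k₀‖ + 1)) ^ p) * (2 ^ (p + 4) * schwartzNorm (p + 4) φ) * (1 + ‖l‖) ^ (-(4 : ℝ)),
    (integrable_rpow_deltaPlus hm).const_mul _, Eventually.of_forall fun l k hk => ?_⟩
  have hC0 : 0 ≤ C := by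
    have := (norm_nonneg _).trans (hC 0)
    simpa using this
  have h1 : 1 + ‖(k, l)‖ ≤ (1 + (‖k₀‖ + 1)) * (1 + ‖l‖) := by
    have hk' : ‖k‖ ≤ ‖k₀‖ + 1 := by
      have := norm_le_norm_add_norm_sub' k k₀
      rw [Metric.mem_ball, dist_eq_norm] at hk
      linarith
    have h2 : ‖(k, l)‖ ≤ ‖k‖ + ‖l‖ := by
      rw [Prod.norm_mk]
      exact max_le (by linarith [norm_nonneg l]) (by linarith [norm_nonneg k])
    nlinarith [norm_nonneg k₀, norm_nonneg l, mul_nonneg (norm_nonneg k₀) (norm_nonneg l)]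
  have h3 := norm_le_schwartzNorm le_rfl φ l (i := p + 4)
  have h4 : (1 + ‖l‖) ^ (4 : ℝ) = (1 + ‖l‖) ^ 4 := by exact_mod_cast Real.rpow_natCast _ 4
  beta_reduce
  rw [Real.rpow_neg (by positivity), h4, ← div_eq_mul_inv, le_div_iff₀ (by positivity)]
  calc ‖φ l‖ * ‖iteratedFDeriv ℝ n (fun p : R4 × R4 =>
        ((η (mdot p.1 p.1 + c * mdot p.1 p.2) : ℝ) : ℂ)) (k, l)‖ * (1 + ‖l‖) ^ 4
      ≤ ‖φ l‖ * (C * ((1 + (‖k₀‖ + 1)) * (1 + ‖l‖)) ^ p) * (1 + ‖l‖) ^ 4 := by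
        gcongr
        exact (hC (k, l)).trans (by gcongr)
    _ = C * (1 + (‖k₀‖ + 1)) ^ p * ((1 + ‖l‖) ^ (p + 4) * ‖φ l‖) := by
        rw [mul_pow, pow_add]; ring
    _ ≤ _ := by gcongr

end FarFunction

/-! ### Uniform Lipschitz bounds -/

section Lipschitz

lemma schwartz_lipschitz (φ : 𝓢(R4, ℂ)) (a b : R4) :
    ‖φ a - φ b‖ ≤ 2 * schwartzNorm 1 φ * ‖a - b‖ := by
  refine Convex.norm_image_sub_le_of_norm_fderiv_le (𝕜 := ℝ) (s := univ)
    (fun x _ => φ.differentiableAt) (fun x _ => ?_) convex_univ (mem_univ b) (mem_univ a)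
  have := weight_le_schwartzNorm (Nat.zero_le 1) le_rfl φ x
  rw [norm_iteratedFDeriv_one] at this
  simpa using this

/-- The mean value inequality in `x`, with the derivative bounded on the compact product of `N`, the
sphere and the interval. -/
lemma exists_lipschitz_const {E F : Type*} [NormedAddCommGroup E] [NormedSpace ℝ E]
    [NormedAddCommGroup F] [NormedSpace ℝ F] {W : Set (E × (R3 × ℝ))} (hW : IsOpen W)
    {f : E × (R3 × ℝ) → F} (hf : ContDiffOn ℝ ∞ f W) {N : Set E} (hN : IsCompact N) {δ : ℝ}
    (hδ : 0 < δ) (hNW : ∀ k ∈ N, ∀ n : S2, ∀ x ∈ Icc (-δ) δ, (k, ((n : R3), x)) ∈ W) :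
    ∃ L, 0 ≤ L ∧ ∀ k ∈ N, ∀ n : S2, ∀ x ∈ Icc (-δ) δ, ‖f (k, ((n : R3), x))‖ ≤ L ∧
      ‖f (k, ((n : R3), x)) - f (k, ((n : R3), 0))‖ ≤ L * |x| := by
  have hcpt : IsCompact (N ×ˢ (Metric.sphere (0 : R3) 1 ×ˢ Icc (-δ) δ)) :=
    hN.prod ((isCompact_sphere _ _).prod isCompact_Icc)
  have hsub : N ×ˢ (Metric.sphere (0 : R3) 1 ×ˢ Icc (-δ) δ) ⊆ W := fun z hz =>
    hNW z.1 hz.1 ⟨z.2.1, hz.2.1⟩ z.2.2 hz.2.2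
  obtain ⟨L₁, h₁⟩ := hcpt.exists_bound_of_continuousOn (hf.continuousOn.mono hsub)
  obtain ⟨L₂, h₂⟩ := hcpt.exists_bound_of_continuousOn
    ((hf.continuousOn_fderiv_of_isOpen hW (by norm_num)).mono hsub)
  refine ⟨max 0 (max L₁ L₂), le_max_left _ _, fun k hk n x hx => ⟨?_, ?_⟩⟩
  · exact (h₁ (k, ((n : R3), x)) ⟨hk, n.2, hx⟩).trans ((le_max_left _ _).trans (le_max_right _ _))
  · have hd : ∀ y ∈ Icc (-δ) δ, HasDerivWithinAt (fun y => f (k, ((n : R3), y)))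
        (fderiv ℝ f (k, ((n : R3), y)) (0, (0, 1))) (Icc (-δ) δ) y := fun y hy => by
      have h3 : HasDerivAt (fun y : ℝ => (k, ((n : R3), y))) ((0 : E), ((0 : R3), (1 : ℝ))) y :=
        (hasDerivAt_const y k).prodMk ((hasDerivAt_const y (n : R3)).prodMk (hasDerivAt_id y))
      have h4 := ((hf.contDiffAt (hW.mem_nhds (hNW k hk n y hy))).differentiableAt
        (by norm_num)).hasFDerivAt
      exact (h4.comp_hasDerivAt y h3).hasDerivWithinAt
    have := (convex_Icc (-δ) δ).norm_image_sub_le_of_norm_hasDerivWithin_le hd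
      (C := max 0 (max L₁ L₂)) (fun y hy => ?_) (x := 0) (y := x) ⟨by linarith, hδ.le⟩ hx
    · simpa using this
    · refine (ContinuousLinearMap.le_opNorm _ _).trans ?_
      have h5 : ‖((0 : E), ((0 : R3), (1 : ℝ)))‖ = 1 := by simp
      rw [h5, mul_one]
      exact (h₂ (k, ((n : R3), y)) ⟨hk, n.2, hy⟩).trans ((le_max_right _ _).trans (le_max_right _ _))

end Lipschitz


/-! ### The limit near the zero of the denominator -/

section NearLimit

open Complex

/-- The denominator `k² - 2 k · l`, which is `(k - l)² - m²` on the mass shell. -/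
noncomputable def pole (k l : R4) : ℝ := mdot k k - 2 * mdot k l

/-- The points of the mass shell close to the zero of the denominator. -/
def nearSet (δ : ℝ) (k : R4) : Set R4 := {l | |mdot k k - 2 * mdot k l| < δ}

lemma measurableSet_nearSet (δ : ℝ) (k : R4) : MeasurableSet (nearSet δ k) := by
  have : Continuous fun l => |mdot k k - 2 * mdot k l| := by fun_prop
  exact (isOpen_lt this continuous_const).measurableSet

/-- The test function near the zero of the denominator, with the density of the measure. -/
noncomputable def nearAmp (m : ℝ) (k : R4) (φ : 𝓢(R4, ℂ)) (n : R3) (x : ℝ) : ℂ :=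
  ((nearRadius m k x / (4 * Real.sqrt (mdot k k)) : ℝ) : ℂ) * φ (nearPoint m k n x)

/-- The contribution of the direction `n` to the limit of the regularized integral near the zero
of the denominator. -/
noncomputable def nearTerm (m δ σ : ℝ) (k : R4) (φ : 𝓢(R4, ℂ)) (n : R3) : ℂ :=
  (∫ x in (-δ)..δ, (nearAmp m k φ n x - nearAmp m k φ n 0) / (x : ℂ)) -
    I * (σ * Real.pi : ℝ) * nearAmp m k φ n 0

/-- The functions `s` for which `1 / (k² - 2 k · l ± i ε s)` is a regularization, uniformly for
`k` in `N`. -/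
structure IsRegularizer (m δ : ℝ) (N : Set R4) (s : R4 → R4 → ℝ) (s₀ L : ℝ) : Prop where
  pos : 0 < s₀
  nonneg : 0 ≤ L
  cont : ∀ k ∈ N, Continuous fun v => s k (onShell m v)
  le : ∀ k ∈ N, ∀ v, |pole k (onShell m v)| ≤ δ → s₀ ≤ s k (onShell m v)
  lip : ∀ k ∈ N, ∀ n : S2, ∀ x ∈ Icc (-δ) δ,
    |s k (nearPoint m k n x) - s k (nearPoint m k n 0)| ≤ L * |x|

/-- The regularized integrand. -/
noncomputable def regular (σ ε : ℝ) (s : R4 → R4 → ℝ) (φ : R4 → ℂ) (k l : R4) : ℂ :=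
  φ l / ((pole k l : ℂ) + I * ((σ * ε * s k l : ℝ) : ℂ))

variable {m δ : ℝ} (hm : 0 < m) (hδ : 0 < δ) {N : Set R4} {s : R4 → R4 → ℝ} {s₀ L : ℝ}

lemma abs_sign_eq_one {σ : ℝ} (hσ : σ = 1 ∨ σ = -1) : |σ| = 1 := by
  rcases hσ with rfl | rfl <;> simp

lemma IsRegularizer.le_norm (hs : IsRegularizer m δ N s s₀ L) {σ : ℝ} (hσ : σ = 1 ∨ σ = -1)
    {ε : ℝ} (hε : 0 < ε) {k : R4} (hk : k ∈ N) (v : R3) :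
    min δ (ε * s₀) ≤ ‖(pole k (onShell m v) : ℂ) + I * ((σ * ε * s k (onShell m v) : ℝ) : ℂ)‖ := by
  rcases le_or_gt |pole k (onShell m v)| δ with h | h
  · have h1 := hs.le k hk v h
    have h0 := hs.pos
    refine (min_le_right _ _).trans (le_trans ?_ (abs_im_le_norm _))
    simp only [add_im, ofReal_im, mul_im, I_re, I_im, ofReal_re, zero_mul, one_mul, zero_add]
    rw [abs_mul, abs_mul, abs_sign_eq_one hσ, one_mul, abs_of_pos hε, abs_of_pos (by linarith)]
    gcongr
  · exact (min_le_left _ _).trans (h.le.trans (abs_le_norm_ofReal_add_I_mul _ _))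

include hm hδ in
lemma IsRegularizer.integrable (hs : IsRegularizer m δ N s s₀ L) {σ : ℝ} (hσ : σ = 1 ∨ σ = -1)
    {ε : ℝ} (hε : 0 < ε) {k : R4} (hk : k ∈ N) (φ : 𝓢(R4, ℂ)) :
    Integrable (regular σ ε s φ k) (deltaPlus m) := by
  have hlow := hs.le_norm hσ hε hk
  have hpos : 0 < min δ (ε * s₀) := lt_min hδ (mul_pos hε hs.pos)
  have h1 := (integrable_deltaPlus_iff hm).1 (integrable_schwartz_deltaPlus hm φ)
  rw [integrable_deltaPlus_iff hm]
  refine ((h1.norm.mul_const (min δ (ε * s₀))⁻¹)).mono' ?_ (Eventually.of_forall fun v => ?_)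
  · have hc := hs.cont k hk
    have hcφ : Continuous fun v => φ (onShell m v) := φ.continuous.comp (continuous_onShell m)
    have hcp : Continuous fun v => pole k (onShell m v) := by unfold pole; fun_prop
    have hw : Continuous fun v => 1 / (2 * omega m v) :=
      continuous_const.div (by fun_prop) fun v => by
        have := omega_pos hm v
        positivity
    have hden : Continuous fun v => (pole k (onShell m v) : ℂ) +
        I * ((σ * ε * s k (onShell m v) : ℝ) : ℂ) := (continuous_ofReal.comp hcp).add
      (continuous_const.mul (continuous_ofReal.comp (continuous_const.mul hc)))
    refine ((continuous_ofReal.comp hw).mul (hcφ.div hden fun v hv => ?_)).aestronglyMeasurable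
    have := hlow v
    rw [hv, norm_zero] at this
    linarith
  · rw [regular, ← mul_div_assoc, norm_div, div_eq_mul_inv]
    gcongr
    exact hlow v

lemma schwartzNorm_mono {E : Type*} [NormedAddCommGroup E] [NormedSpace ℝ E] {a b : ℕ}
    (h : a ≤ b) (φ : 𝓢(E, ℂ)) : schwartzNorm a φ ≤ schwartzNorm b φ := by
  have : (schwartzNorm a : Seminorm ℂ 𝓢(E, ℂ)) ≤ schwartzNorm b :=
    Finset.sup_mono (Finset.Iic_subset_Iic.2 ⟨h, h⟩)
  exact this φ

include hm in
lemma exists_integral_norm_le : ∃ C, 0 ≤ C ∧ ∀ φ : 𝓢(R4, ℂ),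
    (∫ l, ‖φ l‖ ∂(deltaPlus m)) ≤ C * schwartzNorm 4 φ := by
  refine ⟨2 ^ 4 * ∫ l : R4, (1 + ‖l‖) ^ (-(4 : ℝ)) ∂(deltaPlus m),
    mul_nonneg (by positivity) (integral_nonneg fun l => by positivity), fun φ => ?_⟩
  calc ∫ l, ‖φ l‖ ∂(deltaPlus m)
      ≤ ∫ l, 2 ^ 4 * schwartzNorm 4 φ * (1 + ‖l‖) ^ (-(4 : ℝ)) ∂(deltaPlus m) := by
        refine integral_mono (integrable_schwartz_deltaPlus hm φ).norm
          ((integrable_rpow_deltaPlus hm).const_mul _) fun l => ?_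
        have h4 : (1 + ‖l‖) ^ (4 : ℝ) = (1 + ‖l‖) ^ 4 := by exact_mod_cast Real.rpow_natCast _ 4
        beta_reduce
        rw [Real.rpow_neg (by positivity), h4, ← div_eq_mul_inv, le_div_iff₀' (by positivity)]
        exact norm_le_schwartzNorm le_rfl φ l
    _ = _ := by rw [integral_const_mul]; ring

include hm hδ in
/-- Away from the zero of the denominator the limit is the integral of the limit. -/
lemma IsRegularizer.tendsto_far (hs : IsRegularizer m δ N s s₀ L) {σ : ℝ} (hσ : σ = 1 ∨ σ = -1)
    {k : R4} (hk : k ∈ N) (φ : 𝓢(R4, ℂ)) :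
    (∀ ε > 0, ‖∫ l in (nearSet δ k)ᶜ, regular σ ε s φ k l ∂(deltaPlus m)‖ ≤
      δ⁻¹ * ∫ l, ‖φ l‖ ∂(deltaPlus m)) ∧
    Tendsto (fun ε => ∫ l in (nearSet δ k)ᶜ, regular σ ε s φ k l ∂(deltaPlus m)) (𝓝[>] 0)
      (𝓝 (∫ l in (nearSet δ k)ᶜ, φ l / (pole k l : ℂ) ∂(deltaPlus m))) := by
  have hA := (measurableSet_nearSet δ k).compl
  have hφ := (integrable_schwartz_deltaPlus hm φ)
  have hb : ∀ ε : ℝ, ∀ l ∈ (nearSet δ k)ᶜ, ‖regular σ ε s φ k l‖ ≤ δ⁻¹ * ‖φ l‖ := fun ε l hl => by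
    have h1 : δ ≤ |pole k l| := not_lt.1 hl
    rw [regular, norm_div, div_eq_inv_mul]
    gcongr
    exact h1.trans (abs_le_norm_ofReal_add_I_mul _ _)
  refine ⟨fun ε hε => ?_, ?_⟩
  · rw [← integral_const_mul]
    refine (norm_integral_le_of_norm_le ((hφ.norm.const_mul δ⁻¹).integrableOn)
      ((ae_restrict_mem hA).mono fun l hl => hb ε l hl)).trans ?_
    exact setIntegral_le_integral (hφ.norm.const_mul δ⁻¹)
      (Eventually.of_forall fun l => by positivity)
  · refine tendsto_integral_filter_of_dominated_convergence (fun l => δ⁻¹ * ‖φ l‖) ?_ ?_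
      (hφ.norm.const_mul δ⁻¹).integrableOn ?_
    · filter_upwards [self_mem_nhdsWithin] with ε hε
      exact (hs.integrable hm hδ hσ hε hk φ).aestronglyMeasurable.restrict
    · exact Eventually.of_forall fun ε => (ae_restrict_mem hA).mono fun l hl => hb ε l hl
    · refine (ae_restrict_mem hA).mono fun l hl => ?_
      have h1 : δ ≤ |pole k l| := not_lt.1 hl
      have h2 : (pole k l : ℂ) ≠ 0 := by
        rw [Ne, ofReal_eq_zero]
        rintro h
        rw [h, abs_zero] at h1
        linarith
      have h3 : Tendsto (fun ε : ℝ => (pole k l : ℂ) + I * ((σ * ε * s k l : ℝ) : ℂ)) (𝓝[>] 0)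
          (𝓝 ((pole k l : ℂ) + I * ((σ * 0 * s k l : ℝ) : ℂ))) :=
        ((by fun_prop : Continuous fun ε : ℝ =>
          (pole k l : ℂ) + I * ((σ * ε * s k l : ℝ) : ℂ)).tendsto 0).mono_left nhdsWithin_le_nhds
      have h4 : (pole k l : ℂ) + I * ((σ * 0 * s k l : ℝ) : ℂ) = pole k l := by simp
      rw [h4] at h3
      exact tendsto_const_nhds.div h3 h2

variable (hN : ∀ k ∈ N, 0 < mdot k k ∧ 0 < k 0 ∧ 2 * δ ≤ mdot k k - 2 * m * Real.sqrt (mdot k k))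
include hm hδ hN

lemma mem_nearDomain_of_mem {k : R4} (hk : k ∈ N) {x : ℝ} (hx : x ∈ Icc (-δ) δ) :
    (k, x) ∈ nearDomain m :=
  mem_nearDomain hm (hN k hk).1 (hN k hk).2.1 (hN k hk).2.2 (by linarith [hx.2])

/-- The product rule for Lipschitz functions, with constants for the density and for `nearPoint`
that are uniform over the compact set. The test function enters only through one seminorm. -/
lemma exists_nearAmp_le (hNc : IsCompact N) : ∃ C, 0 ≤ C ∧ ∀ k ∈ N, ∀ (φ : 𝓢(R4, ℂ)) (n : S2),
    ∀ x ∈ Icc (-δ) δ, ‖nearAmp m k φ n x‖ ≤ C * schwartzNorm 1 φ ∧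
      ‖nearAmp m k φ n x - nearAmp m k φ n 0‖ ≤ C * schwartzNorm 1 φ * |x| := by
  have hW : IsOpen {p : R4 × (R3 × ℝ) | (p.1, p.2.2) ∈ nearDomain m} :=
    (isOpen_nearDomain m).preimage (f := fun p : R4 × (R3 × ℝ) => (p.1, p.2.2)) (by fun_prop)
  have hNW : ∀ k ∈ N, ∀ n : S2, ∀ x ∈ Icc (-δ) δ, (k, ((n : R3), x)) ∈
      {p : R4 × (R3 × ℝ) | (p.1, p.2.2) ∈ nearDomain m} := fun k hk n x hx =>
    mem_nearDomain_of_mem hm hδ hN hk hx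
  obtain ⟨L₁, hL₁, h₁⟩ := exists_lipschitz_const hW (contDiffOn_nearPoint hm) hNc hδ hNW
  have hw : ContDiffOn ℝ ∞ (fun p : R4 × (R3 × ℝ) =>
      nearRadius m p.1 p.2.2 / (4 * Real.sqrt (mdot p.1 p.1)))
      {p | (p.1, p.2.2) ∈ nearDomain m} := by
    refine ContDiffOn.div ((contDiffOn_nearRadius m).comp (t := nearDomain m)
      (f := fun p : R4 × (R3 × ℝ) => (p.1, p.2.2))
      (contDiff_fst.prodMk (contDiff_snd.comp contDiff_snd)).contDiffOn fun p hp => hp)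
      (contDiffOn_const.mul (ContDiffOn.sqrt (contDiff_mdot contDiff_fst contDiff_fst).contDiffOn
        fun p hp => hp.1.ne')) fun p hp => ?_
    have := Real.sqrt_pos.2 hp.1
    positivity
  obtain ⟨L₂, hL₂, h₂⟩ := exists_lipschitz_const hW hw hNc hδ hNW
  refine ⟨2 * L₂ + L₂ * (2 * L₁), by positivity, fun k hk φ n x hx => ?_⟩
  have hS : 0 ≤ schwartzNorm 1 φ := apply_nonneg _ _
  have hφ : ∀ l, ‖φ l‖ ≤ 2 * schwartzNorm 1 φ := fun l => by
    simpa using norm_le_schwartzNorm (Nat.zero_le 1) φ l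
  obtain ⟨a1, a2⟩ := h₁ k hk n x hx
  obtain ⟨b1, b2⟩ := h₂ k hk n x hx
  obtain ⟨b3, -⟩ := h₂ k hk n 0 ⟨by linarith, hδ.le⟩
  simp only at a1 a2 b1 b2 b3
  constructor
  · rw [nearAmp, norm_mul, norm_real]
    calc _ ≤ L₂ * (2 * schwartzNorm 1 φ) := by gcongr; exact hφ _
      _ ≤ _ := by nlinarith [mul_nonneg hL₂ hL₁, mul_nonneg (mul_nonneg hL₂ hL₁) hS]
  · have e : nearAmp m k φ n x - nearAmp m k φ n 0 =
        ((nearRadius m k x / (4 * Real.sqrt (mdot k k)) -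
          nearRadius m k 0 / (4 * Real.sqrt (mdot k k)) : ℝ) : ℂ) * φ (nearPoint m k n x) +
        ((nearRadius m k 0 / (4 * Real.sqrt (mdot k k)) : ℝ) : ℂ) *
          (φ (nearPoint m k n x) - φ (nearPoint m k n 0)) := by
      simp only [nearAmp]; push_cast; ring
    rw [e]
    refine (norm_add_le _ _).trans ?_
    rw [norm_mul, norm_mul, norm_real, norm_real]
    have h3 := schwartz_lipschitz φ (nearPoint m k n x) (nearPoint m k n 0)
    calc _ ≤ (L₂ * |x|) * (2 * schwartzNorm 1 φ) + L₂ * (2 * schwartzNorm 1 φ * (L₁ * |x|)) := by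
          gcongr
          · exact hφ _
          · exact h3.trans (by gcongr)
      _ = _ := by ring

lemma continuousOn_nearPoint {k : R4} (hk : k ∈ N) (n : R3) :
    ContinuousOn (fun x => nearPoint m k n x) (Icc (-δ) δ) := by
  have h1 := (contDiffOn_nearPoint hm).continuousOn
  exact h1.comp (f := fun x : ℝ => (k, (n, x))) (by fun_prop) fun x hx =>
    mem_nearDomain_of_mem hm hδ hN hk hx

lemma continuousOn_nearAmp {k : R4} (hk : k ∈ N) (φ : 𝓢(R4, ℂ)) (n : R3) :
    ContinuousOn (nearAmp m k φ n) (Icc (-δ) δ) := by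
  have h1 : ContinuousOn (fun x => nearRadius m k x) (Icc (-δ) δ) :=
    (contDiffOn_nearRadius m).continuousOn.comp (f := fun x : ℝ => (k, x)) (by fun_prop)
      fun x hx => mem_nearDomain_of_mem hm hδ hN hk hx
  exact (continuous_ofReal.comp_continuousOn (h1.div_const _)).mul
    (φ.continuous.comp_continuousOn (continuousOn_nearPoint hm hδ hN hk n))

omit hδ in
lemma onShell_nearPoint {k : R4} (hk : k ∈ N) (n : R3) (x : ℝ) :
    onShell m (spatial (nearPoint m k n x)) = nearPoint m k n x := by
  have h := onShell_shellBoost hm (mdot_velocity (hN k hk).1)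
    (velocity_zero_pos (hN k hk).1 (hN k hk).2.1) (nearRadius m k x • n)
  rw [nearPoint, ← h, spatial_onShell]

/-- In the coordinates `(n, x)` the denominator is `x + iσεs`. The formula for a simple pole applies
in each direction, and its bound, uniform in `n` and `ε`, gives dominated convergence over the
sphere. -/
lemma IsRegularizer.tendsto_near (hNc : IsCompact N) (hs : IsRegularizer m δ N s s₀ L) :
    ∃ C, 0 ≤ C ∧ ∀ σ : ℝ, (σ = 1 ∨ σ = -1) → ∀ k ∈ N, ∀ φ : 𝓢(R4, ℂ),
    (∀ ε > 0, ‖∫ l in nearSet δ k, regular σ ε s φ k l ∂(deltaPlus m)‖ ≤ C * schwartzNorm 1 φ) ∧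
    Tendsto (fun ε => ∫ l in nearSet δ k, regular σ ε s φ k l ∂(deltaPlus m)) (𝓝[>] 0)
      (𝓝 ((1 / (2 * Real.pi) : ℝ) * ∫ n : S2, nearTerm m δ σ k φ n ∂sphereMeasure)) := by
  obtain ⟨C, hC, hamp⟩ := exists_nearAmp_le hm hδ hN hNc
  have hpi := Real.pi_pos
  set c := 2 * δ + L / s₀ * (2 * δ) + Real.pi with hc
  have hc0 : 0 ≤ c := by
    have := hs.pos
    have := hs.nonneg
    positivity
  have harea : 0 ≤ sphereMeasure.real univ := measureReal_nonneg
  refine ⟨1 / (2 * Real.pi) * (C * c * sphereMeasure.real univ), by positivity,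
    fun σ hσ k hk φ => ?_⟩
  have hS : 0 ≤ schwartzNorm 1 φ := apply_nonneg _ _
  have hK := (hN k hk).1
  have hsc : ∀ n : S2, ContinuousOn (fun x => s k (nearPoint m k n x)) (Icc (-δ) δ) := fun n => by
    have h1 := (hs.cont k hk).comp_continuousOn
      (continuous_spatial.comp_continuousOn (continuousOn_nearPoint hm hδ hN hk n))
    refine h1.congr fun x hx => ?_
    simp only [Function.comp_apply, onShell_nearPoint hm hN hk]
  have hpole : ∀ n : S2, ∀ x ∈ Icc (-δ) δ, pole k (nearPoint m k n x) = x := fun n x hx => by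
    rw [pole, mdot_nearPoint (mem_nearDomain_of_mem hm hδ hN hk hx)]; ring
  have hsl : ∀ n : S2, ∀ x ∈ Icc (-δ) δ, s₀ ≤ s k (nearPoint m k n x) := fun n x hx => by
    rw [← onShell_nearPoint hm hN hk]
    refine hs.le k hk _ ?_
    rw [onShell_nearPoint hm hN hk, hpole n x hx]
    exact abs_le.2 hx
  have hsub : ∀ x ∈ uIcc (-δ) δ, x ∈ Icc (-δ) δ := fun x hx => by
    rwa [uIcc_of_le (by linarith)] at hx
  have heq : ∀ ε : ℝ, ∀ n : S2, ∫ x in (-δ)..δ,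
      ((nearRadius m k x / (4 * Real.sqrt (mdot k k)) : ℝ) : ℂ) *
        regular σ ε s φ k (nearPoint m k n x) =
      ∫ x in (-δ)..δ, nearAmp m k φ n x /
        ((x : ℂ) + I * ((σ * ε * s k (nearPoint m k n x) : ℝ) : ℂ)) := fun ε n => by
    refine intervalIntegral.integral_congr fun x hx => ?_
    beta_reduce
    rw [regular, hpole n x (hsub x hx), nearAmp, mul_div_assoc]
  have hσ0 : σ ≠ 0 := by rcases hσ with rfl | rfl <;> norm_num
  have hbound : ∀ ε > 0, ∀ n : S2, ‖∫ x in (-δ)..δ, nearAmp m k φ n x /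
      ((x : ℂ) + I * ((σ * ε * s k (nearPoint m k n x) : ℝ) : ℂ))‖ ≤
      C * schwartzNorm 1 φ * c := fun ε hε n =>
    norm_integral_near_pole_le hδ (continuousOn_nearAmp hm hδ hN hk φ n) (hsc n) hs.pos (hsl n)
      (by positivity) hs.nonneg (hamp k hk φ n 0 ⟨by linarith, hδ.le⟩).1
      (fun x hx => (hamp k hk φ n x hx).2) (hs.lip k hk n) (mul_ne_zero hσ0 hε.ne')
  have hnear := fun (ε : ℝ) (hε : 0 < ε) =>
    near_integral hm hK (hN k hk).2.1 hδ (by linarith [(hN k hk).2.2])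
      (Φ := regular σ ε s φ k) (hs.integrable hm hδ hσ hε hk φ)
  simp only [heq] at hnear
  have hnear2 : ∀ ε > 0, ∫ l in nearSet δ k, regular σ ε s φ k l ∂(deltaPlus m) = _ :=
    fun ε hε => (hnear ε hε).2
  constructor
  · intro ε hε
    rw [hnear2 ε hε, norm_mul, norm_real, Real.norm_of_nonneg (by positivity), mul_assoc]
    refine mul_le_mul_of_nonneg_left ?_ (by positivity)
    refine (norm_integral_le_of_norm_le_const (Eventually.of_forall (hbound ε hε))).trans
      (le_of_eq ?_)
    ring
  · refine Tendsto.congr' (f₁ := fun ε => ((1 / (2 * Real.pi) : ℝ) : ℂ) *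
      ∫ n : S2, (∫ x in (-δ)..δ, nearAmp m k φ n x /
        ((x : ℂ) + I * ((σ * ε * s k (nearPoint m k n x) : ℝ) : ℂ))) ∂sphereMeasure) ?_ ?_
    · filter_upwards [self_mem_nhdsWithin] with ε hε
      exact (hnear2 ε hε).symm
    refine Tendsto.const_mul _ ?_
    refine tendsto_integral_filter_of_dominated_convergence (fun _ => C * schwartzNorm 1 φ * c)
      ?_ ?_ (integrable_const _) ?_
    · filter_upwards [self_mem_nhdsWithin] with ε hε
      exact (hnear ε hε).1.aestronglyMeasurable
    · filter_upwards [self_mem_nhdsWithin] with ε hε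
      exact Eventually.of_forall (hbound ε hε)
    · refine Eventually.of_forall fun n => ?_
      exact tendsto_integral_near_pole hδ (continuousOn_nearAmp hm hδ hN hk φ n) (hsc n) hs.pos
        (hsl n) (A := C * schwartzNorm 1 φ) (by positivity) hs.nonneg
        (fun x hx => (hamp k hk φ n x hx).2) (hs.lip k hk n) hσ

end NearLimit


/-! ### Smooth dependence of integrals over directions and intervals -/

section SphereParameter

variable {E : Type*} [NormedAddCommGroup E] [NormedSpace ℝ E] [FiniteDimensional ℝ E]
  {U : Set E} (hU : IsOpen U)

/-- The surface measure of the unit sphere as a measure on `R3`. -/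
noncomputable def ambientSphereMeasure : Measure R3 := sphereMeasure.map Subtype.val

instance : IsFiniteMeasure ambientSphereMeasure := by
  unfold ambientSphereMeasure; infer_instance

lemma integral_ambientSphereMeasure (f : R3 → ℂ) :
    ∫ n, f n ∂ambientSphereMeasure = ∫ n : S2, f n ∂sphereMeasure :=
  (MeasurableEmbedding.subtype_coe (Metric.isClosed_sphere.measurableSet)).integral_map f

lemma ae_ambientSphereMeasure : ∀ᵐ n ∂ambientSphereMeasure, n ∈ Metric.sphere (0 : R3) 1 := by
  rw [ambientSphereMeasure,
    (MeasurableEmbedding.subtype_coe (Metric.isClosed_sphere.measurableSet)).ae_map_iff]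
  exact Eventually.of_forall fun n => n.2

include hU

/-- The surface measure is carried to the ambient space, where differentiation under the integral is
available for smooth functions of a vector variable. -/
lemma contDiffOn_sphere_integral {g : E × R3 → ℂ} (hg : ContDiffOn ℝ ∞ g (U ×ˢ univ)) :
    ContDiffOn ℝ ∞ (fun k => ∫ n : S2, g (k, n) ∂sphereMeasure) U := by
  have := contDiffOn_integral_of_isCompact hU isOpen_univ (isCompact_sphere (0 : R3) 1)
    (subset_univ _) hg ae_ambientSphereMeasure
  simpa only [integral_ambientSphereMeasure] using this

/-- The measure on the sphere and two intervals. -/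
noncomputable def sphereIntervalMeasure (δ : ℝ) : Measure (R3 × (ℝ × ℝ)) :=
  ambientSphereMeasure.prod
    ((volume.restrict (Ioc (-δ) δ)).prod (volume.restrict (Ioc (0 : ℝ) 1)))

instance (δ : ℝ) : IsFiniteMeasure (sphereIntervalMeasure δ) := by
  unfold sphereIntervalMeasure; infer_instance

omit hU in
lemma ae_sphereIntervalMeasure (δ : ℝ) : ∀ᵐ p ∂(sphereIntervalMeasure δ),
    p ∈ Metric.sphere (0 : R3) 1 ×ˢ (Icc (-δ) δ ×ˢ Icc (0 : ℝ) 1) := by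
  have h1 : ∀ᵐ x ∂(volume.restrict (Ioc (-δ) δ)), x ∈ Icc (-δ) δ :=
    (ae_restrict_mem measurableSet_Ioc).mono fun x hx => Ioc_subset_Icc_self hx
  have h2 : ∀ᵐ x ∂(volume.restrict (Ioc (0 : ℝ) 1)), x ∈ Icc (0 : ℝ) 1 :=
    (ae_restrict_mem measurableSet_Ioc).mono fun x hx => Ioc_subset_Icc_self hx
  have q1 : ∀ᵐ p ∂(sphereIntervalMeasure δ), p.1 ∈ Metric.sphere (0 : R3) 1 :=
    Measure.quasiMeasurePreserving_fst.ae ae_ambientSphereMeasure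
  have q2 : ∀ᵐ p ∂(sphereIntervalMeasure δ), p.2 ∈ Icc (-δ) δ ×ˢ Icc (0 : ℝ) 1 := by
    refine Measure.quasiMeasurePreserving_snd.ae (p := fun q => q ∈ Icc (-δ) δ ×ˢ Icc (0 : ℝ) 1) ?_
    filter_upwards [Measure.quasiMeasurePreserving_fst.ae h1,
      Measure.quasiMeasurePreserving_snd.ae h2] with q a b
    exact ⟨a, b⟩
  filter_upwards [q1, q2] with p a b
  exact ⟨a, b⟩

/-- An integral over directions and an interval, and its smooth dependence on parameters. -/
lemma contDiffOn_sphereInterval {δ : ℝ} (hδ : 0 < δ) {V : Set (ℝ × ℝ)} (hV : IsOpen V)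
    (hδV : Icc (-δ) δ ×ˢ Icc (0 : ℝ) 1 ⊆ V) {g : E × (R3 × (ℝ × ℝ)) → ℂ}
    (hg : ContDiffOn ℝ ∞ g (U ×ˢ (univ ×ˢ V))) :
    (∀ k ∈ U, Integrable (fun n : S2 => ∫ x in (-δ)..δ, ∫ t in (0 : ℝ)..1, g (k, ((n : R3), (x, t))))
      sphereMeasure) ∧
    ContDiffOn ℝ ∞ (fun k => ∫ n : S2, (∫ x in (-δ)..δ, ∫ t in (0 : ℝ)..1,
      g (k, ((n : R3), (x, t)))) ∂sphereMeasure) U := by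
  have hZ : IsCompact (Metric.sphere (0 : R3) 1 ×ˢ (Icc (-δ) δ ×ˢ Icc (0 : ℝ) 1)) :=
    (isCompact_sphere _ _).prod (isCompact_Icc.prod isCompact_Icc)
  have hsub : Metric.sphere (0 : R3) 1 ×ˢ (Icc (-δ) δ ×ˢ Icc (0 : ℝ) 1) ⊆ univ ×ˢ V :=
    prod_mono (subset_univ _) hδV
  have hint : ∀ k ∈ U, Integrable (fun p => g (k, p)) (sphereIntervalMeasure δ) := fun k hk => by
    have hc : ContinuousOn (fun p => g (k, p))
        (Metric.sphere (0 : R3) 1 ×ˢ (Icc (-δ) δ ×ˢ Icc (0 : ℝ) 1)) :=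
      hg.continuousOn.comp (by fun_prop) fun p hp => ⟨hk, hsub hp⟩
    have h2 := hc.integrableOn_compact (μ := sphereIntervalMeasure δ) hZ
    rwa [IntegrableOn, Measure.restrict_eq_self_of_ae_mem (ae_sphereIntervalMeasure δ)] at h2
  have hiter : ∀ k ∈ U, Integrable (fun n : R3 => ∫ x in (-δ)..δ, ∫ t in (0 : ℝ)..1,
      g (k, (n, (x, t)))) ambientSphereMeasure ∧
      ∫ p, g (k, p) ∂(sphereIntervalMeasure δ) =
      ∫ n : S2, (∫ x in (-δ)..δ, ∫ t in (0 : ℝ)..1, g (k, ((n : R3), (x, t)))) ∂sphereMeasure :=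
    fun k hk => by
    have h := hint k hk
    have e : ∀ᵐ n ∂ambientSphereMeasure, ∫ q, g (k, (n, q)) ∂((volume.restrict (Ioc (-δ) δ)).prod
        (volume.restrict (Ioc (0 : ℝ) 1))) =
        ∫ x in (-δ)..δ, ∫ t in (0 : ℝ)..1, g (k, (n, (x, t))) := by
      filter_upwards [h.prod_right_ae] with n hn
      rw [integral_prod _ hn, intervalIntegral.integral_of_le (by linarith)]
      simp only [intervalIntegral.integral_of_le zero_le_one]
    refine ⟨h.integral_prod_left.congr e, ?_⟩
    rw [← integral_ambientSphereMeasure fun n => ∫ x in (-δ)..δ, ∫ t in (0 : ℝ)..1,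
      g (k, (n, (x, t)))]
    exact (integral_prod _ h).trans (integral_congr_ae e)
  refine ⟨fun k hk => ?_, ?_⟩
  · exact (MeasurableEmbedding.subtype_coe
      (Metric.isClosed_sphere.measurableSet)).integrable_map_iff.1 (hiter k hk).1
  · exact (contDiffOn_integral_of_isCompact hU (isOpen_univ.prod hV) hZ hsub hg
      (ae_sphereIntervalMeasure δ)).congr fun k hk => ((hiter k hk).2).symm

lemma contDiffOn_sphere_interval_integral {δ δ' : ℝ} (hδ : 0 < δ) (hδ' : δ < δ')
    {g : E × (R3 × ℝ) → ℂ} (hg : ContDiffOn ℝ ∞ g (U ×ˢ (univ ×ˢ Ioo (-δ') δ'))) :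
    (∀ k ∈ U, Integrable (fun n : S2 => ∫ x in (-δ)..δ, g (k, ((n : R3), x))) sphereMeasure) ∧
    ContDiffOn ℝ ∞ (fun k => ∫ n : S2, (∫ x in (-δ)..δ, g (k, ((n : R3), x))) ∂sphereMeasure)
      U := by
  have h := contDiffOn_sphereInterval hU hδ (V := Ioo (-δ') δ' ×ˢ univ)
    (isOpen_Ioo.prod isOpen_univ)
    (prod_mono (fun x hx => ⟨by linarith [hx.1], by linarith [hx.2]⟩) (subset_univ _))
    (g := fun p => g (p.1, (p.2.1, p.2.2.1)))
    (hg.comp (f := fun p : E × (R3 × (ℝ × ℝ)) => (p.1, (p.2.1, p.2.2.1)))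
      (by fun_prop) fun p hp => ⟨hp.1, hp.2.1, hp.2.2.1⟩)
  simpa using h

/-- Hadamard's formula: the divided difference is the integral of `ψ'(tx)` over `t` in `[0, 1]`,
which is smooth in the parameter and has no singularity at `x = 0`. -/
lemma contDiffOn_sphere_divided_difference {δ δ' : ℝ} (hδ : 0 < δ) (hδ' : δ < δ')
    {ψ : E × (R3 × ℝ) → ℂ} (hψ : ContDiffOn ℝ ∞ ψ (U ×ˢ (univ ×ˢ Ioo (-δ') δ'))) :
    (∀ k ∈ U, Integrable (fun n : S2 => ∫ x in (-δ)..δ,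
      (ψ (k, ((n : R3), x)) - ψ (k, ((n : R3), 0))) / (x : ℂ)) sphereMeasure) ∧
    ContDiffOn ℝ ∞ (fun k => ∫ n : S2, (∫ x in (-δ)..δ,
      (ψ (k, ((n : R3), x)) - ψ (k, ((n : R3), 0))) / (x : ℂ)) ∂sphereMeasure) U := by
  have hW : IsOpen (U ×ˢ ((univ : Set R3) ×ˢ Ioo (-δ') δ')) := hU.prod (isOpen_univ.prod isOpen_Ioo)
  -- The open set on which `ψ` is defined at `tx`; it contains `[-δ, δ] × [0, 1]` because `0 ≤ t ≤
  -- 1` and `δ < δ'`.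
  set V : Set (ℝ × ℝ) := {q | q.2 * q.1 ∈ Ioo (-δ') δ'} with hVdef
  have hV : IsOpen V := isOpen_Ioo.preimage (f := fun q : ℝ × ℝ => q.2 * q.1) (by fun_prop)
  have hδV : Icc (-δ) δ ×ˢ Icc (0 : ℝ) 1 ⊆ V := fun q hq => by
    have h1 := abs_le.2 hq.1
    have h2 : |q.2 * q.1| < δ' := by
      rw [abs_mul, abs_of_nonneg hq.2.1]
      nlinarith [hq.2.1, hq.2.2, abs_nonneg q.1]
    exact abs_lt.1 h2
  set g : E × (R3 × (ℝ × ℝ)) → ℂ := fun p =>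
    fderiv ℝ ψ (p.1, (p.2.1, p.2.2.2 * p.2.2.1)) (0, (0, 1)) with hgdef
  have hd : ContDiffOn ℝ ∞ (fderiv ℝ ψ) (U ×ˢ ((univ : Set R3) ×ˢ Ioo (-δ') δ')) :=
    hψ.fderiv_of_isOpen hW (by norm_num)
  have hg : ContDiffOn ℝ ∞ g (U ×ˢ (univ ×ˢ V)) :=
    (hd.comp (f := fun p : E × (R3 × (ℝ × ℝ)) => (p.1, (p.2.1, p.2.2.2 * p.2.2.1)))
      (by fun_prop) fun p hp => ⟨hp.1, mem_univ _, hp.2.2⟩).clm_apply contDiffOn_const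
  have h := contDiffOn_sphereInterval hU hδ hV hδV hg
  have key : ∀ k ∈ U, ∀ n : S2, ∫ x in (-δ)..δ, ∫ t in (0 : ℝ)..1, g (k, ((n : R3), (x, t))) =
      ∫ x in (-δ)..δ, (ψ (k, ((n : R3), x)) - ψ (k, ((n : R3), 0))) / (x : ℂ) := fun k hk n => by
    refine intervalIntegral.integral_congr_ae ?_
    have h0 : ∀ᵐ x : ℝ, x ≠ 0 := by simp [ae_iff, measure_singleton]
    filter_upwards [h0] with x hx hxδ
    rw [uIoc_of_le (by linarith)] at hxδ
    have hxI : x ∈ Icc (-δ) δ := Ioc_subset_Icc_self hxδ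
    have hmem : ∀ t ∈ uIcc (0 : ℝ) 1, (k, ((n : R3), t * x)) ∈
        U ×ˢ ((univ : Set R3) ×ˢ Ioo (-δ') δ') := fun t ht => by
      rw [uIcc_of_le zero_le_one] at ht
      exact ⟨hk, mem_univ _, hδV (a := (x, t)) ⟨hxI, ht⟩⟩
    have hder : ∀ t ∈ uIcc (0 : ℝ) 1, HasDerivAt (fun t : ℝ => ψ (k, ((n : R3), t * x)))
        ((x : ℂ) * g (k, ((n : R3), (x, t)))) t := fun t ht => by
      have h3 : HasDerivAt (fun t : ℝ => (k, ((n : R3), t * x))) ((0 : E), ((0 : R3), x)) t :=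
        (hasDerivAt_const t k).prodMk ((hasDerivAt_const t (n : R3)).prodMk
          (by simpa using (hasDerivAt_id t).mul_const x))
      have h4 := ((hψ.contDiffAt (hW.mem_nhds (hmem t ht))).differentiableAt
        (by norm_num)).hasFDerivAt
      refine (h4.comp_hasDerivAt t h3).congr_deriv ?_
      have h5 : ((0 : E), ((0 : R3), x)) = x • ((0 : E), ((0 : R3), (1 : ℝ))) := by simp
      rw [h5, map_smul, Complex.real_smul]
    have hcont : ContinuousOn (fun t : ℝ => (x : ℂ) * g (k, ((n : R3), (x, t)))) (uIcc (0 : ℝ) 1) := by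
      refine continuousOn_const.mul (hg.continuousOn.comp (f := fun t : ℝ => (k, ((n : R3), (x, t))))
        (by fun_prop) fun t ht => ?_)
      rw [uIcc_of_le zero_le_one] at ht
      exact ⟨hk, mem_univ _, hδV ⟨hxI, ht⟩⟩
    have h6 := intervalIntegral.integral_eq_sub_of_hasDerivAt hder hcont.intervalIntegrable
    rw [intervalIntegral.integral_const_mul] at h6
    have hx' : (x : ℂ) ≠ 0 := by exact_mod_cast hx
    simp only [one_mul, zero_mul] at h6
    rw [← h6, mul_div_cancel_left₀ _ hx']
  refine ⟨fun k hk => (h.1 k hk).congr (Eventually.of_forall (key k hk)), h.2.congr fun k hk => ?_⟩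
  exact integral_congr_ae (Eventually.of_forall fun n => (key k hk n).symm)

end SphereParameter


/-! ### Limits of the regularized integrals over the mass shell -/

section RetardedLimit

open Complex

/-- The regularized integrals converge to `Lim`, with bounds that are uniform on `N`. -/
def HasLimit (m : ℝ) (N : Set R4) (s : R4 → R4 → ℝ) (Lim : ℝ → 𝓢(R4, ℂ) → R4 → ℂ) : Prop :=
  ∃ C, 0 ≤ C ∧ ∀ σ : ℝ, (σ = 1 ∨ σ = -1) → ∀ k ∈ N, ∀ φ : 𝓢(R4, ℂ),
    (∀ ε > 0, Integrable (regular σ ε s φ k) (deltaPlus m) ∧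
      ‖∫ l, regular σ ε s φ k l ∂(deltaPlus m)‖ ≤ C * schwartzNorm 4 φ) ∧
    Tendsto (fun ε => ∫ l, regular σ ε s φ k l ∂(deltaPlus m)) (𝓝[>] 0) (𝓝 (Lim σ φ k))

variable {m δ : ℝ} (hm : 0 < m) (hδ : 0 < δ) {N : Set R4}
include hm hδ

omit hδ in
lemma integrable_mul_far {η : ℝ → ℝ} (hη : Function.HasTemperateGrowth η) {B : ℝ}
    (hB : ∀ x, |η x| ≤ B) (k : R4) (φ : 𝓢(R4, ℂ)) :
    Integrable (fun l => φ l * ((η (pole k l) : ℝ) : ℂ)) (deltaPlus m) := by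
  refine (integrable_schwartz_deltaPlus hm φ).mul_bdd (c := B) ?_ (Eventually.of_forall fun l => ?_)
  · have h1 : Continuous fun l => pole k l := by unfold pole; fun_prop
    exact (continuous_ofReal.comp (hη.1.continuous.comp h1)).aestronglyMeasurable
  · rw [norm_real]
    exact hB _

omit hδ in
lemma contDiffOn_nearAmp {η : ℝ}
    (hN : ∀ k ∈ N, 0 < mdot k k ∧ 0 < k 0 ∧ η ≤ mdot k k - 2 * m * Real.sqrt (mdot k k))
    (φ : 𝓢(R4, ℂ)) :
    ContDiffOn ℝ ∞ (fun p : R4 × (R3 × ℝ) => nearAmp m p.1 φ p.2.1 p.2.2)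
      (interior N ×ˢ (univ ×ˢ Ioo (-η) η)) := by
  have hsub : ∀ p ∈ interior N ×ˢ ((univ : Set R3) ×ˢ Ioo (-η) η), (p.1, p.2.2) ∈ nearDomain m :=
    fun p hp => by
      obtain ⟨h1, h2, h3⟩ := hN p.1 (interior_subset hp.1)
      exact mem_nearDomain hm h1 h2 h3 hp.2.2.2
  unfold nearAmp
  have h1 : ContDiffOn ℝ ∞ (fun p : R4 × (R3 × ℝ) => nearRadius m p.1 p.2.2)
      (interior N ×ˢ (univ ×ˢ Ioo (-η) η)) :=
    (contDiffOn_nearRadius m).comp (t := nearDomain m)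
      (f := fun p : R4 × (R3 × ℝ) => (p.1, p.2.2))
      (contDiff_fst.prodMk (contDiff_snd.comp contDiff_snd)).contDiffOn hsub
  have h2 : ContDiffOn ℝ ∞ (fun p : R4 × (R3 × ℝ) => 4 * Real.sqrt (mdot p.1 p.1))
      (interior N ×ˢ (univ ×ˢ Ioo (-η) η)) :=
    contDiffOn_const.mul (ContDiffOn.sqrt (contDiff_mdot contDiff_fst contDiff_fst).contDiffOn
        fun p hp => (hsub p hp).1.ne')
  have h3 := h1.div h2 fun p hp => by
    have := Real.sqrt_pos.2 (hsub p hp).1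
    positivity
  exact (ofRealCLM.contDiff.comp_contDiffOn h3).mul
    ((φ.smooth ⊤).comp_contDiffOn ((contDiffOn_nearPoint hm).mono hsub))

/-- The limit of the regularized integrals, above the threshold. -/
theorem exists_hasLimit_above (hNc : IsCompact N)
    (hN : ∀ k ∈ N, 0 < mdot k k ∧ 0 < k 0 ∧ 2 * δ ≤ mdot k k - 2 * m * Real.sqrt (mdot k k)) :
    ∃ Lim : ℝ → 𝓢(R4, ℂ) → R4 → ℂ, (∀ σ φ, ContDiffOn ℝ ∞ (Lim σ φ) (interior N)) ∧
      ∀ s s₀ L, IsRegularizer m δ N s s₀ L → HasLimit m N s Lim := by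
  obtain ⟨η, hη, ⟨B, hB⟩, hηδ⟩ := exists_farFunction hδ
  -- The region of integration depends on `k`, which obscures smoothness. The far part is therefore
  -- written as an integral of a smooth function over the whole shell, minus its part near the zero
  -- in the coordinates `(n, x)`.
  have hfarN : ∀ k ∈ N, ∀ φ : 𝓢(R4, ℂ), ∫ l in (nearSet δ k)ᶜ, φ l / (pole k l : ℂ) ∂(deltaPlus m) =
      (∫ l, φ l * ((η (pole k l) : ℝ) : ℂ) ∂(deltaPlus m)) - (1 / (2 * Real.pi) : ℝ) *
        ∫ n : S2, (∫ x in (-δ)..δ, ((η x : ℝ) : ℂ) * nearAmp m k φ n x) ∂sphereMeasure :=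
    fun k hk φ => by
    obtain ⟨hK, hk0, hKδ⟩ := hN k hk
    have hi := integrable_mul_far hm hη hB k φ
    have h1 := (near_integral hm hK hk0 hδ (by linarith) hi).2
    have h2 : ∀ n : S2, ∫ x in (-δ)..δ, ((nearRadius m k x / (4 * Real.sqrt (mdot k k)) : ℝ) : ℂ) *
        (φ (nearPoint m k n x) * ((η (pole k (nearPoint m k n x)) : ℝ) : ℂ)) =
        ∫ x in (-δ)..δ, ((η x : ℝ) : ℂ) * nearAmp m k φ n x := fun n => by
      refine intervalIntegral.integral_congr fun x hx => ?_
      rw [uIcc_of_le (by linarith)] at hx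
      rw [pole, mdot_nearPoint (mem_nearDomain_of_mem hm hδ hN hk hx), nearAmp]
      ring_nf
    simp only [h2] at h1
    rw [← h1]
    have h3 := integral_add_compl (measurableSet_nearSet δ k) hi
    have h4 : ∫ l in (nearSet δ k)ᶜ, φ l / (pole k l : ℂ) ∂(deltaPlus m) =
        ∫ l in (nearSet δ k)ᶜ, φ l * ((η (pole k l) : ℝ) : ℂ) ∂(deltaPlus m) := by
      refine setIntegral_congr_fun (measurableSet_nearSet δ k).compl fun l hl => ?_
      have : δ ≤ |pole k l| := not_lt.1 hl
      rw [hηδ _ this, ofReal_inv, div_eq_mul_inv]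
    rw [h4, ← h3]
    exact (add_sub_cancel_left _ _).symm
  -- The limit is given without reference to the function `s`, so every regularization has the same
  -- limit.
  refine ⟨fun σ φ k => (∫ l in (nearSet δ k)ᶜ, φ l / (pole k l : ℂ) ∂(deltaPlus m)) +
    (1 / (2 * Real.pi) : ℝ) * ∫ n : S2, nearTerm m δ σ k φ n ∂sphereMeasure, fun σ φ => ?_,
    fun s s₀ L hs => ?_⟩
  · have hψ := contDiffOn_nearAmp hm hN φ
    have hD := contDiffOn_sphere_divided_difference isOpen_interior hδ (by linarith) hψ
    have hE := contDiffOn_sphere_interval_integral isOpen_interior hδ (by linarith : δ < 2 * δ)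
      (g := fun p : R4 × (R3 × ℝ) => ((η p.2.2 : ℝ) : ℂ) * nearAmp m p.1 φ p.2.1 p.2.2)
      ((ofRealCLM.contDiff.comp (hη.1.comp (contDiff_snd.comp contDiff_snd))).contDiffOn.mul hψ)
    have h0 : ContDiffOn ℝ ∞ (fun p : R4 × R3 => I * (σ * Real.pi : ℝ) * nearAmp m p.1 φ p.2 0)
        (interior N ×ˢ univ) := by
      refine contDiffOn_const.mul (hψ.comp (f := fun p : R4 × R3 => (p.1, (p.2, (0 : ℝ))))
        (by fun_prop) fun p hp => ⟨hp.1, mem_univ _, by simpa using hδ⟩)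
    have hF := contDiffOn_sphere_integral isOpen_interior h0
    have h0i : ∀ k ∈ interior N, Integrable
        (fun n : S2 => I * (σ * Real.pi : ℝ) * nearAmp m k φ n 0) sphereMeasure := fun k hk => by
      have hc : Continuous fun n : R3 => I * (σ * Real.pi : ℝ) * nearAmp m k φ n 0 :=
        continuousOn_univ.1 (h0.continuousOn.comp (f := fun n : R3 => (k, n))
          (by fun_prop) fun n _ => ⟨hk, mem_univ _⟩)
      exact (hc.comp continuous_subtype_val).integrable_of_hasCompactSupport
        (HasCompactSupport.of_compactSpace _)
    have hG : ContDiffOn ℝ ∞ (fun k => ∫ l, φ l * ((η (pole k l) : ℝ) : ℂ) ∂(deltaPlus m))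
        (interior N) := by
      have := (contDiff_far hm hη (-2) φ).contDiffOn (s := interior N)
      refine this.congr fun k hk => ?_
      simp only [pole, neg_mul, sub_eq_add_neg]
    refine ((hG.sub ((contDiffOn_const (c := ((1 / (2 * Real.pi) : ℝ) : ℂ))).mul hE.2)).add
      ((contDiffOn_const (c := ((1 / (2 * Real.pi) : ℝ) : ℂ))).mul (hD.2.sub hF))).congr
      fun k hk => ?_
    beta_reduce
    rw [hfarN k (interior_subset hk)]
    simp only [nearTerm]
    rw [integral_sub (hD.1 k hk) (h0i k hk)]
  · obtain ⟨C₁, hC₁, hnear⟩ := hs.tendsto_near hm hδ hN hNc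
    obtain ⟨C₂, hC₂, hint⟩ := exists_integral_norm_le hm
    refine ⟨C₁ + δ⁻¹ * C₂, by positivity, fun σ hσ k hk φ => ?_⟩
    obtain ⟨a1, a2⟩ := hnear σ hσ k hk φ
    obtain ⟨b1, b2⟩ := hs.tendsto_far hm hδ hσ hk φ
    have hsplit : ∀ ε > 0, (∫ l in (nearSet δ k)ᶜ, regular σ ε s φ k l ∂(deltaPlus m)) +
        ∫ l in nearSet δ k, regular σ ε s φ k l ∂(deltaPlus m) =
        ∫ l, regular σ ε s φ k l ∂(deltaPlus m) := fun ε hε => by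
      rw [add_comm]
      exact integral_add_compl (measurableSet_nearSet δ k) (hs.integrable hm hδ hσ hε hk φ)
    refine ⟨fun ε hε => ⟨hs.integrable hm hδ hσ hε hk φ, ?_⟩, ?_⟩
    · rw [← hsplit ε hε]
      refine (norm_add_le _ _).trans ((add_le_add (b1 ε hε) (a1 ε hε)).trans ?_)
      have h1 := hint φ
      have h2 := schwartzNorm_mono (by norm_num : 1 ≤ 4) φ
      calc _ ≤ δ⁻¹ * (C₂ * schwartzNorm 4 φ) + C₁ * schwartzNorm 4 φ := by gcongr
        _ = _ := by ring
    · refine Tendsto.congr' ?_ (b2.add a2)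
      filter_upwards [self_mem_nhdsWithin] with ε hε
      exact hsplit ε hε

/-- The limit of the regularized integrals, below the threshold. -/
theorem exists_hasLimit_below
    (hN : ∀ k ∈ N, 0 < mdot k k ∧ 0 < k 0 ∧ mdot k k - 2 * m * Real.sqrt (mdot k k) ≤ -δ) :
    ∃ Lim : ℝ → 𝓢(R4, ℂ) → R4 → ℂ, (∀ σ φ, ContDiffOn ℝ ∞ (Lim σ φ) (interior N)) ∧
      ∀ s s₀ L, IsRegularizer m δ N s s₀ L → HasLimit m N s Lim := by
  obtain ⟨η, hη, ⟨B, hB⟩, hηδ⟩ := exists_farFunction hδ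
  -- On the shell `k·l ≥ m√k²`, so `k² - 2 k·l ≤ k² - 2m√k² ≤ -δ` and the near region is empty.
  have hshell : ∀ k ∈ N, ∀ᵐ l ∂(deltaPlus m), l ∈ (nearSet δ k)ᶜ := fun k hk => by
    refine ae_deltaPlus fun v => ?_
    obtain ⟨hK, hk0, hKδ⟩ := hN k hk
    have h1 := omega_shellBoost hm (mdot_velocity hK) (velocity_zero_pos hK hk0) v
    have h2 : m ≤ mdot (velocity k) (onShell m v) := h1 ▸ le_omega m _
    have h3 : mdot k (onShell m v) = Real.sqrt (mdot k k) * mdot (velocity k) (onShell m v) := by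
      have := Real.sqrt_pos.2 hK
      rw [velocity, mdot_smul_left]
      field_simp
    rw [mem_compl_iff, nearSet, mem_ofPred_eq, not_lt]
    refine le_trans ?_ (neg_le_abs _)
    have := mul_le_mul_of_nonneg_left h2 (Real.sqrt_nonneg (mdot k k))
    rw [h3]
    linarith
  have hcompl : ∀ k ∈ N, ∀ f : R4 → ℂ, ∫ l in (nearSet δ k)ᶜ, f l ∂(deltaPlus m) =
      ∫ l, f l ∂(deltaPlus m) := fun k hk f => by
    rw [Measure.restrict_eq_self_of_ae_mem (hshell k hk)]
  refine ⟨fun σ φ k => ∫ l, φ l / (pole k l : ℂ) ∂(deltaPlus m), fun σ φ => ?_,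
    fun s s₀ L hs => ?_⟩
  · have := (contDiff_far hm hη (-2) φ).contDiffOn (s := interior N)
    refine this.congr fun k hk => ?_
    refine integral_congr_ae ?_
    filter_upwards [hshell k (interior_subset hk)] with l hl
    have : δ ≤ |pole k l| := not_lt.1 hl
    have e : mdot k k + -2 * mdot k l = pole k l := by unfold pole; ring
    rw [e, hηδ _ this, ofReal_inv, div_eq_mul_inv]
  · obtain ⟨C₂, hC₂, hint⟩ := exists_integral_norm_le hm
    refine ⟨δ⁻¹ * C₂, by positivity, fun σ hσ k hk φ => ?_⟩
    obtain ⟨b1, b2⟩ := hs.tendsto_far hm hδ hσ hk φ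
    simp only [hcompl k hk] at b1 b2
    refine ⟨fun ε hε => ⟨hs.integrable hm hδ hσ hε hk φ, ?_⟩, b2⟩
    refine (b1 ε hε).trans ?_
    rw [mul_assoc]
    exact mul_le_mul_of_nonneg_left (hint φ) (by positivity)

end RetardedLimit


/-! ### The two regularizations and their common limit -/

section Regularizers

/-- The regularization by the energy denominator `(k - l)² - m² + i ε (k₀ - l₀)`. -/
noncomputable def energyGap (k l : R4) : ℝ := k 0 - l 0

/-- The regularization that is symmetric under the rotations that fix `k`. -/
noncomputable def symmetricGap (k l : R4) : ℝ := 4 * mdot k k / (mdot k k + 2 * mdot k l)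

variable {m δ : ℝ} (hm : 0 < m) (hδ : 0 < δ) {N : Set R4}
include hm

/-- Near the pole `p = k - l` satisfies `p² ≥ m² - δ ≥ m²/2` and `2 k·p = k² + pole > 0`. So `p` is
timelike and, like `k`, forward, and its energy is at least `m/√2`. -/
lemma half_mass_le_energyGap {k : R4} (hk : 0 < mdot k k) (hk0 : 0 < k 0) (hδm : 2 * δ ≤ m ^ 2)
    (hδK : δ < mdot k k) {v : R3} (h : |pole k (onShell m v)| ≤ δ) :
    m / 2 ≤ energyGap k (onShell m v) := by
  set p := k - onShell m v with hp
  have h1 := (abs_le.1 h).1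
  have e1 : mdot p p = pole k (onShell m v) + m ^ 2 := by
    rw [hp, mdot_sub_left, mdot_sub_right, mdot_sub_right, mdot_onShell_self, pole,
      mdot_comm (onShell m v) k]
    ring
  have e2 : 2 * mdot k p = mdot k k + pole k (onShell m v) := by
    rw [hp, mdot_sub_right, pole]; ring
  have hpp : m ^ 2 / 2 ≤ mdot p p := by rw [e1]; linarith
  have hsq : mdot p p ≤ p 0 ^ 2 := by
    simp only [mdot]; nlinarith [sq_nonneg (p 1), sq_nonneg (p 2), sq_nonneg (p 3)]
  have hp0 : 0 < p 0 := by
    by_contra hneg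
    have hne : p 0 ≠ 0 := fun h0 => by
      rw [h0] at hsq
      nlinarith [sq_pos_of_pos hm]
    have h3 : 0 < (-p) 0 := by
      have : p 0 < 0 := lt_of_le_of_ne (not_lt.1 hneg) hne
      simpa using this
    have h4 : mdot (-p) (-p) = mdot p p := by simp [mdot]
    have h5 := mdot_pos hk hk0 (by rw [h4]; nlinarith [sq_pos_of_pos hm]) h3
    have h6 : mdot k (-p) = -mdot k p := by simp [mdot]; ring
    linarith
  have : energyGap k (onShell m v) = p 0 := by simp [energyGap, hp]
  rw [this]
  nlinarith

include hδ

omit hm in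
-- Below the threshold the argument of the root in `nearRadius` is nonpositive, where the real
-- square root takes the value zero. The points no longer depend on `x`, and the Lipschitz condition
-- of a regularizer holds trivially.
lemma nearPoint_eq_of_below {k : R4} (hk : 0 < mdot k k)
    (h : mdot k k - 2 * m * Real.sqrt (mdot k k) ≤ -(2 * δ)) (hδK : δ < mdot k k) {x : ℝ}
    (hx : x ∈ Icc (-δ) δ) (n : R3) : nearPoint m k n x = nearPoint m k n 0 := by
  have key : ∀ x ∈ Icc (-δ) δ, nearRadius m k x = 0 := fun x hx => by
    rw [nearRadius, Real.sqrt_eq_zero']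
    have hs := Real.sq_sqrt hk.le
    rw [sub_nonpos, div_le_iff₀ (by positivity)]
    calc (mdot k k - x) ^ 2 ≤ (2 * m * Real.sqrt (mdot k k)) ^ 2 := by
          have := hx.1
          have := hx.2
          gcongr <;> linarith
      _ = _ := by rw [mul_pow, hs]; ring
  rw [nearPoint, nearPoint, key x hx, key 0 ⟨by linarith, hδ.le⟩]

lemma isRegularizer_energyGap (hδm : 2 * δ ≤ m ^ 2) (hNc : IsCompact N)
    (hδK : ∀ k ∈ N, 2 * δ < mdot k k)
    (hN : (∀ k ∈ N, 0 < mdot k k ∧ 0 < k 0 ∧ 2 * δ ≤ mdot k k - 2 * m * Real.sqrt (mdot k k)) ∨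
      ∀ k ∈ N, 0 < mdot k k ∧ 0 < k 0 ∧
        mdot k k - 2 * m * Real.sqrt (mdot k k) ≤ -(2 * δ)) :
    ∃ s₀ L, IsRegularizer m δ N energyGap s₀ L := by
  have hpos : ∀ k ∈ N, 0 < mdot k k ∧ 0 < k 0 := fun k hk => by
    rcases hN with h | h
    · exact ⟨(h k hk).1, (h k hk).2.1⟩
    · exact ⟨(h k hk).1, (h k hk).2.1⟩
  have hlip : ∃ L, 0 ≤ L ∧ ∀ k ∈ N, ∀ n : S2, ∀ x ∈ Icc (-δ) δ,
      ‖nearPoint m k n x - nearPoint m k n 0‖ ≤ L * |x| := by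
    rcases hN with h | h
    · have hW : IsOpen {p : R4 × (R3 × ℝ) | (p.1, p.2.2) ∈ nearDomain m} :=
        (isOpen_nearDomain m).preimage (f := fun p : R4 × (R3 × ℝ) => (p.1, p.2.2)) (by fun_prop)
      obtain ⟨L, hL, hL'⟩ := exists_lipschitz_const hW (contDiffOn_nearPoint hm) hNc hδ
        fun k hk n x hx => mem_nearDomain_of_mem hm hδ h hk hx
      exact ⟨L, hL, fun k hk n x hx => (hL' k hk n x hx).2⟩
    · refine ⟨0, le_rfl, fun k hk n x hx => ?_⟩
      rw [nearPoint_eq_of_below hδ (h k hk).1 (h k hk).2.2 (by linarith [hδK k hk]) hx, sub_self,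
        norm_zero, zero_mul]
  obtain ⟨L, hL, hL'⟩ := hlip
  refine ⟨m / 2, L, by positivity, hL, fun k hk => ?_, fun k hk v hv => ?_, fun k hk n x hx => ?_⟩
  · have := continuous_onShell m
    unfold energyGap
    fun_prop
  · exact half_mass_le_energyGap hm (hpos k hk).1 (hpos k hk).2 hδm (by linarith [hδK k hk]) hv
  · refine le_trans ?_ (hL' k hk n x hx)
    have : energyGap k (nearPoint m k n x) - energyGap k (nearPoint m k n 0) =
        -(nearPoint m k n x - nearPoint m k n 0) 0 := by simp [energyGap]
    rw [this, abs_neg, ← Real.norm_eq_abs]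
    exact PiLp.norm_apply_le _ _

/-- On the near points this function is `4k²/(2k² - x)`, and the condition `k² > 2δ` keeps the
denominator at least `2δ`. -/
lemma isRegularizer_symmetricGap (hδK : ∀ k ∈ N, 2 * δ < mdot k k)
    (hN : (∀ k ∈ N, 0 < mdot k k ∧ 0 < k 0 ∧ 2 * δ ≤ mdot k k - 2 * m * Real.sqrt (mdot k k)) ∨
      ∀ k ∈ N, 0 < mdot k k ∧ 0 < k 0 ∧
        mdot k k - 2 * m * Real.sqrt (mdot k k) ≤ -(2 * δ)) :
    ∃ s₀ L, IsRegularizer m δ N symmetricGap s₀ L := by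
  have hpos : ∀ k ∈ N, 0 < mdot k k ∧ 0 < k 0 := fun k hk => by
    rcases hN with h | h
    · exact ⟨(h k hk).1, (h k hk).2.1⟩
    · exact ⟨(h k hk).1, (h k hk).2.1⟩
  refine ⟨1, δ⁻¹, one_pos, by positivity, fun k hk => ?_, fun k hk v hv => ?_, fun k hk n x hx => ?_⟩
  · have h1 : Continuous fun v => mdot k k + 2 * mdot k (onShell m v) := by
      have := continuous_onShell m
      fun_prop
    refine continuous_const.div h1 fun v => ?_
    have := mdot_onShell_pos hm (hpos k hk).1 (hpos k hk).2 v
    have := (hpos k hk).1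
    positivity
  · have h1 := mdot_onShell_pos hm (hpos k hk).1 (hpos k hk).2 v
    have h2 := (hpos k hk).1
    have h3 := (abs_le.1 hv).1
    have h4 := hδK k hk
    rw [pole] at h3
    rw [symmetricGap, le_div_iff₀ (by positivity)]
    linarith
  · rcases hN with h | h
    · have e : ∀ x ∈ Icc (-δ) δ, symmetricGap k (nearPoint m k n x) =
          4 * mdot k k / (2 * mdot k k - x) := fun x hx => by
        rw [symmetricGap, mdot_nearPoint (mem_nearDomain_of_mem hm hδ h hk hx)]
        ring_nf
      have h4 := hδK k hk
      have h5 : 2 * δ ≤ 2 * mdot k k - x := by linarith [hx.2]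
      have h6 : 0 < mdot k k := (hpos k hk).1
      have h7 : 0 < 2 * mdot k k - x := by linarith
      rw [e x hx, e 0 ⟨by linarith, hδ.le⟩]
      have e2 : 4 * mdot k k / (2 * mdot k k - x) - 4 * mdot k k / (2 * mdot k k - 0) =
          (2 * x) / (2 * mdot k k - x) := by
        have h8 : 2 * mdot k k ≠ 0 := by positivity
        rw [sub_zero, div_sub_div _ _ h7.ne' h8, div_eq_div_iff (mul_ne_zero h7.ne' h8) h7.ne']
        ring
      rw [e2, abs_div, abs_mul, abs_two, abs_of_pos h7, div_le_iff₀ h7]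
      calc 2 * |x| = δ⁻¹ * |x| * (2 * δ) := by field_simp
        _ ≤ _ := by gcongr
    · rw [nearPoint_eq_of_below hδ (h k hk).1 (h k hk).2.2 (by linarith [hδK k hk]) hx, sub_self,
        abs_zero]
      positivity

omit hδ in
/-- The limits of the regularized integrals in a neighbourhood of a forward timelike momentum. -/
theorem exists_local_hasLimit {k₀ : R4} (hk : 0 < mdot k₀ k₀) (hk0 : 0 < k₀ 0)
    (hk4 : mdot k₀ k₀ ≠ 4 * m ^ 2) :
    ∃ N ∈ 𝓝 k₀, IsCompact N ∧ (∃ δ > 0, ∀ k ∈ N, δ ≤ mdot k k ∧ 0 < k 0 ∧ mdot k k ≠ 4 * m ^ 2) ∧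
      ∃ Lim : ℝ → 𝓢(R4, ℂ) → R4 → ℂ, (∀ σ φ, ContDiffOn ℝ ∞ (Lim σ φ) (interior N)) ∧
        HasLimit m N energyGap Lim ∧ HasLimit m N symmetricGap Lim := by
  -- With `M = √k²` this is `M(M - 2m)`, whose sign tells on which side of the threshold `k` lies.
  set q : R4 → ℝ := fun k => mdot k k - 2 * m * Real.sqrt (mdot k k) with hq
  have hqc : Continuous q := by
    have h1 : Continuous fun k : R4 => mdot k k := by fun_prop
    exact h1.sub (continuous_const.mul h1.sqrt)
  have hmc : Continuous fun k : R4 => mdot k k := by fun_prop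
  have h0c : Continuous fun k : R4 => k 0 := by fun_prop
  have hq4 : ∀ k : R4, 0 < mdot k k → mdot k k = 4 * m ^ 2 → q k = 0 := fun k h h' => by
    have : Real.sqrt (mdot k k) = 2 * m := by
      rw [h', show 4 * m ^ 2 = (2 * m) ^ 2 by ring, Real.sqrt_sq (by positivity)]
    rw [hq]
    simp only
    rw [this, h']
    ring
  have hqne : q k₀ ≠ 0 := fun h => by
    have h1 := Real.sqrt_pos.2 hk
    have h2 := Real.sq_sqrt hk.le
    apply hk4
    have h3 : Real.sqrt (mdot k₀ k₀) * (Real.sqrt (mdot k₀ k₀) - 2 * m) = 0 := by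
      rw [hq] at h
      simp only at h
      nlinarith
    have h4 : Real.sqrt (mdot k₀ k₀) = 2 * m := by
      rcases mul_eq_zero.1 h3 with h | h
      · exact absurd h h1.ne'
      · linarith
    rw [← h2, h4]
    ring
  -- The first entry keeps `k - l` timelike near the pole, the second keeps `k² > 2δ`, and the third
  -- keeps a distance from the threshold that persists in a neighbourhood of the base point.
  set δ := min (m ^ 2 / 2) (min (mdot k₀ k₀ / 4) (|q k₀| / 4)) with hδdef
  have hδ : 0 < δ := lt_min (by positivity) (lt_min (by positivity)
    (div_pos (abs_pos.2 hqne) (by norm_num)))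
  have hδm : 2 * δ ≤ m ^ 2 := by linarith [min_le_left (m ^ 2 / 2) (min (mdot k₀ k₀ / 4) (|q k₀| / 4))]
  have hδ2 : δ ≤ min (mdot k₀ k₀ / 4) (|q k₀| / 4) := min_le_right _ _
  have hδK : 2 * δ < mdot k₀ k₀ := by linarith [hδ2.trans (min_le_left _ _)]
  have hδq : 2 * δ < |q k₀| := by
    have := hδ2.trans (min_le_right _ _)
    have := abs_pos.2 hqne
    linarith
  rcases lt_abs.1 hδq with hcase | hcase
  · have hO : {k : R4 | 2 * δ < mdot k k} ∩ ({k | 0 < k 0} ∩ {k | 2 * δ < q k}) ∈ 𝓝 k₀ :=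
      inter_mem ((isOpen_lt continuous_const hmc).mem_nhds hδK)
        (inter_mem ((isOpen_lt continuous_const h0c).mem_nhds hk0)
          ((isOpen_lt continuous_const hqc).mem_nhds hcase))
    obtain ⟨N, hNn, hNs, hNc⟩ := local_compact_nhds hO
    have hK : ∀ k ∈ N, 2 * δ < mdot k k := fun k hk => (hNs hk).1
    have hN : ∀ k ∈ N, 0 < mdot k k ∧ 0 < k 0 ∧ 2 * δ ≤ mdot k k - 2 * m * Real.sqrt (mdot k k) :=
      fun k hk => ⟨by linarith [hK k hk], (hNs hk).2.1, le_of_lt (hNs hk).2.2⟩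
    obtain ⟨Lim, hsm, hlim⟩ := exists_hasLimit_above hm hδ hNc hN
    obtain ⟨_, _, h1⟩ := isRegularizer_energyGap hm hδ hδm hNc hK (Or.inl hN)
    obtain ⟨_, _, h2⟩ := isRegularizer_symmetricGap hm hδ hK (Or.inl hN)
    refine ⟨N, hNn, hNc, ⟨δ, hδ, fun k hk => ⟨by linarith [hK k hk], (hN k hk).2.1, fun h => ?_⟩⟩,
      Lim, hsm, hlim _ _ _ h1, hlim _ _ _ h2⟩
    have h3 := hq4 k (hN k hk).1 h
    have h4 := (hN k hk).2.2
    rw [hq] at h3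
    linarith
  · have hO : {k : R4 | 2 * δ < mdot k k} ∩ ({k | 0 < k 0} ∩ {k | q k < -(2 * δ)}) ∈ 𝓝 k₀ :=
      inter_mem ((isOpen_lt continuous_const hmc).mem_nhds hδK)
        (inter_mem ((isOpen_lt continuous_const h0c).mem_nhds hk0)
          ((isOpen_lt hqc continuous_const).mem_nhds (by simp only [mem_ofPred_eq]; linarith)))
    obtain ⟨N, hNn, hNs, hNc⟩ := local_compact_nhds hO
    have hK : ∀ k ∈ N, 2 * δ < mdot k k := fun k hk => (hNs hk).1
    have hN : ∀ k ∈ N, 0 < mdot k k ∧ 0 < k 0 ∧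
        mdot k k - 2 * m * Real.sqrt (mdot k k) ≤ -(2 * δ) :=
      fun k hk => ⟨by linarith [hK k hk], (hNs hk).2.1, le_of_lt (hNs hk).2.2⟩
    obtain ⟨Lim, hsm, hlim⟩ := exists_hasLimit_below hm hδ fun k hk =>
      ⟨(hN k hk).1, (hN k hk).2.1, by linarith [(hN k hk).2.2]⟩
    obtain ⟨_, _, h1⟩ := isRegularizer_energyGap hm hδ hδm hNc hK (Or.inr hN)
    obtain ⟨_, _, h2⟩ := isRegularizer_symmetricGap hm hδ hK (Or.inr hN)
    refine ⟨N, hNn, hNc, ⟨δ, hδ, fun k hk => ⟨by linarith [hK k hk], (hN k hk).2.1, fun h => ?_⟩⟩,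
      Lim, hsm, hlim _ _ _ h1, hlim _ _ _ h2⟩
    have h3 := hq4 k (hN k hk).1 h
    have h4 := (hN k hk).2.2
    rw [hq] at h3
    linarith

end Regularizers


/-! ### The slices at fixed momentum -/

section Slice

open Complex

/-- The regularized pairing at fixed `k` with a function of `l`. -/
noncomputable def sliceIntegral (m ε : ℝ) (k : R4) (φ : R4 → ℂ) : ℂ :=
  ∫ l : R4, (deltaRet m ε (k - l) + deltaRet m ε (k + l)) * φ l ∂(deltaPlus m)

/-- The integrand with the denominator `(k + l)² - m²`. -/
noncomputable def sumRegular (σ ε : ℝ) (φ : R4 → ℂ) (k l : R4) : ℂ :=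
  φ l / (((mdot k k + 2 * mdot k l : ℝ) : ℂ) + I * ((σ * ε * (k 0 + l 0) : ℝ) : ℂ))

variable {m : ℝ} (hm : 0 < m)

/-- On the shell `(k ∓ l)² - m² = k² ∓ 2 k·l`. Passing from `k` to `-k` exchanges the two
propagators and reverses the sign of `iε`; the sign `σ` thus reduces backward momenta to forward
ones. -/
lemma deltaRet_add_deltaRet {σ : ℝ} (hσ : σ = 1 ∨ σ = -1) (ε : ℝ) (φ : R4 → ℂ) (k : R4) (v : R3) :
    (deltaRet m ε (σ • k - onShell m v) + deltaRet m ε (σ • k + onShell m v)) * φ (onShell m v) =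
      -(1 / (2 * Real.pi) ^ 2 : ℂ) *
        (regular σ ε energyGap φ k (onShell m v) + sumRegular σ ε φ k (onShell m v)) := by
  set l := onShell m v with hl
  have hl2 : mdot l l = m ^ 2 := mdot_onShell_self m v
  have e1 : mdot (k - l) (k - l) - m ^ 2 = pole k l := by
    rw [mdot_sub_left, mdot_sub_right, mdot_sub_right, hl2, pole, mdot_comm l k]; ring
  have e2 : mdot (k + l) (k + l) - m ^ 2 = mdot k k + 2 * mdot k l := by
    rw [mdot_add_left, mdot_add_right, mdot_add_right, hl2, mdot_comm l k]; ring
  rcases hσ with rfl | rfl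
  · rw [one_smul, deltaRet, deltaRet, regular, sumRegular, e1, e2]
    simp only [energyGap, PiLp.sub_apply, PiLp.add_apply, one_mul]
    ring
  · have e3 : (-1 : ℝ) • k - l = -(k + l) := by rw [neg_one_smul]; abel
    have e4 : (-1 : ℝ) • k + l = -(k - l) := by rw [neg_one_smul]; abel
    rw [e3, e4, deltaRet, deltaRet, regular, sumRegular, mdot_neg_neg, mdot_neg_neg, e1, e2]
    have e5 : ε * (-(k + l)) 0 = -1 * ε * (k 0 + l 0) := by simp; ring
    have e6 : ε * (-(k - l)) 0 = -1 * ε * energyGap k l := by simp [energyGap]; ring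
    rw [e5, e6]
    ring

include hm

/-- The propagator in `k + l` has no pole for forward `k`, so its limit is plain dominated
convergence. -/
lemma sum_denominator_ge {k : R4} (hk : 0 < mdot k k) (hk0 : 0 < k 0) (v : R3) :
    mdot k k ≤ mdot k k + 2 * mdot k (onShell m v) := by
  have := mdot_onShell_pos hm hk hk0 v
  linarith

lemma tendsto_sumRegular {δ : ℝ} (hδ : 0 < δ) {C : ℝ} (hint : ∀ φ : 𝓢(R4, ℂ),
      (∫ l, ‖φ l‖ ∂(deltaPlus m)) ≤ C * schwartzNorm 4 φ) (σ : ℝ) {k : R4}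
    (hk : δ ≤ mdot k k) (hk0 : 0 < k 0) (φ : 𝓢(R4, ℂ)) :
    (∀ ε, Integrable (sumRegular σ ε φ k) (deltaPlus m) ∧
      ‖∫ l, sumRegular σ ε φ k l ∂(deltaPlus m)‖ ≤ δ⁻¹ * (C * schwartzNorm 4 φ)) ∧
    Tendsto (fun ε => ∫ l, sumRegular σ ε φ k l ∂(deltaPlus m)) (𝓝[>] 0)
      (𝓝 (∫ l, φ l / ((mdot k k + 2 * mdot k l : ℝ) : ℂ) ∂(deltaPlus m))) := by
  have hφ := integrable_schwartz_deltaPlus hm φ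
  have hle : ∀ v, δ ≤ mdot k k + 2 * mdot k (onShell m v) := fun v =>
    hk.trans (sum_denominator_ge hm (hδ.trans_le hk) hk0 v)
  have hb : ∀ ε, ∀ᵐ l ∂(deltaPlus m), ‖sumRegular σ ε φ k l‖ ≤ δ⁻¹ * ‖φ l‖ := fun ε =>
    ae_deltaPlus fun v => by
      rw [sumRegular, norm_div, div_eq_inv_mul]
      gcongr
      exact (hle v).trans ((le_abs_self _).trans (abs_le_norm_ofReal_add_I_mul _ _))
  have hmeas : ∀ ε, AEStronglyMeasurable (sumRegular σ ε φ k) (deltaPlus m) := fun ε => by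
    have h1 : Measurable fun l : R4 => ((mdot k k + 2 * mdot k l : ℝ) : ℂ) +
        I * ((σ * ε * (k 0 + l 0) : ℝ) : ℂ) := by
      have : Continuous fun l : R4 => ((mdot k k + 2 * mdot k l : ℝ) : ℂ) +
        I * ((σ * ε * (k 0 + l 0) : ℝ) : ℂ) := by fun_prop
      exact this.measurable
    exact (φ.continuous.measurable.div h1).aestronglyMeasurable
  refine ⟨fun ε => ⟨(hφ.norm.const_mul δ⁻¹).mono' (hmeas ε) (hb ε), ?_⟩, ?_⟩
  · refine (norm_integral_le_of_norm_le (hφ.norm.const_mul δ⁻¹) (hb ε)).trans ?_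
    rw [integral_const_mul]
    exact mul_le_mul_of_nonneg_left (hint φ) (by positivity)
  · refine tendsto_integral_filter_of_dominated_convergence (fun l => δ⁻¹ * ‖φ l‖)
      (Eventually.of_forall hmeas) (Eventually.of_forall hb) (hφ.norm.const_mul δ⁻¹)
      (ae_deltaPlus fun v => ?_)
    have h2 : ((mdot k k + 2 * mdot k (onShell m v) : ℝ) : ℂ) ≠ 0 := by
      rw [Ne, ofReal_eq_zero]
      exact (hδ.trans_le (hle v)).ne'
    have h3 : Tendsto (fun ε : ℝ => ((mdot k k + 2 * mdot k (onShell m v) : ℝ) : ℂ) +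
        I * ((σ * ε * (k 0 + onShell m v 0) : ℝ) : ℂ)) (𝓝[>] 0)
        (𝓝 (((mdot k k + 2 * mdot k (onShell m v) : ℝ) : ℂ) +
          I * ((σ * 0 * (k 0 + onShell m v 0) : ℝ) : ℂ))) :=
      ((by fun_prop : Continuous fun ε : ℝ => ((mdot k k + 2 * mdot k (onShell m v) : ℝ) : ℂ) +
        I * ((σ * ε * (k 0 + onShell m v 0) : ℝ) : ℂ)).tendsto 0).mono_left nhdsWithin_le_nhds
    rw [mul_zero, zero_mul, ofReal_zero, mul_zero, add_zero] at h3
    exact tendsto_const_nhds.div h3 h2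

omit hm in
lemma exists_sign_smul_forward {k : R4} (hk : 0 < mdot k k) :
    ∃ σ : ℝ, (σ = 1 ∨ σ = -1) ∧ 0 < (σ • k) 0 := by
  have hne : k 0 ≠ 0 := fun h => by
    rw [mdot, h] at hk
    nlinarith [sq_nonneg (k 1), sq_nonneg (k 2), sq_nonneg (k 3)]
  rcases lt_or_gt_of_ne hne with h | h
  · exact ⟨-1, Or.inr rfl, by simpa using h⟩
  · exact ⟨1, Or.inl rfl, by simpa using h⟩

omit hm in
lemma mdot_sign_smul {σ : ℝ} (hσ : σ = 1 ∨ σ = -1) (k : R4) : mdot (σ • k) (σ • k) = mdot k k := by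
  rcases hσ with rfl | rfl <;> simp [mdot_neg_neg]

omit hm in
lemma sign_smul_smul {σ : ℝ} (hσ : σ = 1 ∨ σ = -1) (k : R4) : σ • σ • k = k := by
  rcases hσ with rfl | rfl <;> simp

omit hm in
lemma sliceIntegral_eq {σ ε : ℝ} (hσ : σ = 1 ∨ σ = -1) {k : R4} {φ : R4 → ℂ}
    (h1 : Integrable (regular σ ε energyGap φ k) (deltaPlus m))
    (h2 : Integrable (sumRegular σ ε φ k) (deltaPlus m)) :
    Integrable (fun l => (deltaRet m ε (σ • k - l) + deltaRet m ε (σ • k + l)) * φ l)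
      (deltaPlus m) ∧
    sliceIntegral m ε (σ • k) φ = -(1 / (2 * Real.pi) ^ 2 : ℂ) *
      ((∫ l, regular σ ε energyGap φ k l ∂(deltaPlus m)) +
        ∫ l, sumRegular σ ε φ k l ∂(deltaPlus m)) := by
  have e : ∀ᵐ l ∂(deltaPlus m), -(1 / (2 * Real.pi) ^ 2 : ℂ) *
      (regular σ ε energyGap φ k l + sumRegular σ ε φ k l) =
      (deltaRet m ε (σ • k - l) + deltaRet m ε (σ • k + l)) * φ l :=
    ae_deltaPlus fun v => (deltaRet_add_deltaRet hσ ε φ k v).symm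
  refine ⟨((h1.add h2).const_mul _).congr e, ?_⟩
  rw [sliceIntegral, ← integral_congr_ae e, integral_const_mul, integral_add h1 h2]

/-- The limits of the regularized slices near a timelike momentum off the threshold. -/
theorem exists_local_slice {k₀ : R4} (hk₀ : k₀ ∈ regularTimelike m) :
    ∃ N ∈ 𝓝 k₀, IsCompact N ∧ N ⊆ regularTimelike m ∧ ∃ S : 𝓢(R4, ℂ) → R4 → ℂ,
      (∀ φ, ContDiffOn ℝ ∞ (S φ) (interior N)) ∧ ∃ C, 0 ≤ C ∧ ∀ k ∈ N, ∀ φ : 𝓢(R4, ℂ),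
        (∀ ε > 0, Integrable (fun l => (deltaRet m ε (k - l) + deltaRet m ε (k + l)) * φ l)
            (deltaPlus m) ∧ ‖sliceIntegral m ε k φ‖ ≤ C * schwartzNorm 4 φ) ∧
        Tendsto (fun ε => sliceIntegral m ε k φ) (𝓝[>] 0) (𝓝 (S φ k)) := by
  obtain ⟨σ, hσ, hσ0⟩ := exists_sign_smul_forward hk₀.1
  have hσne : σ ≠ 0 := by rcases hσ with rfl | rfl <;> norm_num
  obtain ⟨N, hN, hNc, ⟨δ, hδ, hNp⟩, Lim, hsm, ⟨C₁, hC₁, hlim⟩, -⟩ := exists_local_hasLimit hm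
    (k₀ := σ • k₀) (by rw [mdot_sign_smul hσ]; exact hk₀.1) hσ0
    (by rw [mdot_sign_smul hσ]; exact hk₀.2)
  obtain ⟨C₂, hC₂, hint⟩ := exists_integral_norm_le hm
  -- As `k² + 2 k·l ≥ δ` on the shell, the reciprocal of this denominator may be replaced by a
  -- function of temperate growth; this gives smoothness in `k`.
  obtain ⟨η, hη, -, hηδ⟩ := exists_farFunction hδ
  let e : R4 ≃ₜ R4 := Homeomorph.smulOfNeZero σ hσne
  have he : ∀ k, e k = σ • k := fun k => rfl
  refine ⟨e ⁻¹' N, e.continuous.continuousAt.preimage_mem_nhds hN, e.isCompact_preimage.2 hNc,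
    fun k hk => ?_, fun φ k => -(1 / (2 * Real.pi) ^ 2 : ℂ) * (Lim σ φ (σ • k) +
      ∫ l, φ l / ((mdot (σ • k) (σ • k) + 2 * mdot (σ • k) l : ℝ) : ℂ) ∂(deltaPlus m)),
    fun φ => ?_, ‖(1 / (2 * Real.pi) ^ 2 : ℂ)‖ * (C₁ + δ⁻¹ * C₂), by positivity,
    fun k hk φ => ?_⟩
  · obtain ⟨h1, -, h2⟩ := hNp _ hk
    rw [he, mdot_sign_smul hσ] at h1 h2
    exact ⟨by linarith, h2⟩
  · rw [← e.preimage_interior]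
    have hs : ContDiff ℝ ∞ fun k : R4 => σ • k := contDiff_const_smul σ
    refine contDiffOn_const.mul (((hsm σ φ).comp hs.contDiffOn fun k hk => hk).add ?_)
    have h1 := ((contDiff_far hm hη 2 φ).comp hs).contDiffOn (s := e ⁻¹' interior N)
    refine h1.congr fun k hk => integral_congr_ae (ae_deltaPlus fun v => ?_)
    obtain ⟨a1, a2, -⟩ := hNp _ (interior_subset (show σ • k ∈ interior N from hk))
    have a3 := sum_denominator_ge hm (hδ.trans_le a1) a2 v
    simp only
    rw [hηδ _ (by rw [abs_of_pos] <;> linarith), ofReal_inv, div_eq_mul_inv]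
  · obtain ⟨a1, a2, -⟩ := hNp _ (show σ • k ∈ N from hk)
    obtain ⟨b1, b2⟩ := hlim σ hσ (σ • k) hk φ
    obtain ⟨c1, c2⟩ := tendsto_sumRegular hm hδ hint σ a1 a2 φ
    have key := fun (ε : ℝ) (hε : 0 < ε) => sliceIntegral_eq hσ (b1 ε hε).1 (c1 ε).1
    simp only [sign_smul_smul hσ] at key
    refine ⟨fun ε hε => ⟨(key ε hε).1, ?_⟩, ?_⟩
    · rw [(key ε hε).2, norm_mul, norm_neg, mul_assoc]
      refine mul_le_mul_of_nonneg_left ?_ (norm_nonneg _)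
      refine (norm_add_le _ _).trans ((add_le_add (b1 ε hε).2 (c1 ε).2).trans (le_of_eq ?_))
      ring
    · refine Tendsto.congr' ?_ ((b2.add c2).const_mul _)
      filter_upwards [self_mem_nhdsWithin] with ε hε
      exact (key ε hε).2.symm

/-- The slices of the loop distribution: for `k` timelike off the threshold the limit of the
regularized expressions is a tempered distribution. -/
theorem exists_slice : ∃ S : R4 → 𝓢(R4, ℂ) → ℂ, ∃ T : R4 → 𝓢'(R4, ℂ),
    (∀ k f, T k f = S k (testFourier f)) ∧
    (∀ k ∈ regularTimelike m, ∀ φ : 𝓢(R4, ℂ),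
      Tendsto (fun ε => sliceIntegral m ε k φ) (𝓝[>] 0) (𝓝 (S k φ))) ∧
    ∀ φ, ContDiffOn ℝ ∞ (fun k => S k φ) (regularTimelike m) := by
  classical
  choose! N hN hNc hNs S hS C hC hlim using fun k (hk : k ∈ regularTimelike m) =>
    exists_local_slice hm hk
  -- Outside the regular timelike momenta the value is immaterial and is set to zero.
  let S' : R4 → 𝓢(R4, ℂ) → ℂ := fun k φ => if k ∈ regularTimelike m then S k φ k else 0
  have hS' : ∀ k ∈ regularTimelike m, ∀ φ : 𝓢(R4, ℂ),
      Tendsto (fun ε => sliceIntegral m ε k φ) (𝓝[>] 0) (𝓝 (S' k φ)) := fun k hk φ => by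
    simp only [S', if_pos hk]
    exact (hlim k hk k (mem_of_mem_nhds (hN k hk)) φ).2
  have hfun : ∀ k, ∃ A : 𝓢'(R4, ℂ), ∀ f, A f = S' k (testFourier f) := fun k => by
    by_cases hk : k ∈ regularTimelike m
    · have h0 := hlim k hk k (mem_of_mem_nhds (hN k hk))
      have hadd : ∀ φ ψ : 𝓢(R4, ℂ), S' k (φ + ψ) = S' k φ + S' k ψ := fun φ ψ => by
        refine tendsto_nhds_unique (hS' k hk (φ + ψ)) (((hS' k hk φ).add (hS' k hk ψ)).congr' ?_)
        filter_upwards [self_mem_nhdsWithin] with ε hε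
        rw [sliceIntegral, sliceIntegral, sliceIntegral,
          ← integral_add ((h0 φ).1 ε hε).1 ((h0 ψ).1 ε hε).1]
        simp only [add_apply, mul_add]
      have hsmul : ∀ (c : ℂ) (φ : 𝓢(R4, ℂ)), S' k (c • φ) = c * S' k φ := fun c φ => by
        refine tendsto_nhds_unique (hS' k hk (c • φ)) (((hS' k hk φ).const_mul c).congr' ?_)
        filter_upwards [self_mem_nhdsWithin] with ε hε
        rw [sliceIntegral, sliceIntegral, ← integral_const_mul]
        simp only [smul_apply, smul_eq_mul]
        congr 1
        ext l
        ring
      have hbd : ∀ φ : 𝓢(R4, ℂ), ‖S' k φ‖ ≤ C k * schwartzNorm 4 φ := fun φ => by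
        refine le_of_tendsto (hS' k hk φ).norm ?_
        filter_upwards [self_mem_nhdsWithin] with ε hε
        exact ((h0 φ).1 ε hε).2
      obtain ⟨A, hA⟩ := exists_schwartz_functional (S' k) hadd hsmul ⟨4, C k, hbd⟩
      exact ⟨ContinuousLinearMap.toPointwiseConvergenceCLM _ _ _ _ (A.comp testFourier),
        fun f => hA _⟩
    · exact ⟨0, fun f => by simp [S', if_neg hk]⟩
  choose T hT using hfun
  refine ⟨S', T, hT, hS', fun φ k hk => ?_⟩
  -- The local limits agree with the global one by uniqueness of limits, so smoothness near each
  -- point carries over.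
  have h1 : ContDiffAt ℝ ∞ (S k φ) k := (hS k hk φ).contDiffAt
    (isOpen_interior.mem_nhds (mem_interior_iff_mem_nhds.2 (hN k hk)))
  refine (h1.congr_of_eventuallyEq ?_).contDiffWithinAt
  filter_upwards [hN k hk] with k' hk'
  exact tendsto_nhds_unique (hS' k' (hNs k hk hk') φ) (hlim k hk k' hk' φ).2

end Slice


/-! ### The distribution as an integral of its slices -/

section Disintegration

open Complex

variable {m : ℝ} (hm : 0 < m)
include hm

/-- Finitely many of the neighbourhoods with local bounds cover the compact set. The bound, uniform
in `k` and `ε`, justifies the limit under the integral over `k`. -/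
lemma exists_sliceIntegral_le {Z : Set R4} (hZ : IsCompact Z) (hZs : Z ⊆ regularTimelike m) :
    ∃ C, 0 ≤ C ∧ ∀ k ∈ Z, ∀ φ : 𝓢(R4, ℂ), ∀ ε > 0,
      ‖sliceIntegral m ε k φ‖ ≤ C * schwartzNorm 4 φ := by
  refine hZ.induction_on ⟨0, le_rfl, fun k hk => absurd hk (notMem_empty k)⟩ ?_ ?_ ?_
  · rintro s t hst ⟨C, hC, h⟩
    exact ⟨C, hC, fun k hk => h k (hst hk)⟩
  · rintro s t ⟨C, hC, h⟩ ⟨C', hC', h'⟩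
    refine ⟨C + C', by positivity, fun k hk φ ε hε => ?_⟩
    have h0 : 0 ≤ schwartzNorm 4 φ := apply_nonneg _ _
    rcases hk with hk | hk
    · exact (h k hk φ ε hε).trans (by gcongr; linarith)
    · exact (h' k hk φ ε hε).trans (by gcongr; linarith)
  · intro k hk
    obtain ⟨N, hN, -, -, _, -, C, hC, h⟩ := exists_local_slice hm (hZs hk)
    exact ⟨N, mem_nhdsWithin_of_mem_nhds hN, C, hC, fun k' hk' φ ε hε => ((h k' hk' φ).1 ε hε).2⟩

lemma tendsto_integral_loopKernelPairing (h : 𝓢(R4 × R4, ℂ)) :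
    Tendsto (fun ε => ∫ l, loopKernelPairing m ε h l ∂(deltaPlus m)) (𝓝[>] 0)
      (𝓝 (∫ l, loopKernelPairing m 0 h l ∂(deltaPlus m))) := by
  have hev : ∀ᶠ ε : ℝ in 𝓝[>] 0, 0 < ε ∧ ε ≤ m := by
    filter_upwards [Ioc_mem_nhdsGT hm] with ε hε using hε
  obtain ⟨N, C, hb⟩ := exists_loopKernelPairing_le hm
  refine tendsto_integral_filter_of_dominated_convergence
    (fun l => C * schwartzNorm N h * (1 + ‖l‖) ^ (-(4 : ℝ))) ?_ ?_
    ((integrable_rpow_deltaPlus hm).const_mul _) (Eventually.of_forall fun l => ?_)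
  · filter_upwards [hev] with ε hε
    exact aestronglyMeasurable_loopKernelPairing hm hε.1.le hε.2 h
  · filter_upwards [hev] with ε hε
    exact Eventually.of_forall (hb ε hε.1.le hε.2 h)
  · refine (tendsto_loopPairing hm h l).congr' ?_
    filter_upwards [hev] with ε hε
    exact loopPairing_eq hm hε.1 hε.2 h l

instance sfinite_deltaPlus : SFinite (deltaPlus m) := by
  unfold deltaPlus
  infer_instance

/-- At fixed `ε > 0` the propagators are bounded, and the decay of the partial Fourier transform,
with exponent 5 in `k` and 4 on the shell, gives integrability on the product. -/
lemma integrable_deltaRet_prod {ε : ℝ} (h0 : 0 < ε) (h1 : ε ≤ m) (h : 𝓢(R4 × R4, ℂ)) :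
    Integrable (fun p : R4 × R4 => (deltaRet m ε (p.2 - p.1) + deltaRet m ε (p.2 + p.1)) *
      partialFourier h p.2 p.1) ((deltaPlus m).prod volume) := by
  obtain ⟨N, C, hC, hb⟩ := exists_partialFourier_le 5
  have hint : Integrable (fun p : R4 × R4 => (1 + ‖p.1‖) ^ (-(4 : ℝ)) *
      (1 + ‖p.2‖) ^ (-(5 : ℝ))) ((deltaPlus m).prod volume) :=
    (integrable_rpow_deltaPlus hm).mul_prod (integrable_one_add_norm (by simp; norm_num))
  set c := 1 / (2 * Real.pi) ^ 2 * (2 / (ε * m)) with hc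
  have hcd := continuous_deltaRet hm h0
  refine (hint.const_mul ((c + c) * (C * schwartzNorm N h))).mono' ?_
    (Eventually.of_forall fun p => ?_)
  · have a1 : Continuous fun p : R4 × R4 => deltaRet m ε (p.2 - p.1) :=
      hcd.comp (f := fun p : R4 × R4 => p.2 - p.1) (by fun_prop)
    have a2 : Continuous fun p : R4 × R4 => deltaRet m ε (p.2 + p.1) :=
      hcd.comp (f := fun p : R4 × R4 => p.2 + p.1) (by fun_prop)
    have a3 : Continuous fun p : R4 × R4 => partialFourier h p.2 p.1 := by fun_prop
    exact ((a1.add a2).mul a3).aestronglyMeasurable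
  · rw [norm_mul, mul_assoc]
    have hc0 : 0 ≤ c := by positivity
    have hp : ‖partialFourier h p.2 p.1‖ ≤
        C * schwartzNorm N h * ((1 + ‖p.1‖) ^ (-(4 : ℝ)) * (1 + ‖p.2‖) ^ (-(5 : ℝ))) := by
      have e1 : (1 + ‖p.1‖) ^ (4 : ℝ) = (1 + ‖p.1‖) ^ 4 := by exact_mod_cast Real.rpow_natCast _ 4
      have e2 : (1 + ‖p.2‖) ^ (5 : ℝ) = (1 + ‖p.2‖) ^ 5 := by exact_mod_cast Real.rpow_natCast _ 5
      rw [Real.rpow_neg (by positivity), Real.rpow_neg (by positivity), e1, e2, ← mul_inv,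
        ← div_eq_mul_inv, le_div_iff₀' (by positivity)]
      refine le_trans ?_ (hb h p.2 p.1)
      rw [mul_comm ((1 + ‖p.1‖) ^ 4)]
      gcongr
      · linarith [norm_nonneg p.1]
      · norm_num
    gcongr
    exact (norm_add_le _ _).trans (add_le_add (norm_deltaRet_le hm h0 h1 _)
      (norm_deltaRet_le hm h0 h1 _))

/-- The loop distribution is the integral of its slices, on test functions whose support in `k`
is a compact set of timelike momenta off the threshold. -/
theorem loop_eq_integral_slice {S : R4 → 𝓢(R4, ℂ) → ℂ} (hS : ∀ k ∈ regularTimelike m,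
      ∀ φ : 𝓢(R4, ℂ), Tendsto (fun ε => sliceIntegral m ε k φ) (𝓝[>] 0) (𝓝 (S k φ)))
    {Z : Set R4} (hZ : IsCompact Z) (hZs : Z ⊆ regularTimelike m) {h : 𝓢(R4 × R4, ℂ)}
    (hh : ∀ k ∉ Z, slice k h = 0) (hS0 : ∀ k ∉ Z, S k 0 = 0) :
    ∫ l, loopKernelPairing m 0 h l ∂(deltaPlus m) = ∫ k, S k (testFourier (slice k h)) := by
  have hev : ∀ᶠ ε : ℝ in 𝓝[>] 0, 0 < ε ∧ ε ≤ m := by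
    filter_upwards [Ioc_mem_nhdsGT hm] with ε hε using hε
  obtain ⟨C, hC, hb⟩ := exists_sliceIntegral_le hm hZ hZs
  obtain ⟨N, C', hC', hb'⟩ := exists_schwartzNorm_comp_le testFourier 4
  -- At positive `ε` the integrals over `k` and `l` may be exchanged. Both sides then converge as `ε
  -- → 0`, the left by the bounded kernels and the right by the slices.
  have hswap : ∀ ε : ℝ, 0 < ε ∧ ε ≤ m → Integrable (fun k => sliceIntegral m ε k
      (testFourier (slice k h))) ∧ ∫ l, loopKernelPairing m ε h l ∂(deltaPlus m) =
      ∫ k, sliceIntegral m ε k (testFourier (slice k h)) := fun ε hε => by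
    have hi := integrable_deltaRet_prod hm hε.1 hε.2 h
    have e2 : ∀ k, ∫ l, (deltaRet m ε (k - l) + deltaRet m ε (k + l)) * partialFourier h k l
        ∂(deltaPlus m) = sliceIntegral m ε k (testFourier (slice k h)) := fun k => by
      simp only [sliceIntegral, partialFourier]
    refine ⟨hi.integral_prod_right.congr (Eventually.of_forall e2), ?_⟩
    have e : ∀ l, loopKernelPairing m ε h l = ∫ k, (deltaRet m ε (k - l) + deltaRet m ε (k + l)) *
        partialFourier h k l := fun l => by
      rw [← loopPairing_eq hm hε.1 hε.2 h l, loopPairing]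
      simp only [partialFourier_eq]
    simp only [e, ← e2]
    exact integral_integral_swap (f := fun l k => (deltaRet m ε (k - l) + deltaRet m ε (k + l)) *
      partialFourier h k l) hi
  refine tendsto_nhds_unique (tendsto_integral_loopKernelPairing hm h) ?_
  have hlim : Tendsto (fun ε => ∫ k, sliceIntegral m ε k (testFourier (slice k h))) (𝓝[>] 0)
      (𝓝 (∫ k, S k (testFourier (slice k h)))) := by
    have hzero : ∀ k ∉ Z, ∀ ε, sliceIntegral m ε k (testFourier (slice k h)) = 0 := fun k hk ε => by
      rw [hh k hk, map_zero, sliceIntegral]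
      simp
    refine tendsto_integral_filter_of_dominated_convergence
      (Z.indicator fun _ => C * (C' * (2 ^ (N + 0) * schwartzNorm (N + 0) h))) ?_ ?_ ?_ ?_
    · filter_upwards [hev] with ε hε
      exact (hswap ε hε).1.aestronglyMeasurable
    · filter_upwards [hev] with ε hε
      refine Eventually.of_forall fun k => ?_
      by_cases hk : k ∈ Z
      · rw [indicator_of_mem hk]
        refine (hb k hk _ ε hε.1).trans ?_
        have := schwartzNorm_slice_le N 0 k h
        rw [pow_zero, one_mul] at this
        gcongr
        exact (hb' _).trans (by gcongr)
      · rw [indicator_of_notMem hk, hzero k hk, norm_zero]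
    · exact (integrable_indicator_iff hZ.measurableSet).2
        (integrableOn_const hZ.measure_lt_top.ne)
    · refine Eventually.of_forall fun k => ?_
      by_cases hk : k ∈ Z
      · exact hS k (hZs hk) _
      · simp only [hzero k hk]
        rw [hh k hk, map_zero, hS0 k hk]
        exact tendsto_const_nhds
  refine hlim.congr' ?_
  filter_upwards [hev] with ε hε
  exact (hswap ε hε).2.symm

end Disintegration


/-! ### The rotationally symmetric regularization -/

section SymmetricLimit

open Complex

variable {m : ℝ} (hm : 0 < m) {k : R4} (hk : 0 < mdot k k) (hk0 : 0 < k 0)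

lemma ae_deltaPlus_zero_ne (m c : ℝ) : ∀ᵐ l ∂(deltaPlus m), l 0 ≠ c := by
  refine Measure.ae_smul_measure ?_ _
  rw [(measurableEmbedding_onShell m).ae_map_iff]
  refine (withDensity_absolutelyContinuous _ _).ae_le ?_
  have h0 := Measure.addHaar_sphere (volume : Measure R3) 0 (Real.sqrt (c ^ 2 - m ^ 2))
  have h1 : ∀ᵐ v : R3, v ∉ Metric.sphere (0 : R3) (Real.sqrt (c ^ 2 - m ^ 2)) :=
    measure_eq_zero_iff_ae_notMem.1 h0
  filter_upwards [h1] with v hv hvc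
  refine hv ?_
  rw [mem_sphere_zero_iff_norm, ← hvc, onShell_zero, omega_sq, add_sub_cancel_right,
    Real.sqrt_sq (norm_nonneg _)]

include hm hk hk0

/-- In the rest frame the zeros lie at energy `√k²/2`, on a sphere of measure zero; the boost
preserves null sets. -/
lemma ae_pole_ne_zero : ∀ᵐ l ∂(deltaPlus m), pole k l ≠ 0 := by
  have hu := mdot_velocity hk
  have hu0 := velocity_zero_pos hk hk0
  have hM := Real.sqrt_pos.2 hk
  have h1 : ∀ᵐ l ∂(deltaPlus m), pole k (boost (velocity k) l) ≠ 0 := by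
    filter_upwards [ae_deltaPlus_zero_ne m (Real.sqrt (mdot k k) / 2)] with l hl h
    rw [pole, mdot_boost_velocity hk hk0] at h
    refine hl ?_
    have := Real.sq_sqrt hk.le
    field_simp
    nlinarith
  have h2 := (measurePreserving_boost hm hu hu0).quasiMeasurePreserving.ae h1
  filter_upwards [h2] with l hl
  rwa [boost_boost hu hu0] at hl

/-- The denominator of the rotationally symmetric regularization. -/
noncomputable def symmetricDenominator (σ ε : ℝ) (k l : R4) : ℂ :=
  ((mdot k l ^ 2 / mdot k k - mdot k k / 4 : ℝ) : ℂ) - I * ((σ * ε : ℝ) : ℂ)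

/-- Partial fractions. With `y = k² + 2 k·l` the real part of the symmetric denominator is `-y ·
pole/(4k²)`, and `y + pole = 2k²` gives `2k²/y = 1 + pole/y`. The second summand cancels the pole
and tends to `φ/y`, the contribution of the propagator in `k + l`. -/
lemma div_symmetricDenominator (σ ε : ℝ) (φ : R4 → ℂ) (v : R3) :
    φ (onShell m v) / symmetricDenominator σ ε k (onShell m v) =
      -2 * (regular σ ε symmetricGap φ k (onShell m v) +
        ((pole k (onShell m v) / (mdot k k + 2 * mdot k (onShell m v)) : ℝ) : ℂ) *
          regular σ ε symmetricGap φ k (onShell m v)) := by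
  have hA := mdot_onShell_pos hm hk hk0 v
  have hy : 0 < mdot k k + 2 * mdot k (onShell m v) := by positivity
  set l := onShell m v
  set y := mdot k k + 2 * mdot k l with hydef
  have e1 : symmetricDenominator σ ε k l = -((y / (4 * mdot k k) : ℝ) : ℂ) *
      ((pole k l : ℂ) + I * ((σ * ε * symmetricGap k l : ℝ) : ℂ)) := by
    have a1 : mdot k l ^ 2 / mdot k k - mdot k k / 4 = -(y / (4 * mdot k k)) * pole k l := by
      rw [hydef, pole]; field_simp; ring
    have a2 : σ * ε = y / (4 * mdot k k) * (σ * ε * symmetricGap k l) := by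
      rw [symmetricGap, ← hydef]; field_simp
    rw [symmetricDenominator, a1, a2, ofReal_mul (y / (4 * mdot k k)), ofReal_mul, ofReal_neg,
      ← a2]
    ring
  have hyc : ((y / (4 * mdot k k) : ℝ) : ℂ) ≠ 0 := by
    rw [Ne, ofReal_eq_zero]; positivity
  have e2 : (1 : ℂ) + ((pole k l / y : ℝ) : ℂ) = ((2 * mdot k k / y : ℝ) : ℂ) := by
    have : 1 + pole k l / y = 2 * mdot k k / y := by
      field_simp; rw [hydef, pole]; ring
    rw [← this]; push_cast; ring
  have e3 : (-((y / (4 * mdot k k) : ℝ) : ℂ))⁻¹ = -2 * ((2 * mdot k k / y : ℝ) : ℂ) := by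
    have : ((y / (4 * mdot k k) : ℝ) : ℂ) * (-2 * ((2 * mdot k k / y : ℝ) : ℂ)) = -1 := by
      have h : y / (4 * mdot k k) * (-2 * (2 * mdot k k / y)) = -1 := by
        field_simp; norm_num
      exact_mod_cast h
    rw [inv_eq_of_mul_eq_one_right]
    rw [neg_mul, this, neg_neg]
  rw [e1, div_eq_mul_inv, mul_inv, e3, ← e2, regular]
  ring

/-- The limit with the energy gap equals the limit with the symmetric gap, by
`exists_local_hasLimit`. By partial fractions the symmetric integrand is `-2` times the sum of both
propagator terms in the limit; the prefactor `1/(2(2π)²)` restores the normalization `-1/(2π)²`. -/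
theorem tendsto_symmetric (hk4 : mdot k k ≠ 4 * m ^ 2) {σ : ℝ} (hσ : σ = 1 ∨ σ = -1)
    (φ : 𝓢(R4, ℂ)) {s : ℂ}
    (hs : Tendsto (fun ε => sliceIntegral m ε (σ • k) φ) (𝓝[>] 0) (𝓝 s)) :
    (∀ ε > 0, Integrable (fun l => φ l / symmetricDenominator σ ε k l) (deltaPlus m)) ∧
    Tendsto (fun ε => (1 / (2 * (2 * Real.pi) ^ 2) : ℂ) *
      ∫ l, φ l / symmetricDenominator σ ε k l ∂(deltaPlus m)) (𝓝[>] 0) (𝓝 s) := by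
  obtain ⟨N, hN, -, -, Lim, -, ⟨_, -, h1⟩, ⟨_, -, h2⟩⟩ := exists_local_hasLimit hm hk hk0 hk4
  obtain ⟨C, -, hint⟩ := exists_integral_norm_le hm
  have hkN := mem_of_mem_nhds hN
  obtain ⟨a1, a2⟩ := h1 σ hσ k hkN φ
  obtain ⟨b1, b2⟩ := h2 σ hσ k hkN φ
  obtain ⟨c1, c2⟩ := tendsto_sumRegular hm hk hint σ le_rfl hk0 φ
  have hφ := integrable_schwartz_deltaPlus hm φ
  have hs' : s = -(1 / (2 * Real.pi) ^ 2 : ℂ) * (Lim σ φ k +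
      ∫ l, φ l / ((mdot k k + 2 * mdot k l : ℝ) : ℂ) ∂(deltaPlus m)) := by
    refine tendsto_nhds_unique hs (((a2.add c2).const_mul _).congr' ?_)
    filter_upwards [self_mem_nhdsWithin] with ε hε
    exact (sliceIntegral_eq hσ (a1 ε hε).1 (c1 ε).1).2.symm
  set X : ℝ → R4 → ℂ := fun ε l => ((pole k l / (mdot k k + 2 * mdot k l) : ℝ) : ℂ) *
    regular σ ε symmetricGap φ k l with hX
  have hXb : ∀ ε, ∀ᵐ l ∂(deltaPlus m), ‖X ε l‖ ≤ (mdot k k)⁻¹ * ‖φ l‖ := fun ε =>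
    ae_deltaPlus fun v => by
      have hge := sum_denominator_ge hm hk hk0 v
      simp only [hX, regular]
      rw [norm_mul, norm_div, norm_real, norm_div, Real.norm_eq_abs, Real.norm_eq_abs,
        abs_of_pos (hk.trans_le hge), div_mul_div_comm]
      refine div_le_of_le_mul₀ (mul_nonneg (hk.le.trans hge) (norm_nonneg _)) (by positivity) ?_
      have h3 := abs_le_norm_ofReal_add_I_mul (pole k (onShell m v))
        (σ * ε * symmetricGap k (onShell m v))
      calc |pole k (onShell m v)| * ‖φ (onShell m v)‖
          = (mdot k k)⁻¹ * ‖φ (onShell m v)‖ * (mdot k k * |pole k (onShell m v)|) := by field_simp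
        _ ≤ _ := by
          have := hk.le.trans hge
          gcongr
  have hXm : ∀ ε > 0, AEStronglyMeasurable (X ε) (deltaPlus m) := fun ε hε => by
    refine AEStronglyMeasurable.mul ?_ (b1 ε hε).1.aestronglyMeasurable
    have p1 : Continuous fun l => pole k l := by unfold pole; fun_prop
    have p2 : Continuous fun l => mdot k k + 2 * mdot k l := by fun_prop
    exact (measurable_ofReal.comp (p1.measurable.div p2.measurable)).aestronglyMeasurable
  have hXi : ∀ ε > 0, Integrable (X ε) (deltaPlus m) := fun ε hε =>
    (hφ.norm.const_mul _).mono' (hXm ε hε) (hXb ε)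
  have hXt : Tendsto (fun ε => ∫ l, X ε l ∂(deltaPlus m)) (𝓝[>] 0)
      (𝓝 (∫ l, φ l / ((mdot k k + 2 * mdot k l : ℝ) : ℂ) ∂(deltaPlus m))) := by
    refine tendsto_integral_filter_of_dominated_convergence (fun l => (mdot k k)⁻¹ * ‖φ l‖) ?_
      (Eventually.of_forall hXb) (hφ.norm.const_mul _) ?_
    · filter_upwards [self_mem_nhdsWithin] with ε hε using hXm ε hε
    · filter_upwards [ae_pole_ne_zero hm hk hk0] with l hl
      have hlc : (pole k l : ℂ) ≠ 0 := ofReal_ne_zero.2 hl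
      have h3 : Tendsto (fun ε : ℝ => (pole k l : ℂ) + I * ((σ * ε * symmetricGap k l : ℝ) : ℂ))
          (𝓝[>] 0) (𝓝 ((pole k l : ℂ) + I * ((σ * 0 * symmetricGap k l : ℝ) : ℂ))) :=
        ((by fun_prop : Continuous fun ε : ℝ =>
          (pole k l : ℂ) + I * ((σ * ε * symmetricGap k l : ℝ) : ℂ)).tendsto 0).mono_left
            nhdsWithin_le_nhds
      rw [mul_zero, zero_mul, ofReal_zero, mul_zero, add_zero] at h3
      have h4 := ((tendsto_const_nhds (x := φ l)).div h3 hlc).const_mul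
        ((pole k l / (mdot k k + 2 * mdot k l) : ℝ) : ℂ)
      have e : ((pole k l / (mdot k k + 2 * mdot k l) : ℝ) : ℂ) * (φ l / (pole k l : ℂ)) =
          φ l / ((mdot k k + 2 * mdot k l : ℝ) : ℂ) := by
        rw [ofReal_div]; field_simp
      rw [e] at h4
      exact h4
  have hae : ∀ ε, ∀ᵐ l ∂(deltaPlus m), -2 * (regular σ ε symmetricGap φ k l + X ε l) =
      φ l / symmetricDenominator σ ε k l := fun ε =>
    ae_deltaPlus fun v => (div_symmetricDenominator hm hk hk0 σ ε φ v).symm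
  refine ⟨fun ε hε => (((b1 ε hε).1.add (hXi ε hε)).const_mul (-2)).congr (hae ε), ?_⟩
  have hfin := ((b2.add hXt).const_mul (-2 : ℂ)).const_mul (1 / (2 * (2 * Real.pi) ^ 2) : ℂ)
  have e : (1 / (2 * (2 * Real.pi) ^ 2) : ℂ) * (-2 * (Lim σ φ k +
      ∫ l, φ l / ((mdot k k + 2 * mdot k l : ℝ) : ℂ) ∂(deltaPlus m))) = s := by
    rw [hs']
    have : (Real.pi : ℂ) ≠ 0 := ofReal_ne_zero.2 Real.pi_ne_zero
    field_simp
  rw [e] at hfin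
  refine hfin.congr' ?_
  filter_upwards [self_mem_nhdsWithin] with ε hε
  rw [← integral_congr_ae (hae ε), integral_const_mul, integral_add (b1 ε hε).1 (hXi ε hε)]

end SymmetricLimit


/-! ### The slices at spacelike separation -/

section PositionSpace

open Complex

/-- The time coordinate of `y` in the rest frame of `k`. -/
noncomputable def restTime (k y : R4) : ℝ := mdot y (velocity k)

/-- The distance of `y` from the origin in the rest frame of `k`. -/
noncomputable def restDist (k y : R4) : ℝ := Real.sqrt (restTime k y ^ 2 - mdot y y)

/-- Spacelike separation in the form used for the contour rotation: `Y² = τ² - y²` with `y² < 0`. -/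
lemma abs_restTime_lt {k y : R4} (hy : y ∈ spacelike) : |restTime k y| < restDist k y := by
  rw [restDist, ← Real.sqrt_sq_eq_abs]
  have : mdot y y < 0 := hy
  exact Real.sqrt_lt_sqrt (sq_nonneg _) (by linarith)

lemma restDist_pos {k y : R4} (hy : y ∈ spacelike) : 0 < restDist k y :=
  (abs_nonneg _).trans_lt (abs_restTime_lt hy)

lemma continuous_restTime (k : R4) : Continuous (restTime k) := by
  unfold restTime; fun_prop

lemma continuous_restDist (k : R4) : Continuous (restDist k) := by
  have := continuous_restTime k
  unfold restDist
  have h : Continuous fun y : R4 => mdot y y := by fun_prop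
  exact ((this.pow 2).sub h).sqrt

lemma mdot_onShell_smul (y : R4) (m r : ℝ) (n : S2) :
    mdot y (onShell m (r • (n : R3))) = y 0 * energy m r - r * inner ℝ (n : R3) (spatial y) := by
  rw [inner_R3]
  simp only [mdot, onShell_zero, omega_smul_sphere, onShell_one, onShell_two, onShell_three,
    PiLp.smul_apply, smul_eq_mul, spatial]
  simp
  ring

lemma mdot_self_eq (y : R4) : mdot y y = y 0 ^ 2 - ‖spatial y‖ ^ 2 := by
  rw [norm_sq_R3]
  simp [mdot, spatial]
  ring

variable {m : ℝ} (hm : 0 < m) {k : R4} (hk : 0 < mdot k k) (hk0 : 0 < k 0)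
include hk hk0

lemma norm_spatial_boost (y : R4) : ‖spatial (boost (velocity k) y)‖ = restDist k y := by
  have hu := mdot_velocity hk
  have hu0 := velocity_zero_pos hk hk0
  have h1 := mdot_self_eq (boost (velocity k) y)
  rw [mdot_boost_boost hu hu0, boost_zero hu hu0] at h1
  rw [restDist, restTime, h1, sub_sub_cancel, Real.sqrt_sq (norm_nonneg _)]

/-- In the rest frame the phase is `e^{iτω}` times a plane wave on the sphere of radius `r`, and the
spatial part of the boosted `y` has length `Y`. -/
lemma sphere_integral_phase {y : R4} (hy : y ∈ spacelike) {r : ℝ} (hr : 0 < r) :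
    ∫ n : S2, phase y (boost (velocity k) (onShell m (r • (n : R3)))) ∂sphereMeasure =
      exp (I * ((restTime k y * energy m r : ℝ) : ℂ)) *
        (4 * Real.pi * (Real.sin (restDist k y * r) / (restDist k y * r)) : ℝ) := by
  have hu := mdot_velocity hk
  have hu0 := velocity_zero_pos hk hk0
  have hY := restDist_pos (k := k) hy
  have hn : ‖(-r) • spatial (boost (velocity k) y)‖ = restDist k y * r := by
    rw [norm_smul, norm_spatial_boost hk hk0, Real.norm_eq_abs, abs_neg, abs_of_pos hr, mul_comm]
  have hw : (-r) • spatial (boost (velocity k) y) ≠ 0 := by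
    rw [← norm_ne_zero_iff, hn]; positivity
  rw [← hn, ← sphere_integral_exp _ hw, ← integral_const_mul]
  refine integral_congr_ae (Eventually.of_forall fun n => ?_)
  beta_reduce
  rw [phase, ← mdot_boost_left hu hu0, mdot_onShell_smul, boost_zero hu hu0, ← restTime,
    ← Complex.exp_add, inner_smul_right]
  congr 1
  push_cast
  ring

omit hk hk0 in
-- On the support of `f` the distance `Y` is positive, so the quotient is continuous with compact
-- support; elsewhere it vanishes.
lemma integrable_spacelike_div {f : 𝓢(R4, ℂ)} (hf : HasCompactSupport f)
    (hfs : tsupport f ⊆ spacelike) : Integrable fun y => f y / (restDist k y : ℂ) := by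
  have hcont : Continuous fun y => f y / (restDist k y : ℂ) := by
    refine continuous_iff_continuousAt.2 fun y => ?_
    by_cases hy : y ∈ tsupport f
    · exact f.continuous.continuousAt.div
        (continuous_ofReal.comp (continuous_restDist k)).continuousAt
        (ofReal_ne_zero.2 (restDist_pos (hfs hy)).ne')
    · have h : (fun y => f y / (restDist k y : ℂ)) =ᶠ[𝓝 y] fun _ => 0 := by
        filter_upwards [(isClosed_tsupport f).isOpen_compl.mem_nhds hy] with z hz
        rw [image_eq_zero_of_notMem_tsupport hz, zero_div]
      exact continuousAt_const.congr h.symm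
  refine hcont.integrable_of_hasCompactSupport (hf.mono fun y hy => ?_)
  rw [Function.mem_support] at hy ⊢
  exact fun h => hy (by rw [h, zero_div])

include hm

lemma sphere_integral_testFourier {f : 𝓢(R4, ℂ)} (hfs : tsupport f ⊆ spacelike)
    {r : ℝ} (hr : 0 < r) :
    ((r ^ 2 / (2 * energy m r) : ℝ) : ℂ) *
      ∫ n : S2, testFourier f (boost (velocity k) (onShell m (r • (n : R3)))) ∂sphereMeasure =
    4 * Real.pi * ∫ y, f y / (restDist k y : ℂ) *
      radialIntegrand m (restTime k y) (restDist k y) r := by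
  have hswap : ∫ n : S2, testFourier f (boost (velocity k) (onShell m (r • (n : R3))))
      ∂sphereMeasure =
      ∫ y, ∫ n : S2, phase y (boost (velocity k) (onShell m (r • (n : R3)))) * f y
        ∂sphereMeasure := by
    simp only [testFourier_apply]
    refine integral_integral_swap (f := fun (n : S2) (y : R4) =>
      phase y (boost (velocity k) (onShell m (r • (n : R3)))) * f y) ?_
    have h1 : Integrable (fun p : S2 × R4 => f p.2) (sphereMeasure.prod volume) :=
      (f.integrable (μ := volume)).comp_snd sphereMeasure
    refine h1.bdd_mul (c := 1) (Continuous.aestronglyMeasurable ?_)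
      (Eventually.of_forall fun p => (norm_phase _ _).le)
    have h2 : Continuous fun p : S2 × R4 =>
        (p.2, boost (velocity k) (onShell m (r • (p.1 : R3)))) := by
      have hb : Continuous (boost (velocity k)) := by unfold boost; fun_prop
      have ho := continuous_onShell m
      fun_prop
    exact continuous_phase.comp h2
  rw [hswap, ← integral_const_mul, ← integral_const_mul]
  refine integral_congr_ae (Eventually.of_forall fun y => ?_)
  beta_reduce
  by_cases hy : y ∈ tsupport f
  · have hY := restDist_pos (k := k) (hfs hy)
    have hYc : (restDist k y : ℂ) ≠ 0 := ofReal_ne_zero.2 hY.ne'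
    have hE := energy_pos hm r
    rw [integral_mul_const, sphere_integral_phase hk hk0 (hfs hy) hr, radialIntegrand]
    have e : r ^ 2 / (2 * energy m r) * (4 * Real.pi *
        (Real.sin (restDist k y * r) / (restDist k y * r))) =
        4 * Real.pi * (r / (2 * energy m r) * Real.sin (restDist k y * r)) / restDist k y := by
      field_simp
    have e' := congrArg (fun x : ℝ => (x : ℂ)) e
    simp only [ofReal_mul (r ^ 2 / (2 * energy m r)), ofReal_div _ (restDist k y),
      ofReal_mul (4 * Real.pi) (r / (2 * energy m r) * Real.sin (restDist k y * r))] at e'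
    rw [mul_comm (exp _), mul_assoc, ← mul_assoc ((r ^ 2 / (2 * energy m r) : ℝ) : ℂ), e']
    push_cast
    ring
  · rw [image_eq_zero_of_notMem_tsupport hy]
    simp

/-- The value of the slices at spacelike separation. -/
theorem slice_eq_integral_radialLimit (hk4 : mdot k k ≠ 4 * m ^ 2) {σ : ℝ} (hσ : σ = 1 ∨ σ = -1)
    {f : 𝓢(R4, ℂ)} (hf : HasCompactSupport f) (hfs : tsupport f ⊆ spacelike) {s : ℂ}
    (hs : Tendsto (fun ε => sliceIntegral m ε (σ • k) (testFourier f)) (𝓝[>] 0) (𝓝 s)) :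
    s = ∫ y, (1 / (2 * Real.pi) ^ 2 : ℂ) / (restDist k y : ℂ) *
      radialLimit m σ (mdot k k) (restTime k y) (restDist k y) * f y := by
  have hu := mdot_velocity hk
  have hu0 := velocity_zero_pos hk hk0
  obtain ⟨hi, ht⟩ := tendsto_symmetric hm hk hk0 hk4 hσ (testFourier f) hs
  obtain ⟨C, hC⟩ := exists_radial_limit hm hσ hk hk4
  have hfi := integrable_spacelike_div (k := k) hf hfs
  set D : ℝ → ℝ → ℂ := fun ε r => ((r ^ 2 + m ^ 2 - mdot k k / 4 : ℝ) : ℂ) - I * ((σ * ε : ℝ) : ℂ)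
    with hD
  have hDi : ∀ ε > 0, Integrable fun r => 1 / D ε r := fun ε hε => by
    obtain ⟨z, _, hz, -⟩ := exists_pole_approx (m := m) hσ hk hk4
    have h1 : ∀ r, D ε r = (r : ℂ) ^ 2 - z ε ^ 2 := fun r => by
      rw [hD, (hz ε hε).2.2.2]; push_cast; ring
    simp only [h1]
    exact integrable_div_sq_sub_sq (hz ε hε).1 continuous_const (C := 1) (by simp)
  have hprod : ∀ ε > 0, Integrable (fun p : ℝ × R4 => f p.2 / (restDist k p.2 : ℂ) *
      (radialIntegrand m (restTime k p.2) (restDist k p.2) p.1 / D ε p.1))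
      ((volume.restrict (Ioi 0)).prod volume) := fun ε hε => by
    have h1 := ((hDi ε hε).restrict (s := Ioi 0)).mul_prod hfi
    have hc : Continuous fun p : ℝ × R4 =>
        radialIntegrand m (restTime k p.2) (restDist k p.2) p.1 := by
      have a1 := continuous_restTime k
      have a2 := continuous_restDist k
      have a3 := continuous_energy m
      unfold radialIntegrand
      have a4 : Continuous fun p : ℝ × R4 => p.1 / (2 * energy m p.1) :=
        continuous_fst.div (by fun_prop) fun p => by
          have := energy_pos hm p.1
          positivity
      fun_prop
    refine (h1.bdd_mul (c := 1) hc.aestronglyMeasurable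
      (Eventually.of_forall fun p => norm_radialIntegrand_le hm _ _ _)).congr
      (Eventually.of_forall fun p => ?_)
    simp only
    ring
  -- The denominator depends only on `r`, so the directions are integrated first. The integrals over
  -- `r` and `y` may be exchanged because `1/D` is integrable and the radial integrand is bounded by
  -- one. The constants are `1/(2(2π)²) · 1/(2π) · 4π = 1/(2π)²`.
  have heq : ∀ ε > 0, (1 / (2 * (2 * Real.pi) ^ 2) : ℂ) *
      ∫ l, testFourier f l / symmetricDenominator σ ε k l ∂(deltaPlus m) =
      ∫ y, (1 / (2 * Real.pi) ^ 2 : ℂ) * (f y / (restDist k y : ℂ) * ∫ r in Ioi (0 : ℝ),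
        radialIntegrand m (restTime k y) (restDist k y) r / D ε r) := fun ε hε => by
    have hden : ∀ (r : ℝ) (n : S2), symmetricDenominator σ ε k
        (boost (velocity k) (onShell m (r • (n : R3)))) = D ε r := fun r n => by
      have e : (Real.sqrt (mdot k k) * energy m r) ^ 2 / mdot k k = r ^ 2 + m ^ 2 := by
        rw [mul_pow, Real.sq_sqrt hk.le, energy_sq]; field_simp
      rw [symmetricDenominator, mdot_boost_velocity hk hk0, onShell_zero, omega_smul_sphere, e, hD]
    rw [shell_polar_symm hm hu hu0 (hi ε hε)]
    have h1 : ∀ r ∈ Ioi (0 : ℝ), ((r ^ 2 / (2 * energy m r) : ℝ) : ℂ) * ∫ n : S2,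
        testFourier f (boost (velocity k) (onShell m (r • (n : R3)))) / symmetricDenominator σ ε k
          (boost (velocity k) (onShell m (r • (n : R3)))) ∂sphereMeasure =
        4 * Real.pi * ∫ y, f y / (restDist k y : ℂ) *
          (radialIntegrand m (restTime k y) (restDist k y) r / D ε r) := fun r hr => by
      simp only [hden]
      rw [integral_div, ← mul_div_assoc, sphere_integral_testFourier hm hk hk0 hfs hr,
        mul_div_assoc, ← integral_div]
      simp only [mul_div_assoc]
    rw [setIntegral_congr_fun measurableSet_Ioi h1, integral_const_mul, integral_const_mul]
    rw [integral_integral_swap (f := fun (r : ℝ) (y : R4) => f y / (restDist k y : ℂ) *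
      (radialIntegrand m (restTime k y) (restDist k y) r / D ε r)) (hprod ε hε)]
    simp only [integral_const_mul]
    have hpi : (Real.pi : ℂ) ≠ 0 := ofReal_ne_zero.2 Real.pi_ne_zero
    push_cast
    field_simp
    norm_num
  refine tendsto_nhds_unique ht ?_
  have hlim : Tendsto (fun ε => ∫ y, (1 / (2 * Real.pi) ^ 2 : ℂ) * (f y / (restDist k y : ℂ) *
      ∫ r in Ioi (0 : ℝ), radialIntegrand m (restTime k y) (restDist k y) r / D ε r)) (𝓝[>] 0)
      (𝓝 (∫ y, (1 / (2 * Real.pi) ^ 2 : ℂ) * (f y / (restDist k y : ℂ) *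
        radialLimit m σ (mdot k k) (restTime k y) (restDist k y)))) := by
    -- The constant `C` of `exists_radial_limit` serves all `ε` and all pairs `|τ| < Y`, so a
    -- multiple of `|f/Y|` dominates.
    refine tendsto_integral_filter_of_dominated_convergence
      (fun y => ‖(1 / (2 * Real.pi) ^ 2 : ℂ)‖ * (‖f y / (restDist k y : ℂ)‖ * C)) ?_ ?_
      ((hfi.norm.mul_const C).const_mul _) (Eventually.of_forall fun y => ?_)
    · filter_upwards [self_mem_nhdsWithin] with ε hε
      have := (hprod ε hε).integral_prod_right
      simp only [integral_const_mul] at this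
      exact (this.const_mul _).aestronglyMeasurable
    · filter_upwards [self_mem_nhdsWithin] with ε hε
      refine Eventually.of_forall fun y => ?_
      rw [norm_mul, norm_mul]
      by_cases hy : y ∈ tsupport f
      · gcongr
        exact (hC _ _ (abs_restTime_lt (hfs hy))).2.1 ε hε
      · rw [image_eq_zero_of_notMem_tsupport hy]
        simp
    · by_cases hy : y ∈ tsupport f
      · exact (((hC _ _ (abs_restTime_lt (hfs hy))).2.2).const_mul _).const_mul _
      · rw [image_eq_zero_of_notMem_tsupport hy]
        simp only [zero_div, zero_mul, mul_zero]
        exact tendsto_const_nhds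
  have e : ∀ y, (1 / (2 * Real.pi) ^ 2 : ℂ) * (f y / (restDist k y : ℂ) *
        radialLimit m σ (mdot k k) (restTime k y) (restDist k y)) =
      (1 / (2 * Real.pi) ^ 2 : ℂ) / (restDist k y : ℂ) *
      radialLimit m σ (mdot k k) (restTime k y) (restDist k y) * f y := fun y => by ring
  simp only [e] at hlim
  refine hlim.congr' ?_
  filter_upwards [self_mem_nhdsWithin] with ε hε
  exact (heq ε hε).symm

end PositionSpace


/-! ### Smoothness of the integral over imaginary momenta -/

section EuclideanSmooth

/-- The exponential is cut off at negative arguments, so that all derivatives are bounded and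
compositions have temperate growth. Only nonnegative arguments occur in the integral. -/
lemma exists_expCutoff : ∃ χ : ℝ → ℝ, Function.HasTemperateGrowth χ ∧
    ∀ x, 0 ≤ x → χ x = Real.exp (-x) := by
  set χ : ℝ → ℝ := fun x => Real.smoothTransition (x + 1) * Real.exp (-x) with hχ
  have hsm : ContDiff ℝ ∞ χ :=
    (Real.smoothTransition.contDiff.comp (contDiff_id.add contDiff_const)).mul
      (Real.contDiff_exp.comp contDiff_neg)
  have hpos : ∀ x : ℝ, 0 ≤ x → χ x = Real.exp (-x) := fun x hx => by
    rw [hχ]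
    simp only
    rw [Real.smoothTransition.one_of_one_le (by linarith), one_mul]
  refine ⟨χ, ⟨hsm, fun n => ?_⟩, hpos⟩
  have hc : Continuous fun x => iteratedFDeriv ℝ n χ x :=
    hsm.continuous_iteratedFDeriv (mod_cast le_top)
  obtain ⟨C, hC⟩ := (isCompact_Icc (a := (-2 : ℝ)) (b := 1)).exists_bound_of_continuousOn
    hc.continuousOn
  refine ⟨0, max C 1, fun x => ?_⟩
  rw [pow_zero, mul_one]
  rcases le_or_gt (-2) x with h | h
  · rcases le_or_gt x 1 with h' | h'
    · exact (hC x ⟨h, h'⟩).trans (le_max_left _ _)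
    · refine le_trans ?_ (le_max_right _ _)
      have hev : χ =ᶠ[𝓝 x] fun x => Real.exp (-1 * x) := by
        filter_upwards [lt_mem_nhds h'] with y hy
        rw [hpos y (by linarith), neg_one_mul]
      rw [norm_iteratedFDeriv_eq_norm_iteratedDeriv, hev.iteratedDeriv_eq, iteratedDeriv_exp_const_mul]
      simp only [norm_mul, norm_pow, norm_neg, norm_one, one_pow, one_mul, Real.norm_eq_abs,
        Real.abs_exp]
      exact Real.exp_le_one_iff.2 (by linarith)
  · refine le_trans ?_ (le_max_right _ _)
    have hev : χ =ᶠ[𝓝 x] fun _ => 0 := by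
      filter_upwards [gt_mem_nhds h] with y hy
      rw [hχ]
      simp only
      rw [Real.smoothTransition.zero_of_nonpos (by linarith), zero_mul]
    rw [norm_iteratedFDeriv_eq_norm_iteratedDeriv, hev.iteratedDeriv_eq]
    simp

variable {m : ℝ} (hm : 0 < m)
include hm

lemma hasTemperateGrowth_energy : Function.HasTemperateGrowth (energy m) := by
  have h1 : Function.HasTemperateGrowth fun x : ℝ => m⁻¹ * x :=
    (Function.HasTemperateGrowth.const m⁻¹).mul Function.HasTemperateGrowth.id'
  have h := (Function.HasTemperateGrowth.const m).mul
    ((Function.hasTemperateGrowth_one_add_norm_sq_rpow ℝ (1 / 2)).comp h1)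
  have e : energy m = (fun _ => m) * (fun x : ℝ => (1 + ‖x‖ ^ 2) ^ (1 / 2 : ℝ)) ∘ fun x => m⁻¹ * x := by
    funext t
    simp only [Pi.mul_apply, Function.comp_apply]
    rw [← Real.sqrt_eq_rpow, energy, Real.norm_eq_abs, sq_abs]
    nth_rw 2 [← Real.sqrt_sq hm.le]
    rw [← Real.sqrt_mul (sq_nonneg m)]
    congr 1
    field_simp
    ring
  rw [e]
  exact h

omit hm in
lemma integrableOn_pow_mul_exp_energy {δ : ℝ} (hδ : 0 < δ) (n : ℕ) :
    IntegrableOn (fun t : ℝ => (1 + |t|) ^ n * Real.exp (-(δ * energy m t))) (Ioi 0) := by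
  have hE := continuous_energy m
  refine integrable_of_isBigO_exp_neg (b := δ / 2) (by positivity)
    (Continuous.continuousOn (by fun_prop)) ?_
  have h1 : (fun t : ℝ => (1 + |t|) ^ n) =O[atTop] fun t => Real.exp (δ / 2 * t) := by
    have h2 := (isLittleO_pow_exp_pos_mul_atTop n (half_pos hδ)).isBigO
    have h3 : (fun t : ℝ => (1 + |t|) ^ n) =O[atTop] fun t : ℝ => t ^ n := by
      refine Asymptotics.IsBigO.of_bound (2 ^ n) ?_
      filter_upwards [eventually_ge_atTop 1] with t ht
      have ht0 : (0 : ℝ) ≤ t := by linarith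
      rw [Real.norm_eq_abs, Real.norm_eq_abs, abs_of_nonneg ht0, abs_of_nonneg (by positivity),
        abs_of_nonneg (by positivity), ← mul_pow]
      gcongr
      linarith
    exact h3.trans h2
  have h4 : (fun t : ℝ => Real.exp (-(δ * energy m t))) =O[atTop] fun t => Real.exp (-(δ * t)) := by
    refine Asymptotics.IsBigO.of_bound 1 (Eventually.of_forall fun t => ?_)
    rw [Real.norm_eq_abs, Real.norm_eq_abs, Real.abs_exp, Real.abs_exp, one_mul]
    have := (le_abs_self t).trans (abs_le_energy m t)
    gcongr
  refine (h1.mul h4).congr_right fun t => ?_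
  rw [← Real.exp_add]
  congr 1
  ring

/-- The Euclidean integral depends smoothly on all variables. -/
lemma contDiffOn_euclideanIntegral :
    ContDiffOn ℝ ∞ (fun p : ℝ × (ℝ × ℝ) => euclideanIntegral m p.2.1 p.2.2 ((p.1 / 4 : ℝ) : ℂ))
      {p | 0 < p.1 ∧ |p.2.1| < p.2.2} := by
  rintro ⟨K₀, τ₀, Y₀⟩ ⟨hK₀, hτ₀⟩
  simp only at hK₀ hτ₀
  -- Half of the gap: near the base point `|τ| < Y - δ` still holds, so `e^{-δω}` can be split off
  -- as an integrable weight.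
  set δ := (Y₀ - |τ₀|) / 2 with hδdef
  have hδ : 0 < δ := by linarith
  obtain ⟨χ, hχ, hχe⟩ := exists_expCutoff
  obtain ⟨η, hη, -, hηi⟩ := exists_farFunction (δ := K₀ / 8) (by positivity)
  set U : Set (ℝ × (ℝ × ℝ)) := {p | K₀ / 2 < p.1 ∧ |p.2.1| < p.2.2 - δ} with hU
  have hUo : IsOpen U := by
    have c1 : Continuous fun p : ℝ × (ℝ × ℝ) => p.2.2 - δ := by fun_prop
    have c2 : Continuous fun p : ℝ × (ℝ × ℝ) => |p.2.1| := by fun_prop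
    exact (isOpen_lt continuous_const continuous_fst).inter (isOpen_lt c2 c1)
  have hmem : ((K₀, τ₀, Y₀) : ℝ × (ℝ × ℝ)) ∈ U := ⟨by simp only; linarith, by simp only; linarith⟩
  -- The cosh is written as two exponentials. On `U` their arguments `(Y - δ)ω ∓ τt` are nonnegative
  -- and `t² + K/4 ≥ K₀/8`, so the cutoff functions agree with the original ones. Globally `g` has
  -- temperate growth, and the weight beats any power of `t`.
  set g : (ℝ × (ℝ × ℝ)) × ℝ → ℂ := fun q =>
    (((1 / 2) * (χ ((q.1.2.2 - δ) * energy m q.2 + -1 * (q.1.2.1 * q.2)) +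
      χ ((q.1.2.2 - δ) * energy m q.2 + q.1.2.1 * q.2)) * η (q.2 ^ 2 + 1 / 4 * q.1.1) : ℝ) : ℂ)
    with hg
  have hgt : Function.HasTemperateGrowth g := by
    have p1 : Function.HasTemperateGrowth fun q : (ℝ × (ℝ × ℝ)) × ℝ => q.1.1 :=
      ((ContinuousLinearMap.fst ℝ ℝ (ℝ × ℝ)).comp
        (ContinuousLinearMap.fst ℝ (ℝ × (ℝ × ℝ)) ℝ)).hasTemperateGrowth
    have p2 : Function.HasTemperateGrowth fun q : (ℝ × (ℝ × ℝ)) × ℝ => q.1.2.1 :=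
      (((ContinuousLinearMap.fst ℝ ℝ ℝ).comp (ContinuousLinearMap.snd ℝ ℝ (ℝ × ℝ))).comp
        (ContinuousLinearMap.fst ℝ (ℝ × (ℝ × ℝ)) ℝ)).hasTemperateGrowth
    have p3 : Function.HasTemperateGrowth fun q : (ℝ × (ℝ × ℝ)) × ℝ => q.1.2.2 :=
      (((ContinuousLinearMap.snd ℝ ℝ ℝ).comp (ContinuousLinearMap.snd ℝ ℝ (ℝ × ℝ))).comp
        (ContinuousLinearMap.fst ℝ (ℝ × (ℝ × ℝ)) ℝ)).hasTemperateGrowth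
    have p4 : Function.HasTemperateGrowth fun q : (ℝ × (ℝ × ℝ)) × ℝ => q.2 :=
      (ContinuousLinearMap.snd ℝ (ℝ × (ℝ × ℝ)) ℝ).hasTemperateGrowth
    have pE := (hasTemperateGrowth_energy hm).comp p4
    have a1 := (p3.sub (Function.HasTemperateGrowth.const δ)).mul pE
    have a2 := p2.mul p4
    have b1 := hχ.comp (a1.add ((Function.HasTemperateGrowth.const (-1)).mul a2))
    have b2 := hχ.comp (a1.add a2)
    have b3 := hη.comp ((p4.pow 2).add ((Function.HasTemperateGrowth.const (1 / 4)).mul p1))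
    exact Function.Complex.hasTemperateGrowth_ofReal.comp
      (((Function.HasTemperateGrowth.const (1 / 2)).mul (b1.add b2)).mul b3)
  have key := contDiffOn_integral_of_dominated hUo isOpen_univ (g := g) hgt.1.contDiffOn
    (μ := volume.restrict (Ioi (0 : ℝ))) (by simp)
    (w := fun t => ((Real.exp (-(δ * energy m t)) : ℝ) : ℂ)) (by
      have hE := continuous_energy m
      exact Continuous.aestronglyMeasurable (by fun_prop)) ?_
  · have hcd := (key.contDiffAt (hUo.mem_nhds hmem))
    refine (hcd.congr_of_eventuallyEq ?_).contDiffWithinAt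
    filter_upwards [hUo.mem_nhds hmem] with p hp
    obtain ⟨hp1, hp2⟩ := hp
    refine setIntegral_congr_fun measurableSet_Ioi fun t ht => ?_
    have hden : K₀ / 8 ≤ t ^ 2 + 1 / 4 * p.1 := by nlinarith [sq_nonneg t]
    have hdp : 0 < t ^ 2 + 1 / 4 * p.1 := by linarith
    have h1 := abs_le.1 (abs_mul_le_mul_energy hp2 m t)
    simp only [hg]
    rw [hχe _ (by linarith), hχe _ (by linarith), hηi _ (by rwa [abs_of_pos hdp]), ← Complex.ofReal_mul]
    have e : ((t : ℂ) ^ 2 + ((p.1 / 4 : ℝ) : ℂ)) = ((t ^ 2 + 1 / 4 * p.1 : ℝ) : ℂ) := by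
      push_cast; ring
    rw [e, ← Complex.ofReal_div]
    congr 1
    rw [div_eq_mul_inv, ← mul_assoc]
    congr 1
    rw [Real.cosh_eq]
    have f1 : Real.exp (-((p.2.2 - δ) * energy m t + -1 * (p.2.1 * t))) =
        Real.exp (p.2.1 * t) * Real.exp (δ * energy m t) * Real.exp (-(p.2.2 * energy m t)) := by
      rw [← Real.exp_add, ← Real.exp_add]; congr 1; ring
    have f2 : Real.exp (-((p.2.2 - δ) * energy m t + p.2.1 * t)) =
        Real.exp (-(p.2.1 * t)) * Real.exp (δ * energy m t) * Real.exp (-(p.2.2 * energy m t)) := by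
      rw [← Real.exp_add, ← Real.exp_add]; congr 1; ring
    have f3 : Real.exp (-(δ * energy m t)) * Real.exp (δ * energy m t) = 1 := by
      rw [← Real.exp_add]; simp
    rw [f1, f2]
    linear_combination (-(1 / 2) * (Real.exp (p.2.1 * t) + Real.exp (-(p.2.1 * t))) *
      Real.exp (-(p.2.2 * energy m t))) * f3
  · intro n p₀ _
    obtain ⟨j, C, hC⟩ := hgt.2 n
    refine ⟨Metric.ball p₀ 1, Metric.ball_mem_nhds _ one_pos, fun t =>
      C * (2 + ‖p₀‖) ^ j * ((1 + |t|) ^ j * Real.exp (-(δ * energy m t))),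
      (integrableOn_pow_mul_exp_energy hδ j).const_mul _,
      Eventually.of_forall fun t p hp => ?_⟩
    have hC0 : 0 ≤ C := by
      have := (norm_nonneg _).trans (hC 0)
      simpa using this
    have h1 : 1 + ‖(p, t)‖ ≤ (2 + ‖p₀‖) * (1 + |t|) := by
      have hp' : ‖p‖ ≤ ‖p₀‖ + 1 := by
        have := norm_le_norm_add_norm_sub' p p₀
        rw [Metric.mem_ball, dist_eq_norm] at hp
        linarith
      have h2 : ‖(p, t)‖ ≤ ‖p‖ + |t| := by
        rw [Prod.norm_mk, Real.norm_eq_abs]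
        exact max_le (by linarith [abs_nonneg t]) (by linarith [norm_nonneg p])
      nlinarith [norm_nonneg p₀, abs_nonneg t, mul_nonneg (norm_nonneg p₀) (abs_nonneg t)]
    rw [Complex.norm_real, Real.norm_eq_abs, Real.abs_exp]
    calc _ ≤ Real.exp (-(δ * energy m t)) * (C * ((2 + ‖p₀‖) * (1 + |t|)) ^ j) := by
          gcongr
          exact (hC (p, t)).trans (by gcongr)
      _ = _ := by rw [mul_pow]; ring

end EuclideanSmooth


/-! ### The smooth function representing the loop distribution -/

section LoopFunction

open Complex

/-- The function that represents the loop distribution at spacelike separation. -/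
noncomputable def loopFunction (m : ℝ) (z : R4 × R4) : ℂ :=
  (1 / (2 * Real.pi) ^ 2 : ℂ) / (restDist (Real.sign (z.2 0) • z.2) z.1 : ℂ) *
    radialLimit m (Real.sign (z.2 0)) (mdot z.2 z.2) (restTime (Real.sign (z.2 0) • z.2) z.1)
      (restDist (Real.sign (z.2 0) • z.2) z.1)

lemma sign_eq_of_forward {σ : ℝ} (hσ : σ = 1 ∨ σ = -1) {k : R4} (hk : 0 < (σ • k) 0) :
    Real.sign (k 0) = σ := by
  rcases hσ with rfl | rfl
  · exact Real.sign_of_pos (by simpa using hk)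
  · exact Real.sign_of_neg (by simpa using hk)

variable {m : ℝ} (hm : 0 < m)

/-- Off the threshold one of the two cases of the definition holds locally, with a positive number
under the root. -/
lemma contDiffOn_polePosition (m η : ℝ) : ContDiffOn ℝ ∞ (polePosition m η) {K | K ≠ 4 * m ^ 2} := by
  intro K hK
  refine ContDiffAt.contDiffWithinAt ?_
  have hlin : ContDiff ℝ ∞ fun K : ℝ => K / 4 - m ^ 2 := by fun_prop
  have hlin' : ContDiff ℝ ∞ fun K : ℝ => m ^ 2 - K / 4 := by fun_prop
  rcases lt_or_gt_of_ne hK with h | h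
  · have h1 : ContDiffAt ℝ ∞ (fun K : ℝ => I * (Real.sqrt (m ^ 2 - K / 4) : ℂ)) K :=
      contDiffAt_const.mul (ofRealCLM.contDiff.contDiffAt.comp K
        (hlin'.contDiffAt.sqrt (by linarith)))
    refine h1.congr_of_eventuallyEq ?_
    filter_upwards [gt_mem_nhds h] with K' hK'
    rw [polePosition, if_neg (not_lt.2 (le_of_lt hK'))]
  · have h1 : ContDiffAt ℝ ∞ (fun K : ℝ => ((η * Real.sqrt (K / 4 - m ^ 2) : ℝ) : ℂ)) K :=
      ofRealCLM.contDiff.contDiffAt.comp K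
        (contDiffAt_const.mul (hlin.contDiffAt.sqrt (by linarith)))
    refine h1.congr_of_eventuallyEq ?_
    filter_upwards [lt_mem_nhds h] with K' hK'
    rw [polePosition, if_pos hK']

include hm

lemma contDiffOn_radialLimit (η : ℝ) :
    ContDiffOn ℝ ∞ (fun p : ℝ × (ℝ × ℝ) => radialLimit m η p.1 p.2.1 p.2.2)
      {p | (0 < p.1 ∧ p.1 ≠ 4 * m ^ 2) ∧ |p.2.1| < p.2.2} := by
  set D : Set (ℝ × (ℝ × ℝ)) := {p | (0 < p.1 ∧ p.1 ≠ 4 * m ^ 2) ∧ |p.2.1| < p.2.2}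
  have hs : ContDiffOn ℝ ∞ (fun p : ℝ × (ℝ × ℝ) => (Real.sqrt p.1 : ℂ)) D :=
    ofRealCLM.contDiff.comp_contDiffOn
      (ContDiffOn.sqrt contDiff_fst.contDiffOn fun p hp => hp.1.1.ne')
  have hsne : ∀ p ∈ D, (2 * (Real.sqrt p.1 : ℂ)) ≠ 0 := fun p hp => by
    have := Real.sqrt_pos.2 hp.1.1
    exact mul_ne_zero two_ne_zero (ofReal_ne_zero.2 this.ne')
  have hp1 : ContDiffOn ℝ ∞ (fun p : ℝ × (ℝ × ℝ) => polePosition m η p.1) D :=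
    (contDiffOn_polePosition m η).comp contDiff_fst.contDiffOn fun p hp => hp.1.2
  have hτ : ContDiffOn ℝ ∞ (fun p : ℝ × (ℝ × ℝ) => (p.2.1 : ℂ)) D :=
    (ofRealCLM.contDiff.comp (contDiff_fst.comp contDiff_snd)).contDiffOn
  have hY : ContDiffOn ℝ ∞ (fun p : ℝ × (ℝ × ℝ) => (p.2.2 : ℂ)) D :=
    (ofRealCLM.contDiff.comp (contDiff_snd.comp contDiff_snd)).contDiffOn
  have he : ContDiffOn ℝ ∞ (fun p : ℝ × (ℝ × ℝ) => euclideanIntegral m p.2.1 p.2.2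
      ((p.1 / 4 : ℝ) : ℂ)) D := (contDiffOn_euclideanIntegral hm).mono fun p hp => ⟨hp.1.1, hp.2⟩
  have h1 : ContDiffOn ℝ ∞ (fun p : ℝ × (ℝ × ℝ) => (Real.pi : ℂ) / (2 * (Real.sqrt p.1 : ℂ))) D := by
    simp only [div_eq_mul_inv]
    exact contDiffOn_const.mul ((contDiffOn_const.mul hs).inv hsne)
  have h2 : ContDiffOn ℝ ∞ (fun p : ℝ × (ℝ × ℝ) => (Real.sqrt p.1 : ℂ) / 2) D := by
    simp only [div_eq_mul_inv]
    exact hs.mul contDiffOn_const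
  exact (h1.mul ((contDiffOn_const.mul ((hτ.mul h2).add (hY.mul hp1))).cexp)).sub
    (contDiffOn_const.mul he)

lemma contDiffOn_loopFunction_forward (σ : ℝ) :
    ContDiffOn ℝ ∞ (fun z : R4 × R4 => (1 / (2 * Real.pi) ^ 2 : ℂ) / (restDist z.2 z.1 : ℂ) *
      radialLimit m σ (mdot z.2 z.2) (restTime z.2 z.1) (restDist z.2 z.1))
      (spacelike ×ˢ regularTimelike m) := by
  have hv : ContDiffOn ℝ ∞ (fun z : R4 × R4 => velocity z.2) (spacelike ×ˢ regularTimelike m) :=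
    contDiffOn_velocity.comp contDiff_snd.contDiffOn fun z hz => hz.2.1
  have hmd : ContDiff ℝ ∞ fun q : R4 × R4 => mdot q.1 q.2 := contDiff_mdot contDiff_fst contDiff_snd
  have hτ : ContDiffOn ℝ ∞ (fun z : R4 × R4 => restTime z.2 z.1) (spacelike ×ˢ regularTimelike m) :=
    hmd.comp_contDiffOn (contDiff_fst.contDiffOn.prodMk hv)
  have hyy : ContDiff ℝ ∞ fun z : R4 × R4 => mdot z.1 z.1 := contDiff_mdot contDiff_fst contDiff_fst
  have hkk : ContDiff ℝ ∞ fun z : R4 × R4 => mdot z.2 z.2 := contDiff_mdot contDiff_snd contDiff_snd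
  have hY : ContDiffOn ℝ ∞ (fun z : R4 × R4 => restDist z.2 z.1) (spacelike ×ˢ regularTimelike m) := by
    unfold restDist
    refine ContDiffOn.sqrt ((hτ.pow 2).sub hyy.contDiffOn) fun z hz => ?_
    have h1 : mdot z.1 z.1 < 0 := hz.1
    have := sq_nonneg (restTime z.2 z.1)
    linarith
  have hYc : ContDiffOn ℝ ∞ (fun z : R4 × R4 => (restDist z.2 z.1 : ℂ))
      (spacelike ×ˢ regularTimelike m) := ofRealCLM.contDiff.comp_contDiffOn hY
  have hYi : ContDiffOn ℝ ∞ (fun z : R4 × R4 => (1 / (2 * Real.pi) ^ 2 : ℂ) /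
      (restDist z.2 z.1 : ℂ)) (spacelike ×ˢ regularTimelike m) := by
    simp only [div_eq_mul_inv (_ : ℂ) (restDist _ _ : ℂ)]
    exact contDiffOn_const.mul (hYc.inv fun z hz => ofReal_ne_zero.2 (restDist_pos hz.1).ne')
  have hR := (contDiffOn_radialLimit hm σ).comp (f := fun z : R4 × R4 =>
    (mdot z.2 z.2, (restTime z.2 z.1, restDist z.2 z.1))) (s := spacelike ×ˢ regularTimelike m)
    (hkk.contDiffOn.prodMk (hτ.prodMk hY)) fun z hz => ⟨hz.2, abs_restTime_lt hz.1⟩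
  exact hYi.mul hR

theorem contDiffOn_loopFunction :
    ContDiffOn ℝ ∞ (loopFunction m) (spacelike ×ˢ regularTimelike m) := by
  rintro ⟨y, k⟩ ⟨hy, hk⟩
  obtain ⟨σ, hσ, hσ0⟩ := exists_sign_smul_forward hk.1
  have h1 := contDiffOn_loopFunction_forward hm σ
  -- The sign of the time component is locally constant on timelike momenta, so near `k` the
  -- function is the forward expression at `σ • k`.
  have hopen : IsOpen ({z : R4 × R4 | 0 < (σ • z.2) 0}) := by
    have : Continuous fun z : R4 × R4 => (σ • z.2) 0 := by fun_prop
    exact isOpen_lt continuous_const this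
  have h2 := h1.comp (f := fun z : R4 × R4 => (z.1, σ • z.2))
    (contDiff_fst.prodMk ((contDiff_const_smul σ).comp contDiff_snd)).contDiffOn
    (s := spacelike ×ˢ regularTimelike m) fun z hz =>
      ⟨hz.1, by rw [mdot_sign_smul hσ]; exact hz.2.1, by rw [mdot_sign_smul hσ]; exact hz.2.2⟩
  refine (h2 (y, k) ⟨hy, hk⟩).congr_of_eventuallyEq ?_ ?_
  · filter_upwards [mem_nhdsWithin_of_mem_nhds (hopen.mem_nhds hσ0)] with z hz
    simp only [Function.comp_apply, loopFunction, sign_eq_of_forward hσ hz, mdot_sign_smul hσ]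
  · simp only [Function.comp_apply, loopFunction, sign_eq_of_forward hσ hσ0, mdot_sign_smul hσ]

lemma slice_eq_integral_loopFunction {k : R4} (hk : k ∈ regularTimelike m) {f : 𝓢(R4, ℂ)}
    (hf : HasCompactSupport f) (hfs : tsupport f ⊆ spacelike) {s : ℂ}
    (hs : Tendsto (fun ε => sliceIntegral m ε k (testFourier f)) (𝓝[>] 0) (𝓝 s)) :
    s = ∫ y, loopFunction m (y, k) * f y := by
  obtain ⟨σ, hσ, hσ0⟩ := exists_sign_smul_forward hk.1
  rw [← sign_smul_smul hσ k] at hs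
  rw [slice_eq_integral_radialLimit hm (k := σ • k) (by rw [mdot_sign_smul hσ]; exact hk.1) hσ0
    (by rw [mdot_sign_smul hσ]; exact hk.2) hσ hf hfs hs]
  simp only [loopFunction, sign_eq_of_forward hσ hσ0, mdot_sign_smul hσ]

omit hm in
lemma isOpen_regularTimelike (m : ℝ) : IsOpen (regularTimelike m) := by
  have h : Continuous fun k : R4 => mdot k k := by fun_prop
  exact (isOpen_lt continuous_const h).inter (isOpen_ne_fun h continuous_const)

omit hm in
lemma isOpen_spacelike : IsOpen spacelike := by
  have h : Continuous fun k : R4 => mdot k k := by fun_prop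
  exact isOpen_lt h continuous_const

omit hm in
lemma tsupport_slice_subset (k : R4) (h : 𝓢(R4 × R4, ℂ)) :
    tsupport (slice k h) ⊆ (fun y => (y, k)) ⁻¹' tsupport h := by
  refine closure_minimal (fun y hy => subset_tsupport _ ?_)
    ((isClosed_tsupport h).preimage (by fun_prop))
  exact hy

/-- Test functions with compact support in the region of spacelike `y`. -/
lemma integral_slice_eq_integral_loopFunction {S : R4 → 𝓢(R4, ℂ) → ℂ}
    (hS : ∀ k ∈ regularTimelike m, ∀ φ : 𝓢(R4, ℂ),
      Tendsto (fun ε => sliceIntegral m ε k φ) (𝓝[>] 0) (𝓝 (S k φ)))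
    (hS0 : ∀ k, S k 0 = 0) {h : 𝓢(R4 × R4, ℂ)} (hc : HasCompactSupport h)
    (hs : tsupport h ⊆ spacelike ×ˢ regularTimelike m) :
    ∫ l, loopKernelPairing m 0 h l ∂(deltaPlus m) = ∫ z, loopFunction m z * h z := by
  have hZ : IsCompact (Prod.snd '' tsupport h) := hc.isCompact.image continuous_snd
  have hslice0 : ∀ k ∉ Prod.snd '' tsupport h, slice k h = 0 := fun k hk => by
    ext y
    rw [slice_apply, zero_apply]
    exact image_eq_zero_of_notMem_tsupport fun hy => hk ⟨(y, k), hy, rfl⟩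
  rw [loop_eq_integral_slice hm hS hZ (by rintro _ ⟨z, hz, rfl⟩; exact (hs hz).2) hslice0
    fun k _ => hS0 k]
  have hcont : Continuous fun z => loopFunction m z * h z := by
    refine continuous_iff_continuousAt.2 fun z => ?_
    by_cases hz : z ∈ tsupport h
    · have hO := (isOpen_spacelike.prod (isOpen_regularTimelike m)).mem_nhds (hs hz)
      exact ((contDiffOn_loopFunction hm).continuousOn.continuousAt hO).mul h.continuous.continuousAt
    · have h' : (fun z => loopFunction m z * h z) =ᶠ[𝓝 z] fun _ => 0 := by
        filter_upwards [(isClosed_tsupport h).isOpen_compl.mem_nhds hz] with w hw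
        rw [image_eq_zero_of_notMem_tsupport hw, mul_zero]
      exact continuousAt_const.congr h'.symm
  have hint : Integrable (fun z => loopFunction m z * h z) (volume.prod volume) :=
    hcont.integrable_of_hasCompactSupport hc.mul_left
  rw [Measure.volume_eq_prod, integral_prod_symm _ hint]
  refine integral_congr_ae (Eventually.of_forall fun k => ?_)
  beta_reduce
  by_cases hk : k ∈ Prod.snd '' tsupport h
  · obtain ⟨z, hz, rfl⟩ := hk
    have hsub := tsupport_slice_subset z.2 h
    refine (slice_eq_integral_loopFunction hm (hs hz).2 ?_ (fun y hy => (hs (hsub hy)).1)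
      (hS _ (hs hz).2 _)).trans ?_
    · exact (hc.isCompact.image continuous_fst).of_isClosed_subset (isClosed_tsupport _)
        fun y hy => ⟨(y, z.2), hsub hy, rfl⟩
    · simp only [slice_apply]
  · have h0 := hslice0 k hk
    rw [h0, map_zero, hS0]
    have : ∀ y, h (y, k) = 0 := fun y => by
      rw [← slice_apply, h0, zero_apply]
    simp [this]

end LoopFunction


/-! ### The vector `kσ` is spacelike -/

section KSigma

/-- The reversed Cauchy–Schwarz inequality: in the rest frame of `k` it says that `y²` is at most
the square of the time component of `y`. -/
lemma mul_mdot_le_sq {k : R4} (hk : 0 < mdot k k) (hk0 : 0 < k 0) (y : R4) :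
    mdot y y * mdot k k ≤ mdot y k ^ 2 := by
  have hu := mdot_velocity hk
  have hu0 := velocity_zero_pos hk hk0
  have h1 := mdot_self_eq (boost (velocity k) y)
  rw [mdot_boost_boost hu hu0, boost_zero hu hu0] at h1
  have h2 := Real.sqrt_pos.2 hk
  have h3 : mdot y (velocity k) ^ 2 * mdot k k = mdot y k ^ 2 := by
    rw [velocity, mdot_smul_right, mul_pow, inv_pow, Real.sq_sqrt hk.le]
    field_simp
  rw [← h3]
  have := sq_nonneg ‖spatial (boost (velocity k) y)‖
  gcongr
  linarith

/-- The energy-momentum tensor of an electromagnetic field with field strengths `e`, `b`, applied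
to a momentum. -/
noncomputable def stressVector (e b : Fin 3 → ℝ) (k : R4) : R4 :=
  !₂[(e 0 ^ 2 + e 1 ^ 2 + e 2 ^ 2 + b 0 ^ 2 + b 1 ^ 2 + b 2 ^ 2) / 2 * k 0 +
      (k 1 * (b 1 * e 2 - b 2 * e 1) + k 2 * (b 2 * e 0 - b 0 * e 2) +
        k 3 * (b 0 * e 1 - b 1 * e 0)),
    -(k 0 * (b 1 * e 2 - b 2 * e 1) +
      (e 0 ^ 2 + e 1 ^ 2 + e 2 ^ 2 + b 0 ^ 2 + b 1 ^ 2 + b 2 ^ 2) / 2 * k 1 -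
      b 0 * (k 1 * b 0 + k 2 * b 1 + k 3 * b 2) - e 0 * (k 1 * e 0 + k 2 * e 1 + k 3 * e 2)),
    -(k 0 * (b 2 * e 0 - b 0 * e 2) +
      (e 0 ^ 2 + e 1 ^ 2 + e 2 ^ 2 + b 0 ^ 2 + b 1 ^ 2 + b 2 ^ 2) / 2 * k 2 -
      b 1 * (k 1 * b 0 + k 2 * b 1 + k 3 * b 2) - e 1 * (k 1 * e 0 + k 2 * e 1 + k 3 * e 2)),
    -(k 0 * (b 0 * e 1 - b 1 * e 0) +
      (e 0 ^ 2 + e 1 ^ 2 + e 2 ^ 2 + b 0 ^ 2 + b 1 ^ 2 + b 2 ^ 2) / 2 * k 3 -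
      b 2 * (k 1 * b 0 + k 2 * b 1 + k 3 * b 2) - e 2 * (k 1 * e 0 + k 2 * e 1 + k 3 * e 2))]

/-- Rainich's identity: the square of the electromagnetic energy-momentum tensor is a multiple of
the identity, given by the invariants `e² - b²` and `e·b`. -/
lemma mdot_stressVector_self (e b : Fin 3 → ℝ) (k : R4) :
    mdot (stressVector e b k) (stressVector e b k) =
      (((e 0 ^ 2 + e 1 ^ 2 + e 2 ^ 2 - (b 0 ^ 2 + b 1 ^ 2 + b 2 ^ 2)) / 2) ^ 2 +
        (e 0 * b 0 + e 1 * b 1 + e 2 * b 2) ^ 2) * mdot k k := by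
  simp [mdot, stressVector]
  ring

/-- A sum of squares plus `|b|² k²`, which shows that for timelike `k` and nonzero `b` the energy
component has the sign of `k₀`. -/
lemma two_mul_stressVector_zero (e b : Fin 3 → ℝ) (k : R4) :
    2 * k 0 * stressVector e b k 0 =
      (k 0 * e 0 + (k 2 * b 2 - k 3 * b 1)) ^ 2 + (k 0 * e 1 + (k 3 * b 0 - k 1 * b 2)) ^ 2 +
      (k 0 * e 2 + (k 1 * b 1 - k 2 * b 0)) ^ 2 +
      (b 0 ^ 2 + b 1 ^ 2 + b 2 ^ 2) * mdot k k + (k 1 * b 0 + k 2 * b 1 + k 3 * b 2) ^ 2 := by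
  simp [mdot, stressVector]
  ring

variable {σ : Matrix (Fin 4) (Fin 4) ℝ}

lemma kSigma_neg (σ : Matrix (Fin 4) (Fin 4) ℝ) (k : R4) : kSigma σ (-k) = -kSigma σ k := by
  ext i
  simp [kSigma]
  ring

lemma kSigma_sign_smul {η : ℝ} (hη : η = 1 ∨ η = -1) (k : R4) :
    kSigma σ (η • k) = η • kSigma σ k := by
  rcases hη with rfl | rfl
  · simp
  · simp [kSigma_neg]

lemma antisymm_apply (hσ : σ.transpose = -σ) (i j : Fin 4) : σ j i = -σ i j := by
  simpa using congrFun (congrFun hσ i) j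

lemma diag_eq_zero (hσ : σ.transpose = -σ) (i : Fin 4) : σ i i = 0 := by
  have := antisymm_apply hσ i i
  linarith

lemma mdot_kSigma_eq_zero (hσ : σ.transpose = -σ) (k : R4) : mdot (kSigma σ k) k = 0 := by
  simp only [mdot, kSigma, diag_eq_zero hσ, antisymm_apply hσ 0 1, antisymm_apply hσ 0 2,
    antisymm_apply hσ 0 3, antisymm_apply hσ 1 2, antisymm_apply hσ 1 3, antisymm_apply hσ 2 3]
  ring

/-- The energy-momentum tensor is the square of the field tensor up to sign and a trace term, and
the trace term vanishes on the spectrum because `e² = b²`. -/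
lemma neg_mdot_kSigma_self (hσ : σ.transpose = -σ) (k : R4) :
    -mdot (kSigma σ k) (kSigma σ k) =
      mdot (stressVector ![σ 0 1, σ 0 2, σ 0 3] ![σ 2 3, σ 3 1, σ 1 2] k) k +
      ((σ 0 1 ^ 2 + σ 0 2 ^ 2 + σ 0 3 ^ 2) - (σ 2 3 ^ 2 + σ 3 1 ^ 2 + σ 1 2 ^ 2)) / 2 *
        mdot k k := by
  simp only [mdot, kSigma, diag_eq_zero hσ, antisymm_apply hσ 0 1, antisymm_apply hσ 0 2,
    antisymm_apply hσ 0 3, antisymm_apply hσ 1 2, antisymm_apply hσ 3 1, antisymm_apply hσ 2 3,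
    stressVector]
  simp
  ring

/-- For a timelike momentum `k` the vector `kσ` is spacelike, with a lower bound. -/
theorem mdot_kSigma_le {lam : ℝ} (hlam : 0 < lam) (hσ : σ ∈ commutatorSpectrum lam) {k : R4}
    (hk : 0 < mdot k k) :
    mdot (kSigma σ k) (kSigma σ k) ≤ -lam ^ 4 * mdot k k := by
  obtain ⟨η, hη, hη0⟩ := exists_sign_smul_forward hk
  have hinv : mdot (kSigma σ (η • k)) (kSigma σ (η • k)) = mdot (kSigma σ k) (kSigma σ k) := by
    rw [kSigma_sign_smul hη, mdot_sign_smul hη]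
  rw [← hinv, ← mdot_sign_smul hη k]
  rw [← mdot_sign_smul hη k] at hk
  generalize η • k = k at hk hη0
  obtain ⟨hanti, hdiff, hprod⟩ := hσ
  set e : Fin 3 → ℝ := ![σ 0 1, σ 0 2, σ 0 3] with he
  set b : Fin 3 → ℝ := ![σ 2 3, σ 3 1, σ 1 2] with hb
  set q := stressVector e b k with hq
  have h1 : -mdot (kSigma σ k) (kSigma σ k) = mdot q k := by
    rw [neg_mdot_kSigma_self hanti, hdiff]; simp [hq, he, hb]
  have hl : 0 < lam ^ 4 := by positivity
  have hdot : (e 0 * b 0 + e 1 * b 1 + e 2 * b 2) ^ 2 = (lam ^ 4) ^ 2 := by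
    simp only [he, hb, Matrix.cons_val_zero, Matrix.cons_val_one, Matrix.cons_val]
    rcases hprod with h | h <;> rw [h]
    ring
  have h2 : mdot q q = (lam ^ 4) ^ 2 * mdot k k := by
    rw [hq, mdot_stressVector_self, hdot]
    have : e 0 ^ 2 + e 1 ^ 2 + e 2 ^ 2 - (b 0 ^ 2 + b 1 ^ 2 + b 2 ^ 2) = 0 := by
      simpa [he, hb] using hdiff
    rw [this]
    ring
  -- The magnetic part cannot vanish because `e·b` is nonzero; this makes the energy component of
  -- `q` strictly positive.
  have hbpos : 0 < b 0 ^ 2 + b 1 ^ 2 + b 2 ^ 2 := by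
    by_contra hneg
    have h0 : b 0 ^ 2 + b 1 ^ 2 + b 2 ^ 2 = 0 :=
      le_antisymm (not_lt.1 hneg) (by positivity)
    have b0 : b 0 = 0 := by nlinarith [sq_nonneg (b 0), sq_nonneg (b 1), sq_nonneg (b 2)]
    have b1 : b 1 = 0 := by nlinarith [sq_nonneg (b 0), sq_nonneg (b 1), sq_nonneg (b 2)]
    have b2 : b 2 = 0 := by nlinarith [sq_nonneg (b 0), sq_nonneg (b 1), sq_nonneg (b 2)]
    rw [b0, b1, b2] at hdot
    have : 0 < (lam ^ 4) ^ 2 := by positivity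
    linarith [hdot]
  have hq0 : 0 < q 0 := by
    have h3 := two_mul_stressVector_zero e b k
    have h4 : 0 < 2 * k 0 * q 0 := by
      rw [hq, h3]
      have := mul_pos hbpos hk
      positivity
    have h5 : 0 < 2 * k 0 := by linarith
    exact (mul_pos_iff_of_pos_left h5).1 h4
  -- Both vectors are forward timelike, so their product is positive, and the reversed
  -- Cauchy–Schwarz inequality may be passed through the square root.
  have hQ : 0 < mdot q k := mdot_pos (by rw [h2]; positivity) hq0 hk hη0
  have h3 := mul_mdot_le_sq hk hη0 q
  rw [h2] at h3
  have h4 : lam ^ 4 * mdot k k ≤ mdot q k := by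
    refine (sq_le_sq₀ (by positivity) hQ.le).1 ?_
    calc (lam ^ 4 * mdot k k) ^ 2 = (lam ^ 4) ^ 2 * mdot k k * mdot k k := by ring
      _ ≤ _ := h3
  linarith

lemma kSigma_mem_spacelike {lam : ℝ} (hlam : 0 < lam) (hσ : σ ∈ commutatorSpectrum lam) {k : R4}
    (hk : 0 < mdot k k) : kSigma σ k ∈ spacelike := by
  have h := mdot_kSigma_le hlam hσ hk
  have : 0 < lam ^ 4 * mdot k k := by positivity
  show mdot _ _ < 0
  linarith

lemma contDiff_kSigma (σ : Matrix (Fin 4) (Fin 4) ℝ) : ContDiff ℝ ∞ (kSigma σ) := by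
  rw [contDiff_euclidean]
  intro i
  have h : ∀ j : Fin 4, ContDiff ℝ ∞ fun k : R4 => k j := fun j => contDiff_euclidean.1 contDiff_id j
  simp only [kSigma]
  exact (((h 0).mul contDiff_const).sub ((h 1).mul contDiff_const)).sub
    ((h 2).mul contDiff_const) |>.sub ((h 3).mul contDiff_const)

end KSigma


/-! ### The radial integral as a principal value -/

section PrincipalValue

open Complex

variable {m : ℝ} (hm : 0 < m)

/-- At `l = 0` the quotient `sin(al)/(al)` has the default value zero instead of one; the factor
`l²` makes this harmless. -/
lemma npIntegrand_eq (m K : ℝ) {a : ℝ} (ha : 0 < a) (l : ℝ) :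
    (npIntegrand m K a l : ℂ) = (1 / a : ℂ) *
      (radialIntegrand m 0 a l / ((l ^ 2 + m ^ 2 - K / 4 : ℝ) : ℂ)) := by
  have h : npIntegrand m K a l = 1 / a *
      (l / (2 * energy m l) * Real.sin (a * l) / (l ^ 2 + m ^ 2 - K / 4)) := by
    rw [npIntegrand, ← energy, show l ^ 2 - K / 4 + m ^ 2 = l ^ 2 + m ^ 2 - K / 4 by ring]
    rcases eq_or_ne l 0 with rfl | hl
    · simp
    · rw [mul_comm a l]
      have e : l ^ 2 * (Real.sin (l * a) / (l * a)) = l * Real.sin (l * a) / a := by field_simp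
      calc _ = l ^ 2 * (Real.sin (l * a) / (l * a)) * (1 / (2 * energy m l)) *
            (1 / (l ^ 2 + m ^ 2 - K / 4)) := by ring
        _ = _ := by rw [e]; ring
  rw [h, radialIntegrand, zero_mul, ofReal_zero, mul_zero, Complex.exp_zero, mul_one]
  push_cast
  ring

include hm

/-- Off the zeros of the denominator the regularized radial integrals converge to the integral of
the limit. -/
lemma tendsto_radial_off_pole {A : Set ℝ} (hA : MeasurableSet A) (K a η : ℝ) {B : ℝ → ℝ}
    (hB : IntegrableOn (fun r => (B r)⁻¹) A) (hB0 : ∀ r ∈ A, 0 < B r)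
    (hle : ∀ r ∈ A, B r ≤ |r ^ 2 + m ^ 2 - K / 4|) :
    IntegrableOn (fun r => radialIntegrand m 0 a r / ((r ^ 2 + m ^ 2 - K / 4 : ℝ) : ℂ)) A ∧
    Tendsto (fun ε : ℝ => ∫ r in A, radialIntegrand m 0 a r /
      (((r ^ 2 + m ^ 2 - K / 4 : ℝ) : ℂ) - I * ((η * ε : ℝ) : ℂ))) (𝓝[>] 0)
      (𝓝 (∫ r in A, radialIntegrand m 0 a r / ((r ^ 2 + m ^ 2 - K / 4 : ℝ) : ℂ))) := by
  have hmeas : ∀ ε : ℝ, AEStronglyMeasurable (fun r => radialIntegrand m 0 a r /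
      (((r ^ 2 + m ^ 2 - K / 4 : ℝ) : ℂ) - I * ((η * ε : ℝ) : ℂ))) (volume.restrict A) := fun ε => by
    have h1 : Continuous fun r : ℝ => ((r ^ 2 + m ^ 2 - K / 4 : ℝ) : ℂ) - I * ((η * ε : ℝ) : ℂ) := by
      fun_prop
    exact ((continuous_radialIntegrand hm 0 a).measurable.div h1.measurable).aestronglyMeasurable
  have hbd : ∀ ε : ℝ, ∀ r ∈ A, ‖radialIntegrand m 0 a r /
      (((r ^ 2 + m ^ 2 - K / 4 : ℝ) : ℂ) - I * ((η * ε : ℝ) : ℂ))‖ ≤ (B r)⁻¹ := fun ε r hr => by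
    have h2 : |r ^ 2 + m ^ 2 - K / 4| ≤
        ‖((r ^ 2 + m ^ 2 - K / 4 : ℝ) : ℂ) - I * ((η * ε : ℝ) : ℂ)‖ := by
      have := abs_le_norm_ofReal_add_I_mul (r ^ 2 + m ^ 2 - K / 4) (-(η * ε))
      rwa [ofReal_neg, mul_neg, ← sub_eq_add_neg] at this
    rw [norm_div, ← one_div]
    exact div_le_div₀ zero_le_one (norm_radialIntegrand_le hm 0 a r) (hB0 r hr)
      ((hle r hr).trans h2)
  have hzero : ∀ r : ℝ, ((r ^ 2 + m ^ 2 - K / 4 : ℝ) : ℂ) - I * ((η * 0 : ℝ) : ℂ) =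
      ((r ^ 2 + m ^ 2 - K / 4 : ℝ) : ℂ) := fun r => by simp
  constructor
  · have h3 := hmeas 0
    have h4 := hbd 0
    simp only [hzero] at h3 h4
    exact hB.mono' h3 ((ae_restrict_mem hA).mono h4)
  · refine tendsto_integral_filter_of_dominated_convergence (fun r => (B r)⁻¹)
      (Eventually.of_forall hmeas)
      (Eventually.of_forall fun ε => (ae_restrict_mem hA).mono (hbd ε)) hB
      ((ae_restrict_mem hA).mono fun r hr => ?_)
    have hne : ((r ^ 2 + m ^ 2 - K / 4 : ℝ) : ℂ) ≠ 0 := by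
      rw [Ne, ofReal_eq_zero]
      intro h
      have h5 := hle r hr
      rw [h, abs_zero] at h5
      linarith [hB0 r hr]
    have h6 : Tendsto (fun ε : ℝ => ((r ^ 2 + m ^ 2 - K / 4 : ℝ) : ℂ) - I * ((η * ε : ℝ) : ℂ))
        (𝓝[>] 0) (𝓝 (((r ^ 2 + m ^ 2 - K / 4 : ℝ) : ℂ) - I * ((η * 0 : ℝ) : ℂ))) :=
      ((by fun_prop : Continuous fun ε : ℝ =>
        ((r ^ 2 + m ^ 2 - K / 4 : ℝ) : ℂ) - I * ((η * ε : ℝ) : ℂ)).tendsto 0).mono_left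
          nhdsWithin_le_nhds
    rw [hzero] at h6
    exact tendsto_const_nhds.div h6 hne

lemma npIntegrand_below {K a : ℝ} (hK : 0 < K) (hK4 : K < 4 * m ^ 2) (ha : 0 < a) {η : ℝ}
    (hη : η = 1 ∨ η = -1) :
    IntegrableOn (npIntegrand m K a) (Ioi 0) ∧
      ((∫ l in Ioi 0, npIntegrand m K a l : ℝ) : ℂ) = (1 / a : ℂ) * radialLimit m η K 0 a := by
  have hc : 0 < m ^ 2 - K / 4 := by linarith
  obtain ⟨h1, h2⟩ := tendsto_radial_off_pole hm measurableSet_Ioi K a η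
    (B := fun r => r ^ 2 + (m ^ 2 - K / 4)) (integrable_sq_add_inv hc).integrableOn
    (fun r _ => by positivity) (fun r _ => by
      rw [← add_sub_assoc]; exact le_abs_self _)
  obtain ⟨C, hC⟩ := exists_radial_limit hm hη hK hK4.ne
  have h3 := tendsto_nhds_unique h2 (hC 0 a (by simpa using ha)).2.2
  have h4 := h1.const_mul (1 / a : ℂ)
  simp only [← npIntegrand_eq m K ha] at h4
  refine ⟨?_, ?_⟩
  · have h5 : IntegrableOn (fun r => (npIntegrand m K a r : ℂ).re) (Ioi 0) := h4.re
    simpa only [ofReal_re] using h5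
  · rw [← h3, ← integral_const_mul, ← integral_complex_ofReal]
    simp only [npIntegrand_eq m K ha]

omit hm in
-- With `r² - c² = (r - c)(r + c)` it suffices to compare `|r - c|` with `r + c`. For `r ≥ 2c` the
-- ratio is at least `1/3`; for smaller `r` the sum is below `3c` and the difference at least `δ`.
lemma cut_bound {c δ : ℝ} (hc : 0 < c) (hδ : 0 < δ) {r : ℝ} (hr : r ∈ cutHalfLine c δ) :
    min (1 / 3) (δ / (3 * c)) * (r ^ 2 + c ^ 2) ≤ |r ^ 2 - c ^ 2| := by
  obtain ⟨h0, h1⟩ := hr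
  have h2 : |r ^ 2 - c ^ 2| = |r - c| * (r + c) := by
    rw [sq_sub_sq, abs_mul, abs_of_nonneg (by linarith : 0 ≤ r + c), mul_comm]
  have h3 : min (1 / 3) (δ / (3 * c)) * (r + c) ≤ |r - c| := by
    rcases le_or_gt (2 * c) r with h | h
    · calc _ ≤ 1 / 3 * (r + c) := by gcongr; exact min_le_left _ _
        _ ≤ r - c := by linarith
        _ ≤ _ := le_abs_self _
    · calc _ ≤ δ / (3 * c) * (3 * c) := by
            gcongr
            · exact min_le_right _ _
            · linarith
        _ = δ := by field_simp
        _ ≤ _ := h1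
  rw [h2]
  have h4 : 0 < min (1 / 3) (δ / (3 * c)) := lt_min (by norm_num) (by positivity)
  calc _ ≤ min (1 / 3) (δ / (3 * c)) * ((r + c) * (r + c)) := by
        gcongr
        nlinarith [mul_nonneg h0 hc.le]
    _ = min (1 / 3) (δ / (3 * c)) * (r + c) * (r + c) := by ring
    _ ≤ _ := by gcongr

omit hm in
lemma measurableSet_cutHalfLine (c δ : ℝ) : MeasurableSet (cutHalfLine c δ) := by
  have h : Continuous fun l : ℝ => |l - c| := by fun_prop
  exact ((isClosed_le continuous_const continuous_id).inter
    (isClosed_le continuous_const h)).measurableSet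

lemma tendsto_radial_cut {K : ℝ} (hK4 : 4 * m ^ 2 < K) (a η : ℝ) {δ : ℝ} (hδ : 0 < δ) :
    IntegrableOn (fun r => radialIntegrand m 0 a r / ((r ^ 2 + m ^ 2 - K / 4 : ℝ) : ℂ))
      (cutHalfLine (Real.sqrt (K / 4 - m ^ 2)) δ) ∧
    Tendsto (fun ε : ℝ => ∫ r in cutHalfLine (Real.sqrt (K / 4 - m ^ 2)) δ,
      radialIntegrand m 0 a r / (((r ^ 2 + m ^ 2 - K / 4 : ℝ) : ℂ) - I * ((η * ε : ℝ) : ℂ)))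
      (𝓝[>] 0) (𝓝 (∫ r in cutHalfLine (Real.sqrt (K / 4 - m ^ 2)) δ,
        radialIntegrand m 0 a r / ((r ^ 2 + m ^ 2 - K / 4 : ℝ) : ℂ))) := by
  have hcp : 0 < K / 4 - m ^ 2 := by linarith
  set c := Real.sqrt (K / 4 - m ^ 2) with hc
  have hc0 : 0 < c := Real.sqrt_pos.2 hcp
  have hc2 : c ^ 2 = K / 4 - m ^ 2 := Real.sq_sqrt hcp.le
  have h4 : 0 < min (1 / 3) (δ / (3 * c)) := lt_min (by norm_num) (by positivity)
  refine tendsto_radial_off_pole hm (measurableSet_cutHalfLine c δ) K a η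
    (B := fun r => min (1 / 3) (δ / (3 * c)) * (r ^ 2 + c ^ 2)) ?_ (fun r _ => by positivity)
    fun r hr => ?_
  · simp only [mul_inv]
    exact ((integrable_sq_add_inv (by positivity : 0 < c ^ 2)).const_mul _).integrableOn
  · refine (cut_bound hc0 hδ hr).trans (le_of_eq ?_)
    rw [hc2]
    congr 1
    ring

/-- The amplitude of the radial integral near the zero of the denominator. -/
noncomputable def radialAmp (m c a x : ℝ) : ℂ := radialIntegrand m 0 a (c + x) / ((2 * c + x : ℝ) : ℂ)

omit hm in
lemma radialAmp_eq (m c a x : ℝ) : radialAmp m c a x =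
    (((c + x) / (2 * energy m (c + x)) * Real.sin (a * (c + x)) / (2 * c + x) : ℝ) : ℂ) := by
  simp [radialAmp, radialIntegrand]

lemma exists_radialAmp_lipschitz {c : ℝ} (hc : 0 < c) (a : ℝ) : ∃ A, 0 ≤ A ∧
    (∀ x ∈ Icc (-(c / 2)) (c / 2), ∀ y ∈ Icc (-(c / 2)) (c / 2),
      ‖radialAmp m c a x - radialAmp m c a y‖ ≤ A * |x - y|) ∧
    ∀ x ∈ Icc (-(c / 2)) (c / 2), ∀ y ∈ Icc (-(c / 2)) (c / 2),
      |1 / (2 * c + x) - 1 / (2 * c + y)| ≤ A * |x - y| := by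
  have hlin : ContDiffOn ℝ 1 (fun x : ℝ => 2 * c + x) (Icc (-(c / 2)) (c / 2)) := by fun_prop
  have hne : ∀ x ∈ Icc (-(c / 2)) (c / 2), 2 * c + x ≠ 0 := fun x hx => by
    have := hx.1
    exact ne_of_gt (by linarith)
  have hE : ContDiff ℝ 1 fun x : ℝ => energy m (c + x) := by
    unfold energy
    exact ContDiff.sqrt (by fun_prop) fun x => by positivity
  have h1 : ContDiffOn ℝ 1 (fun x : ℝ => (c + x) / (2 * energy m (c + x)) *
      Real.sin (a * (c + x)) / (2 * c + x)) (Icc (-(c / 2)) (c / 2)) := by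
    refine ContDiffOn.div (ContDiffOn.mul (ContDiffOn.div (by fun_prop)
      (contDiff_const.mul hE).contDiffOn fun x _ => ?_) ?_) hlin hne
    · have := energy_pos hm (c + x)
      positivity
    · exact (Real.contDiff_sin.comp (by fun_prop)).contDiffOn
  have h2 : ContDiffOn ℝ 1 (fun x : ℝ => 1 / (2 * c + x)) (Icc (-(c / 2)) (c / 2)) :=
    contDiffOn_const.div hlin hne
  obtain ⟨A₁, hA₁⟩ := h1.exists_lipschitzOnWith one_ne_zero (convex_Icc _ _) isCompact_Icc
  obtain ⟨A₂, hA₂⟩ := h2.exists_lipschitzOnWith one_ne_zero (convex_Icc _ _) isCompact_Icc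
  refine ⟨max A₁ A₂, by positivity, fun x hx y hy => ?_, fun x hx y hy => ?_⟩
  · rw [radialAmp_eq, radialAmp_eq, ← ofReal_sub, norm_real, ← dist_eq_norm]
    refine (hA₁.dist_le_mul x hx y hy).trans ?_
    rw [Real.dist_eq]
    gcongr
    exact le_max_left _ _
  · rw [← Real.dist_eq]
    refine (hA₂.dist_le_mul x hx y hy).trans ?_
    rw [Real.dist_eq]
    gcongr
    exact le_max_right _ _

/-- The relation between the cut integrals and the boundary value of the radial integral. -/
lemma radialLimit_eq_cut {K : ℝ} (hK : 0 < K) (hK4 : 4 * m ^ 2 < K) {a : ℝ} (ha : 0 < a) {η : ℝ}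
    (hη : η = 1 ∨ η = -1) {δ : ℝ} (hδ : 0 < δ) (hδc : δ ≤ Real.sqrt (K / 4 - m ^ 2) / 2) :
    radialLimit m η K 0 a =
      (∫ r in cutHalfLine (Real.sqrt (K / 4 - m ^ 2)) δ,
        radialIntegrand m 0 a r / ((r ^ 2 + m ^ 2 - K / 4 : ℝ) : ℂ)) +
      ((∫ x in (-δ)..δ, (radialAmp m (Real.sqrt (K / 4 - m ^ 2)) a x -
        radialAmp m (Real.sqrt (K / 4 - m ^ 2)) a 0) / (x : ℂ)) +
        I * (η * Real.pi : ℝ) * radialAmp m (Real.sqrt (K / 4 - m ^ 2)) a 0) := by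
  have hcp : 0 < K / 4 - m ^ 2 := by linarith
  obtain ⟨C, hC⟩ := exists_radial_limit hm hη hK hK4.ne'
  obtain ⟨hi, -, ht⟩ := hC 0 a (by simpa using ha)
  obtain ⟨-, hcut⟩ := tendsto_radial_cut hm hK4 a η hδ
  set c := Real.sqrt (K / 4 - m ^ 2) with hc
  have hc0 : 0 < c := Real.sqrt_pos.2 hcp
  have hc2 : c ^ 2 = K / 4 - m ^ 2 := Real.sq_sqrt hcp.le
  obtain ⟨A, hA, hA1, hA2⟩ := exists_radialAmp_lipschitz hm hc0 a
  have hsub : Icc (-δ) δ ⊆ Icc (-(c / 2)) (c / 2) := Icc_subset_Icc (by linarith) hδc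
  have h0 : (0 : ℝ) ∈ Icc (-(c / 2)) (c / 2) := ⟨by linarith, by linarith⟩
  have hψc : ContinuousOn (radialAmp m c a) (Icc (-δ) δ) := by
    have h1 : LipschitzOnWith ⟨A, hA⟩ (radialAmp m c a) (Icc (-(c / 2)) (c / 2)) :=
      LipschitzOnWith.of_dist_le_mul fun x hx y hy => by
        rw [dist_eq_norm, Real.dist_eq]; exact hA1 x hx y hy
    exact h1.continuousOn.mono hsub
  have hsc : ContinuousOn (fun x : ℝ => 1 / (2 * c + x)) (Icc (-δ) δ) :=
    continuousOn_const.div (by fun_prop) fun x hx => by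
      have := (hsub hx).1
      exact ne_of_gt (by linarith)
  -- With `r = c + x` the denominator is `x(2c + x) - iηε`. Division by `2c + x` gives the
  -- regularization with `s = 1/(2c + x)` and sign `-η`; `s ≥ 1/(3c)` because `x ≤ c/2`.
  have hnear := tendsto_integral_near_pole hδ hψc hsc (s₀ := 1 / (3 * c)) (by positivity)
    (fun x hx => by
      have := (hsub hx).1
      have := (hsub hx).2
      exact one_div_le_one_div_of_le (by linarith) (by linarith)) hA hA
    (fun x hx => by simpa using hA1 x (hsub hx) 0 h0)
    (fun x hx => by simpa using hA2 x (hsub hx) 0 h0) (η := -η)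
    (by rcases hη with rfl | rfl <;> simp)
  have hsum := hcut.add hnear
  refine tendsto_nhds_unique ht ?_
  have e : (∫ r in cutHalfLine c δ, radialIntegrand m 0 a r / ((r ^ 2 + m ^ 2 - K / 4 : ℝ) : ℂ)) +
      ((∫ x in (-δ)..δ, (radialAmp m c a x - radialAmp m c a 0) / (x : ℂ)) -
        I * (-η * Real.pi : ℝ) * radialAmp m c a 0) =
      (∫ r in cutHalfLine c δ, radialIntegrand m 0 a r / ((r ^ 2 + m ^ 2 - K / 4 : ℝ) : ℂ)) +
      ((∫ x in (-δ)..δ, (radialAmp m c a x - radialAmp m c a 0) / (x : ℂ)) +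
        I * (η * Real.pi : ℝ) * radialAmp m c a 0) := by
    push_cast; ring
  rw [← e]
  refine hsum.congr' ?_
  filter_upwards [self_mem_nhdsWithin] with ε hε
  set f : ℝ → ℂ := fun r => radialIntegrand m 0 a r /
    (((r ^ 2 + m ^ 2 - K / 4 : ℝ) : ℂ) - I * ((η * ε : ℝ) : ℂ)) with hf
  have hfi : Integrable f := hi ε hε
  have hunion : Ici (0 : ℝ) = cutHalfLine c δ ∪ Ioo (c - δ) (c + δ) := by
    ext r
    simp only [mem_Ici, mem_union, cutHalfLine, mem_ofPred_eq, mem_Ioo]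
    constructor
    · intro hr
      rcases le_or_gt δ |r - c| with h | h
      · exact Or.inl ⟨hr, h⟩
      · have := abs_lt.1 h
        exact Or.inr ⟨by linarith [this.1], by linarith [this.2]⟩
    · rintro (h | h)
      · exact h.1
      · linarith [h.1]
  have hdisj : Disjoint (cutHalfLine c δ) (Ioo (c - δ) (c + δ)) := by
    rw [disjoint_left]
    rintro r hr hr'
    have : |r - c| < δ := abs_lt.2 ⟨by linarith [hr'.1], by linarith [hr'.2]⟩
    exact absurd hr.2 (not_le.2 this)
  have hshift : ∫ r in Ioo (c - δ) (c + δ), f r = ∫ x in (-δ)..δ, radialAmp m c a x /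
      ((x : ℂ) + I * ((-η * ε * (1 / (2 * c + x)) : ℝ) : ℂ)) := by
    rw [← integral_Ioc_eq_integral_Ioo, ← intervalIntegral.integral_of_le (by linarith),
      show c - δ = -δ + c by ring, show c + δ = δ + c by ring,
      ← intervalIntegral.integral_comp_add_right]
    refine intervalIntegral.integral_congr fun x hx => ?_
    rw [uIcc_of_le (by linarith)] at hx
    have hx1 := (hsub hx).1
    have h2c : (2 * c + x : ℝ) ≠ 0 := ne_of_gt (by linarith)
    have h2c' : ((2 * c + x : ℝ) : ℂ) ≠ 0 := ofReal_ne_zero.2 h2c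
    simp only [hf]
    have e1 : (((x + c) ^ 2 + m ^ 2 - K / 4 : ℝ) : ℂ) - I * ((η * ε : ℝ) : ℂ) =
        ((2 * c + x : ℝ) : ℂ) *
          ((x : ℂ) + I * ((-η * ε * (1 / (2 * c + x)) : ℝ) : ℂ)) := by
      have p1 : (x + c) ^ 2 + m ^ 2 - K / 4 = (2 * c + x) * x := by
        have : K / 4 = c ^ 2 + m ^ 2 := by linarith
        rw [this]; ring
      have p2 : η * ε = -((2 * c + x) * (-η * ε * (1 / (2 * c + x)))) := by field_simp
      rw [p1, p2, ofReal_neg, ofReal_mul, ofReal_mul (2 * c + x) (-η * ε * (1 / (2 * c + x)))]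
      ring
    rw [e1, radialAmp, div_div, add_comm c x]
  rw [← integral_Ici_eq_integral_Ioi, hunion, setIntegral_union hdisj measurableSet_Ioo
    hfi.integrableOn hfi.integrableOn, hshift]

/-- For small `δ` the boundary value is the cut integral, plus a divided difference over `[-δ, δ]`,
plus a delta term that does not depend on `δ`. As the divided difference vanishes with `δ`, the cut
integrals converge. -/
lemma tendsto_npIntegrand_above {K : ℝ} (hK : 0 < K) (hK4 : 4 * m ^ 2 < K) {a : ℝ} (ha : 0 < a)
    {η : ℝ} (hη : η = 1 ∨ η = -1) :
    (∀ δ > 0, IntegrableOn (npIntegrand m K a) (cutHalfLine (Real.sqrt (K / 4 - m ^ 2)) δ)) ∧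
    Tendsto (fun δ => ((∫ l in cutHalfLine (Real.sqrt (K / 4 - m ^ 2)) δ, npIntegrand m K a l : ℝ) : ℂ))
      (𝓝[>] 0) (𝓝 ((1 / a : ℂ) * (radialLimit m η K 0 a -
        I * (η * Real.pi : ℝ) * radialAmp m (Real.sqrt (K / 4 - m ^ 2)) a 0))) := by
  have hcp : 0 < K / 4 - m ^ 2 := by linarith
  have hint := fun (δ : ℝ) (hδ : 0 < δ) => (tendsto_radial_cut hm hK4 a η hδ).1
  have hrel := fun (δ : ℝ) (hδ : 0 < δ) (hδc : δ ≤ Real.sqrt (K / 4 - m ^ 2) / 2) =>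
    radialLimit_eq_cut hm hK hK4 ha hη hδ hδc
  set c := Real.sqrt (K / 4 - m ^ 2) with hc
  have hc0 : 0 < c := Real.sqrt_pos.2 hcp
  have hnp : ∀ δ > 0, IntegrableOn (npIntegrand m K a) (cutHalfLine c δ) ∧
      ((∫ l in cutHalfLine c δ, npIntegrand m K a l : ℝ) : ℂ) = (1 / a : ℂ) *
        ∫ r in cutHalfLine c δ, radialIntegrand m 0 a r / ((r ^ 2 + m ^ 2 - K / 4 : ℝ) : ℂ) :=
    fun δ hδ => by
    have h4 := (hint δ hδ).const_mul (1 / a : ℂ)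
    simp only [← npIntegrand_eq m K ha] at h4
    refine ⟨?_, ?_⟩
    · have h5 : IntegrableOn (fun r => (npIntegrand m K a r : ℂ).re) (cutHalfLine c δ) := h4.re
      simpa only [ofReal_re] using h5
    · rw [← integral_const_mul, ← integral_complex_ofReal]
      simp only [npIntegrand_eq m K ha]
  refine ⟨fun δ hδ => (hnp δ hδ).1, ?_⟩
  obtain ⟨A, hA, hA1, -⟩ := exists_radialAmp_lipschitz hm hc0 a
  -- The amplitude is Lipschitz, so the divided difference is bounded and its integral is of order
  -- `δ`.
  have hsmall : Tendsto (fun δ : ℝ => ∫ x in (-δ)..δ,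
      (radialAmp m c a x - radialAmp m c a 0) / (x : ℂ)) (𝓝[>] 0) (𝓝 0) := by
    have hlin : Tendsto (fun δ : ℝ => A * |δ - -δ|) (𝓝[>] 0) (𝓝 0) := by
      have : Continuous fun δ : ℝ => A * |δ - -δ| := by fun_prop
      have h := (this.tendsto 0).mono_left (nhdsWithin_le_nhds (s := Ioi 0))
      simpa using h
    refine squeeze_zero_norm' ?_ hlin
    filter_upwards [Ioc_mem_nhdsGT (half_pos hc0)] with δ hδ
    refine intervalIntegral.norm_integral_le_of_norm_le_const fun x hx => ?_
    rw [uIoc_of_le (by linarith [hδ.1])] at hx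
    have hx' : x ∈ Icc (-(c / 2)) (c / 2) := ⟨by linarith [hx.1, hδ.2], by linarith [hx.2, hδ.2]⟩
    rw [norm_div, norm_real, Real.norm_eq_abs]
    refine div_le_of_le_mul₀ (abs_nonneg _) hA ?_
    simpa using hA1 x hx' 0 ⟨by linarith, by linarith⟩
  have h1 := (((tendsto_const_nhds (x := radialLimit m η K 0 a -
    I * (η * Real.pi : ℝ) * radialAmp m c a 0)).sub hsmall).const_mul (1 / a : ℂ))
  rw [sub_zero] at h1
  refine h1.congr' ?_
  filter_upwards [Ioc_mem_nhdsGT (half_pos hc0)] with δ hδ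
  rw [(hnp δ hδ.1).2, hrel δ hδ.1 hδ.2]
  ring

end PrincipalValue


/-! ### The self-energy on the diagonal `y = kσ` -/

section Diagonal

open Complex

/-- By antisymmetry `kσ` is orthogonal to `k`, hence purely spatial in the rest frame. -/
lemma restTime_sign_smul_kSigma {σ : Matrix (Fin 4) (Fin 4) ℝ} (hσ : σ.transpose = -σ) (η : ℝ)
    (k : R4) : restTime (η • k) (kSigma σ k) = 0 := by
  rw [restTime, velocity, smul_smul, mdot_smul_right, mdot_kSigma_eq_zero hσ, mul_zero]

/-- The loop function at `y = kσ`, as a radial boundary value. -/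
lemma loopFunction_kSigma {σ : Matrix (Fin 4) (Fin 4) ℝ} (hσ : σ.transpose = -σ) (m : ℝ) (k : R4) :
    loopFunction m (kSigma σ k, k) = (1 / (2 * Real.pi) ^ 2 : ℂ) *
      ((1 / (Real.sqrt (-mdot (kSigma σ k) (kSigma σ k)) : ℂ)) *
        radialLimit m (Real.sign (k 0)) (mdot k k) 0
          (Real.sqrt (-mdot (kSigma σ k) (kSigma σ k)))) := by
  have h : restDist (Real.sign (k 0) • k) (kSigma σ k) =
      Real.sqrt (-mdot (kSigma σ k) (kSigma σ k)) := by
    rw [restDist, restTime_sign_smul_kSigma hσ]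
    congr 1
    ring
  simp only [loopFunction, h, restTime_sign_smul_kSigma hσ]
  ring

/-- Below the threshold the pole tends to a point of the imaginary axis that does not depend on the
side from which it is approached. This is the source of the symmetry under `k ↦ -k`. -/
lemma radialLimit_below {m K : ℝ} (hK : K < 4 * m ^ 2) (η η' τ Y : ℝ) :
    radialLimit m η K τ Y = radialLimit m η' K τ Y := by
  simp only [radialLimit, polePosition, if_neg (not_lt.2 hK.le)]

lemma loopFunction_kSigma_neg {σ : Matrix (Fin 4) (Fin 4) ℝ} (hσ : σ.transpose = -σ) {m : ℝ} {k : R4}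
    (hk : mdot k k < 4 * m ^ 2) :
    loopFunction m (kSigma σ k, k) = loopFunction m (kSigma σ (-k), -k) := by
  have h : ∀ x : R4, mdot (-x) (-x) = mdot x x := fun x => by simp [mdot]
  rw [loopFunction_kSigma hσ, loopFunction_kSigma hσ, kSigma_neg, h, h,
    radialLimit_below hk (Real.sign (k 0)) (Real.sign ((-k) 0))]

lemma radialAmp_zero {m K : ℝ} (hm : 0 < m) (hK4 : 4 * m ^ 2 < K) (a : ℝ) :
    radialAmp m (Real.sqrt (K / 4 - m ^ 2)) a 0 =
      ((Real.sin (a * Real.sqrt (K / 4 - m ^ 2)) / (2 * Real.sqrt K) : ℝ) : ℂ) := by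
  have hc : 0 < Real.sqrt (K / 4 - m ^ 2) := Real.sqrt_pos.2 (by linarith)
  have hK : 0 < K := lt_trans (by positivity) hK4
  have he : energy m (Real.sqrt (K / 4 - m ^ 2)) = Real.sqrt K / 2 := by
    rw [energy, Real.sq_sqrt (by linarith), sub_add_cancel, Real.sqrt_div hK.le,
      show (4 : ℝ) = 2 ^ 2 by norm_num, Real.sqrt_sq zero_le_two]
  have := Real.sqrt_pos.2 hK
  rw [radialAmp_eq, add_zero, add_zero, he]
  generalize Real.sqrt (K / 4 - m ^ 2) = c at hc
  congr 1
  field_simp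

lemma npThreshold_above {m K : ℝ} (hm : 0 < m) (hK4 : 4 * m ^ 2 < K) {a : ℝ} (ha : 0 < a) :
    npThreshold m K a = 1 / (2 * Real.pi) ^ 2 * (1 / a * (Real.pi *
      (Real.sin (a * Real.sqrt (K / 4 - m ^ 2)) / (2 * Real.sqrt K)))) := by
  have hc : 0 < Real.sqrt (K / 4 - m ^ 2) := Real.sqrt_pos.2 (by linarith)
  have hK : 0 < Real.sqrt K := Real.sqrt_pos.2 (lt_trans (by positivity) hK4)
  have he : Real.sqrt (K - 4 * m ^ 2) = 2 * Real.sqrt (K / 4 - m ^ 2) := by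
    rw [show K - 4 * m ^ 2 = 2 ^ 2 * (K / 4 - m ^ 2) by ring, Real.sqrt_mul (by positivity),
      Real.sqrt_sq zero_le_two]
  have := Real.pi_pos
  rw [npThreshold, if_pos hK4, he,
    show 1 / 2 * a * (2 * Real.sqrt (K / 4 - m ^ 2)) = a * Real.sqrt (K / 4 - m ^ 2) by ring]
  generalize Real.sqrt (K / 4 - m ^ 2) = c at hc
  field_simp
  ring

/-- The radial boundary value at rest time zero, as a threshold term and a principal value. -/
lemma exists_isNpIntegral {m : ℝ} (hm : 0 < m) {K a : ℝ} (hK : 0 < K) (hKm : K ≠ 4 * m ^ 2)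
    (ha : 0 < a) {η : ℝ} (hη : η = 1 ∨ η = -1) : ∃ P : ℝ, IsNpIntegral m K a P ∧
    (1 / (2 * Real.pi) ^ 2 : ℂ) * ((1 / (a : ℂ)) * radialLimit m η K 0 a) =
      I * ((η * npThreshold m K a : ℝ) : ℂ) + ((1 / (2 * Real.pi) ^ 2 * P : ℝ) : ℂ) := by
  rcases lt_or_gt_of_ne hKm with h | h
  · obtain ⟨h1, h2⟩ := npIntegrand_below hm hK h ha hη
    refine ⟨_, ⟨fun _ => ⟨h1, rfl⟩, fun h' => absurd h' h.not_gt⟩, ?_⟩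
    rw [← h2, npThreshold, if_neg h.not_gt]
    push_cast
    ring
  · obtain ⟨h1, h2⟩ := tendsto_npIntegrand_above hm hK h ha hη
    -- The cut integrals are real, so their limit is determined by its real part, which serves as
    -- the principal value; the delta term gives the threshold term.
    have h3 := (continuous_re.tendsto _).comp h2
    simp only [Function.comp_def, ofReal_re] at h3
    refine ⟨_, ⟨fun h' => absurd h' h.not_gt, fun _ => ⟨h1, h3⟩⟩, ?_⟩
    rw [ofReal_mul (1 / (2 * Real.pi) ^ 2), ← tendsto_nhds_unique h2 ((continuous_ofReal.tendsto _).comp h3),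
      radialAmp_zero hm h, npThreshold_above hm h ha]
    push_cast
    ring

/-- The value of the loop function at `y = kσ`. -/
theorem exists_loopFunction_kSigma {m lam : ℝ} (hm : 0 < m) (hlam : 0 < lam)
    {σ : Matrix (Fin 4) (Fin 4) ℝ} (hσ : σ ∈ commutatorSpectrum lam) {k : R4}
    (hk : k ∈ regularTimelike m) : ∃ P : ℝ,
    IsNpIntegral m (mdot k k) (Real.sqrt (-mdot (kSigma σ k) (kSigma σ k))) P ∧
      loopFunction m (kSigma σ k, k) =
        I * ((Real.sign (k 0) * npThreshold m (mdot k k)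
          (Real.sqrt (-mdot (kSigma σ k) (kSigma σ k))) : ℝ) : ℂ) +
        ((1 / (2 * Real.pi) ^ 2 * P : ℝ) : ℂ) := by
  obtain ⟨η, hη, hη0⟩ := exists_sign_smul_forward hk.1
  have ha : 0 < Real.sqrt (-mdot (kSigma σ k) (kSigma σ k)) :=
    Real.sqrt_pos.2 (neg_pos.2 (kSigma_mem_spacelike hlam hσ hk.1))
  rw [loopFunction_kSigma hσ.1, sign_eq_of_forward hη hη0]
  exact exists_isNpIntegral hm hk.1 hk.2 ha hη

end Diagonal

end NCPhi3

/-! ### The distribution, its slices and the self-energy -/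

theorem mainTheorem4 (m : ℝ) (hm : 0 < m) (lam : ℝ) (hlam : 0 < lam) :
    -- the two-variable distribution `F`
    ∃ F : 𝓢'(R4 × R4, ℂ), NCPhi3.IsLoopDistribution m F ∧
    -- its slices `F(·, k)`, which depend smoothly on `k`
    ∃ T : R4 → 𝓢'(R4, ℂ),
      (∀ k ∈ NCPhi3.regularTimelike m, NCPhi3.IsLoopSlice m k (T k)) ∧
      (∀ f : 𝓢(R4, ℂ), ContDiffOn ℝ ∞ (fun k => T k f) (NCPhi3.regularTimelike m)) ∧
      (∀ (f g : 𝓢(R4, ℂ)) (h : 𝓢(R4 × R4, ℂ)), (∀ y k, h (y, k) = f y * g k) →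
        HasCompactSupport g → tsupport g ⊆ NCPhi3.regularTimelike m →
        F h = ∫ k, T k f * g k) ∧
    -- the smooth function `G` that represents `F` for spacelike `y`
    ∃ G : R4 × R4 → ℂ,
      ContDiffOn ℝ ∞ G (NCPhi3.spacelike ×ˢ NCPhi3.regularTimelike m) ∧
      (∀ h : 𝓢(R4 × R4, ℂ), HasCompactSupport h →
        tsupport h ⊆ NCPhi3.spacelike ×ˢ NCPhi3.regularTimelike m →
        F h = ∫ z, G z * h z) ∧
      (∀ k ∈ NCPhi3.regularTimelike m, ∀ f : 𝓢(R4, ℂ), HasCompactSupport f →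
        tsupport f ⊆ NCPhi3.spacelike → T k f = ∫ y, G (y, k) * f y) ∧
      -- the diagonal `y = kσ`
      ∀ σ ∈ NCPhi3.commutatorSpectrum lam,
        (∀ k, 0 < NCPhi3.mdot k k →
          NCPhi3.mdot (NCPhi3.kSigma σ k) (NCPhi3.kSigma σ k) ≤ -lam ^ 4 * NCPhi3.mdot k k ∧
          NCPhi3.kSigma σ k ∈ NCPhi3.spacelike) ∧
        ContDiffOn ℝ ∞ (fun k => G (NCPhi3.kSigma σ k, k)) (NCPhi3.regularTimelike m) ∧
        (∀ k ∈ NCPhi3.regularTimelike m, ∃ P : ℝ,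
          NCPhi3.IsNpIntegral m (NCPhi3.mdot k k)
            (Real.sqrt (-NCPhi3.mdot (NCPhi3.kSigma σ k) (NCPhi3.kSigma σ k))) P ∧
          G (NCPhi3.kSigma σ k, k) =
            Complex.I * ((Real.sign (k 0) * NCPhi3.npThreshold m (NCPhi3.mdot k k)
              (Real.sqrt (-NCPhi3.mdot (NCPhi3.kSigma σ k) (NCPhi3.kSigma σ k))) : ℝ) : ℂ) +
            ((1 / (2 * Real.pi) ^ 2 * P : ℝ) : ℂ)) ∧
        (∀ k, 0 < NCPhi3.mdot k k → NCPhi3.mdot k k < 4 * m ^ 2 →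
          G (NCPhi3.kSigma σ k, k) = G (NCPhi3.kSigma σ (-k), -k)) := by 
  obtain ⟨F, hF, hFeq⟩ := NCPhi3.exists_isLoopDistribution hm
  obtain ⟨S, T, hTS, hS, hSd⟩ := NCPhi3.exists_slice hm
  have hS0 : ∀ k, S k 0 = 0 := fun k => by
    rw [← map_zero NCPhi3.testFourier, ← hTS, map_zero]
  refine ⟨F, hF, T, fun k hk f => ?_, fun f => ?_, fun f g h hfg hg hgs => ?_,
    NCPhi3.loopFunction m, NCPhi3.contDiffOn_loopFunction hm, fun h hc hs => ?_,
    fun k hk f hf hfs => ?_, fun σ hσ => ⟨fun k hk => ?_, ?_, fun k hk => ?_, fun k _ hk => ?_⟩⟩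
  · have h1 := hS k hk (NCPhi3.testFourier f)
    rw [← hTS] at h1
    simpa only [NCPhi3.sliceIntegral, NCPhi3.testFourier_apply] using h1
  · simpa only [hTS] using hSd (NCPhi3.testFourier f)
  -- For a product test function the slice at `k` is a multiple of `f` that vanishes off the support
  -- of `g`, a compact set of regular momenta.
  · have hslice : ∀ k, NCPhi3.slice k h = g k • f := fun k => by
      ext y
      rw [NCPhi3.slice_apply, hfg, smul_apply, smul_eq_mul, mul_comm]
    rw [hFeq, NCPhi3.loop_eq_integral_slice hm hS hg.isCompact hgs (fun k hk => by
      rw [hslice, image_eq_zero_of_notMem_tsupport hk, zero_smul]) fun k _ => hS0 k]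
    refine integral_congr_ae (Eventually.of_forall fun k => ?_)
    beta_reduce
    rw [← hTS, hslice, map_smul, smul_eq_mul, mul_comm]
  · rw [hFeq, NCPhi3.integral_slice_eq_integral_loopFunction hm hS hS0 hc hs]
  · exact NCPhi3.slice_eq_integral_loopFunction hm hk hf hfs (by rw [hTS]; exact hS k hk _)
  · exact ⟨NCPhi3.mdot_kSigma_le hlam hσ hk, NCPhi3.kSigma_mem_spacelike hlam hσ hk⟩
  · exact (NCPhi3.contDiffOn_loopFunction hm).comp
      ((NCPhi3.contDiff_kSigma σ).prodMk contDiff_id).contDiffOn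
      fun k hk => ⟨NCPhi3.kSigma_mem_spacelike hlam hσ hk.1, hk⟩
  · exact NCPhi3.exists_loopFunction_kSigma hm hlam hσ hk
  · exact NCPhi3.loopFunction_kSigma_neg hσ.1 hk
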